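/- Let $k$ be an algebraically closed field, let $N=\mathbb{Z}^n$ with dual lattice $M$, and let $\Delta$ be a fan in $N$, that is, a finite nonempty collection of strongly convex rational polyhedral cones in $N_{\mathbb{R}}$ which contains all faces of its cones and in which any two cones meet in a common face. Let $X=X_\Delta$ be the associated toric variety over $k$, glued from the affine varieties $U_\sigma=\operatorname{Spec}k[\sigma^\vee\cap M]$, $\sigma\in\Delta$, with torus $T=\operatorname{Spec}k[M]$; neither smoothness nor completeness of $X$ is assumed. Let $\mathcal{E}$ be a toric vector bundle of rank two on $X$, that is, a locally free sheaf of rank two together with an action of $T$ on its total space $\mathbf{V}(\mathcal{E})$ (the geometric vector bundle with sheaf of sections $\mathcal{E}$) such that the projection to $X$ is equivariant and $T$ acts linearly on the fibres. Let $\mathbf{P}(\mathcal{E})=\mathbf{Proj}\bigoplus_{m\ge 0}\operatorname{Sym}^m\mathcal{E}$. Then every Cox ring of $\mathbf{P}(\mathcal{E})$ is a finitely generated $k$-algebra. That is, if $\mathcal{L}_1,\dots,\mathcal{L}_s$ are line bundles on $\mathbf{P}(\mathcal{E})$ whose classes span $\operatorname{Pic}(\mathbf{P}(\mathcal{E}))\otimes_{\mathbb{Z}}\mathbb{Q}$,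 then the $k$-algebra $$\operatorname{Cox}\bigl(\mathbf{P}(\mathcal{E}),(\mathcal{L}_1,\dots,\mathcal{L}_s)\bigr)=\bigoplus_{(m_1,\dots,m_s)\in\mathbb{Z}^s}H^0\bigl(\mathbf{P}(\mathcal{E}),\mathcal{L}_1^{\otimes m_1}\otimes\cdots\otimes\mathcal{L}_s^{\otimes m_s}\bigr),$$ with the multiplication given by the tensor product of sections, is finitely generated. -/

import Mathlib

universe u
open CategoryTheory CategoryTheory.Limits AlgebraicGeometry TopologicalSpace
noncomputable section

namespace ToricCox

/-! ### Fans and toric varieties -/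

/-- The pairing `⟨u, v⟩` of a character `u ∈ M = ℤⁿ` with a vector `v ∈ N_ℝ = ℝⁿ`. -/
def pairing {n : ℕ} (u : Fin n → ℤ) : (Fin n → ℝ) →ₗ[ℝ] ℝ where
  toFun v := ∑ i, (u i : ℝ) * v i
  map_add' v w := by simp [mul_add, Finset.sum_add_distrib]
  map_smul' c v := by simp [Finset.mul_sum, mul_left_comm]

lemma pairing_add {n : ℕ} (u u' : Fin n → ℤ) (v : Fin n → ℝ) :
    pairing (u + u') v = pairing u v + pairing u' v := by
  simp [pairing, add_mul, Finset.sum_add_distrib]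

lemma pairing_zero {n : ℕ} (v : Fin n → ℝ) : pairing (0 : Fin n → ℤ) v = 0 := by
  simp [pairing]

lemma pairing_neg {n : ℕ} (u : Fin n → ℤ) (v : Fin n → ℝ) :
    pairing (-u) v = - pairing u v := by
  simp [pairing]

/-- The semigroup `σ^∨ ∩ M` of a cone `σ` in `N_ℝ = ℝⁿ`. -/
def dualMonoid {n : ℕ} (σ : PointedCone ℝ (Fin n → ℝ)) : AddSubmonoid (Fin n → ℤ) where
  carrier := {u | ∀ v ∈ σ, 0 ≤ pairing u v}
  zero_mem' v _ := (pairing_zero v).ge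
  add_mem' hu hu' v hv := by
    rw [pairing_add]; exact add_nonneg (hu v hv) (hu' v hv)

/-- `τ` is a face of the cone `σ`: it is cut out of `σ` by a supporting hyperplane
`u^⊥`, with `u ∈ σ^∨ ∩ M`. -/
def IsFace {n : ℕ} (τ σ : PointedCone ℝ (Fin n → ℝ)) : Prop :=
  ∃ u ∈ dualMonoid σ, ∀ v, v ∈ τ ↔ v ∈ σ ∧ pairing u v = 0

/-- A fan in the lattice `N = ℤⁿ`: a finite nonempty collection of strongly convex rational
polyhedral cones in `N_ℝ = ℝⁿ`, containing all the faces of its cones, such that any two of its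
cones intersect in a common face. -/
structure Fan (n : ℕ) where
  cones : Set (PointedCone ℝ (Fin n → ℝ))
  finite : cones.Finite
  nonempty : cones.Nonempty
  rational : ∀ σ ∈ cones, ∃ s : Finset (Fin n → ℤ),
    σ = PointedCone.hull ℝ ((fun w : Fin n → ℤ => fun i => (w i : ℝ)) '' s)
  stronglyConvex : ∀ σ ∈ cones, ∀ v ∈ σ, -v ∈ σ → v = 0
  face_mem : ∀ σ ∈ cones, ∀ τ, IsFace τ σ → τ ∈ cones
  inter_isFace : ∀ σ ∈ cones, ∀ τ ∈ cones, IsFace (σ ⊓ τ) σ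

lemma dualMonoid_anti {n : ℕ} {σ τ : PointedCone ℝ (Fin n → ℝ)} (h : τ ≤ σ) :
    dualMonoid σ ≤ dualMonoid τ :=
  fun _ hu v hv => hu v (h hv)

lemma exists_add_nsmul_mem {n : ℕ} {σ τ : PointedCone ℝ (Fin n → ℝ)} (s : Finset (Fin n → ℤ))
    (hs : σ = PointedCone.hull ℝ ((fun w : Fin n → ℤ => fun i => (w i : ℝ)) '' s))
    {u : Fin n → ℤ} (hu : u ∈ dualMonoid σ)
    (hτ : ∀ v, v ∈ τ ↔ v ∈ σ ∧ pairing u v = 0) {w : Fin n → ℤ} (hw : w ∈ dualMonoid τ) :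
    ∃ N : ℕ, ∀ m : ℕ, N ≤ m → w + m • u ∈ dualMonoid σ := by
  classical
  let c : (Fin n → ℤ) → (Fin n → ℝ) := fun w i => (w i : ℝ)
  have hc : ∀ a b : Fin n → ℤ, pairing a (c b) = ((∑ i, a i * b i : ℤ) : ℝ) := by
    intro a b; simp [pairing, c]
  have hmem : ∀ b ∈ s, c b ∈ σ := by
    intro b hb; rw [hs]; exact PointedCone.subset_hull ⟨b, hb, rfl⟩
  refine ⟨s.sup (fun b => (∑ i, w i * b i).natAbs), fun m hm => ?_⟩
  have key : ∀ b ∈ s, 0 ≤ pairing (w + m • u) (c b) := by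
    intro b hb
    have h1 := hu _ (hmem b hb)
    have h2 : (∑ i, w i * b i).natAbs ≤ m := (Finset.le_sup (f := fun b => (∑ i, w i * b i).natAbs) hb).trans hm
    rcases h1.eq_or_lt with h | h
    · have h3 := hw (c b) ((hτ _).2 ⟨hmem b hb, h.symm⟩)
      rw [hc] at h h3 ⊢
      have h4 : ∑ i, u i * b i = 0 := by exact_mod_cast h.symm
      have h5 : ∑ i, (w + m • u) i * b i = ∑ i, w i * b i + m * ∑ i, u i * b i := by
        simp [add_mul, Finset.sum_add_distrib, Finset.mul_sum, mul_assoc]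
      rw [h5, h4, mul_zero, add_zero]; exact h3
    · rw [hc] at h ⊢
      have h4 : 0 < ∑ i, u i * b i := by exact_mod_cast h
      have h5 : ∑ i, (w + m • u) i * b i = ∑ i, w i * b i + m * ∑ i, u i * b i := by
        simp [add_mul, Finset.sum_add_distrib, Finset.mul_sum, mul_assoc]
      rw [h5]
      have : (0 : ℤ) ≤ ∑ i, w i * b i + m * ∑ i, u i * b i := by
        have : (m : ℤ) * 1 ≤ m * ∑ i, u i * b i := by gcongr; omega
        omega
      exact_mod_cast this
  intro v hv
  rw [hs] at hv
  induction hv using Submodule.span_induction with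
  | mem x hx => obtain ⟨b, hb, rfl⟩ := hx; exact key b hb
  | zero => simp
  | add x y _ _ hx hy => rw [map_add]; exact add_nonneg hx hy
  | smul a x _ hx =>
    have : a • x = (a : ℝ) • x := rfl
    rw [this, map_smul]; exact mul_nonneg a.2 hx

namespace Fan

variable {n : ℕ} (Δ : Fan n)

/-- The cones of a fan, ordered by inclusion. -/
abbrev Cone : Type := {σ : PointedCone ℝ (Fin n → ℝ) // σ ∈ Δ.cones}

variable {Δ} in
lemma isFace_of_le {τ σ : Δ.Cone} (h : τ ≤ σ) : IsFace τ.1 σ.1 := by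
  have := Δ.inter_isFace σ.1 σ.2 τ.1 τ.2
  rwa [inf_eq_right.2 (show τ.1 ≤ σ.1 from h)] at this

variable (k : Type u) [Field k]

/-- The coordinate ring `k[σ^∨ ∩ M]` of the affine toric variety `U_σ`. -/
abbrev CoordRing (σ : Δ.Cone) : Type u := AddMonoidAlgebra k (dualMonoid σ.1)

variable {Δ} in
/-- The inclusion `k[σ^∨ ∩ M] ⊆ k[τ^∨ ∩ M]` for `τ ≤ σ`. -/
def coordMap {τ σ : Δ.Cone} (h : τ ≤ σ) : Δ.CoordRing k σ →ₐ[k] Δ.CoordRing k τ :=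
  AddMonoidAlgebra.mapDomainAlgHom k k (AddSubmonoid.inclusion (dualMonoid_anti h))

variable {Δ k} in
@[simp] lemma coordMap_single {τ σ : Δ.Cone} (h : τ ≤ σ) (u : dualMonoid σ.1) (a : k) :
    coordMap k h (.single u a) = .single (AddSubmonoid.inclusion (dualMonoid_anti h) u) a := by
  simp [coordMap]

lemma coordMap_injective {τ σ : Δ.Cone} (h : τ ≤ σ) : Function.Injective (coordMap k h) := by
  have := AddMonoidAlgebra.mapDomain_injective (R := k) (AddSubmonoid.inclusion_injective (dualMonoid_anti h))
  exact this

lemma isLocalization_coordMap {τ σ : Δ.Cone} (h : τ ≤ σ) (u : dualMonoid σ.1)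
    (hu : ∀ v, v ∈ τ.1 ↔ v ∈ σ.1 ∧ pairing u.1 v = 0) :
    letI := (coordMap k h).toRingHom.toAlgebra
    IsLocalization.Away (AddMonoidAlgebra.single u 1 : Δ.CoordRing k σ) (Δ.CoordRing k τ) := by
  let := (coordMap k h).toRingHom.toAlgebra
  have halg : ∀ x, algebraMap (Δ.CoordRing k σ) (Δ.CoordRing k τ) x = coordMap k h x := fun _ => rfl
  have hneg : -u.1 ∈ dualMonoid τ.1 := by
    intro v hv
    rw [pairing_neg, ((hu v).1 hv).2, neg_zero]
  obtain ⟨s, hs⟩ := Δ.rational σ.1 σ.2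
  refine IsLocalization.Away.mk _ ?_ ?_ ?_
  · rw [halg, coordMap_single]
    refine IsUnit.of_mul_eq_one (.single ⟨-u.1, hneg⟩ 1) ?_
    rw [AddMonoidAlgebra.single_mul_single, AddMonoidAlgebra.one_def]
    congr 1
    · ext; simp
    · simp
  · intro f
    have : ∃ N : ℕ, ∀ m : ℕ, N ≤ m → ∃ a, f * coordMap k h (.single u 1) ^ m = coordMap k h a := by
      induction f using AddMonoidAlgebra.induction_on with
      | of w =>
        obtain ⟨N, hN⟩ := exists_add_nsmul_mem s hs u.2 hu w.2
        refine ⟨N, fun m hm => ⟨.single ⟨w.1 + m • u.1, hN m hm⟩ 1, ?_⟩⟩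
        rw [coordMap_single, coordMap_single, AddMonoidAlgebra.single_pow, AddMonoidAlgebra.of_apply,
          AddMonoidAlgebra.single_mul_single]
        congr 1
        simp
      | add x y hx hy =>
        obtain ⟨N, hN⟩ := hx
        obtain ⟨N', hN'⟩ := hy
        refine ⟨max N N', fun m hm => ?_⟩
        obtain ⟨a, ha⟩ := hN m (le_of_max_le_left hm)
        obtain ⟨b, hb⟩ := hN' m (le_of_max_le_right hm)
        exact ⟨a + b, by rw [add_mul, ha, hb, map_add]⟩
      | smul r x hx =>
        obtain ⟨N, hN⟩ := hx
        refine ⟨N, fun m hm => ?_⟩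
        obtain ⟨a, ha⟩ := hN m hm
        exact ⟨r • a, by rw [map_smul, ← ha, smul_mul_assoc]⟩
    obtain ⟨N, hN⟩ := this
    obtain ⟨a, ha⟩ := hN N le_rfl
    exact ⟨N, a, ha⟩
  · intro a b hab
    exact ⟨0, by rw [Δ.coordMap_injective k h hab]⟩


/-- The affine toric varieties `U_σ = Spec k[σ^∨ ∩ M]`, for `σ` a cone of the fan, and the
inclusions between them. -/
def chartFunctor : Δ.Cone ⥤ Scheme.{u} where
  obj σ := Spec (.of (Δ.CoordRing k σ))
  map f := Spec.map (CommRingCat.ofHom (coordMap k (leOfHom f)).toRingHom)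
  map_id σ := by
    rw [← Spec.map_id]
    refine congrArg Spec.map (CommRingCat.hom_ext (RingHom.ext fun x => ?_))
    change coordMap k (le_refl σ) x = x
    induction x using AddMonoidAlgebra.induction_linear with
    | zero => simp
    | add x y hx hy => rw [map_add, hx, hy]
    | single u a => exact coordMap_single _ _ _
  map_comp f g := by
    rw [← Spec.map_comp]
    refine congrArg Spec.map (CommRingCat.hom_ext (RingHom.ext fun x => ?_))
    change coordMap k (leOfHom (f ≫ g)) x = coordMap k (leOfHom f) (coordMap k (leOfHom g) x)
    induction x using AddMonoidAlgebra.induction_linear with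
    | zero => simp
    | add x y hx hy => rw [map_add, hx, hy, map_add, map_add]
    | single u a =>
      simp only [coordMap_single]
      rfl

lemma range_chartFunctor_map {τ σ : Δ.Cone} (f : τ ⟶ σ) (u : dualMonoid σ.1)
    (hu : ∀ v, v ∈ τ.1 ↔ v ∈ σ.1 ∧ pairing u.1 v = 0) :
    Set.range ((Δ.chartFunctor k).map f) =
      (PrimeSpectrum.basicOpen (AddMonoidAlgebra.single u 1 : Δ.CoordRing k σ) :
        Set (PrimeSpectrum (Δ.CoordRing k σ))) := by
  let := (coordMap k (leOfHom f)).toRingHom.toAlgebra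
  have := Δ.isLocalization_coordMap k (leOfHom f) u hu
  exact PrimeSpectrum.localization_away_comap_range (Δ.CoordRing k τ)
    (AddMonoidAlgebra.single u 1 : Δ.CoordRing k σ)

instance {τ σ : Δ.Cone} (f : τ ⟶ σ) : IsOpenImmersion ((Δ.chartFunctor k).map f) := by
  obtain ⟨u, hu, h⟩ := isFace_of_le (leOfHom f)
  let := (coordMap k (leOfHom f)).toRingHom.toAlgebra
  have := Δ.isLocalization_coordMap k (leOfHom f) ⟨u, hu⟩ h
  exact IsOpenImmersion.of_isLocalization
    (AddMonoidAlgebra.single ⟨u, hu⟩ 1 : Δ.CoordRing k σ)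

instance : (Δ.chartFunctor k ⋙ Scheme.forget).IsLocallyDirected where
  cond {i j l} fi fj xi xj hx := by
    obtain ⟨u, hu, h⟩ := isFace_of_le (leOfHom fi)
    obtain ⟨u', hu', h'⟩ := isFace_of_le (leOfHom fj)
    change (Δ.chartFunctor k).map fi xi = (Δ.chartFunctor k).map fj xj at hx
    let m : Δ.Cone := ⟨i.1 ⊓ j.1, Δ.face_mem _ i.2 _ (Δ.inter_isFace _ i.2 _ j.2)⟩
    have hmi : m ≤ i := inf_le_left (a := i.1) (b := j.1)
    have hmj : m ≤ j := inf_le_right (a := i.1) (b := j.1)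
    have hm : ∀ v, v ∈ m.1 ↔ v ∈ l.1 ∧ pairing (u + u') v = 0 := by
      intro v
      rw [pairing_add]
      constructor
      · intro hv
        have h1 := (h v).1 hv.1
        have h2 := (h' v).1 hv.2
        exact ⟨h1.1, by rw [h1.2, h2.2, add_zero]⟩
      · rintro ⟨hv, h0⟩
        have h1 := hu v hv
        have h2 := hu' v hv
        exact ⟨(h v).2 ⟨hv, by linarith⟩, (h' v).2 ⟨hv, by linarith⟩⟩
    have hr := Δ.range_chartFunctor_map k (homOfLE hmi ≫ fi)
      ⟨u + u', add_mem hu hu'⟩ hm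
    have hri := Δ.range_chartFunctor_map k fi ⟨u, hu⟩ h
    have hrj := Δ.range_chartFunctor_map k fj ⟨u', hu'⟩ h'
    have hmem : (Δ.chartFunctor k).map fi xi ∈
        Set.range ((Δ.chartFunctor k).map (homOfLE hmi ≫ fi)) := by
      have h1 : (Δ.chartFunctor k).map fi xi ∈ Set.range ((Δ.chartFunctor k).map fi) := ⟨xi, rfl⟩
      have h2 : (Δ.chartFunctor k).map fi xi ∈ Set.range ((Δ.chartFunctor k).map fj) :=
        ⟨xj, hx.symm⟩
      rw [hri] at h1
      rw [hrj] at h2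
      rw [hr]
      have : (AddMonoidAlgebra.single ⟨u + u', add_mem hu hu'⟩ 1 : Δ.CoordRing k l) =
          AddMonoidAlgebra.single ⟨u, hu⟩ 1 * AddMonoidAlgebra.single ⟨u', hu'⟩ 1 := by
        rw [AddMonoidAlgebra.single_mul_single, mul_one]
        rfl
      rw [this, PrimeSpectrum.basicOpen_mul]
      exact ⟨h1, h2⟩
    obtain ⟨x, hx'⟩ := hmem
    refine ⟨m, homOfLE hmi, homOfLE hmj, x, ?_, ?_⟩
    · apply ((Δ.chartFunctor k).map fi).isOpenEmbedding.injective
      rw [← hx', Functor.map_comp]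
      rfl
    · apply ((Δ.chartFunctor k).map fj).isOpenEmbedding.injective
      rw [← hx, ← hx']
      have : homOfLE hmi ≫ fi = homOfLE hmj ≫ fj := rfl
      rw [this, Functor.map_comp]
      rfl

/-- The toric variety `X_Δ` over `k`, glued from the affine toric varieties `U_σ` along the
open subschemes `U_{σ ∩ τ}`. -/
def toricVariety : Scheme.{u} := colimit (Δ.chartFunctor k)

/-- The structure morphism of the toric variety. -/
def toricStructure : Δ.toricVariety k ⟶ Spec (.of k) :=
  colimit.desc (Δ.chartFunctor k)
    { pt := Spec (.of k)
      ι :=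
        { app := fun σ => Spec.map (CommRingCat.ofHom (algebraMap k (Δ.CoordRing k σ)))
          naturality := by
            intro τ σ f
            change Spec.map _ ≫ Spec.map _ = _ ≫ 𝟙 _
            rw [Category.comp_id, ← Spec.map_comp, ← CommRingCat.ofHom_comp]
            congr 2
            exact (coordMap k (leOfHom f)).comp_algebraMap } }

/-- The open immersion of the chart `U_σ` in the toric variety. -/
def chartι (σ : Δ.Cone) : Spec (.of (Δ.CoordRing k σ)) ⟶ Δ.toricVariety k :=
  colimit.ι (Δ.chartFunctor k) σ

instance (σ : Δ.Cone) : IsOpenImmersion (Δ.chartι k σ) :=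
  inferInstanceAs (IsOpenImmersion (colimit.ι (Δ.chartFunctor k) σ))

/-- The chart `U_σ`, as an open subset of the toric variety. -/
def chart (σ : Δ.Cone) : (Δ.toricVariety k).Opens := Δ.chartι k σ ''ᵁ ⊤

variable {Δ} in
lemma chart_mono {τ σ : Δ.Cone} (h : τ ≤ σ) : Δ.chart k τ ≤ Δ.chart k σ := by
  rintro _ ⟨x, -, rfl⟩
  refine ⟨(Δ.chartFunctor k).map (homOfLE h) x, trivial, ?_⟩
  have := colimit.w (Δ.chartFunctor k) (homOfLE h)
  exact congr($this x)

/-- The identification of `k[σ^∨ ∩ M]` with the regular functions on the chart `U_σ`. -/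
def coord (σ : Δ.Cone) : Δ.CoordRing k σ →+* Γ(Δ.toricVariety k, Δ.chart k σ) :=
  ((Scheme.ΓSpecIso (.of (Δ.CoordRing k σ))).inv ≫ ((Δ.chartι k σ).appIso ⊤).inv).hom

end Fan

/-! ### The grading of the symmetric algebra -/

section Sym

variable (A : Type u) (M : Type u) [CommRing A] [AddCommGroup M] [Module A M]

/-- The symmetric power `Sym^i M`, as a submodule of the symmetric algebra. -/
def symGrading (i : ℕ) : Submodule A (SymmetricAlgebra A M) :=
  LinearMap.range (SymmetricAlgebra.ι A M) ^ i

variable {A M} in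
lemma ι_mem_symGrading (m : M) : SymmetricAlgebra.ι A M m ∈ symGrading A M 1 := by
  rw [symGrading, pow_one]; exact ⟨m, rfl⟩

instance : SetLike.GradedMonoid (symGrading A M) where
  one_mem := by rw [symGrading, pow_zero]; exact Submodule.one_le.1 le_rfl
  mul_mem i j x y hx hy := by
    rw [symGrading, pow_add]; exact Submodule.mul_mem_mul hx hy

/-- The map sending `m` to itself, in degree one. -/
def symGradingι : M →ₗ[A] DirectSum ℕ fun i => symGrading A M i :=
  DirectSum.lof A ℕ (fun i => symGrading A M i) 1 ∘ₗ
    (SymmetricAlgebra.ι A M).codRestrict _ ι_mem_symGrading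

lemma symGradingι_apply (m : M) : symGradingι A M m =
    DirectSum.of (fun i => symGrading A M i) 1 ⟨SymmetricAlgebra.ι A M m, ι_mem_symGrading m⟩ :=
  rfl

open scoped DirectSum in
instance : GradedAlgebra (symGrading A M) :=
  GradedAlgebra.ofAlgHom _ (SymmetricAlgebra.lift (symGradingι A M))
    (by
      apply SymmetricAlgebra.algHom_ext
      ext m
      change DirectSum.coeAlgHom (symGrading A M) (SymmetricAlgebra.lift (symGradingι A M)
        (SymmetricAlgebra.ι A M m)) = SymmetricAlgebra.ι A M m
      rw [SymmetricAlgebra.lift_ι_apply, symGradingι_apply, DirectSum.coeAlgHom_of])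
    fun i x => by
    obtain ⟨x, hx⟩ := x
    dsimp only [Subtype.coe_mk, DirectSum.lof_eq_of]
    have hx' : x ∈ LinearMap.range (SymmetricAlgebra.ι A M) ^ i := hx
    induction hx' using Submodule.pow_induction_on_left' with
    | algebraMap r =>
      rw [AlgHom.commutes, DirectSum.algebraMap_apply]; rfl
    | add x y i hx' hy' ihx ihy =>
      rw [map_add, ihx hx', ihy hy', ← map_add]
      rfl
    | mem_mul m hm i x hx' ih =>
      obtain ⟨_, rfl⟩ := hm
      rw [map_mul, ih hx', SymmetricAlgebra.lift_ι_apply, symGradingι_apply, DirectSum.of_mul_of]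
      exact DirectSum.of_eq_of_gradedMonoid_eq (Sigma.subtype_ext (add_comm _ _) rfl)

end Sym

section map

variable {A B : Type u} {M N : Type u} [CommRing A] [AddCommGroup M] [Module A M]
  [CommRing B] [AddCommGroup N] [Module B N] (φ : A →+* B) (ψ : M →ₛₗ[φ] N)

/-- The ring homomorphism of symmetric algebras induced by a semilinear map. -/
def symMapRingHom : SymmetricAlgebra A M →+* SymmetricAlgebra B N :=
  let := φ.toAlgebra
  let : Module A N := Module.compHom N φ
  let : Algebra A (SymmetricAlgebra B N) := ((algebraMap B (SymmetricAlgebra B N)).comp φ).toAlgebra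
  (SymmetricAlgebra.lift (R := A) (M := M) (A := SymmetricAlgebra B N)
    { toFun := fun m => SymmetricAlgebra.ι B N (ψ m)
      map_add' := fun x y => by simp
      map_smul' := fun a x => by
        rw [map_smulₛₗ, map_smul, Algebra.smul_def]; rfl }).toRingHom

@[simp] lemma symMapRingHom_ι (m : M) :
    symMapRingHom φ ψ (SymmetricAlgebra.ι A M m) = SymmetricAlgebra.ι B N (ψ m) := by
  let := φ.toAlgebra
  let : Module A N := Module.compHom N φ
  let : Algebra A (SymmetricAlgebra B N) := ((algebraMap B (SymmetricAlgebra B N)).comp φ).toAlgebra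
  exact SymmetricAlgebra.lift_ι_apply _ _

@[simp] lemma symMapRingHom_algebraMap (a : A) :
    symMapRingHom φ ψ (algebraMap A _ a) = algebraMap B _ (φ a) := by
  let := φ.toAlgebra
  let : Module A N := Module.compHom N φ
  let : Algebra A (SymmetricAlgebra B N) := ((algebraMap B (SymmetricAlgebra B N)).comp φ).toAlgebra
  exact AlgHom.commutes (SymmetricAlgebra.lift _) a

/-- The graded ring homomorphism of symmetric algebras induced by a semilinear map. -/
def symMap : symGrading A M →+*ᵍ symGrading B N where
  __ := symMapRingHom φ ψ
  map_mem {i x} hx := by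
    have hx' : x ∈ LinearMap.range (SymmetricAlgebra.ι A M) ^ i := hx
    change symMapRingHom φ ψ x ∈ _
    induction hx' using Submodule.pow_induction_on_left' with
    | algebraMap r =>
      rw [symMapRingHom_algebraMap]
      exact SetLike.algebraMap_mem_graded (symGrading B N) _
    | add x y i hx' hy' ihx ihy => rw [map_add]; exact add_mem (ihx hx') (ihy hy')
    | mem_mul m hm i x hx' ih =>
      obtain ⟨_, rfl⟩ := hm
      rw [map_mul, symMapRingHom_ι, Nat.succ_eq_one_add]
      exact SetLike.mul_mem_graded (ι_mem_symGrading _) (ih hx')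

end map

section away

variable {A : Type u} {M : Type u} [CommRing A] [AddCommGroup M] [Module A M]

/-- The structure of an `A`-algebra on the degree-zero localization of `Sym_A M` away from `s`. -/
def awayAlgebraMap (s : SymmetricAlgebra A M) :
    A →+* HomogeneousLocalization.Away (symGrading A M) s :=
  (HomogeneousLocalization.fromZeroRingHom (symGrading A M) _).comp
    (algebraMap A (symGrading A M 0))

/-- The fraction `m / s`, for `s` of degree one. -/
def awayFrac {s : SymmetricAlgebra A M} (hs : s ∈ symGrading A M 1) (m : M) :
    HomogeneousLocalization.Away (symGrading A M) s :=
  HomogeneousLocalization.Away.mk (symGrading A M) hs 1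
    (SymmetricAlgebra.ι A M m) (ι_mem_symGrading m)

lemma val_awayAlgebraMap (s : SymmetricAlgebra A M) (a : A) :
    (awayAlgebraMap s a).val = algebraMap _ _ (algebraMap A (SymmetricAlgebra A M) a) := by
  rw [← Localization.mk_one_eq_algebraMap]; rfl

lemma val_awayFrac {s : SymmetricAlgebra A M} (hs : s ∈ symGrading A M 1) (m : M) :
    (awayFrac hs m).val =
      Localization.mk (SymmetricAlgebra.ι A M m) ⟨s, Submonoid.mem_powers s⟩ := by
  rw [awayFrac, HomogeneousLocalization.Away.val_mk]
  congr 1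
  ext
  exact pow_one _

variable {s : SymmetricAlgebra A M} (hs : s ∈ symGrading A M 1)

lemma awayFrac_add (x y : M) :
    awayFrac hs (x + y) = awayFrac hs x + awayFrac hs y := by
  apply HomogeneousLocalization.val_injective
  rw [HomogeneousLocalization.val_add, val_awayFrac, val_awayFrac, val_awayFrac, map_add,
    Localization.add_mk_self]

lemma awayFrac_smul (x : M) (a : A) :
    awayFrac hs (a • x) = awayAlgebraMap _ a * awayFrac hs x := by
  apply HomogeneousLocalization.val_injective
  rw [HomogeneousLocalization.val_mul, val_awayFrac, val_awayFrac, val_awayAlgebraMap,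
    ← Localization.mk_one_eq_algebraMap, Localization.mk_mul, map_smul, one_mul, Algebra.smul_def]

lemma awayFrac_self (m : M) (h : s = SymmetricAlgebra.ι A M m) : awayFrac hs m = 1 := by
  subst h
  apply HomogeneousLocalization.val_injective
  rw [HomogeneousLocalization.val_one, val_awayFrac]
  exact Localization.mk_self (S := Submonoid.powers (SymmetricAlgebra.ι A M m))
    ⟨SymmetricAlgebra.ι A M m, Submonoid.mem_powers _⟩

lemma awayHom_ext {C : Type*} [CommRing C]
    {f g : HomogeneousLocalization.Away (symGrading A M) s →+* C}
    (h0 : ∀ a, f (awayAlgebraMap _ a) = g (awayAlgebraMap _ a))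
    (h1 : ∀ m, f (awayFrac hs m) = g (awayFrac hs m)) : f = g := by
  have key : ∀ (n : ℕ) (x : SymmetricAlgebra A M) (hx : x ∈ symGrading A M (n • 1)),
      f (.mk _ hs n x hx) = g (.mk _ hs n x hx) := by
    intro n x hx
    have hx' : x ∈ LinearMap.range (SymmetricAlgebra.ι A M) ^ n := by
      rw [smul_eq_mul, mul_one] at hx; exact hx
    induction hx' using Submodule.pow_induction_on_left' with
    | algebraMap r =>
      have : HomogeneousLocalization.Away.mk (symGrading A M) hs 0
          (algebraMap A _ r) hx = awayAlgebraMap _ r := by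
        apply HomogeneousLocalization.val_injective
        rw [HomogeneousLocalization.Away.val_mk, val_awayAlgebraMap,
          ← Localization.mk_one_eq_algebraMap]
        congr 1
        ext
        exact pow_zero _
      rw [this, h0]
    | add x y i hx' hy' ihx ihy =>
      have hx'' : x ∈ symGrading A M (i • 1) := by rw [smul_eq_mul, mul_one]; exact hx'
      have hy'' : y ∈ symGrading A M (i • 1) := by rw [smul_eq_mul, mul_one]; exact hy'
      have : HomogeneousLocalization.Away.mk (symGrading A M) hs i (x + y) hx =
          .mk _ hs i x hx'' + .mk _ hs i y hy'' := by
        apply HomogeneousLocalization.val_injective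
        rw [HomogeneousLocalization.val_add, HomogeneousLocalization.Away.val_mk,
          HomogeneousLocalization.Away.val_mk, HomogeneousLocalization.Away.val_mk,
          Localization.add_mk_self]
      rw [this, map_add, map_add, ihx, ihy]
    | mem_mul m' hm i x hx' ih =>
      obtain ⟨m', rfl⟩ := hm
      have hx'' : x ∈ symGrading A M (i • 1) := by rw [smul_eq_mul, mul_one]; exact hx'
      have : HomogeneousLocalization.Away.mk (symGrading A M) hs i.succ
          (SymmetricAlgebra.ι A M m' * x) hx =
          awayFrac hs m' * .mk _ hs i x hx'' := by
        apply HomogeneousLocalization.val_injective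
        rw [HomogeneousLocalization.val_mul, HomogeneousLocalization.Away.val_mk,
          HomogeneousLocalization.Away.val_mk, val_awayFrac, Localization.mk_mul]
        congr 1
        ext
        exact pow_succ' _ _
      rw [this, map_mul, map_mul, h1, ih]
  ext x
  obtain ⟨n, y, hy, rfl⟩ := HomogeneousLocalization.Away.mk_surjective _ hs x
  exact key n y hy

lemma irrelevant_le_span :
    (HomogeneousIdeal.irrelevant (symGrading A M)).toIdeal ≤
      Ideal.span (Set.range (SymmetricAlgebra.ι A M)) := by
  rw [HomogeneousIdeal.toIdeal_irrelevant_le]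
  intro i hi x hx
  obtain ⟨j, rfl⟩ : ∃ j, i = j + 1 := ⟨i - 1, by omega⟩
  have hx' : x ∈ LinearMap.range (SymmetricAlgebra.ι A M) *
      LinearMap.range (SymmetricAlgebra.ι A M) ^ j := by rw [← pow_succ']; exact hx
  clear hx
  induction hx' using Submodule.mul_induction_on' with
  | mem_mul_mem a ha b hb =>
    obtain ⟨m, rfl⟩ := ha
    exact Ideal.mul_mem_right _ _ (Ideal.subset_span ⟨m, rfl⟩)
  | add x hx' y hy' h1 h2 => exact add_mem h1 h2

end away

section pushout

variable {A B : Type u} {M N : Type u} [CommRing A] [AddCommGroup M] [Module A M]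
  [CommRing B] [AddCommGroup N] [Module B N] (φ : A →+* B) (ψ : M →ₛₗ[φ] N)

lemma awayMap_awayAlgebraMap (s : SymmetricAlgebra A M) (a : A) :
    HomogeneousLocalization.Away.map (symMap φ ψ) s (awayAlgebraMap s a) =
      awayAlgebraMap _ (φ a) := by
  apply HomogeneousLocalization.val_injective
  rw [val_awayAlgebraMap, ← symMapRingHom_algebraMap φ ψ, ← Localization.mk_one_eq_algebraMap]
  have : awayAlgebraMap s a = HomogeneousLocalization.mk ⟨0, algebraMap A (symGrading A M 0) a, 1, one_mem _⟩ := rfl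
  rw [this, HomogeneousLocalization.Away.map, HomogeneousLocalization.map_mk,
    HomogeneousLocalization.val_mk]
  congr 1
  ext
  exact map_one _

lemma awayMap_awayFrac {s : SymmetricAlgebra A M} (hs : s ∈ symGrading A M 1) (m : M) :
    HomogeneousLocalization.Away.map (symMap φ ψ) s (awayFrac hs m) =
      awayFrac ((symMap φ ψ).map_mem hs) (ψ m) := by
  rw [awayFrac, HomogeneousLocalization.Away.map_mk]
  apply HomogeneousLocalization.val_injective
  rw [HomogeneousLocalization.Away.val_mk, val_awayFrac, ← symMapRingHom_ι]
  congr 1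
  ext
  exact pow_one _

lemma irrelevant_le_map_symMap {ι : Type*} (bM : Module.Basis ι A M) (bN : Module.Basis ι B N)
    (h : ∀ i, ψ (bM i) = bN i) :
    HomogeneousIdeal.irrelevant (symGrading B N) ≤
      (HomogeneousIdeal.irrelevant (symGrading A M)).map (symMap φ ψ) := by
  change (HomogeneousIdeal.irrelevant (symGrading B N)).toIdeal ≤
      ((HomogeneousIdeal.irrelevant (symGrading A M)).map (symMap φ ψ)).toIdeal
  refine irrelevant_le_span.trans (Ideal.span_le.2 ?_)
  rintro _ ⟨x, rfl⟩
  rw [← bN.linearCombination_repr x, Finsupp.linearCombination_apply, Finsupp.sum, map_sum]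
  refine sum_mem fun i _ => ?_
  rw [map_smul, Algebra.smul_def]
  refine Ideal.mul_mem_left _ _ ?_
  rw [← h, ← symMapRingHom_ι]
  refine Ideal.mem_map_of_mem (symMap φ ψ) ?_
  change GradedRing.proj (symGrading A M) 0 _ = 0
  rw [GradedRing.proj_apply, DirectSum.decompose_of_mem_ne _ (ι_mem_symGrading _) one_ne_zero]

/-- The universal property of the degree-zero localization after base change. -/
lemma exists_awayLift {ι : Type*} (bM : Module.Basis ι A M) (bN : Module.Basis ι B N)
    (h : ∀ i, ψ (bM i) = bN i)
    (m : M) {C : Type u} [CommRing C] (f : B →+* C)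
    (g : HomogeneousLocalization.Away (symGrading A M) (SymmetricAlgebra.ι A M m) →+* C)
    (hfg : ∀ a, f (φ a) = g (awayAlgebraMap _ a)) :
    ∃ l : HomogeneousLocalization.Away (symGrading B N)
        (symMap φ ψ (SymmetricAlgebra.ι A M m)) →+* C,
      (∀ b, l (awayAlgebraMap _ b) = f b) ∧
      ∀ x, l (HomogeneousLocalization.Away.map (symMap φ ψ) _ x) = g x := by
  have hm : symMap φ ψ (SymmetricAlgebra.ι A M m) = SymmetricAlgebra.ι B N (ψ m) :=
    symMapRingHom_ι φ ψ m
  let := f.toAlgebra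
  let L : N →ₗ[B] C := bN.constr B fun i => g (awayFrac (ι_mem_symGrading m) (bM i))
  have hL : ∀ x, L (ψ x) = g (awayFrac (ι_mem_symGrading m) x) := by
    intro x
    have hx := bM.mem_span x
    induction hx using Submodule.span_induction with
    | mem x hx =>
      obtain ⟨i, rfl⟩ := hx
      rw [h, bN.constr_basis]
    | zero =>
      have := awayFrac_smul (ι_mem_symGrading (A := A) m) 0 0
      rw [zero_smul, map_zero, zero_mul] at this
      rw [map_zero, map_zero, this, map_zero]
    | add x y _ _ hx hy => rw [map_add, map_add, hx, hy, awayFrac_add, map_add]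
    | smul a x _ hx =>
      rw [map_smulₛₗ, map_smul, hx, awayFrac_smul, map_mul, ← hfg]
      rfl
  let Λ : SymmetricAlgebra B N →ₐ[B] C := SymmetricAlgebra.lift L
  have hΛ : ∀ x, Λ (SymmetricAlgebra.ι B N (ψ x)) = g (awayFrac (ι_mem_symGrading m) x) :=
    fun x => (SymmetricAlgebra.lift_ι_apply L (ψ x)).trans (hL x)
  have hΛm : Λ.toRingHom (symMap φ ψ (SymmetricAlgebra.ι A M m)) = 1 := by
    rw [hm]
    refine (hΛ m).trans ?_
    rw [awayFrac_self _ m rfl, map_one]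
  have hu : IsUnit (Λ.toRingHom (symMap φ ψ (SymmetricAlgebra.ι A M m))) := by
    rw [hΛm]; exact isUnit_one
  let l0 : Localization.Away (symMap φ ψ (SymmetricAlgebra.ι A M m)) →+* C :=
    IsLocalization.Away.lift (symMap φ ψ (SymmetricAlgebra.ι A M m)) hu
  have hl0 : ∀ x, l0 (algebraMap _ _ x) = Λ x := fun x => IsLocalization.Away.lift_eq _ hu x
  let l : HomogeneousLocalization.Away (symGrading B N)
        (symMap φ ψ (SymmetricAlgebra.ι A M m)) →+* C :=
    l0.comp (algebraMap _ _)
  have hl : ∀ x, l x = l0 x.val := fun _ => rfl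
  have hlB : ∀ b, l (awayAlgebraMap _ b) = f b := by
    intro b
    rw [hl, val_awayAlgebraMap, hl0]
    exact Λ.commutes b
  have hlF : ∀ x, l (awayFrac ((symMap φ ψ).map_mem (ι_mem_symGrading m)) (ψ x)) =
      g (awayFrac (ι_mem_symGrading m) x) := by
    intro x
    rw [hl, val_awayFrac, ← hΛ, ← hl0]
    have := congrArg l0 (Localization.mk_one_eq_algebraMap
      (M := Submonoid.powers (symMap φ ψ (SymmetricAlgebra.ι A M m)))
      (symMap φ ψ (SymmetricAlgebra.ι A M m)))
    have h1 : l0 (Localization.mk (SymmetricAlgebra.ι B N (ψ x)) ⟨symMap φ ψ (SymmetricAlgebra.ι A M m), Submonoid.mem_powers _⟩) * l0 (algebraMap _ _ (symMap φ ψ (SymmetricAlgebra.ι A M m))) = l0 (algebraMap _ _ (SymmetricAlgebra.ι B N (ψ x))) := by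
      rw [← map_mul, ← Localization.mk_one_eq_algebraMap, ← Localization.mk_one_eq_algebraMap,
        Localization.mk_mul, mul_one]
      congr 1
      rw [Localization.mk_eq_mk_iff, Localization.r_iff_exists]
      exact ⟨1, by simp [mul_comm]⟩
    rw [← h1, hl0]
    erw [hΛm]
    rw [mul_one]
  refine ⟨l, hlB, fun x => ?_⟩
  refine RingHom.congr_fun (f := l.comp (HomogeneousLocalization.Away.map (symMap φ ψ) _))
    (awayHom_ext (ι_mem_symGrading m) (fun a => ?_) fun x => ?_) x
  · rw [RingHom.comp_apply, awayMap_awayAlgebraMap, hlB, hfg]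
  · rw [RingHom.comp_apply, awayMap_awayFrac, hlF]

lemma awayHom_ext' {ι : Type*} (bM : Module.Basis ι A M) (bN : Module.Basis ι B N)
    (h : ∀ i, ψ (bM i) = bN i)
    (m : M) {C : Type u} [CommRing C]
    {f g : HomogeneousLocalization.Away (symGrading B N)
        (symMap φ ψ (SymmetricAlgebra.ι A M m)) →+* C}
    (h0 : ∀ b, f (awayAlgebraMap _ b) = g (awayAlgebraMap _ b))
    (h1 : ∀ x, f (HomogeneousLocalization.Away.map (symMap φ ψ) _ x) =
      g (HomogeneousLocalization.Away.map (symMap φ ψ) _ x)) : f = g := by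
  refine awayHom_ext ((symMap φ ψ).map_mem (ι_mem_symGrading m)) h0 fun n => ?_
  have hn := bN.mem_span n
  induction hn using Submodule.span_induction with
  | mem x hx =>
    obtain ⟨i, rfl⟩ := hx
    rw [← h, ← awayMap_awayFrac φ ψ (ι_mem_symGrading m), h1]
  | zero =>
    have := awayFrac_smul ((symMap φ ψ).map_mem (ι_mem_symGrading (A := A) m)) 0 0
    rw [zero_smul, map_zero, zero_mul] at this
    rw [this, map_zero, map_zero]
  | add x y _ _ hx hy => rw [awayFrac_add, map_add, map_add, hx, hy]
  | smul a x _ hx =>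
    rw [awayFrac_smul, map_mul, map_mul, hx]
    congr 1
    exact h0 a

lemma isPushout_away {ι : Type*} (bM : Module.Basis ι A M) (bN : Module.Basis ι B N)
    (h : ∀ i, ψ (bM i) = bN i)
    (m : M) :
    IsPushout (CommRingCat.ofHom φ) (CommRingCat.ofHom (awayAlgebraMap (SymmetricAlgebra.ι A M m)))
      (CommRingCat.ofHom (awayAlgebraMap (symMap φ ψ (SymmetricAlgebra.ι A M m))))
      (CommRingCat.ofHom (HomogeneousLocalization.Away.map (symMap φ ψ)
        (SymmetricAlgebra.ι A M m))) := by
  have hw : CommRingCat.ofHom φ ≫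
      CommRingCat.ofHom (awayAlgebraMap (symMap φ ψ (SymmetricAlgebra.ι A M m))) =
      CommRingCat.ofHom (awayAlgebraMap (SymmetricAlgebra.ι A M m)) ≫
      CommRingCat.ofHom (HomogeneousLocalization.Away.map (symMap φ ψ)
        (SymmetricAlgebra.ι A M m)) := by
    exact CommRingCat.hom_ext (RingHom.ext fun a => (awayMap_awayAlgebraMap φ ψ _ a).symm)
  refine ⟨⟨hw⟩, ⟨PushoutCocone.isColimitAux' _ fun c => ?_⟩⟩
  have hc : ∀ a, c.inl.hom (φ a) = c.inr.hom (awayAlgebraMap _ a) := fun a =>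
    congr($(c.condition) a)
  have hex := exists_awayLift φ ψ bM bN h m c.inl.hom c.inr.hom hc
  refine ⟨CommRingCat.ofHom hex.choose, ?_, ?_, ?_⟩
  · exact CommRingCat.hom_ext (RingHom.ext hex.choose_spec.1)
  · exact CommRingCat.hom_ext (RingHom.ext hex.choose_spec.2)
  · intro l hl1 hl2
    refine CommRingCat.hom_ext (awayHom_ext' φ ψ bM bN h m (f := l.hom) (g := hex.choose)
      (fun b => ?_) fun x => ?_)
    · exact (congr($hl1 b) : _ = c.inl.hom b).trans (hex.choose_spec.1 b).symm
    · exact (congr($hl2 x) : _ = c.inr.hom x).trans (hex.choose_spec.2 x).symm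

end pushout

/-- The projective space `Proj (Sym_A M)`. -/
abbrev projSym (A M : Type u) [CommRing A] [AddCommGroup M] [Module A M] : Scheme.{u} :=
  Proj (symGrading A M)

/-- The structure morphism `Proj (Sym_A M) ⟶ Spec A`. -/
def projSymStructure (A M : Type u) [CommRing A] [AddCommGroup M] [Module A M] :
    projSym A M ⟶ Spec (.of A) :=
  Proj.toSpecZero (symGrading A M) ≫
    Spec.map (CommRingCat.ofHom (algebraMap A (symGrading A M 0)))

section square

variable {A B : Type u} {M N : Type u} [CommRing A] [AddCommGroup M] [Module A M]
  [CommRing B] [AddCommGroup N] [Module B N]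

lemma awayι_projSymStructure {s : SymmetricAlgebra A M} {i : ℕ} (hs : s ∈ symGrading A M i)
    (hi : 0 < i) : Proj.awayι (symGrading A M) s hs hi ≫ projSymStructure A M =
      Spec.map (CommRingCat.ofHom (awayAlgebraMap s)) := by
  rw [projSymStructure, Proj.awayι_toSpecZero_assoc, ← Spec.map_comp, ← CommRingCat.ofHom_comp]
  rfl

/-- The covering of `Proj (Sym_A M)` by the open sets where some element of `M` does not vanish. -/
def projSymCover (A M : Type u) [CommRing A] [AddCommGroup M] [Module A M] :
    (projSym A M).OpenCover :=
  (Proj.affineOpenCoverOfIrrelevantLESpan (symGrading A M) (SymmetricAlgebra.ι A M)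
    (m := fun _ => 1) ι_mem_symGrading (fun _ => one_pos) irrelevant_le_span).openCover

lemma isPullback_projSym (φ : A →+* B) (ψ : M →ₛₗ[φ] N)
    {ι : Type*} (bM : Module.Basis ι A M) (bN : Module.Basis ι B N)
    (h : ∀ i, ψ (bM i) = bN i) :
    IsPullback (Proj.map (symMap φ ψ) (irrelevant_le_map_symMap φ ψ bM bN h))
      (projSymStructure B N) (projSymStructure A M) (Spec.map (CommRingCat.ofHom φ)) := by
  refine Scheme.isPullback_of_openCover _ _ _ _ (projSymCover A M) fun m => ?_
  change M at m
  let hs := ι_mem_symGrading (A := A) m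
  let ψm := (symMap φ ψ).map_mem hs
  have h1 := isPullback_SpecMap_of_isPushout _ _ _ _ (isPushout_away φ ψ bM bN h m)
  have h2 : IsPullback (Spec.map (CommRingCat.ofHom (HomogeneousLocalization.Away.map (symMap φ ψ)
        (SymmetricAlgebra.ι A M m))))
      (Proj.awayι (symGrading B N) (symMap φ ψ (SymmetricAlgebra.ι A M m)) ψm one_pos)
      (Proj.awayι (symGrading A M) (SymmetricAlgebra.ι A M m) hs one_pos)
      (Proj.map (symMap φ ψ) (irrelevant_le_map_symMap φ ψ bM bN h)) := by
    refine IsOpenImmersion.isPullback _ _ _ _ ?_ ?_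
    · exact Proj.awayι_comp_map _ _ one_pos _ hs
    · rw [Proj.opensRange_awayι, Proj.opensRange_awayι, Proj.map_preimage_basicOpen]
  have h3 : IsPullback (pullback.snd (Proj.map (symMap φ ψ) (irrelevant_le_map_symMap φ ψ bM bN h))
      (Proj.awayι (symGrading A M) (SymmetricAlgebra.ι A M m) hs one_pos))
      (pullback.fst (Proj.map (symMap φ ψ) (irrelevant_le_map_symMap φ ψ bM bN h))
      (Proj.awayι (symGrading A M) (SymmetricAlgebra.ι A M m) hs one_pos))
      (Proj.awayι (symGrading A M) (SymmetricAlgebra.ι A M m) hs one_pos)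
      (Proj.map (symMap φ ψ) (irrelevant_le_map_symMap φ ψ bM bN h)) :=
    (IsPullback.of_hasPullback _ _).flip
  change IsPullback (pullback.snd _ (Proj.awayι (symGrading A M) (SymmetricAlgebra.ι A M m) hs
    one_pos)) (pullback.fst _ (Proj.awayι (symGrading A M) (SymmetricAlgebra.ι A M m) hs
    one_pos) ≫ projSymStructure B N) (Proj.awayι (symGrading A M) (SymmetricAlgebra.ι A M m) hs
    one_pos ≫ projSymStructure A M) (Spec.map (CommRingCat.ofHom φ))
  rw [awayι_projSymStructure]
  let e := h3.isoIsPullback _ _ h2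
  refine IsPullback.of_iso h1.flip e.symm (Iso.refl _) (Iso.refl _) (Iso.refl _) ?_ ?_ ?_ ?_
  · simp [e]
  · rw [Iso.refl_hom, Category.comp_id, Iso.symm_hom, ← awayι_projSymStructure ψm one_pos,
      ← Category.assoc]
    simp [e]
  · simp
  · simp

end square

section functoriality

variable {A B C : Type u} {M N P : Type u} [CommRing A] [AddCommGroup M] [Module A M]
  [CommRing B] [AddCommGroup N] [Module B N] [CommRing C] [AddCommGroup P] [Module C P]

lemma symMap_ext {f g : symGrading A M →+*ᵍ symGrading B N}
    (h0 : ∀ a, f (algebraMap A _ a) = g (algebraMap A _ a))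
    (h1 : ∀ m, f (SymmetricAlgebra.ι A M m) = g (SymmetricAlgebra.ι A M m)) : f = g := by
  refine DFunLike.ext _ _ fun x => ?_
  induction x using SymmetricAlgebra.induction with
  | algebraMap r => exact h0 r
  | ι x => exact h1 x
  | mul a b ha hb => rw [map_mul, map_mul, ha, hb]
  | add a b ha hb => rw [map_add, map_add, ha, hb]

lemma symMap_id (φ : A →+* A) (ψ : M →ₛₗ[φ] M) (h0 : ∀ a, φ a = a) (h1 : ∀ m, ψ m = m) :
    symMap φ ψ = .id _ := by
  refine symMap_ext (fun a => ?_) fun m => ?_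
  · exact (symMapRingHom_algebraMap φ ψ a).trans (by rw [h0]; rfl)
  · exact (symMapRingHom_ι φ ψ m).trans (by rw [h1]; rfl)

lemma symMap_comp (φ : A →+* B) (ψ : M →ₛₗ[φ] N) (φ' : B →+* C) (ψ' : N →ₛₗ[φ'] P)
    (φ'' : A →+* C) (ψ'' : M →ₛₗ[φ''] P) (h0 : ∀ a, φ'' a = φ' (φ a))
    (h1 : ∀ m, ψ'' m = ψ' (ψ m)) :
    symMap φ'' ψ'' = (symMap φ' ψ').comp (symMap φ ψ) := by
  refine symMap_ext (fun a => ?_) fun m => ?_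
  · refine (symMapRingHom_algebraMap φ'' ψ'' a).trans ?_
    change _ = symMapRingHom φ' ψ' (symMapRingHom φ ψ _)
    rw [symMapRingHom_algebraMap, symMapRingHom_algebraMap, h0]
  · refine (symMapRingHom_ι φ'' ψ'' m).trans ?_
    change _ = symMapRingHom φ' ψ' (symMapRingHom φ ψ _)
    rw [symMapRingHom_ι, symMapRingHom_ι, h1]

end functoriality

/-! ### Vector bundles and their projectivizations -/

section bundles

variable {X : Scheme.{u}}

/-- Restriction of functions. -/
def resFun {U V : X.Opens} (h : V ≤ U) : Γ(X, U) →+* Γ(X, V) :=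
  (X.presheaf.map (homOfLE h).op).hom

/-- Restriction of sections of a sheaf of modules. -/
def resSec (M : X.Modules) {U V : X.Opens} (h : V ≤ U) : Γ(M, U) →ₛₗ[resFun h] Γ(M, V) where
  toFun := M.presheaf.map (homOfLE h).op
  map_add' := map_add _
  map_smul' := Scheme.Modules.map_smul M (homOfLE h)

lemma resFun_self {U : X.Opens} (h : U ≤ U) (a : Γ(X, U)) : resFun h a = a :=
  congr($(X.presheaf.map_id (.op U)) a)

lemma resFun_resFun {U V W : X.Opens} (h : V ≤ U) (h' : W ≤ V) (a : Γ(X, U)) :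
    resFun h' (resFun h a) = resFun (h'.trans h) a :=
  congr($(X.presheaf.map_comp (homOfLE h).op (homOfLE h').op) a).symm

lemma resSec_self (M : X.Modules) {U : X.Opens} (h : U ≤ U) (s : Γ(M, U)) : resSec M h s = s :=
  congr($(M.presheaf.map_id (.op U)) s)

lemma resSec_resSec (M : X.Modules) {U V W : X.Opens} (h : V ≤ U) (h' : W ≤ V) (s : Γ(M, U)) :
    resSec M h' (resSec M h s) = resSec M (h'.trans h) s :=
  congr($(M.presheaf.map_comp (homOfLE h).op (homOfLE h').op) s).symm

/-- The sections `e i` form a frame of `M` over `U`: they induce an isomorphism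
`𝒪^ι ≅ M` over `U`. -/
def IsFrame (M : X.Modules) {ι : Type} [Fintype ι] (U : X.Opens) (e : ι → Γ(M, U)) : Prop :=
  ∀ (V : X.Opens) (h : V ≤ U),
    Function.Bijective fun c : ι → Γ(X, V) => ∑ i, c i • resSec M h (e i)

lemma IsFrame.res {M : X.Modules} {ι : Type} [Fintype ι] {U V : X.Opens} {e : ι → Γ(M, U)}
    (he : IsFrame M U e) (h : V ≤ U) : IsFrame M V fun i => resSec M h (e i) := by
  intro W h'
  simp only [resSec_resSec]
  exact he W (h'.trans h)

/-- A frame over `U` restricts to a basis over any smaller open set. -/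
def IsFrame.basis {M : X.Modules} {ι : Type} [Fintype ι] {U : X.Opens} {e : ι → Γ(M, U)}
    (he : IsFrame M U e) {V : X.Opens} (h : V ≤ U) : Module.Basis ι Γ(X, V) Γ(M, V) :=
  .ofEquivFun (LinearEquiv.ofBijective
    ({ toFun := fun c : ι → Γ(X, V) => ∑ i, c i • resSec M h (e i)
       map_add' := fun c d => by
        simp only [Pi.add_apply, add_smul, Finset.sum_add_distrib]
       map_smul' := fun a c => by
        simp only [Pi.smul_apply, smul_eq_mul, mul_smul, Finset.smul_sum, RingHom.id_apply] }
      : (ι → Γ(X, V)) →ₗ[Γ(X, V)] Γ(M, V)) (he V h)).symm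

lemma IsFrame.basis_apply {M : X.Modules} {ι : Type} [Fintype ι] {U : X.Opens} {e : ι → Γ(M, U)}
    (he : IsFrame M U e) {V : X.Opens} (h : V ≤ U) (i : ι) :
    he.basis h i = resSec M h (e i) := by
  classical
  rw [IsFrame.basis, Module.Basis.coe_ofEquivFun]
  change ∑ j, (Function.update (0 : ι → Γ(X, V)) i 1 j) • resSec M h (e j) = _
  rw [Finset.sum_eq_single i]
  · simp
  · intro j _ hj; simp [hj]
  · simp

/-- A vector bundle of rank `r` on `X`: a locally free sheaf of rank `r`. -/
structure VectorBundle (X : Scheme.{u}) (r : ℕ) where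
  sheaf : X.Modules
  locallyFree : ∀ x : X, ∃ U : X.Opens, x ∈ U ∧ ∃ e : Fin r → Γ(sheaf, U), IsFrame sheaf U e

/-- A line bundle on `X`: a locally free sheaf of rank one. -/
abbrev LineBundle (X : Scheme.{u}) := VectorBundle X 1

namespace VectorBundle

variable {r : ℕ} (E : VectorBundle X r)

/-- The affine open subsets over which `E` is free. -/
abbrev FreeOpen : Type u :=
  {U : X.Opens // IsAffineOpen U ∧ ∃ e : Fin r → Γ(E.sheaf, U), IsFrame E.sheaf U e}

lemma exists_freeOpen {x : X} {W : X.Opens} (hx : x ∈ W) : ∃ U : E.FreeOpen, x ∈ U.1 ∧ U.1 ≤ W := by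
  obtain ⟨U, hxU, e, he⟩ := E.locallyFree x
  obtain ⟨_, ⟨V, hV, rfl⟩, hxV, hVU⟩ :=
    X.isBasis_affineOpens.exists_subset_of_mem_open (show x ∈ U ⊓ W from ⟨hxU, hx⟩) (U ⊓ W).2
  exact ⟨⟨V, hV, _, he.res fun y hy => (hVU hy).1⟩, hxV, fun y hy => (hVU hy).2⟩

/-- The covering of `X` by the affine open subsets over which `E` is free. -/
def freeCover : X.OpenCover where
  I₀ := E.FreeOpen
  X U := Spec Γ(X, U.1)
  f U := U.2.1.fromSpec
  mem₀ := by
    rw [Scheme.presieve₀_mem_precoverage_iff]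
    refine ⟨fun x => ?_, fun U => U.2.1.isOpenImmersion_fromSpec⟩
    obtain ⟨U, hU, -⟩ := E.exists_freeOpen (show x ∈ (⊤ : X.Opens) from trivial)
    refine ⟨U, ?_⟩
    rw [U.2.1.range_fromSpec]
    exact hU

instance : PartialOrder E.freeCover.I₀ := inferInstanceAs (PartialOrder E.FreeOpen)

instance : E.freeCover.LocallyDirected :=
  .ofIsBasisOpensRange
    (fun {U V} => by
      change U.1 ≤ V.1 ↔ (U.2.1.fromSpec).opensRange ≤ (V.2.1.fromSpec).opensRange
      rw [U.2.1.opensRange_fromSpec, V.2.1.opensRange_fromSpec])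
    (by
      rw [Opens.isBasis_iff_nbhd]
      intro W x hx
      obtain ⟨U, hxU, hU⟩ := E.exists_freeOpen hx
      exact ⟨U.1, ⟨U, U.2.1.opensRange_fromSpec⟩, hxU, hU⟩)

lemma freeCover_trans {U V : E.FreeOpen} (h : V ≤ U) :
    E.freeCover.trans (i := V) (j := U) (homOfLE h) =
      Spec.map (CommRingCat.ofHom (resFun (show V.1 ≤ U.1 from h))) := by
  have : IsOpenImmersion (E.freeCover.f U) := U.2.1.isOpenImmersion_fromSpec
  refine (cancel_mono (E.freeCover.f U)).1 ((Scheme.Cover.trans_map E.freeCover _).trans ?_)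
  exact (U.2.1.map_fromSpec V.2.1 (homOfLE h).op).symm

/-- The basis of sections over `V ≤ U` given by the restriction of a frame over `U`. -/
def freeBasis {U V : E.FreeOpen} (h : V ≤ U) : Module.Basis (Fin r) Γ(X, V.1) Γ(E.sheaf, V.1) :=
  U.2.2.choose_spec.basis h

lemma resSec_freeBasis {U V : E.FreeOpen} (h : V ≤ U) (i : Fin r) :
    resSec E.sheaf h (E.freeBasis (le_refl U) i) = E.freeBasis h i := by
  rw [freeBasis, freeBasis, IsFrame.basis_apply, IsFrame.basis_apply, resSec_resSec]

/-- `Proj (Sym E)` over the affine open subsets over which `E` is free. -/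
def projFunctor : E.FreeOpen ⥤ Scheme.{u} where
  obj U := projSym Γ(X, U.1) Γ(E.sheaf, U.1)
  map {V U} f := Proj.map (symMap (resFun (leOfHom f)) (resSec E.sheaf (leOfHom f)))
    (irrelevant_le_map_symMap _ _ (E.freeBasis (le_refl U)) (E.freeBasis (leOfHom f))
      (E.resSec_freeBasis (leOfHom f)))
  map_id U := by
    rw [← Proj.map_id]
    congr 1
    exact symMap_id _ _ (resFun_self _) (resSec_self _ _)
  map_comp {W V U} f g := by
    rw [← Proj.map_comp]
    congr 1
    exact symMap_comp _ _ _ _ _ _ (fun a => (resFun_resFun _ _ a).symm)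
      fun m => (resSec_resSec _ _ _ m).symm

/-- The gluing datum for `Proj (Sym E)`. -/
def projGluing : E.freeCover.RelativeGluingData where
  functor := E.projFunctor
  natTrans :=
    { app := fun U => projSymStructure Γ(X, U.1) Γ(E.sheaf, U.1)
      naturality := fun V U f => by
        refine (isPullback_projSym _ _ (E.freeBasis (le_refl U)) (E.freeBasis (leOfHom f))
          (E.resSec_freeBasis (leOfHom f))).w.trans ?_
        exact congrArg (projSymStructure Γ(X, V.1) Γ(E.sheaf, V.1) ≫ ·)
          (E.freeCover_trans (leOfHom f)).symm }
  equifibered := fun V U f => by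
    refine IsPullback.of_iso (isPullback_projSym _ _ (E.freeBasis (le_refl U))
      (E.freeBasis (leOfHom f)) (E.resSec_freeBasis (leOfHom f)))
      (Iso.refl _) (Iso.refl _) (Iso.refl _) (Iso.refl _) ?_ ?_ ?_ ?_
    · exact (Category.comp_id _).trans (Category.id_comp _).symm
    · exact (Category.comp_id _).trans (Category.id_comp _).symm
    · exact (Category.comp_id _).trans (Category.id_comp _).symm
    · refine (Category.comp_id _).trans ((E.freeCover_trans (leOfHom f)).symm.trans
        (Category.id_comp _).symm)

/-- The projectivization `ℙ(E) = Proj (Sym E)`, glued from the schemes `Proj (Sym_{𝒪(U)} E(U))` for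
`U` an affine open subset over which `E` is free. -/
def projectivization : Scheme.{u} := E.projGluing.glued

/-- The projection `ℙ(E) ⟶ X`. -/
def projection : E.projectivization ⟶ X := E.projGluing.toBase

end VectorBundle

end bundles

/-! ### Toric vector bundles -/

/-- The character `χ^u` of the torus `T = (kˣ)ⁿ`. -/
def character (k : Type u) [Field k] {n : ℕ} (u : Fin n → ℤ) : (Fin n → kˣ) →* kˣ where
  toFun t := ∏ i, t i ^ u i
  map_one' := by simp
  map_mul' s t := by simp [mul_zpow, Finset.prod_mul_distrib]

/-- A toric vector bundle of rank `r` on the toric variety `X_Δ`: a vector bundle with an action of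
the torus `T` on its total space, linear on the fibres and covering the action of `T` on `X_Δ`.
The action is given through the induced action `(t · s)(x) = t (s (t⁻¹ x))` on the sections over the
`T`-invariant affine open sets `U_σ`. Functions are acted on by `(t · f)(x) = f (t⁻¹ x)`, so that
`t · χ^u = χ^u(t)⁻¹ χ^u`. -/
structure ToricVectorBundle (k : Type u) [Field k] {n : ℕ} (Δ : Fan n) (r : ℕ) extends
    VectorBundle (Δ.toricVariety k) r where
  /-- The action of the torus on the sections over `U_σ`. -/
  act (σ : Δ.Cone) : (Fin n → kˣ) →* AddMonoid.End Γ(sheaf, Δ.chart k σ)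
  /-- The action is semilinear: `t · (f s) = (t · f) (t · s)`. -/
  act_smul (σ : Δ.Cone) (t : Fin n → kˣ) (u : dualMonoid σ.1) (a : k) (s : Γ(sheaf, Δ.chart k σ)) :
    act σ t (Δ.coord k σ (.single u a) • s) =
      Δ.coord k σ (.single u (((character k u.1 t)⁻¹ : kˣ) * a)) • act σ t s
  /-- The action is compatible with restriction. -/
  act_res {τ σ : Δ.Cone} (h : τ ≤ σ) (t : Fin n → kˣ) (s : Γ(sheaf, Δ.chart k σ)) :
    act τ t (resSec sheaf (Fan.chart_mono k h) s) = resSec sheaf (Fan.chart_mono k h) (act σ t s)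
  /-- The action is algebraic: the orbit of a section `s` is given by a Laurent polynomial
  `∑ χ^u s_u` with coefficients sections `s_u`. -/
  act_algebraic (σ : Δ.Cone) (s : Γ(sheaf, Δ.chart k σ)) :
    ∃ c : (Fin n → ℤ) →₀ Γ(sheaf, Δ.chart k σ), ∀ t : Fin n → kˣ,
      act σ t s = c.sum fun u x => Δ.coord k σ (.single 0 (character k u t : k)) • x

/-- The structure morphism of the projectivization of a toric vector bundle. -/
def ToricVectorBundle.structureMorphism {k : Type u} [Field k] {n : ℕ} {Δ : Fan n} {r : ℕ}
    (E : ToricVectorBundle k Δ r) : E.projectivization ⟶ Spec (.of k) :=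
  E.projection ≫ Δ.toricStructure k

/-! ### Cox rings -/

section Cox

variable {P : Scheme.{u}} {s : ℕ} (L : Fin s → LineBundle P)

/-- A choice of a generator `e_l` of each of the line bundles `L_l` over an open set `V`. -/
@[ext]
structure Frame (V : P.Opens) where
  gen : ∀ l, Γ((L l).sheaf, V)
  isFrame : ∀ l, IsFrame (L l).sheaf V fun _ : Fin 1 => gen l

variable {L} in
/-- Restriction of generators. -/
def Frame.res {U V : P.Opens} (e : Frame L U) (h : V ≤ U) : Frame L V where
  gen l := resSec (L l).sheaf h (e.gen l)
  isFrame l := (e.isFrame l).res h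

/-- The ring of all functions assigning to generators `e_1, …, e_s` of the `L_l` over an open set
`V` a function on `V`. -/
abbrev FrameFunctions : Type u := ∀ V : P.Opens, Frame L V → Γ(P, V)

/-- The global sections of `L_1^{⊗ m_1} ⊗ ⋯ ⊗ L_s^{⊗ m_s}`. A section is given by its coefficients:
over an open set `V` where the `L_l` have generators `e_l`, it is
`f V e • e_1^{⊗ m_1} ⊗ ⋯ ⊗ e_s^{⊗ m_s}`. If `e'_l = w_l e_l` with units `w_l`, then
`f V e = w_1^{m_1} ⋯ w_s^{m_s} f V e'`. -/
def tensorSections (m : Fin s → ℤ) : AddSubgroup (FrameFunctions L) where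
  carrier := {f |
    (∀ (U V : P.Opens) (h : V ≤ U) (e : Frame L U), f V (e.res h) = resFun h (f U e)) ∧
    ∀ (V : P.Opens) (e e' : Frame L V) (w : Fin s → Γ(P, V)ˣ),
      (∀ l, e'.gen l = (w l : Γ(P, V)) • e.gen l) → f V e = (∏ l, w l ^ m l : Γ(P, V)ˣ) * f V e'}
  zero_mem' := by
    refine ⟨fun U V h e => (map_zero _).symm, fun V e e' w _ => (mul_zero _).symm⟩
  add_mem' := by
    rintro f g ⟨hf, hf'⟩ ⟨hg, hg'⟩
    refine ⟨fun U V h e => ?_, fun V e e' w hw => ?_⟩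
    · simp only [Pi.add_apply, hf U V h, hg U V h, map_add]
    · simp only [Pi.add_apply, hf' V e e' w hw, hg' V e e' w hw, mul_add]
  neg_mem' := by
    rintro f ⟨hf, hf'⟩
    refine ⟨fun U V h e => ?_, fun V e e' w hw => ?_⟩
    · simp only [Pi.neg_apply, hf U V h, map_neg]
    · simp only [Pi.neg_apply, hf' V e e' w hw, mul_neg]

instance : SetLike.GradedMonoid (tensorSections L) where
  one_mem := by
    refine ⟨fun U V h e => (map_one _).symm, fun V e e' w _ => ?_⟩
    simp
  mul_mem := by
    rintro m m' f g ⟨hf, hf'⟩ ⟨hg, hg'⟩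
    refine ⟨fun U V h e => ?_, fun V e e' w hw => ?_⟩
    · simp only [Pi.mul_apply, hf U V h, hg U V h, map_mul]
    · simp only [Pi.mul_apply, hf' V e e' w hw, hg' V e e' w hw, Pi.add_apply, zpow_add,
        Finset.prod_mul_distrib, Units.val_mul]
      ring

/-- The tensor product `L_1^{⊗ m_1} ⊗ ⋯ ⊗ L_s^{⊗ m_s}` is trivial: it has a nowhere vanishing
section. -/
def IsTrivialTensor (m : Fin s → ℤ) : Prop :=
  ∃ f ∈ tensorSections L m, ∀ (V : P.Opens) (e : Frame L V), IsUnit (f V e)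

/-- The classes of `L_1, …, L_s` span `Pic(P) ⊗ ℚ`: for each line bundle `N` there are `d > 0` and
`m_1, …, m_s ∈ ℤ` such that `N^{⊗ d}` is isomorphic to `L_1^{⊗ m_1} ⊗ ⋯ ⊗ L_s^{⊗ m_s}`. -/
def SpansPicQ : Prop :=
  ∀ N : LineBundle P, ∃ d : ℤ, 0 < d ∧ ∃ m : Fin s → ℤ,
    IsTrivialTensor (Fin.cons N L : Fin (s + 1) → LineBundle P)
      (Fin.cons d (-m) : Fin (s + 1) → ℤ)

/-- A function, as a section of the trivial bundle `L_1^{⊗ 0} ⊗ ⋯ ⊗ L_s^{⊗ 0}`. -/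
def constSection : Γ(P, ⊤) →+* tensorSections L 0 where
  toFun a := ⟨fun V _ => resFun le_top a,
    fun U V h e => (resFun_resFun _ _ a).symm, fun V e e' w _ => by simp⟩
  map_one' := Subtype.ext (funext fun V => funext fun _ => map_one _)
  map_mul' a b := Subtype.ext (funext fun V => funext fun _ => map_mul _ a b)
  map_zero' := Subtype.ext (funext fun V => funext fun _ => map_zero _)
  map_add' a b := Subtype.ext (funext fun V => funext fun _ => map_add _ a b)

variable {k : Type u} [Field k] (p : P ⟶ Spec (.of k))

/-- The ring `⨁ H⁰(P, L_1^{⊗ m_1} ⊗ ⋯ ⊗ L_s^{⊗ m_s})`, the sum ranging over `m ∈ ℤ^s`. It is a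
Cox ring of `P` if the classes of the `L_l` span `Pic(P) ⊗ ℚ`. -/
def CoxRing (_ : P ⟶ Spec (.of k)) (L : Fin s → LineBundle P) : Type u :=
  DirectSum (Fin s → ℤ) fun m => tensorSections L m

instance : CommRing (CoxRing p L) :=
  inferInstanceAs (CommRing (DirectSum (Fin s → ℤ) fun m => tensorSections L m))

/-- The structure of a `k`-algebra on the Cox ring of a `k`-scheme. -/
instance : Algebra k (CoxRing p L) :=
  ((DirectSum.ofZeroRingHom fun m => tensorSections L m).comp ((constSection L).comp
    ((Scheme.ΓSpecIso (.of k)).inv ≫ p.appTop).hom)).toAlgebra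

end Cox

end ToricCox

end

set_option linter.unusedSectionVars false

noncomputable section

/-! ### Gordan's lemma: lattice points of rational polyhedral cones. -/

namespace ToricCox

/-! The projectivization is covered by affine charts that look toric, with common characters of the
torus but with a fibre coordinate depending on the cone. Since `k` is infinite, distinct characters
are linearly independent and sections over an invariant chart split into weight vectors. A graded
Nakayama argument at the distinguished point of a chart gives a frame of weight vectors there
(`exists_weightFrame`). Over the torus the frame can be rescaled to weight zero, say `ε 0, ε 1`; so
the part of the projectivization over the torus is the product of the torus and a projective line
with coordinate `y = ε 1 / ε 0`. Over the chart of a cone, the weight vectors multiplied by suitable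
characters become linear forms in `ε 0, ε 1` with constant coefficients (`exists_invariantFrame`).
Hence the two charts of the projectivization over it have rings spanned by monomials in the
characters and in a homographic transform `z` of `y` (`isMonomialChart_toricChart`).

The projectivization is integral, so sections of tensor products of the line bundles become rational
functions, and the Cox ring becomes a subring of Laurent polynomials in `s` variables over the
function field: its elements are those whose coefficient in degree `m` is a section of degree `m` at
every point (`finiteType_coxRing`). The chart with ring `k[ℤⁿ][y]` is factorial, so all the line
bundles are trivial on it (`exists_forall_isSectionAt_iff_mem_range`), and a section of degree `m`
over it is `E^m` times a finite sum `∑ χ^u f_u(y)`, where `E` consists of fixed generators.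

It remains to say when such a sum extends to the other charts. On a monomial chart, extension is
decided by finitely many monomial valuations, with lower bounds additive in `m`
(`LocalChart.exists_forall_isSectionAt_iff_le`). A monomial valuation takes the minimum over terms,
so the condition separates over the characters `u`. For a single `f_u`, viewed as a binary form, the
least exponent of `z` weighted by an integer is a vanishing order at the zero or at the pole of `z`,
both of them points of the projective line over `k` (`exists_monomialValuation_vanishing`). The
chart with ring `k[ℤⁿ][y⁻¹]` contributes the bound for the degree. So the sections of degree `m` are
spanned by the `E^m χ^u f(y)` where `f` is a form of degree `d(m)` whose vanishing orders at
finitely many points are bounded below by linear inequalities in `(u, m)`.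

Rank two matters here: on a projective line, a form with prescribed zeros is divisible by the
corresponding product of powers of linear forms, and expanding the cofactor in powers of `y` writes
it as a combination of products of linear forms that satisfy the same conditions (`Good.mem_span`).
The exponents of these products are the lattice points of a rational polyhedral cone, so Gordan's
lemma provides finitely many generators (`fg_of_forall_mem_iff`). -/

/-- **Gordan's lemma**. -/
theorem fg_comap_nonneg {ι κ : Type*} [Finite ι] [Finite κ]
    (φ : (κ → ℤ) →+ (ι → ℤ)) : ((AddSubmonoid.nonneg (ι → ℤ)).comap φ).FG := by
  let g : (κ → ℕ) × (κ → ℕ) →+ (κ → ℤ) :=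
    { toFun := fun c i => (c.1 i : ℤ) - c.2 i
      map_zero' := by ext; simp
      map_add' := fun a b => by ext; simp; ring }
  let e : (ι → ℕ) →+ (ι → ℤ) :=
    { toFun := fun c i => (c i : ℤ)
      map_zero' := by ext; simp
      map_add' := fun a b => by ext; simp }
  let p : ((κ → ℕ) × (κ → ℕ)) × (ι → ℕ) →+ (κ → ℤ) := g.comp (AddMonoidHom.fst _ _)
  have h := (AddSubmonoid.fg_eqLocusM (φ.comp p) (e.comp (AddMonoidHom.snd _ _))).map p
  convert h using 1
  ext x
  simp only [AddSubmonoid.mem_comap, AddSubmonoid.mem_nonneg, AddSubmonoid.mem_map]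
  constructor
  · intro hx
    refine ⟨((fun i => (x i).toNat, fun i => (-x i).toNat), fun i => (φ x i).toNat), ?_, ?_⟩
    · have hp : p ((fun i => (x i).toNat, fun i => (-x i).toNat), fun i => (φ x i).toNat) = x := by
        ext i; simp [p, g]
      change φ (p _) = e _
      rw [hp]
      ext i
      exact (Int.toNat_of_nonneg (hx i)).symm
    · ext i; simp [p, g]
  · rintro ⟨y, hy, rfl⟩
    have : φ (p y) = e y.2 := hy
    rw [this]
    intro i
    exact Int.natCast_nonneg _

/-! ### Triviality of line bundles on factorial affine schemes. -/

section UFD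

variable {S : Type*} [CommRing S]

/-- A maximal ideal above `I` is prime, so it would contain every `g i`, which generate the unit
ideal. -/
theorem eq_top_of_pow_mem {ι : Type*} {g : ι → S} (hg : Ideal.span (Set.range g) = ⊤)
    {I : Ideal S} (h : ∀ i, ∃ N, g i ^ N ∈ I) : I = ⊤ := by
  by_contra hI
  obtain ⟨M, hM, hIM⟩ := I.exists_le_maximal hI
  refine hM.ne_top (top_unique (hg.symm.trans_le (Ideal.span_le.2 ?_)))
  rintro _ ⟨i, rfl⟩
  obtain ⟨N, hN⟩ := h i
  exact hM.isPrime.mem_of_pow_mem N (hIM hN)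

/-- Divisibility is local on the spectrum: the ideal of the `r` with `x ∣ y * r` contains a power of
each `g i`. -/
theorem dvd_of_dvd_mul_pow {ι : Type*} {g : ι → S} (hg : Ideal.span (Set.range g) = ⊤)
    {x y : S} (h : ∀ i, ∃ N, x ∣ y * g i ^ N) : x ∣ y := by
  have := eq_top_of_pow_mem hg (I := Submodule.comap (LinearMap.mulLeft S y) (Ideal.span {x}))
    fun i => (h i).imp fun N hN => Ideal.mem_span_singleton.2 hN
  have := (Ideal.eq_top_iff_one _).1 this
  simpa [Ideal.mem_span_singleton] using this

/-- In a unique factorization domain, cocycles of nonzero elements which are units on the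
intersections of the members of a finite open cover of the spectrum are coboundaries. -/
theorem exists_generator_of_cocycle [IsDomain S] [UniqueFactorizationMonoid S]
    {ι : Type*} [Finite ι] {g : ι → S} (hg : Ideal.span (Set.range g) = ⊤) {n : ι → S}
    (hn : ∀ i, n i ≠ 0) (hc : ∀ i j, ∃ N, n j ∣ n i * (g i * g j) ^ N) :
    ∃ t ≠ 0, ∀ i, (∃ N, t ∣ n i * g i ^ N) ∧ ∃ N, n i ∣ t * g i ^ N := by
  classical
  have := Fintype.ofFinite ι
  have hmono : ∀ {x y z : S} {N M : ℕ}, N ≤ M → x ∣ y * z ^ N → x ∣ y * z ^ M :=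
    fun h hd => hd.trans (mul_dvd_mul_left _ (pow_dvd_pow _ h))
  obtain ⟨N, hN⟩ : ∃ N, ∀ i j, n j ∣ n i * (g i * g j) ^ N := by
    choose N hN using hc
    exact ⟨∑ i, ∑ j, N i j, fun i j => hmono
      ((Finset.single_le_sum (f := fun j => N i j) (fun _ _ => zero_le) (Finset.mem_univ j)).trans
        (Finset.single_le_sum (f := fun i => ∑ j, N i j) (fun _ _ => zero_le)
          (Finset.mem_univ i))) (hN i j)⟩
  let P (x y : ι → S) : Ideal S :=
    { carrier := {s | ∀ i, ∃ N, x i ∣ s * y i * g i ^ N}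
      zero_mem' := fun i => ⟨0, by simp⟩
      add_mem' := fun {a b} ha hb i => by
        obtain ⟨N, hN⟩ := ha i
        obtain ⟨M, hM⟩ := hb i
        refine ⟨max N M, ?_⟩
        rw [add_mul, add_mul]
        exact dvd_add (hmono (le_max_left _ _) hN) (hmono (le_max_right _ _) hM)
      smul_mem' := fun c a ha i => by
        obtain ⟨N, hN⟩ := ha i
        refine ⟨N, ?_⟩
        rw [smul_eq_mul, mul_assoc, mul_assoc, ← mul_assoc a]
        exact hN.mul_left c }
  have hP : ∀ {x y : ι → S} {s}, s ∈ P x y ↔ ∀ i, ∃ N, x i ∣ s * y i * g i ^ N := Iff.rfl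
  let T := ∏ i, n i
  have hT : T ≠ 0 := Finset.prod_ne_zero_iff.2 fun i _ => hn i
  -- `I` is the invertible ideal generated by `n i` over the basic open set of `g i`, and `J` plays
  -- the role of `T` times its inverse.
  let I := P n 1
  let J := P (fun _ => T) n
  have hnI : ∀ i, n i * g i ^ N ∈ I := fun i => hP.2 fun j =>
    ⟨N, by rw [Pi.one_apply, mul_one, mul_assoc, ← mul_pow]; exact hN i j⟩
  have hIJ : I * J = Ideal.span {T} := by
    refine le_antisymm (Ideal.mul_le.2 fun r hr s hs => ?_) ?_
    · refine Ideal.mem_span_singleton.2 (dvd_of_dvd_mul_pow hg fun i => ?_)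
      obtain ⟨M, a, ha⟩ := hP.1 hr i
      obtain ⟨M', hM'⟩ := hP.1 hs i
      refine ⟨M + M', ?_⟩
      rw [Pi.one_apply, mul_one] at ha
      have : r * s * g i ^ (M + M') = s * n i * g i ^ M' * a := by
        rw [pow_add]; linear_combination (s * g i ^ M') * ha
      rw [this]
      exact hM'.mul_right a
    · rw [Ideal.span_singleton_le_iff_mem]
      have := eq_top_of_pow_mem hg
        (I := Submodule.comap (LinearMap.mulLeft S T) (I * J)) fun i => ⟨N + N, ?_⟩
      · have := (Ideal.eq_top_iff_one _).1 this
        simpa using this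
      -- The cofactor `T / n i` lies in `J` up to a power of `g i`; its product with the element of
      -- `I` from `hnI` is `T` times a power of `g i`.
      · have h1 : (∏ j ∈ Finset.univ.erase i, n j) * g i ^ N ∈ J := hP.2 fun j => by
          refine ⟨N, ?_⟩
          have h2 : T = n i * ∏ j ∈ Finset.univ.erase i, n j :=
            (Finset.mul_prod_erase _ _ (Finset.mem_univ i)).symm
          have h3 : (∏ j ∈ Finset.univ.erase i, n j) * g i ^ N * n j * g j ^ N =
            (n j * (g j * g i) ^ N) * ∏ j ∈ Finset.univ.erase i, n j := by
            rw [mul_pow]; ring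
          rw [h2, h3]
          exact mul_dvd_mul_right (hN j i) _
        have h4 := Ideal.mul_mem_mul (hnI i) h1
        have h5 : n i * g i ^ N * ((∏ j ∈ Finset.univ.erase i, n j) * g i ^ N) =
            T * g i ^ (N + N) := by
          rw [show T = n i * ∏ j ∈ Finset.univ.erase i, n j from
            (Finset.mul_prod_erase _ _ (Finset.mem_univ i)).symm, pow_add]
          ring
        rw [h5] at h4
        exact h4
  -- In a domain with greatest common divisors, an ideal is principal as soon as its product with
  -- some ideal is principal and nonzero.
  obtain ⟨t, ht⟩ := (IsGCDMonoid.isPrincipal_of_exists_mul_ne_zero_isPrincipal (J := I)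
    ⟨J, by rw [hIJ]; simpa using hT, by rw [hIJ]; infer_instance⟩).principal
  have htI : ∀ s, s ∈ I ↔ t ∣ s := fun s => by
    rw [ht]; exact Ideal.mem_span_singleton
  refine ⟨t, ?_, fun i => ⟨⟨N, (htI _).1 (hnI i)⟩, ?_⟩⟩
  · rintro rfl
    have : I = ⊥ := by rw [ht]; simp
    rw [this, Ideal.bot_mul, eq_comm, Ideal.span_singleton_eq_bot] at hIJ
    exact hT hIJ
  · simpa using hP.1 ((htI t).2 dvd_rfl) i

end UFD

/-! ### Affine charts inside a field, and sections of line bundles over them. -/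

section Charts

variable {P K : Type*} [Field K]

/-- An affine chart of a space of points `P`, with local rings `O p` in a field `K`: a
subring `S` of `K`, with a map from the spectrum of `S` to `P` such that the local rings of `P` are
the localizations of `S`. -/
structure LocalChart (O : P → Subring K) (S : Type*) [CommRing S] where
  hom : S →+* K
  injective : Function.Injective hom
  pt : PrimeSpectrum S → P
  mem_iff (q : PrimeSpectrum S) (x : K) :
    x ∈ O (pt q) ↔ ∃ a b, b ∉ q.asIdeal ∧ x * hom b = hom a

variable {O : P → Subring K} {S : Type*} [CommRing S] (C : LocalChart O S)

namespace LocalChart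

lemma hom_ne_zero {a : S} (h : a ≠ 0) : C.hom a ≠ 0 :=
  (map_ne_zero_iff _ C.injective).2 h

/-- The denominators of `x` form an ideal. If `x` is regular wherever `g` does not vanish, every
prime containing this ideal contains `g`, so some power of `g` is a denominator. -/
lemma forall_mem_iff (g : S) (x : K) :
    (∀ q, g ∉ q.asIdeal → x ∈ O (C.pt q)) ↔ ∃ N a, x * C.hom g ^ N = C.hom a := by
  constructor
  · intro h
    let I : Ideal S :=
      { carrier := {b | ∃ a, x * C.hom b = C.hom a}
        zero_mem' := ⟨0, by simp⟩
        add_mem' := by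
          rintro b b' ⟨a, ha⟩ ⟨a', ha'⟩
          exact ⟨a + a', by rw [map_add, mul_add, ha, ha', map_add]⟩
        smul_mem' := by
          rintro c b ⟨a, ha⟩
          exact ⟨c * a, by rw [smul_eq_mul, map_mul, map_mul, ← ha]; ring⟩ }
    have : g ∈ I.radical := by
      rw [Ideal.radical_eq_sInf, Ideal.mem_sInf]
      rintro q ⟨hIq, hq⟩
      by_contra hg
      obtain ⟨a, b, hb, hab⟩ := (C.mem_iff ⟨q, hq⟩ x).1 (h ⟨q, hq⟩ hg)
      exact hb (hIq ⟨a, hab⟩)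
    obtain ⟨N, a, ha⟩ := this
    exact ⟨N, a, by rw [← ha, map_pow]⟩
  · rintro ⟨N, a, ha⟩ q hq
    exact (C.mem_iff q x).2 ⟨a, g ^ N, fun h => hq (q.2.mem_of_pow_mem N h), by rw [map_pow, ha]⟩

end LocalChart

variable {s : ℕ}

/-- The monomial `h_1^{m_1} ⋯ h_s^{m_s}`. -/
def unitsMonomial (h : Fin s → Kˣ) (m : Fin s → ℤ) : Kˣ := ∏ l, h l ^ m l

@[simp] lemma unitsMonomial_zero (h : Fin s → Kˣ) : unitsMonomial h 0 = 1 := by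
  simp [unitsMonomial]

lemma unitsMonomial_add (h : Fin s → Kˣ) (m m' : Fin s → ℤ) :
    unitsMonomial h (m + m') = unitsMonomial h m * unitsMonomial h m' := by
  simp [unitsMonomial, zpow_add, Finset.prod_mul_distrib]

lemma unitsMonomial_div (h h' : Fin s → Kˣ) (m : Fin s → ℤ) :
    unitsMonomial (fun l => h l / h' l) m = unitsMonomial h m / unitsMonomial h' m := by
  simp [unitsMonomial, div_zpow, Finset.prod_div_distrib]

/-- The group of units of a subring of a field. -/
def _root_.Subring.unitGroup (R : Subring K) : Subgroup Kˣ where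
  carrier := {u | (u : K) ∈ R ∧ ((u⁻¹ : Kˣ) : K) ∈ R}
  one_mem' := by simp [R.one_mem]
  mul_mem' := by
    rintro a b ⟨ha, ha'⟩ ⟨hb, hb'⟩
    rw [Set.mem_ofPred_eq, mul_inv]
    exact ⟨R.mul_mem ha hb, R.mul_mem ha' hb'⟩
  inv_mem' := by
    rintro a ⟨ha, ha'⟩
    exact ⟨ha', by rwa [inv_inv]⟩

lemma _root_.Subring.mul_mem_iff_of_mem_unitGroup {R : Subring K} {u : Kˣ} (hu : u ∈ R.unitGroup) {x : K} :
    x * u ∈ R ↔ x ∈ R := by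
  refine ⟨fun h => ?_, fun h => R.mul_mem h hu.1⟩
  simpa using R.mul_mem h hu.2

lemma unitsMonomial_mem_unitGroup {R : Subring K} {h : Fin s → Kˣ} (hR : ∀ l, h l ∈ R.unitGroup)
    (m : Fin s → ℤ) : unitsMonomial h m ∈ R.unitGroup :=
  Subgroup.prod_mem _ fun l _ => Subgroup.zpow_mem _ (hR l) _

/-- `x` is a section at `p` of `L_1^{m_1} ⊗ ⋯ ⊗ L_s^{m_s}`, where `L_l` is generated by `t p l`. -/
def IsSectionAt (O : P → Subring K) (t : P → Fin s → Kˣ) (m : Fin s → ℤ) (x : K) (p : P) : Prop :=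
  x * ((unitsMonomial (t p) m)⁻¹ : Kˣ) ∈ O p

/-- The local generators `t` are restrictions of generators over basic open sets of the chart. -/
def LocalChart.IsLocallyTrivial (t : P → Fin s → Kˣ) : Prop :=
  ∀ q : PrimeSpectrum S, ∃ g ∉ q.asIdeal, ∃ h : Fin s → Kˣ, ∀ q' : PrimeSpectrum S, g ∉ q'.asIdeal →
    ∀ l, h l / t (C.pt q') l ∈ (O (C.pt q')).unitGroup

namespace LocalChart

variable {C} {t : P → Fin s → Kˣ}

/-- The pointwise generators `t` and the generators `h` over a basic open set differ by units of the
local rings, which do not affect regularity. -/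
lemma isSectionAt_iff {g : S} {h : Fin s → Kˣ}
    (hh : ∀ q' : PrimeSpectrum S, g ∉ q'.asIdeal →
      ∀ l, h l / t (C.pt q') l ∈ (O (C.pt q')).unitGroup)
    {q : PrimeSpectrum S} (hq : g ∉ q.asIdeal) (m : Fin s → ℤ) (x : K) :
    IsSectionAt O t m x (C.pt q) ↔ x * ((unitsMonomial h m)⁻¹ : Kˣ) ∈ O (C.pt q) := by
  have := unitsMonomial_mem_unitGroup (hh q hq) m
  rw [IsSectionAt, ← Subring.mul_mem_iff_of_mem_unitGroup
    (x := x * ((unitsMonomial h m)⁻¹ : Kˣ)) this, unitsMonomial_div, mul_assoc, ← Units.val_mul,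
    div_eq_mul_inv, inv_mul_cancel_left]

/-- This is quasi-compactness of the spectrum: finitely many of the chosen `g` already generate the
unit ideal. -/
lemma IsLocallyTrivial.exists_finite (ht : C.IsLocallyTrivial t) :
    ∃ (ι : Type) (_ : Finite ι) (g : ι → S) (h : ι → Fin s → Kˣ),
      Ideal.span (Set.range g) = ⊤ ∧ ∀ i (q' : PrimeSpectrum S), g i ∉ q'.asIdeal →
        ∀ l, h i l / t (C.pt q') l ∈ (O (C.pt q')).unitGroup := by
  choose g hg h hh using ht
  have : Ideal.span (Set.range g) = ⊤ := by
    by_contra hI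
    obtain ⟨M, hM, hIM⟩ := Ideal.exists_le_maximal _ hI
    exact hg ⟨M, hM.isPrime⟩ (hIM (Ideal.subset_span ⟨_, rfl⟩))
  obtain ⟨F, hF, hF'⟩ := (Ideal.span_eq_top_iff_finite _).1 this
  have hF'' : ∀ i : Fin F.card, ∃ q, g q = F.equivFin.symm i := fun i => hF (F.equivFin.symm i).2
  choose c hc using hF''
  refine ⟨Fin F.card, inferInstance, fun i => g (c i), fun i => h (c i), ?_, fun i => hh (c i)⟩
  rw [← hF']
  congr 1
  ext x
  constructor
  · rintro ⟨i, rfl⟩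
    simp only [hc]
    exact (F.equivFin.symm i).2
  · intro hx
    exact ⟨F.equivFin ⟨x, hx⟩, by simp [hc]⟩

lemma forall_isSectionAt_iff {g : S} {h : Fin s → Kˣ}
    (hh : ∀ q' : PrimeSpectrum S, g ∉ q'.asIdeal →
      ∀ l, h l / t (C.pt q') l ∈ (O (C.pt q')).unitGroup) (f : S) (m : Fin s → ℤ) (x : K) :
    (∀ q, g * f ∉ q.asIdeal → IsSectionAt O t m x (C.pt q)) ↔
      ∃ N a, x * ((unitsMonomial h m)⁻¹ : Kˣ) * C.hom (g * f) ^ N = C.hom a := by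
  rw [← C.forall_mem_iff]
  refine forall₂_congr fun q hq => isSectionAt_iff hh (fun h => hq ?_) m x
  exact q.asIdeal.mul_mem_right _ h

/-- The transition function between two local generators is a unit at each point of the overlap, so
it is regular there and a power of `g * g'` clears its denominator. -/
lemma exists_compat {g g' : S} {h h' : Fin s → Kˣ}
    (hh : ∀ q' : PrimeSpectrum S, g ∉ q'.asIdeal →
      ∀ l, h l / t (C.pt q') l ∈ (O (C.pt q')).unitGroup)
    (hh' : ∀ q' : PrimeSpectrum S, g' ∉ q'.asIdeal →
      ∀ l, h' l / t (C.pt q') l ∈ (O (C.pt q')).unitGroup) (m : Fin s → ℤ) :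
    ∃ N a, ((unitsMonomial h m / unitsMonomial h' m : Kˣ) : K) * C.hom (g * g') ^ N = C.hom a := by
  refine (C.forall_mem_iff _ _).1 fun q hq => ?_
  have h1 := unitsMonomial_mem_unitGroup (hh q fun h => hq (q.asIdeal.mul_mem_right _ h)) m
  have h2 := unitsMonomial_mem_unitGroup (hh' q fun h => hq (q.asIdeal.mul_mem_left _ h)) m
  have h3 := Subgroup.div_mem _ h1 h2
  rw [unitsMonomial_div, unitsMonomial_div, div_div_div_cancel_right] at h3
  exact h3.1

end LocalChart

end Charts

/-! ### Integer-valued valuations and the extension of sections across their centres. -/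

section Valuations

variable {K : Type*} [Field K] (v : AddValuation K (WithTop ℤ))

lemma _root_.AddValuation.ne_top_of_unit (u : Kˣ) : v u ≠ ⊤ := (v.ne_top_iff).2 u.ne_zero

/-- The valuation of a unit, as an integer. -/
def _root_.AddValuation.unitsOrd : Additive Kˣ →+ ℤ where
  toFun u := (v (u.toMul : Kˣ)).untop (v.ne_top_of_unit _)
  map_zero' := by
    rw [WithTop.untop_eq_iff]
    simp
  map_add' a b := by
    rw [WithTop.untop_eq_iff]
    simp

lemma _root_.AddValuation.coe_unitsOrd (u : Kˣ) : ((v.unitsOrd (.ofMul u) : ℤ) : WithTop ℤ) = v u :=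
  WithTop.coe_untop _ _

end Valuations

section Extension

variable {P K : Type*} [Field K] {O : P → Subring K} {S : Type*} [CommRing S]
  {C : LocalChart O S} {s : ℕ} {t : P → Fin s → Kˣ}

/-- If a ring `S` is cut out by finitely many valuations in a localization `S[1/f]`, then the
sections of line bundles over the spectrum of `S` are cut out by valuations among the sections
over the spectrum of `S[1/f]`. -/
theorem LocalChart.exists_forall_isSectionAt_iff_le (ht : C.IsLocallyTrivial t)
    {κ : Type*} [Finite κ] (v : κ → AddValuation K (WithTop ℤ)) (hv : ∀ j a, 0 ≤ v j (C.hom a))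
    (f : S) (hf : ∀ x N a, x * C.hom f ^ N = C.hom a → (∀ j, 0 ≤ v j x) → ∃ a, x = C.hom a) :
    ∃ A : κ → (Fin s → ℤ) →+ ℤ, ∀ m x,
      (∀ q : PrimeSpectrum S, f ∉ q.asIdeal → IsSectionAt O t m x (C.pt q)) →
        ((∀ q, IsSectionAt O t m x (C.pt q)) ↔ ∀ j, ((A j m : ℤ) : WithTop ℤ) ≤ v j x) := by
  classical
  have := Fintype.ofFinite κ
  obtain ⟨ι, hι, g, h, hg, hh⟩ := ht.exists_finite
  -- The centre of `v j` meets one of the trivializing open sets: otherwise the valuation would be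
  -- positive on the unit ideal.
  have hex : ∀ j, ∃ i, v j (C.hom (g i)) = 0 := by
    intro j
    by_contra! hne
    have hpos : ∀ b ∈ Ideal.span (Set.range g), 0 < v j (C.hom b) := by
      intro b hb
      induction hb using Submodule.span_induction with
      | mem x hx =>
        obtain ⟨i, rfl⟩ := hx
        exact lt_of_le_of_ne (hv j _) (hne i).symm
      | zero => simp
      | add x y _ _ hx hy =>
        rw [map_add]
        exact (lt_min hx hy).trans_le (v j |>.map_add _ _)
      | smul a x _ hx =>
        rw [smul_eq_mul, map_mul, (v j).map_mul]
        exact hx.trans_le (le_add_of_nonneg_left (hv j a))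
    have := hpos 1 (by rw [hg]; trivial)
    simp at this
  choose c hc using hex
  -- The bound is the valuation of the local generator over an open set meeting the centre of `v j`;
  -- it is additive in `m` because the generator is a monomial.
  let A : κ → (Fin s → ℤ) →+ ℤ := fun j => (v j).unitsOrd.comp
    { toFun := fun m => .ofMul (unitsMonomial (h (c j)) m)
      map_zero' := by simp
      map_add' := fun m m' => by rw [unitsMonomial_add]; rfl }
  have hA : ∀ j m, ((A j m : ℤ) : WithTop ℤ) = v j (unitsMonomial (h (c j)) m : Kˣ) :=
    fun j m => (v j).coe_unitsOrd _
  -- The bound does not depend on which such open set is used: transition functions have valuation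
  -- zero where the `g` do.
  have key : ∀ j i m, v j (C.hom (g i)) = 0 → ((A j m : ℤ) : WithTop ℤ) = v j (unitsMonomial (h i) m : Kˣ) := by
    have : ∀ j i i' m, v j (C.hom (g i)) = 0 → v j (C.hom (g i')) = 0 →
        v j (unitsMonomial (h i') m : Kˣ) ≤ v j (unitsMonomial (h i) m : Kˣ) := by
      intro j i i' m hi hi'
      obtain ⟨N, a, ha⟩ := exists_compat (hh i) (hh i') m
      have h1 := hv j a
      rw [← ha, (v j).map_mul, (v j).map_pow, map_mul C.hom, (v j).map_mul, hi, hi', add_zero,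
        smul_zero, add_zero] at h1
      have h2 : (unitsMonomial (h i) m : K) = (unitsMonomial (h i) m / unitsMonomial (h i') m : Kˣ) *
        (unitsMonomial (h i') m : Kˣ) := by rw [← Units.val_mul, div_mul_cancel]
      rw [h2, (v j).map_mul]
      exact le_add_of_nonneg_left h1
    intro j i m hi
    rw [hA]
    exact le_antisymm (this _ _ _ _ hi (hc j)) (this _ _ _ _ (hc j) hi)
  have hord : ∀ j (x : Kˣ) i m N, v j ((x : K) * ((unitsMonomial (h i) m)⁻¹ : Kˣ) * C.hom (g i) ^ N) =
      ((v j).unitsOrd (.ofMul x) - (v j).unitsOrd (.ofMul (unitsMonomial (h i) m)) : ℤ) +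
        N • v j (C.hom (g i)) := by
    intro j x i m N
    rw [(v j).map_mul, (v j).map_pow, ← Units.val_mul, ← AddValuation.coe_unitsOrd]
    rw [ofMul_mul, ofMul_inv, map_add, map_neg, sub_eq_add_neg]
  refine ⟨A, fun m x hx => ⟨fun hs j => ?_, fun hle => ?_⟩⟩
  · by_cases hx0 : x = 0
    · simp [hx0]
    lift x to Kˣ using isUnit_iff_ne_zero.2 hx0
    obtain ⟨N, a, ha⟩ := (forall_isSectionAt_iff (hh (c j)) 1 m x).1 fun q _ => hs q
    have h1 := hv j a
    rw [← ha, mul_one, hord, hc, smul_zero, add_zero] at h1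
    rw [← AddValuation.coe_unitsOrd]
    have h2 : A j m = (v j).unitsOrd (.ofMul (unitsMonomial (h (c j)) m)) := rfl
    rw [h2]
    norm_cast at h1 ⊢
    omega
  · by_cases hx0 : x = 0
    · intro q
      rw [IsSectionAt, hx0, zero_mul]
      exact Subring.zero_mem _
    lift x to Kˣ using isUnit_iff_ne_zero.2 hx0
    intro q
    obtain ⟨i, hi⟩ : ∃ i, g i ∉ q.asIdeal := by
      by_contra! hq
      refine q.2.ne_top (top_unique (hg.symm.trans_le (Ideal.span_le.2 ?_)))
      rintro _ ⟨i, rfl⟩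
      exact hq i
    obtain ⟨N, a, ha⟩ := (forall_isSectionAt_iff (hh i) f m x).1 fun q hq =>
      hx q fun hq' => hq (q.asIdeal.mul_mem_left _ hq')
    rw [isSectionAt_iff (hh i) hi]
    -- If `g i` has positive valuation, the bound given for `x` says nothing about its quotient by
    -- this generator; `B` measures the possible defect, which enough factors `g i` compensate.
    let B : κ → ℕ := fun j => ((v j).unitsOrd (.ofMul x) -
      (v j).unitsOrd (.ofMul (unitsMonomial (h i) m))).natAbs
    obtain ⟨M, hM⟩ : ∃ M, ∀ j, B j ≤ M := ⟨∑ j, B j, fun j => Finset.single_le_sum (fun _ _ => zero_le) (Finset.mem_univ j)⟩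
    -- The exponent `N` clears `g i` from the equation over the overlap with the locus where `f` is
    -- invertible, and `M` makes all the valuations nonnegative.
    obtain ⟨b, hb⟩ := hf ((x : K) * ((unitsMonomial (h i) m)⁻¹ : Kˣ) * C.hom (g i) ^ (N + M)) N
      (a * g i ^ M) (by rw [map_mul, ← ha, map_mul, map_pow]; ring) fun j => by
        rw [hord]
        by_cases h0 : v j (C.hom (g i)) = 0
        · have h1 := key j i m h0
          have h2 := hle j
          rw [h1, ← AddValuation.coe_unitsOrd, ← AddValuation.coe_unitsOrd] at h2
          rw [h0, smul_zero, add_zero]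
          norm_cast at h2 ⊢
          omega
        · have h1 : 1 ≤ v j (C.hom (g i)) := by
            have h2 := lt_of_le_of_ne (hv j (g i)) (Ne.symm h0)
            cases hvv : v j (C.hom (g i)) with
            | top => exact le_top
            | coe z => rw [hvv] at h2; norm_cast at h2 ⊢
          have h3 := nsmul_le_nsmul_right h1 (N + M)
          have h4 := hM j
          refine le_trans ?_ (add_le_add_right h3 _)
          rw [nsmul_one]
          norm_cast
          simp only [B] at h4
          push_cast
          omega
    exact (C.mem_iff q _).2 ⟨b, g i ^ (N + M), fun h => hi (q.2.mem_of_pow_mem _ h), by rw [map_pow, hb]⟩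

end Extension

/-! ### Monomial valuations. -/

section MonomialValuation

variable {k K G : Type*} [Field k] [Field K] [Algebra k K] [AddCommMonoid G]
  (θ : AddMonoidAlgebra k G →ₐ[k] K) (wt : G →+ ℤ)

/-- The ring homomorphism sending `χ^g` to `χ^g T^{wt g}`. -/
def weightHom : AddMonoidAlgebra k G →+* HahnSeries ℤ K :=
  AddMonoidAlgebra.liftNCRingHom ((HahnSeries.C (Γ := ℤ)).comp (algebraMap k K))
    { toFun := fun g => HahnSeries.single (wt g.toAdd) (θ (.single g.toAdd 1))
      map_one' := by
        change HahnSeries.single (wt 0) (θ 1) = 1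
        rw [map_zero, map_one]; rfl
      map_mul' := fun a b => by
        rw [HahnSeries.single_mul_single, ← map_mul, AddMonoidAlgebra.single_mul_single, mul_one,
          toAdd_mul, map_add] }
    fun _ _ => mul_comm _ _

lemma weightHom_single (g : G) (c : k) :
    weightHom θ wt (.single g c) = HahnSeries.single (wt g) (θ (.single g c)) := by
  refine (AddMonoidAlgebra.liftNC_single _ _ _ _).trans ?_
  change HahnSeries.C (algebraMap k K c) * HahnSeries.single (wt g) (θ (.single g 1)) = _
  rw [HahnSeries.C_apply, HahnSeries.single_mul_single, zero_add, ← Algebra.smul_def, ← map_smul,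
    AddMonoidAlgebra.smul_single, smul_eq_mul, mul_one]

lemma coeff_weightHom (f : AddMonoidAlgebra k G) (i : ℤ) :
    (weightHom θ wt f).coeff i = θ (.ofCoeff (f.coeff.filter fun g => wt g = i)) := by
  induction f using AddMonoidAlgebra.induction_linear with
  | zero =>
    rw [map_zero, AddMonoidAlgebra.coeff_zero, Finsupp.filter_zero, AddMonoidAlgebra.ofCoeff_zero,
      map_zero, HahnSeries.coeff_zero]
  | add x y hx hy =>
    rw [map_add, HahnSeries.coeff_add, hx, hy, ← map_add]
    congr 1
    rw [AddMonoidAlgebra.coeff_add, Finsupp.filter_add]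
    rfl
  | single g c =>
    rw [weightHom_single]
    by_cases h : i = wt g
    · subst h
      rw [HahnSeries.coeff_single_same, AddMonoidAlgebra.coeff_single, Finsupp.filter_single_of_pos]
      · rfl
      · rfl
    · rw [HahnSeries.coeff_single_of_ne h, AddMonoidAlgebra.coeff_single,
        Finsupp.filter_single_of_neg]
      · simp
      · exact fun h' => h h'.symm

/-- The order in `T` of the image under `weightHom` is the least weight that occurs. The coefficient
of `T^i` is the value under `θ` of the part of weight `i`, which is nonzero by injectivity unless
that part is. Since `K` is the fraction field of the monoid algebra, the homomorphism extends to `K`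
and the order pulls back to a valuation. -/
theorem exists_monomialValuation (hθ : Function.Injective θ)
    (hfrac : ∀ x : K, ∃ a b, b ≠ 0 ∧ x * θ b = θ a) :
    ∃ v : AddValuation K (WithTop ℤ), ∀ f (N : ℤ),
      (N : WithTop ℤ) ≤ v (θ f) ↔ ∀ g ∈ f.coeff.support, N ≤ wt g := by
  have hcoeff : ∀ f i, (weightHom θ wt f).coeff i ≠ 0 ↔ ∃ g ∈ f.coeff.support, wt g = i := by
    intro f i
    rw [coeff_weightHom, (map_ne_zero_iff _ hθ), Ne, ← AddMonoidAlgebra.coeff_inj,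
      AddMonoidAlgebra.coeff_ofCoeff, ← Ne, AddMonoidAlgebra.coeff_zero, Finsupp.ne_iff]
    simp [Finsupp.filter_apply, and_comm]
  have hinj : Function.Injective (weightHom θ wt) := by
    rw [injective_iff_map_eq_zero]
    intro f hf
    by_contra h
    obtain ⟨g, hg⟩ := Finsupp.ne_iff.1 (mt AddMonoidAlgebra.coeff_inj.1 h)
    have := (hcoeff f (wt g)).2 ⟨g, Finsupp.mem_support_iff.2 hg, rfl⟩
    rw [hf] at this
    simp at this
  let := θ.toRingHom.toAlgebra
  have halg : ∀ x, algebraMap (AddMonoidAlgebra k G) K x = θ x := fun _ => rfl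
  have : FaithfulSMul (AddMonoidAlgebra k G) K := (faithfulSMul_iff_algebraMap_injective _ _).2 hθ
  have : IsFractionRing (AddMonoidAlgebra k G) K 
    := .of_field _ _ fun x => by
    obtain ⟨a, b, hb, h⟩ := hfrac x
    exact ⟨a, b, by rw [halg, halg, ← h, mul_div_cancel_right₀ _ ((map_ne_zero_iff _ hθ).2 hb)]⟩
  have : IsDomain (AddMonoidAlgebra k G) := hθ.isDomain θ.toRingHom
  let Λ : K →+* HahnSeries ℤ K := IsFractionRing.lift (g := weightHom θ wt) hinj
  have hΛ : ∀ f, Λ (θ f) = weightHom θ wt f := fun f => IsFractionRing.lift_algebraMap hinj f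
  refine ⟨(HahnSeries.addVal ℤ K).comap Λ, fun f N => ?_⟩
  change _ ≤ HahnSeries.addVal ℤ K (Λ (θ f)) ↔ _
  rw [hΛ, HahnSeries.addVal_apply, HahnSeries.le_orderTop_iff_forall]
  constructor
  · intro h g hg
    by_contra! hN
    exact (hcoeff f (wt g)).2 ⟨g, hg, rfl⟩ (h _ (by exact_mod_cast hN))
  · intro h i hi
    by_contra hne
    obtain ⟨g, hg, rfl⟩ := (hcoeff f i).1 hne
    have := h g hg
    norm_cast at hi
    omega

end MonomialValuation

/-! ### Factoriality of the ring of polynomials over Laurent polynomials. -/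

section UFD

variable (k : Type*) [Field k] (n : ℕ)

/-- The inclusion of `ℕⁿ × ℕ` in `ℤⁿ × ℕ`. -/
def natToIntExponent : (Option (Fin n) →₀ ℕ) →+ (Fin n → ℤ) × ℕ where
  toFun c := (fun i => c (some i), c none)
  map_zero' := by ext <;> simp
  map_add' a b := by ext <;> simp

lemma natToIntExponent_injective : Function.Injective (natToIntExponent n) := by
  intro a b h
  ext (_ | i)
  · exact congr($h.2)
  · have := congr_fun congr($h.1) i
    simpa [natToIntExponent] using this

/-- The inclusion of the polynomial ring in the ring of polynomials which are Laurent polynomials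
in the first `n` variables. -/
def polyToLaurent :
    MvPolynomial (Option (Fin n)) k →ₐ[k] AddMonoidAlgebra k ((Fin n → ℤ) × ℕ) :=
  AddMonoidAlgebra.mapDomainAlgHom k k (natToIntExponent n)

lemma polyToLaurent_monomial (c : Option (Fin n) →₀ ℕ) (a : k) :
    polyToLaurent k n (MvPolynomial.monomial c a) = .single (natToIntExponent n c) a := by
  exact AddMonoidAlgebra.mapDomain_single

lemma polyToLaurent_injective : Function.Injective (polyToLaurent k n) :=
  AddMonoidAlgebra.mapDomain_injective (R := k) (natToIntExponent_injective n)

/-- The ring is the localization of a polynomial ring in `n + 1` variables at the product `D` of the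
`n` variables to be inverted, and localization preserves unique factorization. -/
instance : UniqueFactorizationMonoid (AddMonoidAlgebra k ((Fin n → ℤ) × ℕ)) := by
  let := (polyToLaurent k n).toRingHom.toAlgebra
  have halg : ∀ x, algebraMap (MvPolynomial (Option (Fin n)) k)
    (AddMonoidAlgebra k ((Fin n → ℤ) × ℕ)) x = polyToLaurent k n x := fun _ => rfl
  let d : Option (Fin n) →₀ ℕ := Finsupp.equivFunOnFinite.symm fun o => o.elim 0 fun _ => 1
  let D : MvPolynomial (Option (Fin n)) k := MvPolynomial.monomial d 1
  have hd : ∀ m : ℕ, natToIntExponent n (m • d) = (fun _ => (m : ℤ), 0) := by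
    intro m
    ext <;> simp [natToIntExponent, d]
  have hD : ∀ m : ℕ, polyToLaurent k n (D ^ m) = .single (fun _ => (m : ℤ), 0) 1 := by
    intro m
    rw [MvPolynomial.monomial_pow, polyToLaurent_monomial, hd, one_pow]
  have : IsLocalization.Away D (AddMonoidAlgebra k ((Fin n → ℤ) × ℕ)) := by
    refine IsLocalization.Away.mk _ ?_ ?_ ?_
    · rw [halg, ← pow_one D, hD]
      refine IsUnit.of_mul_eq_one (.single (fun _ => -1, 0) 1) ?_
      rw [AddMonoidAlgebra.single_mul_single, AddMonoidAlgebra.one_def, mul_one]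
      congr 1
    · intro f
      -- Asking for all large exponents, and not just one, makes the claim stable under sums.
      have : ∃ N : ℕ, ∀ m : ℕ, N ≤ m → ∃ a, f * polyToLaurent k n (D ^ m) = polyToLaurent k n a := by
        induction f using AddMonoidAlgebra.induction_on with
        | of w =>
          refine ⟨∑ i, (w.1 i).natAbs, fun m hm => ?_⟩
          have hm' : ∀ i, (w.1 i).natAbs ≤ m := fun i =>
            (Finset.single_le_sum (f := fun i => (w.1 i).natAbs) (fun _ _ => zero_le)
              (Finset.mem_univ i)).trans hm
          refine ⟨MvPolynomial.monomial (Finsupp.equivFunOnFinite.symm fun o =>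
            o.elim w.2 fun i => (w.1 i + m).toNat) 1, ?_⟩
          rw [hD, polyToLaurent_monomial, AddMonoidAlgebra.of_apply,
            AddMonoidAlgebra.single_mul_single, mul_one]
          congr 1
          ext i
          · have := hm' i
            simp [natToIntExponent]
            omega
          · simp [natToIntExponent]
        | add x y hx hy =>
          obtain ⟨N, hN⟩ := hx
          obtain ⟨N', hN'⟩ := hy
          refine ⟨max N N', fun m hm => ?_⟩
          obtain ⟨a, ha⟩ := hN m (le_of_max_le_left hm)
          obtain ⟨b, hb⟩ := hN' m (le_of_max_le_right hm)
          exact ⟨a + b, by rw [add_mul, ha, hb, map_add]⟩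
        | smul r x hx =>
          obtain ⟨N, hN⟩ := hx
          refine ⟨N, fun m hm => ?_⟩
          obtain ⟨a, ha⟩ := hN m hm
          exact ⟨r • a, by rw [map_smul, ← ha, smul_mul_assoc]⟩
      obtain ⟨N, hN⟩ := this
      obtain ⟨a, ha⟩ := hN N le_rfl
      exact ⟨N, a, by rw [halg, halg, ← map_pow, ha]⟩
    · intro a b hab
      exact ⟨0, by rw [polyToLaurent_injective k n hab]⟩
  exact UniqueFactorizationMonoid.of_isLocalization (Submonoid.powers D) _

end UFD

/-! ### Finite generation for vanishing conditions on the projective line. -/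

section Generation

open Polynomial

variable {k K : Type*} [Field k] [Field K] [Algebra k K] {n s : ℕ}

/-- The homogeneous form of degree `D` with dehomogenization `f` vanishes to order at least `c` at
the point `a` of the projective line. -/
def VanishesToOrder (a : Option k) (c D : ℤ) (f : k[X]) : Prop :=
  a.elim ((f.natDegree : ℤ) + c ≤ D) fun a => (X - C a) ^ c.toNat ∣ f

/-- Data of linear conditions on polynomials `f`, depending on characters `u ∈ ℤⁿ` and multidegrees
`m ∈ ℤ^s`: bounds `d m` for the degree of `f`, and bounds for the vanishing orders of `f` at points
`pt r` of the projective line. -/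
structure VanishingConditions (k : Type*) (n s : ℕ) where
  Index : Type
  finite : Finite Index
  d : (Fin s → ℤ) →+ ℤ
  pt : Index → Option k
  slope : Index → ℕ
  bound : Index → ((Fin n → ℤ) × (Fin s → ℤ) →+ ℤ)

attribute [instance] VanishingConditions.finite

/-- The nonzero polynomials which satisfy the conditions. -/
def VanishingConditions.Good (V : VanishingConditions k n s) (m : Fin s → ℤ) (u : Fin n → ℤ)
    (f : k[X]) : Prop :=
  f ≠ 0 ∧ (f.natDegree : ℤ) ≤ V.d m ∧ ∀ r, ∃ c : ℕ, VanishesToOrder (V.pt r) c (V.d m) f ∧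
    0 ≤ V.bound r (u, m) + V.slope r * c

variable (V : VanishingConditions k n s) (χ : Multiplicative (Fin n → ℤ) →* Kˣ) (y : K)
  (E : Fin s → Kˣ)

/-- The linear span of the elements `E^m χ^u f(y)` for `f` satisfying the conditions. -/
def VanishingConditions.sections (m : Fin s → ℤ) : Submodule k K :=
  Submodule.span k {x | ∃ u f, V.Good m u f ∧
    x = unitsMonomial E m * χ (.ofAdd u) * aeval y f}

namespace VanishingConditions

/-- The points of the affine line at which there are conditions. -/
abbrev Pts : Type _ := {a : k // ∃ r, V.pt r = some a}

instance : Finite V.Pts :=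
  Finite.of_injective (fun a : V.Pts => a.2.choose) fun a b h => by
    have ha := a.2.choose_spec
    have hb := b.2.choose_spec
    ext
    change a.2.choose = b.2.choose at h
    rw [h, hb] at ha
    exact (Option.some_injective _ ha).symm

instance : Fintype V.Pts := Fintype.ofFinite _

/-- The points of the projective line at which there are conditions. -/
def point (r : V.Index) : Option V.Pts :=
  match h : V.pt r with
  | none => none
  | some a => some ⟨a, r, h⟩

lemma point_eq_none {r : V.Index} (h : V.pt r = none) : V.point r = none := by
  unfold point; split <;> simp_all

lemma point_eq_some {r : V.Index} {a : k} (h : V.pt r = some a) :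
    V.point r = some ⟨a, r, h⟩ := by
  unfold point
  split
  · simp_all
  · rename_i b hb
    rw [h] at hb
    obtain rfl := Option.some_injective _ hb
    rfl

/-- The exponents of the monomials in `E`, `χ`, the linear forms vanishing at the points with
conditions, and `y`. -/
abbrev Exponent : Type _ := (Fin n ⊕ Fin s) ⊕ (Option V.Pts ⊕ Unit) → ℤ

variable {V} in
/-- The exponent of `χ`. -/
def Exponent.char (x : V.Exponent) : Fin n → ℤ := fun i => x (.inl (.inl i))

variable {V} in
/-- The multidegree of a monomial. -/
def Exponent.multidegree (x : V.Exponent) : Fin s → ℤ := fun i => x (.inl (.inr i))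

variable {V} in
/-- The exponent of a linear form. -/
def Exponent.ord (x : V.Exponent) (o : Option V.Pts) : ℤ := x (.inr (.inl o))

variable {V} in
/-- The exponent of `y`. -/
def Exponent.exp (x : V.Exponent) : ℤ := x (.inr (.inr ()))

/-- The linear inequalities which define the monomials satisfying the conditions. -/
def inequalities : V.Exponent →+ ((Option V.Pts ⊕ Unit) ⊕ (Unit ⊕ V.Index) → ℤ) where
  toFun x
    | .inl j => x (.inr j)
    -- The slack in this inequality is the remaining power of the homogenizing coordinate, which
    -- becomes `1` in the affine coordinate and is not recorded.
    | .inr (.inl _) => V.d x.multidegree - ∑ o, x.ord o - x.exp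
    | .inr (.inr r) => V.bound r (x.char, x.multidegree) + V.slope r * x.ord (V.point r)
  map_zero' := by
    ext (j | j | r)
    · rfl
    · change V.d 0 - ∑ _, 0 - 0 = 0
      simp
    · change V.bound r 0 + V.slope r * 0 = 0
      simp
  map_add' x y := by
    ext (j | j | r)
    · rfl
    · change V.d (x.multidegree + y.multidegree) - ∑ o, (x.ord o + y.ord o) - (x.exp + y.exp) =
        (V.d x.multidegree - ∑ o, x.ord o - x.exp) + (V.d y.multidegree - ∑ o, y.ord o - y.exp)
      rw [map_add, Finset.sum_add_distrib]
      ring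
    · change V.bound r ((x.char, x.multidegree) + (y.char, y.multidegree)) +
        V.slope r * (x.ord (V.point r) + y.ord (V.point r)) =
        (V.bound r (x.char, x.multidegree) + V.slope r * x.ord (V.point r)) +
        (V.bound r (y.char, y.multidegree) + V.slope r * y.ord (V.point r))
      rw [map_add]
      ring

/-- The monoid of the monomials which satisfy the conditions. -/
def monoid : AddSubmonoid V.Exponent := (AddSubmonoid.nonneg _).comap V.inequalities

lemma mem_monoid {x : V.Exponent} : x ∈ V.monoid ↔ (∀ o, 0 ≤ x.ord o) ∧ 0 ≤ x.exp ∧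
    ∑ o, x.ord o + x.exp ≤ V.d x.multidegree ∧
    ∀ r, 0 ≤ V.bound r (x.char, x.multidegree) + V.slope r * x.ord (V.point r) := by
  change (∀ j, _) ↔ _
  simp only [Sum.forall, Option.forall, Unique.forall_iff]
  change (_ ∧ 0 ≤ x.exp) ∧ 0 ≤ V.d x.multidegree - ∑ o, x.ord o - x.exp ∧
    (∀ r, 0 ≤ V.bound r (x.char, x.multidegree) + V.slope r * x.ord (V.point r)) ↔ _
  rw [sub_sub, sub_nonneg, and_assoc]
  rfl

variable (ℓ : Option V.Pts → Kˣ) (y : Kˣ)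

/-- The value of a monomial in the field `K`. -/
def value (x : V.Exponent) : Kˣ :=
  unitsMonomial E x.multidegree * χ (.ofAdd x.char) * (∏ o, ℓ o ^ x.ord o) * y ^ x.exp

lemma value_add (x x' : V.Exponent) :
    V.value χ E ℓ y (x + x') = V.value χ E ℓ y x * V.value χ E ℓ y x' := by
  change unitsMonomial E (x.multidegree + x'.multidegree) * χ (.ofAdd (x.char + x'.char)) *
    (∏ o, ℓ o ^ (x.ord o + x'.ord o)) * y ^ (x.exp + x'.exp) = _
  rw [unitsMonomial_add, ofAdd_add, map_mul, zpow_add]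
  simp only [zpow_add, Finset.prod_mul_distrib, value]
  ac_rfl

lemma value_zero : V.value χ E ℓ y 0 = 1 := by
  change unitsMonomial E 0 * χ (.ofAdd 0) * (∏ o, ℓ o ^ (0 : ℤ)) * y ^ (0 : ℤ) = 1
  simp

variable {ℓ y}

/-- The polynomial with the given vanishing orders. -/
def polyOfExponent (x : V.Exponent) : k[X] :=
  (∏ a : V.Pts, (X - C a.1) ^ (x.ord (some a)).toNat) * X ^ x.exp.toNat

lemma monic_polyOfExponent (x : V.Exponent) : (V.polyOfExponent x).Monic :=
  (monic_prod_of_monic _ _ fun _ _ => (monic_X_sub_C _).pow _).mul (monic_X_pow _)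

lemma natDegree_polyOfExponent {x : V.Exponent} (hx : ∀ o, 0 ≤ x.ord o) (hx' : 0 ≤ x.exp) :
    ((V.polyOfExponent x).natDegree : ℤ) = ∑ a : V.Pts, x.ord (some a) + x.exp := by
  rw [polyOfExponent, Monic.natDegree_mul (monic_prod_of_monic _ _ fun _ _ =>
    (monic_X_sub_C _).pow _) (monic_X_pow _), natDegree_prod_of_monic _ _ fun _ _ =>
    (monic_X_sub_C _).pow _, natDegree_X_pow]
  push_cast
  rw [Int.toNat_of_nonneg hx']
  congr 1
  refine Finset.sum_congr rfl fun a _ => ?_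
  rw [natDegree_pow, natDegree_X_sub_C, mul_one, Int.toNat_of_nonneg (hx _)]

lemma value_eq (hℓ : ℓ none = 1) (hℓ' : ∀ a : V.Pts, (ℓ (some a) : K) = y - algebraMap k K a)
    {x : V.Exponent} (hx : ∀ o, 0 ≤ x.ord o) (hx' : 0 ≤ x.exp) :
    (V.value χ E ℓ y x : K) = unitsMonomial E x.multidegree * χ (.ofAdd x.char) *
      aeval (y : K) (V.polyOfExponent x) := by
  have h : ∀ (u : Kˣ) (c : ℤ), 0 ≤ c → ((u ^ c : Kˣ) : K) = (u : K) ^ c.toNat := by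
    intro u c hc
    lift c to ℕ using hc
    simp
  rw [value, Fintype.prod_option, hℓ, one_zpow, one_mul, polyOfExponent]
  simp only [Units.val_mul, Units.coe_prod, map_mul, map_prod, map_pow, map_sub, aeval_X, aeval_C]
  rw [h _ _ hx', mul_assoc (_ * _)]
  refine congrArg₂ _ rfl (congrArg₂ _ (Finset.prod_congr rfl fun a _ => ?_) rfl)
  rw [h _ _ (hx _), hℓ']

/-- The exponents of the linear forms are admissible values for the vanishing orders. The factor `X
^ x.exp` may add further zeros at the origin; this is harmless, since only lower bounds for the
orders matter. -/
lemma good_polyOfExponent {x : V.Exponent} (hx : x ∈ V.monoid) :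
    V.Good x.multidegree x.char (V.polyOfExponent x) := by
  obtain ⟨h1, h2, h3, h4⟩ := V.mem_monoid.1 hx
  rw [Fintype.sum_option] at h3
  have hd := V.natDegree_polyOfExponent h1 h2
  refine ⟨(V.monic_polyOfExponent x).ne_zero, by linarith [h1 none], fun r => ?_⟩
  refine ⟨(x.ord (V.point r)).toNat, ?_, by rw [Int.toNat_of_nonneg (h1 _)]; exact h4 r⟩
  rw [Int.toNat_of_nonneg (h1 _)]
  rcases hr : V.pt r with _ | a
  · rw [V.point_eq_none hr]
    change _ ≤ _
    linarith
  · rw [V.point_eq_some hr]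
    exact (Finset.dvd_prod_of_mem (fun a : V.Pts => (X - C a.1) ^ (x.ord (some a)).toNat)
      (Finset.mem_univ (⟨a, r, hr⟩ : V.Pts))).mul_right _

/-- Polynomials satisfying the conditions are linear combinations of monomials in the linear forms
vanishing at the points with conditions and the variable. -/
lemma Good.mem_span {V : VanishingConditions k n s} {m : Fin s → ℤ} {u : Fin n → ℤ} {f : k[X]}
    (hf : V.Good m u f) :
    f ∈ Submodule.span k {p | ∃ x ∈ V.monoid, x.multidegree = m ∧ x.char = u ∧
      p = V.polyOfExponent x} := by
  classical
  obtain ⟨h0, hd, hr⟩ := hf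
  choose c hc hc' using hr
  have := Fintype.ofFinite V.Index
  -- Several conditions may concern one point; `e` takes the largest of the orders required there.
  let e : Option V.Pts → ℕ := fun o => (Finset.univ.filter fun r => V.point r = o).sup c
  have he : ∀ r, c r ≤ e (V.point r) := fun r => Finset.le_sup (by simp)
  have h1 : ∀ a : V.Pts, (X - C a.1) ^ e (some a) ∣ f := by
    intro a
    refine Finset.sup_induction (p := fun c => (X - C a.1) ^ c ∣ f) (by simp) ?_ ?_
    · intro c₁ h₁ c₂ h₂
      rcases le_total c₁ c₂ with h | h
      · rwa [sup_eq_right.2 h]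
      · rwa [sup_eq_left.2 h]
    · intro r hr
      have hr := (Finset.mem_filter.1 hr).2
      have := hc r
      rcases hp : V.pt r with _ | b
      · rw [V.point_eq_none hp] at hr; cases hr
      · rw [V.point_eq_some hp] at hr
        obtain rfl := Option.some_injective _ hr
        rw [hp] at this
        simpa [VanishesToOrder] using this
  have h2 : (f.natDegree : ℤ) + e none ≤ V.d m := by
    refine Finset.sup_induction (p := fun c : ℕ => (f.natDegree : ℤ) + c ≤ V.d m) (by simpa) ?_ ?_
    · intro c₁ h₁ c₂ h₂
      rcases le_total c₁ c₂ with h | h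
      · rwa [sup_eq_right.2 h]
      · rwa [sup_eq_left.2 h]
    · intro r hr
      have hr := (Finset.mem_filter.1 hr).2
      have := hc r
      rcases hp : V.pt r with _ | b
      · rw [hp] at this
        exact this
      · rw [V.point_eq_some hp] at hr; cases hr
  -- Linear forms at distinct points are coprime, so the separate divisibilities combine.
  obtain ⟨g, hg⟩ : ∏ a : V.Pts, (X - C a.1) ^ e (some a) ∣ f := by
    refine Finset.prod_dvd_of_coprime (fun a _ b _ hab => ?_) fun a _ => h1 a
    exact (isCoprime_X_sub_C_of_isUnit_sub (sub_ne_zero.2 fun h =>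
      hab (Subtype.ext h)).isUnit).pow
  have hmon : (∏ a : V.Pts, (X - C a.1) ^ e (some a)).Monic :=
    monic_prod_of_monic _ _ fun _ _ => (monic_X_sub_C _).pow _
  have hg0 : g ≠ 0 := by
    rintro rfl
    exact h0 (by rw [hg, mul_zero])
  have hdeg : f.natDegree = ∑ a : V.Pts, e (some a) + g.natDegree := by
    conv_lhs => rw [hg]
    rw [hmon.natDegree_mul' hg0, natDegree_prod_of_monic _ _ fun _ _ => (monic_X_sub_C _).pow _]
    simp
  -- No condition is lost on expanding the cofactor: each term keeps the zeros from the product, and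
  -- its degree is at most that of `f`, which leaves room for the order required at infinity.
  have hsum : f = ∑ i ∈ Finset.range (g.natDegree + 1), g.coeff i •
      ((∏ a : V.Pts, (X - C a.1) ^ e (some a)) * X ^ i) := by
    conv_lhs => rw [hg, g.as_sum_range_C_mul_X_pow, Finset.mul_sum]
    refine Finset.sum_congr rfl fun i _ => ?_
    rw [smul_eq_C_mul]
    ring
  rw [hsum]
  refine Submodule.sum_mem _ fun i hi => Submodule.smul_mem _ _ (Submodule.subset_span ?_)
  let x : V.Exponent := Sum.elim (Sum.elim u m) (Sum.elim (fun o => (e o : ℤ)) fun _ => (i : ℤ))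
  have hx1 : ∀ o, x.ord o = e o := fun _ => rfl
  have hx2 : x.exp = i := rfl
  have hx3 : x.multidegree = m := rfl
  have hx4 : x.char = u := rfl
  refine ⟨x, V.mem_monoid.2 ⟨fun o => by rw [hx1]; positivity, by rw [hx2]; positivity, ?_,
    fun r => ?_⟩, rfl, rfl, ?_⟩
  · simp only [hx1, hx2, hx3]
    rw [Fintype.sum_option]
    rw [hdeg] at h2
    rw [Finset.mem_range] at hi
    push_cast at h2
    omega
  · rw [hx1, hx3, hx4]
    refine (hc' r).trans ?_
    have := he r
    gcongr
  · simp [polyOfExponent, hx1, hx2]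

/-- The algebra of the sections satisfying vanishing conditions is finitely generated. -/
theorem fg_of_forall_mem_iff (hy : Transcendental k (y : K))
    (R : Subalgebra k (AddMonoidAlgebra K (Fin s → ℤ)))
    (hR : ∀ F, F ∈ R ↔ ∀ m, F.coeff m ∈ V.sections χ (y : K) E m) : R.FG := by
  have hne : ∀ a : k, (y : K) - algebraMap k K a ≠ 0 := by
    intro a h
    rw [sub_eq_zero] at h
    exact hy (h ▸ isAlgebraic_algebraMap a)
  -- The linear form which vanishes at infinity dehomogenizes to `1`.
  let ℓ : Option V.Pts → Kˣ := fun o => o.elim 1 fun a => Units.mk0 _ (hne a)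
  have hℓ : ℓ none = 1 := rfl
  have hℓ' : ∀ a : V.Pts, (ℓ (some a) : K) = y - algebraMap k K a := fun _ => rfl
  let Ψ : Multiplicative V.Exponent →* AddMonoidAlgebra K (Fin s → ℤ) :=
    { toFun := fun x => .single x.toAdd.multidegree (V.value χ E ℓ y x.toAdd : K)
      map_one' := by
        change AddMonoidAlgebra.single 0 (V.value χ E ℓ y 0 : K) = 1
        rw [value_zero]; rfl
      map_mul' := fun x x' => by
        rw [AddMonoidAlgebra.single_mul_single, ← Units.val_mul, ← value_add]; rfl }
  -- Generators of the monoid of admissible exponents yield generators of the algebra.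
  obtain ⟨T, hT⟩ : V.monoid.FG := fg_comap_nonneg V.inequalities
  have hval : ∀ x ∈ V.monoid, (V.value χ E ℓ y x : K) ∈ V.sections χ (y : K) E x.multidegree :=
    fun x hx => Submodule.subset_span ⟨x.char, V.polyOfExponent x, V.good_polyOfExponent hx,
      value_eq V χ E hℓ hℓ' (V.mem_monoid.1 hx).1 (V.mem_monoid.1 hx).2.1⟩
  have hΨR : ∀ x ∈ V.monoid, Ψ (.ofAdd x) ∈ R := by
    intro x hx
    refine (hR _).2 fun m => ?_
    change (AddMonoidAlgebra.single x.multidegree (V.value χ E ℓ y x : K)).coeff m ∈ _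
    rw [AddMonoidAlgebra.coeff_single, Finsupp.single_apply]
    split_ifs with h
    · exact h ▸ hval x hx
    · exact zero_mem _
  have hΨ : ∀ x ∈ V.monoid, Ψ (.ofAdd x) ∈ Algebra.adjoin k ((fun x => Ψ (.ofAdd x)) '' (T : Set V.Exponent)) := by
    intro x hx
    rw [← hT] at hx
    induction hx using AddSubmonoid.closure_induction with
    | mem x hx => exact Algebra.subset_adjoin ⟨x, hx, rfl⟩
    | zero => rw [ofAdd_zero, map_one]; exact one_mem _
    | add x y _ _ hx hy => rw [ofAdd_add, map_mul]; exact mul_mem hx hy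
  classical
  refine ⟨T.image fun x => Ψ (.ofAdd x), le_antisymm ?_ fun F hF => ?_⟩
  · rw [Algebra.adjoin_le_iff]
    intro F hF
    obtain ⟨x, hx, rfl⟩ := Finset.mem_image.1 (Finset.mem_coe.1 hF)
    exact hΨR x (hT ▸ AddSubmonoid.subset_closure hx)
  · rw [Finset.coe_image]
    have hF' := (hR F).1 hF
    have hsum : F = ∑ m ∈ F.coeff.support, .single m (F.coeff m) :=
      F.sum_coeff_single.symm
    rw [hsum]
    refine sum_mem fun m _ => ?_
    let A := Algebra.adjoin k ((fun x => Ψ (.ofAdd x)) '' (T : Set V.Exponent))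
    -- Both sides are linear, so it suffices to treat the products of linear forms, which are
    -- monomials with admissible exponents.
    have : V.sections χ (y : K) E m ≤ A.toSubmodule.comap
        (AddMonoidAlgebra.lsingle (R := k) m) := by
      refine Submodule.span_le.2 ?_
      rintro _ ⟨u, f, hf, rfl⟩
      have h : Submodule.span k {p | ∃ x ∈ V.monoid, x.multidegree = m ∧ x.char = u ∧
          p = V.polyOfExponent x} ≤ A.toSubmodule.comap ((AddMonoidAlgebra.lsingle (R := k) m).comp
            ((LinearMap.mulLeft k ((unitsMonomial E m * χ (.ofAdd u) : Kˣ) : K)).comp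
              (aeval (y : K)).toLinearMap)) := by
        refine Submodule.span_le.2 ?_
        rintro _ ⟨x, hx, rfl, rfl, rfl⟩
        have := hΨ x hx
        change AddMonoidAlgebra.single x.multidegree (V.value χ E ℓ y x : K) ∈ _ at this
        rw [value_eq V χ E hℓ hℓ' (V.mem_monoid.1 hx).1 (V.mem_monoid.1 hx).2.1] at this
        exact this
      exact h hf.mem_span
    exact this (hF' m)

end VanishingConditions

end Generation

/-! ### Homographies acting on binary forms. -/

section Moebius

open Polynomial

variable {k K : Type*} [Field k] [Field K] [Algebra k K]

/-- The linear polynomial `a + b X`. -/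
def linPoly (p : k × k) : k[X] := C p.1 + C p.2 * X

/-- The point of the projective line where the linear form `a Y₀ + b Y₁` vanishes. -/
def linPoint (p : k × k) : Option k := open Classical in if p.2 = 0 then none else some (-p.1 / p.2)

lemma linPoly_ne_zero {p : k × k} (hp : p ≠ 0) : linPoly p ≠ 0 := by
  intro h
  apply hp
  ext
  · simpa [linPoly] using congr(coeff $h 0)
  · simpa [linPoly] using congr(coeff $h 1)

/-- The polynomial `f`, of degree at most `d`, is the product of the `c`th power of the linear form
`ℓ` and of a polynomial of degree at most `d - c`. -/
def LinDvd (ℓ : k[X]) (c d : ℕ) (f : k[X]) : Prop := ∃ g : k[X], g.natDegree + c ≤ d ∧ f = ℓ ^ c * g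

/-- A constant form `linPoly p` is a multiple of the homogenizing coordinate: divisibility then
bounds the degree, which is vanishing at infinity. Otherwise the form is a unit times `X - C a`, and
divisibility is vanishing at `a`. -/
lemma linDvd_linPoly_iff {p : k × k} (hp : p ≠ 0) (c d : ℕ) {f : k[X]} (hf : f ≠ 0)
    (hd : f.natDegree ≤ d) : LinDvd (linPoly p) c d f ↔ VanishesToOrder (linPoint p) c d f := by
  by_cases h : p.2 = 0
  · have h1 : p.1 ≠ 0 := fun h1 => hp (Prod.ext h1 h)
    rw [linPoint, if_pos h]
    change _ ↔ (f.natDegree : ℤ) + c ≤ d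
    have h2 : linPoly p = C p.1 := by rw [linPoly, h]; simp
    rw [h2]
    constructor
    · rintro ⟨g, hg, rfl⟩
      rw [← C_pow, natDegree_C_mul (pow_ne_zero _ h1)]
      exact_mod_cast hg
    · intro hc
      refine ⟨C (p.1⁻¹ ^ c) * f, ?_, ?_⟩
      · rw [natDegree_C_mul (pow_ne_zero _ (inv_ne_zero h1))]
        exact_mod_cast hc
      · rw [← mul_assoc, ← C_pow, ← C_mul, ← mul_pow, mul_inv_cancel₀ h1]
        simp
  · rw [linPoint, if_neg h]
    change _ ↔ (X - C (-p.1 / p.2)) ^ (c : ℤ).toNat ∣ f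
    rw [Int.toNat_natCast]
    have h2 : linPoly p = C p.2 * (X - C (-p.1 / p.2)) := by
      rw [linPoly, mul_sub, ← C_mul, mul_div_cancel₀ _ h, C_neg]
      ring
    constructor
    · rintro ⟨g, -, rfl⟩
      rw [h2, mul_pow]
      exact ((dvd_mul_left _ _)).mul_right _
    · rintro ⟨g, rfl⟩
      have hg : g ≠ 0 := right_ne_zero_of_mul hf
      rw [((monic_X_sub_C _).pow c).natDegree_mul' hg, natDegree_pow, natDegree_X_sub_C,
        mul_one] at hd
      refine ⟨C (p.2⁻¹ ^ c) * g, ?_, ?_⟩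
      · rw [natDegree_C_mul (pow_ne_zero _ (inv_ne_zero h))]
        omega
      · rw [h2, mul_pow, ← C_pow, mul_mul_mul_comm, ← C_mul, ← mul_pow, mul_inv_cancel₀ h]
        simp

variable (p p' : k × k)

/-- The substitution of linear forms in a homogeneous form of degree `d`. -/
def linSubst (d : ℕ) : k[X] →ₗ[k] k[X] where
  toFun g := ∑ b ∈ Finset.range (d + 1), g.coeff b • (linPoly p' ^ b * linPoly p ^ (d - b))
  map_add' f g := by simp [add_smul, Finset.sum_add_distrib]
  map_smul' c g := by simp [Finset.smul_sum, mul_smul]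

lemma natDegree_linPoly_le : (linPoly p).natDegree ≤ 1 := by
  rw [linPoly]; compute_degree

lemma natDegree_linSubst_le (d : ℕ) (g : k[X]) : (linSubst p p' d g).natDegree ≤ d := by
  refine natDegree_sum_le_of_forall_le (n := d) (Finset.range (d + 1))
    (fun b => g.coeff b • (linPoly p' ^ b * linPoly p ^ (d - b)))
    fun b hb => (natDegree_smul_le _ _).trans ?_
  have hb := Finset.mem_range.1 hb
  refine natDegree_mul_le.trans ?_
  have h1 := natDegree_pow_le_of_le b (natDegree_linPoly_le p')
  have h2 := natDegree_pow_le_of_le (d - b) (natDegree_linPoly_le p)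
  omega

variable {p p'} (hp : p.1 * p'.2 - p'.1 * p.2 ≠ 0) {y : K} (hy : Transcendental k y)

include hp in
lemma ne_zero_of_det : p ≠ 0 := by rintro rfl; simp at hp

include hp in
lemma ne_zero_of_det' : p' ≠ 0 := by rintro rfl; simp at hp

include hy in
lemma aeval_linPoly_ne_zero {p : k × k} (hp : p ≠ 0) : aeval y (linPoly p) ≠ 0 :=
  fun h => linPoly_ne_zero hp ((transcendental_iff.1 hy) _ h)

variable (p p' y) in
/-- The image of `y` under a homography. -/
def homography : K := aeval y (linPoly p') / aeval y (linPoly p)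

include hp hy in
-- Homogeneity: substituting the two linear forms in a binary form of degree `d` and pulling out the
-- `d`th power of the first leaves a polynomial in their quotient.
lemma aeval_linSubst {d : ℕ} {g : k[X]} (hg : g.natDegree ≤ d) :
    aeval y (linSubst p p' d g) = aeval y (linPoly p) ^ d * aeval (homography p p' y) g := by
  have h0 := aeval_linPoly_ne_zero hy (ne_zero_of_det hp)
  rw [g.aeval_eq_sum_range' (Nat.lt_succ_of_le hg), Finset.mul_sum]
  change aeval y (∑ b ∈ Finset.range (d + 1), _) = _
  rw [map_sum]
  refine Finset.sum_congr rfl fun b hb => ?_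
  rw [map_smul, map_mul, map_pow, map_pow, mul_smul_comm, homography, div_pow]
  congr 1
  have : aeval y (linPoly p) ^ d = aeval y (linPoly p) ^ (d - b) * aeval y (linPoly p) ^ b := by
    rw [← pow_add, Nat.sub_add_cancel (Nat.lt_succ_iff.1 (Finset.mem_range.1 hb))]
  rw [this]
  field_simp

include hp hy in
-- Solving for `y` expresses it rationally in terms of `z` by the inverse homography, so `y` would
-- be algebraic if `z` were.
lemma transcendental_homography : Transcendental k (homography p p' y) := by
  intro hz
  apply hy
  have h0 := aeval_linPoly_ne_zero hy (ne_zero_of_det hp)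
  set z := homography p p' y with hzdef
  have h1 : z * (algebraMap k K p.1 + algebraMap k K p.2 * y) =
      algebraMap k K p'.1 + algebraMap k K p'.2 * y := by
    have : z * aeval y (linPoly p) = aeval y (linPoly p') := div_mul_cancel₀ _ h0
    simpa [linPoly] using this
  -- If the denominator of the inverse homography vanished, so would the determinant.
  have h2 : algebraMap k K p.2 * z - algebraMap k K p'.2 ≠ 0 := by
    intro h
    apply hp
    apply (algebraMap k K).injective
    rw [map_zero, map_sub, map_mul, map_mul]
    linear_combination (algebraMap k K p.2) * h1 -
      h * (algebraMap k K p.1 + algebraMap k K p.2 * y)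
  have h3 : y = (algebraMap k K p'.1 - algebraMap k K p.1 * z) /
      (algebraMap k K p.2 * z - algebraMap k K p'.2) := by
    rw [eq_div_iff h2]
    linear_combination h1
  rw [h3, div_eq_mul_inv]
  have ha : ∀ c, IsAlgebraic k (algebraMap k K c) := fun c => isAlgebraic_algebraMap c
  exact ((ha _).sub ((ha _).mul hz)).mul (((ha _).mul hz).sub (ha _)).inv

include hp hy in
lemma linSubst_injective {d : ℕ} {g : k[X]} (hg : g.natDegree ≤ d) (h : linSubst p p' d g = 0) :
    g = 0 := by
  have h1 := aeval_linSubst hp hy hg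
  rw [h, map_zero, eq_comm, mul_eq_zero] at h1
  rcases h1 with h1 | h1
  · exact absurd h1 (pow_ne_zero _ (aeval_linPoly_ne_zero hy (ne_zero_of_det hp)))
  · exact transcendental_iff.1 (transcendental_homography hp hy) _ h1

include hp hy in
-- The substitution is an injective endomorphism of the finite-dimensional space of polynomials of
-- degree at most `d`.
lemma linSubst_surjective {d : ℕ} {f : k[X]} (hf : f.natDegree ≤ d) :
    ∃ g : k[X], g.natDegree ≤ d ∧ linSubst p p' d g = f := by
  have hmem : ∀ g : k[X], g ∈ degreeLT k (d + 1) ↔ g.natDegree ≤ d := fun g => by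
    rw [mem_degreeLT, ← Nat.lt_succ_iff, Nat.succ_eq_add_one]
    by_cases hg : g = 0
    · simp [hg]
    · rw [natDegree_lt_iff_degree_lt hg]
  let T : degreeLT k (d + 1) →ₗ[k] degreeLT k (d + 1) :=
    (linSubst p p' d).restrict fun g _ => (hmem _).2 (natDegree_linSubst_le p p' d g)
  have hT : Function.Injective T := by
    rw [injective_iff_map_eq_zero]
    intro g hg
    exact Subtype.ext (linSubst_injective hp hy ((hmem _).1 g.2) congr(($hg).1))
  have : FiniteDimensional k (degreeLT k (d + 1)) :=
    (degreeLTEquiv k (d + 1)).symm.finiteDimensional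
  obtain ⟨g, hg⟩ := LinearMap.injective_iff_surjective.1 hT ⟨f, (hmem _).2 hf⟩
  exact ⟨g, (hmem _).1 g.2, congr(($hg).1)⟩

include hp hy in
-- On binary forms the substitution is bijective in degrees `d` and `d - c`, and carries the `c`th
-- power of the homogenizing coordinate (here `1`) to that of `linPoly p`. It therefore transports
-- the zero at infinity to the zero of `linPoly p`; the companion lemma does the same for the origin
-- and `linPoly p'`.
lemma linDvd_linSubst_iff {c d : ℕ} {g : k[X]} (hg : g.natDegree ≤ d) :
    LinDvd (linPoly p) c d (linSubst p p' d g) ↔ LinDvd 1 c d g := by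
  have hinj : Function.Injective (aeval (R := k) y) :=
    (transcendental_iff_injective).1 hy
  have key : ∀ g : k[X], g.natDegree + c ≤ d →
      linSubst p p' d g = linPoly p ^ c * linSubst p p' (d - c) g := by
    intro g hg
    apply hinj
    rw [aeval_linSubst hp hy (by omega), map_mul, map_pow, aeval_linSubst hp hy (by omega),
      ← mul_assoc, ← pow_add, Nat.add_sub_cancel' (by omega)]
  constructor
  · rintro ⟨f, hf, h⟩
    obtain ⟨g', hg', rfl⟩ := linSubst_surjective hp hy (d := d - c) (f := f) (by omega)
    rw [← key _ (by omega), ← sub_eq_zero, ← map_sub] at h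
    have := linSubst_injective hp hy ((natDegree_sub_le _ _).trans (max_le hg (by omega))) h
    rw [sub_eq_zero] at this
    exact ⟨g', by omega, by rw [this, one_pow, one_mul]⟩
  · rintro ⟨g', hg', h⟩
    rw [one_pow, one_mul] at h
    subst h
    refine ⟨_, ?_, key _ hg'⟩
    have := natDegree_linSubst_le p p' (d - c) g
    omega

include hp hy in
lemma linDvd_linSubst_iff' {c d : ℕ} {g : k[X]} (hg : g.natDegree ≤ d) :
    LinDvd (linPoly p') c d (linSubst p p' d g) ↔ LinDvd X c d g := by
  have hinj : Function.Injective (aeval (R := k) y) :=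
    (transcendental_iff_injective).1 hy
  have h0 := aeval_linPoly_ne_zero hy (ne_zero_of_det hp)
  have key : ∀ g : k[X], g.natDegree + c ≤ d →
      linSubst p p' d (X ^ c * g) = linPoly p' ^ c * linSubst p p' (d - c) g := by
    intro g hg
    apply hinj
    have h1 : (X ^ c * g).natDegree ≤ d := natDegree_mul_le.trans (by rw [natDegree_X_pow]; omega)
    rw [aeval_linSubst hp hy h1, map_mul, map_mul, map_pow, map_pow, aeval_X,
      aeval_linSubst hp hy (by omega)]
    nth_rw 1 [← Nat.add_sub_cancel' (show c ≤ d by omega)]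
    have h2 : homography p p' y ^ c * aeval y (linPoly p) ^ c = aeval y (linPoly p') ^ c := by
      rw [homography, div_pow, div_mul_cancel₀ _ (pow_ne_zero _ h0)]
    rw [pow_add]
    linear_combination (aeval y (linPoly p) ^ (d - c) * aeval (homography p p' y) g) * h2
  constructor
  · rintro ⟨f, hf, h⟩
    obtain ⟨g', hg', rfl⟩ := linSubst_surjective hp hy (d := d - c) (f := f) (by omega)
    rw [← key _ (by omega), ← sub_eq_zero, ← map_sub] at h
    have h1 : (X ^ c * g').natDegree ≤ d := natDegree_mul_le.trans (by rw [natDegree_X_pow]; omega)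
    have := linSubst_injective hp hy ((natDegree_sub_le _ _).trans (max_le hg h1)) h
    rw [sub_eq_zero] at this
    exact ⟨g', by omega, this⟩
  · rintro ⟨g', hg', h⟩
    subst h
    refine ⟨_, ?_, key _ hg'⟩
    have := natDegree_linSubst_le p p' (d - c) g'
    omega

end Moebius

/-! ### Weighted exponents of a polynomial as vanishing orders. -/

section MonomialExponents

open Polynomial

/-- The least value of `ν * b` over the exponents `b` that occur is reached at the lowest one if `ν
≥ 0`, which is the order of vanishing at the origin. It is reached at the degree if `ν < 0`; writing
the degree as `d - c`, with `c` the order at infinity, gives `ν * d + |ν| * c`. -/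
lemma forall_coeff_iff_linDvd {k : Type*} [Field k] {g : k[X]} (hg : g ≠ 0) {d : ℕ}
    (hd : g.natDegree ≤ d) (ν N : ℤ) : (∀ b, g.coeff b ≠ 0 → N ≤ ν * b) ↔
      ∃ c, LinDvd (if 0 ≤ ν then X else 1) c d g ∧
        N ≤ (if 0 ≤ ν then 0 else ν) * d + ν.natAbs * c := by
  split_ifs with hν
  · constructor
    · intro h
      obtain ⟨g', hg'⟩ : X ^ g.natTrailingDegree ∣ g := X_pow_dvd_iff.2 fun b hb =>
        coeff_eq_zero_of_lt_natTrailingDegree hb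
      refine ⟨g.natTrailingDegree, ⟨g', ?_, hg'⟩, ?_⟩
      · have hg0 : g' ≠ 0 := by rintro rfl; exact hg (by rw [hg', mul_zero])
        have := congrArg natDegree hg'
        rw [(monic_X_pow _).natDegree_mul' hg0, natDegree_X_pow] at this
        omega
      · have := h g.natTrailingDegree (by
          rw [← trailingCoeff]; exact trailingCoeff_nonzero_iff_nonzero.2 hg)
        rw [Int.natAbs_of_nonneg hν]
        linarith
    · rintro ⟨c, ⟨g', -, hg'⟩, hN⟩ b hb
      rw [Int.natAbs_of_nonneg hν] at hN
      have hcb : c ≤ b := by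
        by_contra! hlt
        exact hb (X_pow_dvd_iff.1 ⟨g', hg'⟩ b hlt)
      have : ν * (c : ℤ) ≤ ν * b := by gcongr
      linarith
  · have hν' : (ν.natAbs : ℤ) = -ν := by omega
    rw [hν']
    constructor
    · intro h
      refine ⟨d - g.natDegree, ⟨g, by omega, by simp⟩, ?_⟩
      have := h g.natDegree (by rw [coeff_natDegree]; exact leadingCoeff_ne_zero.2 hg)
      rw [Nat.cast_sub hd]
      linarith
    · rintro ⟨c, ⟨g', hg', hg''⟩, hN⟩ b hb
      rw [one_pow, one_mul] at hg''
      subst hg''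
      have h1 : b + c ≤ d := by have := le_natDegree_of_ne_zero hb; omega
      have h2 : ((b : ℤ) + c) ≤ d := by exact_mod_cast h1
      nlinarith

end MonomialExponents

/-! ### Rational functions on the product of a torus and a projective line. -/

section ToricHom

open Polynomial

variable {k K : Type*} [Field k] [Field K] [Algebra k K] {n : ℕ}
  (χ : Multiplicative (Fin n → ℤ) →* Kˣ) (z : K)

/-- Polynomials with Laurent polynomials as coefficients, evaluated in a field. -/
def toricHom : AddMonoidAlgebra k ((Fin n → ℤ) × ℕ) →ₐ[k] K :=
  AddMonoidAlgebra.lift k K _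
    { toFun := fun g => (χ (.ofAdd g.toAdd.1) : K) * z ^ g.toAdd.2
      map_one' := by
        change (χ 1 : K) * z ^ 0 = 1
        simp
      map_mul' := fun g h => by
        change (χ (.ofAdd g.toAdd.1 * .ofAdd h.toAdd.1) : K) * z ^ (g.toAdd.2 + h.toAdd.2) = _
        rw [map_mul, pow_add, Units.val_mul]
        ring }

lemma toricHom_single (g : (Fin n → ℤ) × ℕ) (c : k) :
    toricHom χ z (.single g c) = c • ((χ (.ofAdd g.1) : K) * z ^ g.2) :=
  AddMonoidAlgebra.lift_single ..

/-- Sums of products of characters and of polynomials, evaluated in a field. -/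
def toricEval : ((Fin n → ℤ) →₀ k[X]) →ₗ[k] K :=
  Finsupp.lsum k fun u => (LinearMap.mulLeft k (χ (.ofAdd u) : K)).comp (aeval z).toLinearMap

lemma toricEval_apply (F : (Fin n → ℤ) →₀ k[X]) :
    toricEval χ z F = F.sum fun u f => (χ (.ofAdd u) : K) * aeval z f := rfl

lemma toricEval_single (u : Fin n → ℤ) (f : k[X]) :
    toricEval χ z (.single u f) = χ (.ofAdd u) * aeval z f := by
  rw [toricEval_apply, Finsupp.sum_single_index]; simp

variable (k n) in
/-- Polynomials with Laurent polynomials as coefficients, as Laurent polynomials with polynomials as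
coefficients. -/
def toFamily : AddMonoidAlgebra k ((Fin n → ℤ) × ℕ) ≃ₗ[k] ((Fin n → ℤ) →₀ k[X]) :=
  (AddMonoidAlgebra.coeffLinearEquiv k).trans ((Finsupp.curryLinearEquiv k).trans
    (Finsupp.mapRange.linearEquiv (basisMonomials k).repr.symm))

lemma coeff_toFamily (F : AddMonoidAlgebra k ((Fin n → ℤ) × ℕ)) (u : Fin n → ℤ) (b : ℕ) :
    (toFamily k n F u).coeff b = F.coeff (u, b) := by
  change ((basisMonomials k).repr.symm (Finsupp.curry F.coeff u)).coeff b = _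
  exact Finsupp.curry_apply ..

lemma toFamily_single (u : Fin n → ℤ) (b : ℕ) (c : k) :
    toFamily k n (.single (u, b) c) = .single u (monomial b c) := by
  ext v i
  rw [coeff_toFamily, AddMonoidAlgebra.coeff_single]
  classical
  simp only [Finsupp.single_apply, Prod.mk.injEq]
  split_ifs <;> simp_all [coeff_monomial]

lemma toricEval_toFamily (F : AddMonoidAlgebra k ((Fin n → ℤ) × ℕ)) :
    toricEval χ z (toFamily k n F) = toricHom χ z F := by
  induction F using AddMonoidAlgebra.induction_linear with
  | zero => simp
  | add x y hx hy => rw [map_add, map_add, hx, hy, map_add]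
  | single g c =>
    rw [toFamily_single, toricEval_single, toricHom_single, aeval_monomial, ← Algebra.smul_def,
      mul_smul_comm]

lemma transcendental_of_toricHom_injective (h : Function.Injective (toricHom (k := k) χ z)) :
    Transcendental k z := by
  rw [transcendental_iff]
  intro f hf
  have : toricEval χ z (.single 0 f) = 0 := by rw [toricEval_single, hf, mul_zero]
  rw [← (toFamily k n).apply_symm_apply (.single 0 f), toricEval_toFamily] at this
  have h2 := (injective_iff_map_eq_zero _).1 h _ this
  rw [LinearEquiv.map_eq_zero_iff, Finsupp.single_eq_zero] at h2
  exact h2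

variable {χ} {y : K} {p p' : k × k} (hp : p.1 * p'.2 - p'.1 * p.2 ≠ 0)
  (hinj : Function.Injective (toricHom (k := k) χ y))

include hp hinj in
-- The substitution acts on the coefficient of each character separately, and the common degree
-- bound gives a single power of the linear form as the factor.
lemma toricEval_homography {d : ℕ} {F : (Fin n → ℤ) →₀ k[X]} (hF : ∀ u, (F u).natDegree ≤ d) :
    toricEval χ y (F.mapRange (linSubst p p' d) (map_zero _)) =
      aeval y (linPoly p) ^ d * toricEval χ (homography p p' y) F := by
  rw [toricEval_apply, Finsupp.sum_mapRange_index (by simp), toricEval_apply, Finsupp.mul_sum]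
  refine Finset.sum_congr rfl fun u _ => ?_
  beta_reduce
  rw [aeval_linSubst hp (transcendental_of_toricHom_injective _ _ hinj) (hF u)]
  ring

include hinj in
lemma toricEval_injective : Function.Injective (toricEval (k := k) χ y) := by
  intro F G h
  rw [← (toFamily k n).apply_symm_apply F, ← (toFamily k n).apply_symm_apply G,
    toricEval_toFamily, toricEval_toFamily] at h
  exact (toFamily k n).symm.injective (hinj h)

lemma exists_natDegree_le (F : (Fin n → ℤ) →₀ k[X]) : ∃ d, ∀ u, (F u).natDegree ≤ d := by
  classical
  refine ⟨F.support.sup fun u => (F u).natDegree, fun u => ?_⟩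
  by_cases hu : u ∈ F.support
  · exact Finset.le_sup (f := fun u => (F u).natDegree) hu
  · rw [Finsupp.notMem_support_iff.1 hu, natDegree_zero]; exact zero_le

include hp hinj in
-- A relation in the new coordinate becomes, after multiplication by a power of the linear form, a
-- relation in `y`; injectivity of the substitution then kills every coefficient.
lemma toricHom_homography_injective :
    Function.Injective (toricHom (k := k) χ (homography p p' y)) := by
  have hy := transcendental_of_toricHom_injective _ _ hinj
  rw [injective_iff_map_eq_zero]
  intro F hF
  rw [← toricEval_toFamily] at hF
  obtain ⟨d, hd⟩ := exists_natDegree_le (toFamily k n F)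
  have h1 := toricEval_homography hp hinj hd
  rw [hF, mul_zero] at h1
  have h2 := toricEval_injective hinj (h1.trans (map_zero _).symm)
  rw [← LinearEquiv.map_eq_zero_iff (toFamily k n)]
  ext1 u
  have h3 := DFunLike.congr_fun h2 u
  rw [Finsupp.mapRange_apply] at h3
  exact linSubst_injective hp hy (hd u) h3

include hp hinj in
lemma exists_linSubst_eq {d : ℕ} {F : (Fin n → ℤ) →₀ k[X]} (hF : ∀ u, (F u).natDegree ≤ d) :
    ∃ G : (Fin n → ℤ) →₀ k[X], (∀ u, (G u).natDegree ≤ d) ∧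
      G.mapRange (linSubst p p' d) (map_zero _) = F := by
  have hy := transcendental_of_toricHom_injective _ _ hinj
  choose g hg hg' using fun u => linSubst_surjective hp hy (hF u)
  have h0 : ∀ u, g u ≠ 0 → u ∈ F.support := by
    intro u hu
    rw [Finsupp.mem_support_iff]
    intro h
    exact hu (linSubst_injective hp hy (hg u) (by rw [hg', h]))
  refine ⟨.onFinset F.support g h0, hg, ?_⟩
  ext1 u
  rw [Finsupp.mapRange_apply]
  exact hg' u

include hp hinj in
-- Numerator and denominator are rewritten in the new coordinate with the same degree bound, so the
-- powers of the linear form cancel in the quotient.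
lemma exists_homography_frac (hfrac : ∀ x : K, ∃ a b : AddMonoidAlgebra k ((Fin n → ℤ) × ℕ),
      b ≠ 0 ∧ x * toricHom χ y b = toricHom χ y a) (x : K) :
    ∃ a b : AddMonoidAlgebra k ((Fin n → ℤ) × ℕ), b ≠ 0 ∧
      x * toricHom χ (homography p p' y) b = toricHom χ (homography p p' y) a := by
  have hy := transcendental_of_toricHom_injective _ _ hinj
  obtain ⟨a, b, hb, h⟩ := hfrac x
  obtain ⟨d, hd⟩ := exists_natDegree_le (toFamily k n a)
  obtain ⟨d', hd'⟩ := exists_natDegree_le (toFamily k n b)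
  obtain ⟨G, hG, hG'⟩ := exists_linSubst_eq hp hinj fun u => (hd u).trans (le_max_left d d')
  obtain ⟨G', hG1, hG1'⟩ := exists_linSubst_eq hp hinj fun u => (hd' u).trans (le_max_right d d')
  refine ⟨(toFamily k n).symm G, (toFamily k n).symm G', ?_, ?_⟩
  · rw [Ne, LinearEquiv.map_eq_zero_iff]
    rintro rfl
    rw [Finsupp.mapRange_zero, eq_comm, LinearEquiv.map_eq_zero_iff] at hG1'
    exact hb hG1'
  · rw [← toricEval_toFamily, ← toricEval_toFamily, LinearEquiv.apply_symm_apply,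
      LinearEquiv.apply_symm_apply]
    rw [← toricEval_toFamily, ← toricEval_toFamily, ← hG', ← hG1', toricEval_homography hp hinj hG,
      toricEval_homography hp hinj hG1] at h
    apply mul_left_cancel₀ (pow_ne_zero (max d d') (aeval_linPoly_ne_zero hy (ne_zero_of_det hp)))
    rw [← h]
    ring

include hp hinj in
/-- The monomial valuations in a coordinate obtained from `y` by a homography are described by
vanishing conditions. -/
theorem exists_monomialValuation_vanishing
    (hfrac : ∀ x : K, ∃ a b : AddMonoidAlgebra k ((Fin n → ℤ) × ℕ),
      b ≠ 0 ∧ x * toricHom χ y b = toricHom χ y a) (wt : (Fin n → ℤ) →+ ℤ) (ν : ℤ) :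
    ∃ v : AddValuation K (WithTop ℤ),
      (∀ (F : AddMonoidAlgebra k ((Fin n → ℤ) × ℕ)) (N : ℤ),
        N ≤ v (toricHom χ (homography p p' y) F) ↔
          ∀ g ∈ F.coeff.support, N ≤ wt g.1 + ν * g.2) ∧
      ∃ κ : ℤ, v (aeval y (linPoly p)) = (κ - (if 0 ≤ ν then 0 else ν) : ℤ) ∧ ∀ (d : ℕ) (F : (Fin n → ℤ) →₀ k[X]),
        (∀ u, (F u).natDegree ≤ d) → ∀ N : ℤ, N ≤ v (toricEval χ y F) ↔
          ∀ u, F u ≠ 0 → ∃ c : ℕ,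
            VanishesToOrder (if 0 ≤ ν then linPoint p' else linPoint p) c d (F u) ∧
              N ≤ wt u + κ * d + ν.natAbs * c := by
  have hy := transcendental_of_toricHom_injective _ _ hinj
  let w : (Fin n → ℤ) × ℕ →+ ℤ := wt.coprod
    ((AddMonoidHom.mulLeft ν).comp (Nat.castAddMonoidHom ℤ))
  obtain ⟨v, hv⟩ := exists_monomialValuation (toricHom χ (homography p p' y)) w
    (toricHom_homography_injective hp hinj) (exists_homography_frac hp hinj hfrac)
  have h0 := aeval_linPoly_ne_zero hy (ne_zero_of_det hp)
  let κ₀ : ℤ := v.unitsOrd (.ofMul (Units.mk0 _ h0))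
  have hκ₀ : v (aeval y (linPoly p)) = κ₀ := (v.coe_unitsOrd (Units.mk0 _ h0)).symm
  -- Two terms are proportional to `d`: the valuation `κ₀` of the linear form pulled out `d` times,
  -- and for negative `ν` the constant `ν * d` from counting the order at infinity.
  refine ⟨v, hv, κ₀ + if 0 ≤ ν then 0 else ν, by rw [hκ₀, add_sub_cancel_right], fun d F hF N => ?_⟩
  obtain ⟨G, hG, rfl⟩ := exists_linSubst_eq hp hinj hF
  rw [toricEval_homography hp hinj hG, v.map_mul, v.map_pow, hκ₀]
  have h1 : (N : WithTop ℤ) ≤ d • (κ₀ : WithTop ℤ) + v (toricEval χ (homography p p' y) G) ↔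
      ((N - κ₀ * d : ℤ) : WithTop ℤ) ≤ v (toricEval χ (homography p p' y) G) := by
    rw [← WithTop.coe_nsmul]
    cases v (toricEval χ (homography p p' y) G) with
    | top => simp
    | coe a =>
      norm_cast
      rw [nsmul_eq_mul, sub_le_iff_le_add, mul_comm, add_comm]
  rw [h1, ← (toFamily k n).apply_symm_apply G, toricEval_toFamily, hv,
    LinearEquiv.apply_symm_apply]
  have h2 : (∀ g ∈ ((toFamily k n).symm G).coeff.support, N - κ₀ * d ≤ w g) ↔
      ∀ u, G u ≠ 0 → ∀ b, (G u).coeff b ≠ 0 → N - κ₀ * d - wt u ≤ ν * b := by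
    simp only [Prod.forall, Finsupp.mem_support_iff, ← coeff_toFamily,
      LinearEquiv.apply_symm_apply]
    refine forall_congr' fun u => ⟨fun h _ b hb => ?_, fun h b hb => ?_⟩
    · have := h b hb
      simp [w] at this
      linarith
    · have := h (by rintro h0; simp [h0] at hb) b hb
      simp [w]
      linarith
  rw [h2]
  refine forall_congr' fun u => ?_
  rw [Finsupp.mapRange_apply]
  have h3 : linSubst p p' d (G u) ≠ 0 ↔ G u ≠ 0 :=
    not_congr ⟨fun h => linSubst_injective hp hy (hG u) h, fun h => by rw [h, map_zero]⟩
  rw [h3]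
  refine forall_congr' fun hu => ?_
  rw [forall_coeff_iff_linDvd hu (hG u)]
  refine exists_congr fun c => and_congr ?_ ?_
  · split_ifs with hν
    · rw [← linDvd_linSubst_iff' hp hy (hG u), linDvd_linPoly_iff (ne_zero_of_det' hp) _ _ (h3.2 hu)
        (natDegree_linSubst_le ..)]
    · rw [← linDvd_linSubst_iff hp hy (hG u), linDvd_linPoly_iff (ne_zero_of_det hp) _ _ (h3.2 hu)
        (natDegree_linSubst_le ..)]
  · constructor <;> intro h <;> linarith

end ToricHom

lemma homography_swap {k K : Type*} [Field k] [Field K] [Algebra k K] (y : K) :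
    homography ((0, 1) : k × k) (1, 0) y = y⁻¹ := by
  simp [homography, linPoly]

/-! ### Extension conditions on factorial charts and on monomial charts. -/

section ToricCharts

open Polynomial

variable {k K P : Type*} [Field k] [Field K] [Algebra k K] {n s : ℕ}
  {O : P → Subring K} {t : P → Fin s → Kˣ}

/-- Over a factorial chart, the line bundles are trivial. -/
theorem LocalChart.exists_forall_isSectionAt_iff_mem_range {S : Type*} [CommRing S] [IsDomain S]
    [UniqueFactorizationMonoid S] {C : LocalChart O S} (ht : C.IsLocallyTrivial t)
    (hfrac : ∀ x : K, ∃ a b, b ≠ 0 ∧ x * C.hom b = C.hom a) :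
    ∃ E : Fin s → Kˣ, ∀ m x, (∀ q, IsSectionAt O t m x (C.pt q)) ↔
      x * ((unitsMonomial E m)⁻¹ : Kˣ) ∈ C.hom.range := by
  classical
  obtain ⟨ι, _, g, h, hg, hh⟩ := ht.exists_finite
  have := Fintype.ofFinite ι
  choose num den hden hnum using hfrac
  -- A common denominator of the local generators of each line bundle; with it the generators become
  -- elements `N l i` of `S`.
  let D : Fin s → S := fun l => ∏ i, den (h i l)
  have hD : ∀ l, D l ≠ 0 := fun l => Finset.prod_ne_zero_iff.2 fun i _ => hden _
  obtain ⟨N, hN⟩ : ∃ N : Fin s → ι → S, ∀ l i, (h i l : K) * C.hom (D l) = C.hom (N l i) := by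
    refine ⟨fun l i => num (h i l) * ∏ j ∈ Finset.univ.erase i, den (h j l), fun l i => ?_⟩
    rw [map_mul, ← hnum, mul_assoc, ← map_mul,
      Finset.mul_prod_erase _ (fun i => den (h i l)) (Finset.mem_univ i)]
  have hN0 : ∀ l i, N l i ≠ 0 := by
    intro l i h0
    have := hN l i
    rw [h0, map_zero] at this
    exact mul_ne_zero (h i l).ne_zero (C.hom_ne_zero (hD l)) this
  have key : ∀ l, ∃ t ≠ 0, ∀ i, (∃ M, t ∣ N l i * g i ^ M) ∧ ∃ M, N l i ∣ t * g i ^ M := by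
    intro l
    -- Regularity of the transition functions of the `l`th bundle, isolated by the multidegree
    -- `Pi.single l 1`, is the required divisibility of the numerators.
    refine exists_generator_of_cocycle hg (hN0 l) fun i j => ?_
    obtain ⟨M, a, ha⟩ := exists_compat (hh i) (hh j) (Pi.single l 1)
    refine ⟨M, a, C.injective ?_⟩
    have h1 : ∀ h : Fin s → Kˣ, unitsMonomial h (Pi.single l 1) = h l := by
      intro h
      rw [unitsMonomial, Finset.prod_eq_single l]
      · simp
      · intro j _ hj; simp [hj]
      · simp
    rw [h1, h1] at ha
    rw [map_mul, map_mul, ← ha, ← hN, ← hN, map_pow, Units.val_div_eq_div_val]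
    field_simp
  choose T hT hT1 using key
  let E : Fin s → Kˣ := fun l => Units.mk0 (C.hom (T l) / C.hom (D l))
    (div_ne_zero (C.hom_ne_zero (hT l)) (C.hom_ne_zero (hD l)))
  -- `E` generates the bundles over the whole spectrum, that is, over the basic open set of `1`.
  have hE : ∀ q' : PrimeSpectrum S, (1 : S) ∉ q'.asIdeal →
      ∀ l, E l / t (C.pt q') l ∈ (O (C.pt q')).unitGroup := by
    intro q _ l
    obtain ⟨i, hi⟩ : ∃ i, g i ∉ q.asIdeal := by
      by_contra! hq
      refine q.2.ne_top (top_unique (hg.symm.trans_le (Ideal.span_le.2 ?_)))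
      rintro _ ⟨i, rfl⟩
      exact hq i
    have h1 : E l / t (C.pt q) l = (E l / h i l) * (h i l / t (C.pt q) l) := by simp
    rw [h1]
    refine mul_mem ?_ (hh i q hi l)
    obtain ⟨⟨M, a, ha⟩, M', a', ha'⟩ := hT1 l i
    have hh1 := hN l i
    have hD0 := C.hom_ne_zero (hD l)
    have hT0 := C.hom_ne_zero (hT l)
    have e1 : ((E l / h i l : Kˣ) : K) = C.hom (T l) / C.hom (N l i) := by
      rw [Units.val_div_eq_div_val, ← hh1]
      simp only [E, Units.val_mk0]
      field_simp
    have e2 : (((E l / h i l)⁻¹ : Kˣ) : K) = C.hom (N l i) / C.hom (T l) := by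
      rw [Units.val_inv_eq_inv_val, e1, inv_div]
    have hN1 := C.hom_ne_zero (hN0 l i)
    constructor
    · rw [e1]
      refine (C.mem_iff q _).2 ⟨a', g i ^ M', fun h => hi (q.2.mem_of_pow_mem _ h), ?_⟩
      rw [div_mul_eq_mul_div, ← map_mul, ha', map_mul, mul_div_cancel_left₀ _ hN1]
    · rw [e2]
      refine (C.mem_iff q _).2 ⟨a, g i ^ M, fun h => hi (q.2.mem_of_pow_mem _ h), ?_⟩
      rw [div_mul_eq_mul_div, ← map_mul, ha, map_mul, mul_div_cancel_left₀ _ hT0]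
  refine ⟨E, fun m x => ?_⟩
  have := forall_isSectionAt_iff hE 1 m x
  have h1 : ∀ q : PrimeSpectrum S, (1 * 1 : S) ∉ q.asIdeal := fun q h =>
    q.2.ne_top ((Ideal.eq_top_iff_one _).2 (by simpa using h))
  simp only [h1, not_false_eq_true, forall_const] at this
  rw [this]
  simp only [mul_one, map_one, one_pow, exists_const]
  exact ⟨fun ⟨a, h⟩ => ⟨a, h.symm⟩, fun ⟨a, h⟩ => ⟨a, h.symm⟩⟩

variable {χ : Multiplicative (Fin n → ℤ) →* Kˣ} {y : K}

/-- A chart whose ring is spanned by the monomials in the characters and in a coordinate `z`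
with exponents in the cone where the weights `wt j` are nonnegative, with an element `f` which is
a monomial. -/
structure IsMonomialChart {S : Type*} [CommRing S] (k : Type*) [Field k] [Algebra k K]
    (χ : Multiplicative (Fin n → ℤ) →* Kˣ) (z : K)
    (C : LocalChart O S) {J : Type*} (wt : J → (Fin n → ℤ) →+ ℤ) (ν : J → ℤ)
    (f : S) : Prop where
  mem_range_iff : ∀ x, x ∈ C.hom.range ↔ ∃ F : AddMonoidAlgebra k ((Fin n → ℤ) × ℕ),
    (∀ g ∈ F.coeff.support, ∀ j, 0 ≤ wt j g.1 + ν j * g.2) ∧ toricHom χ z F = x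
  exists_monomial : ∃ g₀ : (Fin n → ℤ) × ℕ, C.hom f = χ (.ofAdd g₀.1) * z ^ g₀.2 ∧
    ∀ (g : (Fin n → ℤ) × ℕ) (N : ℕ),
      (∀ j, N * (wt j g₀.1 + ν j * g₀.2) ≤ wt j g.1 + ν j * g.2) → ∃ g', g = g' + N • g₀

variable {S : Type*} [CommRing S] {C : LocalChart O S} {p p' : k × k}
  (hp : p.1 * p'.2 - p'.1 * p.2 ≠ 0)
  (hinj : Function.Injective (toricHom (k := k) χ y))
  (hfrac : ∀ x : K, ∃ a b : AddMonoidAlgebra k ((Fin n → ℤ) × ℕ),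
      b ≠ 0 ∧ x * toricHom χ y b = toricHom χ y a)
  {J : Type*} [Finite J] {wt : J → (Fin n → ℤ) →+ ℤ} {ν : J → ℤ} {f : S}
  (hC : IsMonomialChart k χ (homography p p' y) C wt ν f) (ht : C.IsLocallyTrivial t)

include hp hinj hfrac hC ht in
-- The weights `wt j`, `ν j` define monomial valuations that cut out the ring of the chart in its
-- localization at the monomial `f`, so extension of a section is a bound on these valuations; such
-- a bound translates into vanishing orders at the zero or the pole of the coordinate. The clause
-- about `κ j` fixes the normalization for the coordinate `y⁻¹`, where the condition must reduce to
-- a degree bound.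
theorem IsMonomialChart.exists_forall_isSectionAt_iff (E : Fin s → Kˣ) :
    ∃ (A : J → (Fin s → ℤ) →+ ℤ) (κ : J → ℤ),
      (∀ j, p = (0, 1) → p' = (1, 0) → wt j = 0 → ν j = 1 → κ j = -1) ∧ ∀ m (F : (Fin n → ℤ) →₀ k[X]) (d : ℕ),
      (∀ u, (F u).natDegree ≤ d) → (∀ q : PrimeSpectrum S, f ∉ q.asIdeal →
        IsSectionAt O t m (unitsMonomial E m * toricEval χ y F) (C.pt q)) →
        ((∀ q, IsSectionAt O t m (unitsMonomial E m * toricEval χ y F) (C.pt q)) ↔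
          ∀ u, F u ≠ 0 → ∀ j, ∃ c : ℕ,
            VanishesToOrder (if 0 ≤ ν j then linPoint p' else linPoint p) c d (F u) ∧
              A j m ≤ wt j u + κ j * d + (ν j).natAbs * c) := by
  choose v hv κ hκ0 hκ using fun j => exists_monomialValuation_vanishing hp hinj hfrac (wt j) (ν j)
  obtain ⟨g₀, hg₀, hdiv⟩ := hC.exists_monomial
  have hf₀ : C.hom f = toricHom χ (homography p p' y) (.single g₀ (1 : k)) := by
    rw [toricHom_single, one_smul, hg₀]
  have hvf : ∀ j, ((wt j g₀.1 + ν j * g₀.2 : ℤ) : WithTop ℤ) ≤ v j (C.hom f) := by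
    intro j
    rw [hf₀, hv]
    intro g hg
    rw [AddMonoidAlgebra.coeff_single] at hg
    rw [Finset.mem_singleton.1 (Finsupp.support_single_subset hg)]
  have hv0 : ∀ j a, 0 ≤ v j (C.hom a) := by
    intro j a
    obtain ⟨F, hF, h⟩ := (hC.mem_range_iff _).1 ⟨a, rfl⟩
    rw [← h]
    exact (hv j F 0).2 fun g hg => hF g hg j
  -- Nonnegative valuations of `x` force every monomial of `x * f ^ N` to be divisible by `f ^ N`;
  -- dividing term by term shows that `x` lies in the ring.
  have hvr : ∀ x N a, x * C.hom f ^ N = C.hom a → (∀ j, 0 ≤ v j x) → ∃ a, x = C.hom a := by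
    intro x N a hxa hx
    obtain ⟨F, hF, h⟩ := (hC.mem_range_iff _).1 ⟨a, rfl⟩
    have h1 : ∀ g ∈ F.coeff.support, ∀ j, N * (wt j g₀.1 + ν j * g₀.2) ≤ wt j g.1 + ν j * g.2 := by
      intro g hg j
      have h2 : ((N * (wt j g₀.1 + ν j * g₀.2) : ℤ) : WithTop ℤ) ≤
          v j (toricHom χ (homography p p' y) F) := by
        rw [h, ← hxa, (v j).map_mul, (v j).map_pow]
        refine le_trans ?_ (le_add_of_nonneg_left (hx j))
        refine le_trans ?_ (nsmul_le_nsmul_right (hvf j) N)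
        rw [← WithTop.coe_nsmul, nsmul_eq_mul]
      exact (hv j F _).1 h2 g hg
    choose! g' hg' using fun g hg => hdiv g N (h1 g hg)
    have hfN : C.hom f ^ N ≠ 0 := by
      apply pow_ne_zero
      rw [hf₀]
      intro h0
      have := (injective_iff_map_eq_zero _).1 (toricHom_homography_injective hp hinj) _ h0
      exact one_ne_zero ((AddMonoidAlgebra.single_eq_zero).1 this)
    have h3 : x = ∑ g ∈ F.coeff.support,
        toricHom χ (homography p p' y) (.single (g' g) (F.coeff g)) := by
      apply mul_right_cancel₀ hfN
      rw [hxa, ← h, Finset.sum_mul]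
      conv_lhs => rw [← AddMonoidAlgebra.sum_coeff_single F]
      rw [Finsupp.sum, map_sum]
      refine Finset.sum_congr rfl fun g hg => ?_
      rw [hf₀, ← map_pow, ← map_mul, AddMonoidAlgebra.single_pow,
        AddMonoidAlgebra.single_mul_single, ← hg' g hg, one_pow, mul_one]
    suffices x ∈ C.hom.range by
      obtain ⟨a, ha⟩ := this
      exact ⟨a, ha.symm⟩
    rw [h3]
    refine sum_mem fun g hg => (hC.mem_range_iff _).2 ⟨_, fun g1 hg1 j => ?_, rfl⟩
    rw [AddMonoidAlgebra.coeff_single] at hg1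
    have := Finset.mem_singleton.1 (Finsupp.support_single_subset hg1)
    subst this
    have h4 := h1 g hg j
    conv_rhs at h4 => rw [hg' g hg]
    simp only [Prod.fst_add, Prod.snd_add, Prod.smul_fst, Prod.smul_snd, map_add, map_nsmul] at h4
    push_cast at h4
    simp only [nsmul_eq_mul, smul_eq_mul] at h4
    push_cast at h4
    linarith
  obtain ⟨A, hA⟩ := C.exists_forall_isSectionAt_iff_le ht v hv0 f hvr
  let ordE : J → (Fin s → ℤ) →+ ℤ := fun j => (v j).unitsOrd.comp
    { toFun := fun m => .ofMul (unitsMonomial E m)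
      map_zero' := by simp
      map_add' := fun m m' => by rw [unitsMonomial_add]; rfl }
  have hordE : ∀ j m, ((ordE j m : ℤ) : WithTop ℤ) = v j (unitsMonomial E m : Kˣ) :=
    fun j m => (v j).coe_unitsOrd _
  -- The bound for the rational section `E^m * toricEval χ y F` is shifted by the valuation of
  -- `E^m`.
  refine ⟨fun j => A j - ordE j, κ, ?_, fun m F d hF hx => ?_⟩
  · rintro j rfl rfl hwt hν
    have hy0 : y ≠ 0 := by
      rintro rfl
      exact transcendental_of_toricHom_injective _ _ hinj isAlgebraic_zero
    have hz : toricHom χ (homography ((0, 1) : k × k) (1, 0) y) (.single (0, 1) (1 : k)) = y⁻¹ := by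
      rw [toricHom_single]
      simp [homography_swap]
    have h1 : ((1 : ℤ) : WithTop ℤ) ≤ v j y⁻¹ := by
      rw [← hz, hv]
      intro g hg
      rw [AddMonoidAlgebra.coeff_single] at hg
      rw [Finset.mem_singleton.1 (Finsupp.support_single_subset hg), hwt, hν]
      simp
    -- Together with `h1` this pins the valuation of `y⁻¹` to `1`; as the linear form is `y` here,
    -- `κ j` is the valuation of `y`.
    have h2 : ¬ ((2 : ℤ) : WithTop ℤ) ≤ v j y⁻¹ := by
      rw [← hz, hv]
      intro h
      have := h (0, 1) (by simp)
      rw [hwt, hν] at this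
      norm_num at this
    have h3 : v j y + v j y⁻¹ = 0 := by rw [← (v j).map_mul, mul_inv_cancel₀ hy0, (v j).map_one]
    have h4 := hκ0 j
    simp only [hν, zero_le_one, if_true, sub_zero] at h4
    have h5 : aeval y (linPoly ((0, 1) : k × k)) = y := by simp [linPoly]
    rw [h5] at h4
    rw [h4] at h3
    cases hvv : v j y⁻¹ with
    | top => rw [hvv] at h3; simp at h3
    | coe a =>
      rw [hvv] at h3 h2 h1
      have h6 : κ j + a = 0 := by exact_mod_cast h3
      rw [WithTop.coe_le_coe] at h1 h2
      omega
  rw [hA m _ hx]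
  have hcomm : ∀ Q : (Fin n → ℤ) → J → Prop, (∀ u, F u ≠ 0 → ∀ j, Q u j) ↔
      ∀ j u, F u ≠ 0 → Q u j := fun Q => ⟨fun h j u hu => h u hu j, fun h u hu j => h j u hu⟩
  rw [hcomm]
  refine forall_congr' fun j => ?_
  rw [← hκ j d F hF, (v j).map_mul, ← hordE]
  cases v j (toricEval χ y F) with
  | top => simp
  | coe a =>
    norm_cast
    simp only [AddMonoidHom.sub_apply]
    constructor <;> intro h <;> linarith

end ToricCharts

/-! ### Finite generation for a cover by monomial charts. -/

section MonomialCover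

open Polynomial

variable {k K P : Type*} [Field k] [Field K] [Algebra k K] {n s : ℕ}
  {O : P → Subring K} {t : P → Fin s → Kˣ} {χ : Multiplicative (Fin n → ℤ) →* Kˣ} {y : K}

/-- The sections of line bundles at a point form a vector space. -/
def sectionsAt (hk : ∀ p (c : k), algebraMap k K c ∈ O p) (t : P → Fin s → Kˣ)
    (m : Fin s → ℤ) (p : P) : Submodule k K where
  carrier := {x | IsSectionAt O t m x p}
  zero_mem' := by
    rw [Set.mem_ofPred_eq, IsSectionAt, zero_mul]
    exact (O p).zero_mem
  add_mem' {a b} ha hb := by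
    rw [Set.mem_ofPred_eq, IsSectionAt, add_mul]
    exact (O p).add_mem ha hb
  smul_mem' c x hx := by
    rw [Set.mem_ofPred_eq, IsSectionAt, Algebra.smul_def, mul_assoc]
    exact (O p).mul_mem (hk p c) hx

/-- If the space of points `P` is covered by a chart with ring `k[ℤⁿ][y]`, a chart with
ring `k[ℤⁿ][y⁻¹]`, and finitely many monomial charts, then the algebra of the sections of line
bundles on `P` is finitely generated. -/
theorem fg_of_monomialCharts (hk : ∀ p (c : k), algebraMap k K c ∈ O p)
    (hinj : Function.Injective (toricHom (k := k) χ y))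
    (hfrac : ∀ x : K, ∃ a b : AddMonoidAlgebra k ((Fin n → ℤ) × ℕ),
      b ≠ 0 ∧ x * toricHom χ y b = toricHom χ y a)
    {S₁ S₂ : Type*} [CommRing S₁] [CommRing S₂] (C₁ : LocalChart O S₁) (C₂ : LocalChart O S₂)
    (h₁ : ∀ x, x ∈ C₁.hom.range ↔ ∃ F, toricHom (k := k) χ y F = x)
    (h₂ : ∀ x, x ∈ C₂.hom.range ↔ ∃ F, toricHom (k := k) χ y⁻¹ F = x)
    (f₂ : S₂) (hf₂ : C₂.hom f₂ = y⁻¹)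
    (hf₂' : ∀ q, f₂ ∉ q.asIdeal → ∃ q', C₂.pt q = C₁.pt q')
    {ι : Type} [Finite ι] {S : ι → Type*} [∀ i, CommRing (S i)] (C : ∀ i, LocalChart O (S i))
    (p p' : ι → k × k) (hp : ∀ i, (p i).1 * (p' i).2 - (p' i).1 * (p i).2 ≠ 0)
    {J : ι → Type} [∀ i, Finite (J i)] (wt : ∀ i, J i → (Fin n → ℤ) →+ ℤ) (ν : ∀ i, J i → ℤ)
    (f : ∀ i, S i)
    (hC : ∀ i, IsMonomialChart k χ (homography (p i) (p' i) y) (C i) (wt i) (ν i) (f i))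
    (hf' : ∀ i q, f i ∉ q.asIdeal →
      (∃ q', (C i).pt q = C₁.pt q') ∨ ∃ q', (C i).pt q = C₂.pt q')
    (hcover : ∀ x, (∃ q, x = C₁.pt q) ∨ (∃ q, x = C₂.pt q) ∨ ∃ i q, x = (C i).pt q)
    (ht₁ : C₁.IsLocallyTrivial t) (ht₂ : C₂.IsLocallyTrivial t)
    (ht : ∀ i, (C i).IsLocallyTrivial t)
    (R : Subalgebra k (AddMonoidAlgebra K (Fin s → ℤ)))
    (hR : ∀ F, F ∈ R ↔ ∀ m x, IsSectionAt O t m (F.coeff m) x) : R.FG := by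
  have hy := transcendental_of_toricHom_injective _ _ hinj
  have hy0 : y ≠ 0 := by
    rintro rfl
    exact hy isAlgebraic_zero
  -- the chart `C₁` is factorial
  choose e₁ he₁ using fun F => (h₁ (toricHom (k := k) χ y F)).2 ⟨F, rfl⟩
  let e₁ : AddMonoidAlgebra k ((Fin n → ℤ) × ℕ) ≃+* S₁ := RingEquiv.ofBijective
    (⟨⟨⟨e₁, C₁.injective (by rw [he₁, map_one, map_one])⟩,
      fun a b => C₁.injective (by rw [he₁, map_mul, map_mul, he₁, he₁])⟩,
      C₁.injective (by rw [he₁, map_zero, map_zero]),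
      fun a b => C₁.injective (by rw [he₁, map_add, map_add, he₁, he₁])⟩ : _ →+* S₁)
    ⟨fun a b h => hinj (by rw [← he₁, ← he₁]; exact congrArg C₁.hom h), fun x => by
      obtain ⟨F, hF⟩ := (h₁ _).1 ⟨x, rfl⟩
      exact ⟨F, C₁.injective ((he₁ F).trans hF)⟩⟩
  replace he₁ : ∀ F, C₁.hom (e₁ F) = toricHom χ y F := he₁
  have : IsDomain S₁ := e₁.symm.toMulEquiv.isDomain _
  have : UniqueFactorizationMonoid S₁ :=
    e₁.toMulEquiv.uniqueFactorizationMonoid inferInstance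
  obtain ⟨E, hE⟩ := C₁.exists_forall_isSectionAt_iff_mem_range ht₁ fun x => by
    obtain ⟨a, b, hb, h⟩ := hfrac x
    exact ⟨e₁ a, e₁ b, (map_ne_zero_iff _ e₁.injective).2 hb, by rw [he₁, he₁, h]⟩
  -- Products of `E^m` with any finite sum `∑ χ^u f_u(y)` are sections over the first chart; only
  -- extension remains at stake.
  have hE' : ∀ m (F : (Fin n → ℤ) →₀ k[X]) q,
      IsSectionAt O t m (unitsMonomial E m * toricEval χ y F) (C₁.pt q) := by
    intro m F
    rw [hE, h₁]
    refine ⟨(toFamily k n).symm F, ?_⟩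
    rw [← toricEval_toFamily, LinearEquiv.apply_symm_apply, mul_comm, Units.inv_mul_cancel_left]
  -- the chart `C₂` bounds the degree
  have hC₂ : IsMonomialChart k χ (homography ((0, 1) : k × k) (1, 0) y) C₂
      (fun _ : Unit => 0) (fun _ => 1) f₂ := by
    rw [homography_swap]
    refine ⟨fun x => (h₂ x).trans (exists_congr fun F => ?_), (0, 1), ?_, ?_⟩
    · rw [iff_and_self]
      intro _ g _ _
      simp
    · simp [hf₂]
    · intro g N hg
      have := hg ()
      simp only [AddMonoidHom.zero_apply, zero_add, one_mul, Nat.cast_one, mul_one,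
        Nat.cast_le] at this
      exact ⟨(g.1, g.2 - N), Prod.ext (by simp) (by simp [this])⟩
  obtain ⟨A₂, κ₂, hκ₂, hA₂⟩ := hC₂.exists_forall_isSectionAt_iff (by simp) hinj hfrac ht₂ E
  have hκ : κ₂ () = -1 := hκ₂ () rfl rfl rfl rfl
  -- The auxiliary bound `d` cancels: with `κ = -1`, a witness `c ≤ d - deg` satisfying `A₂ m ≤ -d +
  -- c` exists exactly when the degree is at most `-A₂ m`.
  have hdeg : ∀ m (F : (Fin n → ℤ) →₀ k[X]),
      (∀ q, IsSectionAt O t m (unitsMonomial E m * toricEval χ y F) (C₂.pt q)) ↔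
        ∀ u, F u ≠ 0 → ((F u).natDegree : ℤ) ≤ (-A₂ ()) m := by
    intro m F
    obtain ⟨d, hd⟩ := exists_natDegree_le F
    rw [hA₂ m F d hd fun q hq => by
      obtain ⟨q', h⟩ := hf₂' q hq
      rw [h]
      exact hE' ..]
    refine forall₂_congr fun u _ => ?_
    have h1 : linPoint ((1, 0) : k × k) = none := if_pos rfl
    have h2 : ∀ Q : Unit → Prop, (∀ j, Q j) ↔ Q () := fun Q => ⟨fun h => h (), fun h j => h⟩
    rw [h2]
    simp only [zero_le_one, if_true, h1, hκ, AddMonoidHom.neg_apply,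
      AddMonoidHom.zero_apply, zero_add]
    constructor
    · rintro ⟨c, hc, h⟩
      have hc : ((F u).natDegree : ℤ) + c ≤ d := hc
      simp at h
      linarith
    · intro h
      refine ⟨d - (F u).natDegree, ?_, ?_⟩
      · change ((F u).natDegree : ℤ) + (d - (F u).natDegree : ℕ) ≤ d
        have := hd u
        omega
      · have := hd u
        simp
        omega
  choose A κ _ hA using fun i => (hC i).exists_forall_isSectionAt_iff (hp i) hinj hfrac (ht i) E
  -- One condition for each valuation of each monomial chart. The degree bound is `-A₂`, and
  -- substituting it for `d` makes the bounds additive in the character and the multidegree.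
  let V : VanishingConditions k n s :=
    { Index := Σ i, J i
      finite := inferInstance
      d := -A₂ ()
      pt := fun r => if 0 ≤ ν r.1 r.2 then linPoint (p' r.1) else linPoint (p r.1)
      slope := fun r => (ν r.1 r.2).natAbs
      bound := fun r => (wt r.1 r.2).coprod ((κ r.1 r.2) • (-A₂ ()) - A r.1 r.2) }
  have key : ∀ m (F : (Fin n → ℤ) →₀ k[X]),
      (∀ x, IsSectionAt O t m (unitsMonomial E m * toricEval χ y F) x) ↔
        ∀ u, F u ≠ 0 → V.Good m u (F u) := by
    intro m F
    have h1 : (∀ x, IsSectionAt O t m (unitsMonomial E m * toricEval χ y F) x) ↔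
        (∀ q, IsSectionAt O t m (unitsMonomial E m * toricEval χ y F) (C₂.pt q)) ∧
        ∀ i q, IsSectionAt O t m (unitsMonomial E m * toricEval χ y F) ((C i).pt q) := by
      refine ⟨fun h => ⟨fun q => h _, fun i q => h _⟩, fun h x => ?_⟩
      obtain ⟨q, rfl⟩ | ⟨q, rfl⟩ | ⟨i, q, rfl⟩ := hcover x
      exacts [hE' _ _ _, h.1 q, h.2 i q]
    rw [h1, hdeg]
    have h2 : (∀ u, F u ≠ 0 → ((F u).natDegree : ℤ) ≤ (-A₂ ()) m) →
        ((∀ i q, IsSectionAt O t m (unitsMonomial E m * toricEval χ y F) ((C i).pt q)) ↔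
        ∀ i u, F u ≠ 0 → ∀ j : J i, ∃ c : ℕ,
            VanishesToOrder (if 0 ≤ ν i j then linPoint (p' i) else linPoint (p i)) c
              ((-A₂ ()) m) (F u) ∧
              A i j m ≤ wt i j u + κ i j * ((-A₂ ()) m) + (ν i j).natAbs * c) := by
      intro hd
      refine forall_congr' fun i => ?_
      by_cases hF : F = 0
      · subst hF
        simp only [map_zero, mul_zero, Finsupp.coe_zero, Pi.zero_apply, ne_eq, not_true_eq_false,
          false_imp_iff, implies_true, iff_true]
        intro q
        rw [IsSectionAt, zero_mul]
        exact Subring.zero_mem _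
      · obtain ⟨u, hu⟩ := Finsupp.ne_iff.1 hF
        have h0 := hd u hu
        -- A nonzero coefficient has degree at least zero, so the degree bound is a natural number
        -- and can be used as `d`.
        obtain ⟨d, hd'⟩ : ∃ d : ℕ, (-A₂ ()) m = d :=
          ⟨((-A₂ ()) m).toNat, (Int.toNat_of_nonneg (by omega)).symm⟩
        rw [hd'] at hd ⊢
        refine hA i m F d (fun u => ?_) fun q hq => ?_
        · by_cases hu : F u = 0
          · rw [hu, natDegree_zero]; exact zero_le
          · exact_mod_cast hd u hu
        -- Where `f i` is invertible the chart lies in the union of the first two charts, where the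
        -- sum is already known to be a section.
        · obtain ⟨q', h⟩ | ⟨q', h⟩ := hf' i q hq
          · rw [h]; exact hE' ..
          · rw [h]
            refine (hdeg m F).2 ?_ q'
            rwa [hd']
    constructor
    · rintro ⟨h3, h4⟩ u hu
      refine ⟨hu, h3 u hu, fun ⟨i, j⟩ => ?_⟩
      obtain ⟨c, hc, h⟩ := (h2 h3).1 h4 i u hu j
      refine ⟨c, hc, ?_⟩
      simp only [V, AddMonoidHom.coprod_apply, AddMonoidHom.sub_apply, AddMonoidHom.smul_apply,
        smul_eq_mul]
      linarith
    · intro h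
      refine ⟨fun u hu => (h u hu).2.1, (h2 fun u hu => (h u hu).2.1).2 fun i u hu j => ?_⟩
      obtain ⟨c, hc, h⟩ := (h u hu).2.2 ⟨i, j⟩
      refine ⟨c, hc, ?_⟩
      simp only [V, AddMonoidHom.coprod_apply, AddMonoidHom.sub_apply, AddMonoidHom.smul_apply,
        smul_eq_mul] at h
      linarith
  refine V.fg_of_forall_mem_iff χ E (y := Units.mk0 y hy0) hy R fun G => ?_
  rw [hR]
  refine forall_congr' fun m => ?_
  constructor
  · intro h
    -- A global section restricts to the first chart, where it is `E^m` times an element of the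
    -- ring; its components for the various characters then satisfy the conditions separately.
    obtain ⟨F₀, hF₀⟩ := (h₁ _).1 ((hE m _).1 fun q => h _)
    have h3 : G.coeff m = unitsMonomial E m * toricEval χ y (toFamily k n F₀) := by
      rw [toricEval_toFamily, hF₀, mul_comm, Units.inv_mul_cancel_right]
    rw [h3] at h ⊢
    have h4 := (key m _).1 h
    rw [toricEval_apply, Finsupp.mul_sum]
    refine sum_mem fun u hu => Submodule.subset_span ⟨u, _, h4 u (Finsupp.mem_support_iff.1 hu), ?_⟩
    exact (mul_assoc ..).symm
  · intro h x
    -- Sections at a point form a vector space over `k`, so spanning elements suffice; they are sums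
    -- with a single character.
    suffices V.sections χ y E m ≤ sectionsAt hk t m x from this h
    refine Submodule.span_le.2 ?_
    rintro _ ⟨u, g, hg, rfl⟩
    rw [mul_assoc, ← toricEval_single]
    refine (key m (.single u g)).2 (fun u' hu' => ?_) x
    by_cases h : u = u'
    · subst h
      simpa using hg
    · rw [Finsupp.single_eq_of_ne' h] at hu'
      exact absurd rfl hu'

end MonomialCover

/-! ### Rational functions on an integral scheme. -/

section RationalFunctions

variable {P : Scheme.{u}} [IsIntegral P]

lemma genericPoint_mem {U : P.Opens} {x : P} (hx : x ∈ U) : genericPoint P ∈ U :=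
  ((genericPoint_spec P).mem_open_set_iff U.isOpen).2 ⟨x, trivial, hx⟩

/-- Functions on a nonempty open set, as rational functions. -/
def ratFun {U : P.Opens} (hU : genericPoint P ∈ U) : Γ(P, U) →+* P.functionField :=
  (P.presheaf.germ U _ hU).hom

lemma ratFun_injective {U : P.Opens} (hU : genericPoint P ∈ U) :
    Function.Injective (ratFun hU) :=
  germ_injective_of_isIntegral P _ hU

lemma ratFun_resFun {U V : P.Opens} (hV : genericPoint P ∈ V) (h : V ≤ U) (a : Γ(P, U)) :
    ratFun hV (resFun h a) = ratFun (h hV) a :=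
  P.presheaf.germ_res_apply (homOfLE h) _ hV a

/-- The local ring of a point, as a subring of the field of rational functions. -/
def localRing (p : P) : Subring P.functionField :=
  (algebraMap (P.presheaf.stalk p) P.functionField).range

lemma mem_localRing_iff (p : P) (x : P.functionField) :
    x ∈ localRing p ↔ ∃ (U : P.Opens) (hp : p ∈ U) (a : Γ(P, U)),
      ratFun (genericPoint_mem hp) a = x := by
  constructor
  · rintro ⟨a, rfl⟩
    obtain ⟨U, hp, b, rfl⟩ := P.presheaf.exists_germ_eq a
    have : Nonempty U := ⟨⟨_, hp⟩⟩
    exact ⟨U, hp, b, (P.algebraMap_germ_eq_germToFunctionField hp b).symm⟩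
  · rintro ⟨U, hp, a, rfl⟩
    have : Nonempty U := ⟨⟨_, hp⟩⟩
    exact ⟨P.presheaf.germ U p hp a, P.algebraMap_germ_eq_germToFunctionField hp a⟩

lemma ratFun_mem_localRing {U : P.Opens} {p : P} (hp : p ∈ U) (hU : genericPoint P ∈ U)
    (a : Γ(P, U)) : ratFun hU a ∈ localRing p :=
  (mem_localRing_iff p _).2 ⟨U, hp, a, rfl⟩

/-- A rational function which is regular at the points of an open set is regular on it. -/
lemma exists_ratFun_eq {U : P.Opens} (hU : genericPoint P ∈ U) {x : P.functionField}
    (hx : ∀ p ∈ U, x ∈ localRing p) : ∃ a, ratFun hU a = x := by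
  have hx' : ∀ p : U, ∃ (V : P.Opens) (_ : V ≤ U) (hp : p.1 ∈ V) (a : Γ(P, V)),
      ratFun (genericPoint_mem hp) a = x := by
    intro p
    obtain ⟨V, hp, a, ha⟩ := (mem_localRing_iff p.1 _).1 (hx p p.2)
    refine ⟨V ⊓ U, inf_le_right, ⟨hp, p.2⟩, resFun inf_le_left a, ?_⟩
    rw [ratFun_resFun, ha]
  choose V hVU hpV a ha using hx'
  have hcov : U ≤ iSup V := by
    intro p hp
    exact Opens.mem_iSup.2 ⟨⟨p, hp⟩, hpV _⟩
  -- Functions with the same value at the generic point agree on overlaps, because functions on an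
  -- integral scheme embed in its function field.
  have hcompat : TopCat.Presheaf.IsCompatible P.sheaf.1 V a := by
    intro p q
    have hη : genericPoint P ∈ V p ⊓ V q := ⟨genericPoint_mem (hpV p), genericPoint_mem (hpV q)⟩
    apply ratFun_injective hη
    exact (ratFun_resFun hη inf_le_left _).trans ((ha p).trans
      ((ha q).symm.trans (ratFun_resFun hη inf_le_right _).symm))
  obtain ⟨b, hb, -⟩ := P.sheaf.existsUnique_gluing' V U (fun p => homOfLE (hVU p)) hcov a hcompat
  refine ⟨b, ?_⟩
  let p : U := ⟨genericPoint P, hU⟩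
  have := ha p
  rw [← hb p] at this
  rw [← this]
  exact (ratFun_resFun (hpV p) (hVU p) b).symm

/-- A unit, as an invertible rational function. -/
def ratUnit {U : P.Opens} (hU : genericPoint P ∈ U) : Γ(P, U)ˣ →* P.functionFieldˣ :=
  Units.map (ratFun hU)

lemma ratUnit_mem_unitGroup {U : P.Opens} {p : P} (hp : p ∈ U) (hU : genericPoint P ∈ U)
    (a : Γ(P, U)ˣ) : ratUnit hU a ∈ (localRing p).unitGroup :=
  ⟨ratFun_mem_localRing hp hU _, by
    rw [← map_inv]
    exact ratFun_mem_localRing hp hU _⟩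

end RationalFunctions

/-! ### Generators of line bundles compared with a rational reference frame. -/

section CoxFrames

variable {P : Scheme.{u}} {s : ℕ} {L : Fin s → LineBundle P}

/-- Each of two generators is a multiple of the other, and uniqueness of coefficients makes the two
factors mutually inverse. -/
lemma Frame.exists_smul {V : P.Opens} (e e' : Frame L V) :
    ∃ w : Fin s → Γ(P, V)ˣ, ∀ l, e'.gen l = (w l : Γ(P, V)) • e.gen l := by
  have key : ∀ (e e' : Frame L V) l, ∃ a : Γ(P, V), e'.gen l = a • e.gen l := by
    intro e e' l
    obtain ⟨c, hc⟩ := (e.isFrame l V le_rfl).2 (e'.gen l)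
    refine ⟨c 0, hc.symm.trans ?_⟩
    simp [resSec_self]
  choose a ha using key e e'
  choose b hb using key e' e
  have hinj : ∀ (e : Frame L V) l (c d : Γ(P, V)), c • e.gen l = d • e.gen l → c = d := by
    intro e l c d h
    have := (e.isFrame l V le_rfl).1 (a₁ := fun _ => c) (a₂ := fun _ => d)
      (by simpa [resSec_self] using h)
    exact congrFun this 0
  refine ⟨fun l => ⟨a l, b l, hinj e' l _ _ ?_, hinj e l _ _ ?_⟩, ha⟩
  · rw [mul_smul, ← hb, one_smul, ← ha]
  · rw [mul_smul, ← ha, one_smul, ← hb]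

lemma exists_frame (L : Fin s → LineBundle P) (p : P) : ∃ V : P.Opens, p ∈ V ∧ Nonempty (Frame L V) := by
  choose U hU e he using fun l => (L l).locallyFree p
  refine ⟨Finset.univ.inf U, ?_, ⟨⟨fun l => resSec _ (Finset.inf_le (Finset.mem_univ l)) (e l 0),
    fun l => ?_⟩⟩⟩
  · rw [← SetLike.mem_coe, Opens.coe_finset_inf]
    simp [hU]
  · have := (he l).res (Finset.inf_le (f := U) (Finset.mem_univ l))
    convert! this using 2 with i
    rw [Subsingleton.elim i 0]

variable [IsIntegral P]

variable (L) in
/-- An open set where the line bundles have generators, which serve as rational sections. -/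
def refOpen : P.Opens := (exists_frame L (genericPoint P)).choose

lemma genericPoint_mem_refOpen : genericPoint P ∈ refOpen L :=
  (exists_frame L (genericPoint P)).choose_spec.1

variable (L) in
/-- The generators of the line bundles over the reference open set. -/
def refFrame : Frame L (refOpen L) := (exists_frame L (genericPoint P)).choose_spec.2.some

/-- The quotients of the generators of the line bundles by the reference generators, as
rational functions. -/
def Frame.ratio {V : P.Opens} (hV : genericPoint P ∈ V) (e : Frame L V) :
    Fin s → P.functionFieldˣ := fun l =>
  ratUnit (U := V ⊓ refOpen L) ⟨hV, genericPoint_mem_refOpen⟩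
    ((Frame.exists_smul ((refFrame L).res inf_le_right) (e.res inf_le_left)).choose l)

/-- The quotient may be computed over any smaller open set containing the generic point, since
restriction does not change a rational function. -/
lemma Frame.ratio_eq {V W : P.Opens} (hV : genericPoint P ∈ V) (e : Frame L V) (h : W ≤ V)
    (h' : W ≤ refOpen L) (hW : genericPoint P ∈ W) (w : Fin s → Γ(P, W)ˣ)
    (hw : ∀ l, resSec _ h (e.gen l) = (w l : Γ(P, W)) • resSec _ h' ((refFrame L).gen l)) :
    e.ratio hV = fun l => ratUnit hW (w l) := by
  ext l
  have h1 := (Frame.exists_smul ((refFrame L).res inf_le_right)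
    (e.res (inf_le_left : V ⊓ refOpen L ≤ V))).choose_spec l
  have h2 := congrArg (resSec (L l).sheaf (le_inf h h')) h1
  rw [map_smulₛₗ] at h2
  simp only [Frame.res, resSec_resSec] at h2
  rw [hw l] at h2
  have h3 := ((refFrame L).isFrame l W h').1 (a₁ := fun _ => _) (a₂ := fun _ => _)
    (by simpa using h2)
  have h4 := congrArg (ratFun hW) (congrFun h3 0)
  rw [ratFun_resFun] at h4
  exact h4.symm

lemma Frame.exists_ratio_eq {V : P.Opens} (hV : genericPoint P ∈ V) (e : Frame L V) :
    ∃ (W : P.Opens) (h : W ≤ V) (h' : W ≤ refOpen L) (hW : genericPoint P ∈ W)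
      (w : Fin s → Γ(P, W)ˣ),
      (∀ l, resSec _ h (e.gen l) = (w l : Γ(P, W)) • resSec _ h' ((refFrame L).gen l)) ∧
      e.ratio hV = fun l => ratUnit hW (w l) :=
  ⟨V ⊓ refOpen L, inf_le_left, inf_le_right, ⟨hV, genericPoint_mem_refOpen⟩, _,
    (Frame.exists_smul ((refFrame L).res inf_le_right) (e.res inf_le_left)).choose_spec, rfl⟩

lemma Frame.ratio_res {V W : P.Opens} (hW : genericPoint P ∈ W) (e : Frame L V) (h : W ≤ V) :
    (e.res h).ratio hW = e.ratio (h hW) := by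
  obtain ⟨W', h1, h2, hW', w, hw, he⟩ := (e.res h).exists_ratio_eq hW
  rw [he, e.ratio_eq (h hW) (h1.trans h) h2 hW' w fun l => by
    rw [← hw, Frame.res, resSec_resSec]]

lemma Frame.ratio_smul {V : P.Opens} (hV : genericPoint P ∈ V) (e e' : Frame L V)
    (w : Fin s → Γ(P, V)ˣ) (hw : ∀ l, e'.gen l = (w l : Γ(P, V)) • e.gen l) (l : Fin s) :
    e'.ratio hV l = ratUnit hV (w l) * e.ratio hV l := by
  obtain ⟨W, h1, h2, hW, w', hw', he⟩ := e.exists_ratio_eq hV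
  rw [he, e'.ratio_eq hV h1 h2 hW (fun l => Units.map (resFun h1 : _ →* _) (w l) * w' l) fun l => by
    rw [hw, map_smulₛₗ, hw', Units.val_mul, mul_smul]
    rfl]
  beta_reduce
  rw [map_mul]
  congr 1
  ext
  exact ratFun_resFun hW h1 _

lemma Frame.ratio_refFrame : (refFrame L).ratio genericPoint_mem_refOpen = 1 := by
  rw [(refFrame L).ratio_eq genericPoint_mem_refOpen le_rfl le_rfl genericPoint_mem_refOpen
    (fun _ => 1) fun l => by rw [Units.val_one, one_smul]]
  ext l
  simp

variable (L) in
/-- Quotients of local generators of the line bundles by the reference generators. -/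
def localRatio (p : P) : Fin s → P.functionFieldˣ :=
  (exists_frame L p).choose_spec.2.some.ratio
    (genericPoint_mem (exists_frame L p).choose_spec.1)

lemma Frame.ratio_div_localRatio_mem {V : P.Opens} (hV : genericPoint P ∈ V) (e : Frame L V)
    {p : P} (hp : p ∈ V) (l : Fin s) :
    e.ratio hV l / localRatio L p l ∈ (localRing p).unitGroup := by
  set e' := (exists_frame L p).choose_spec.2.some with he'
  have hp' : p ∈ V ⊓ (exists_frame L p).choose := ⟨hp, (exists_frame L p).choose_spec.1⟩
  obtain ⟨w, hw⟩ := Frame.exists_smul (e'.res (inf_le_right : V ⊓ (exists_frame L p).choose ≤ _))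
    (e.res inf_le_left)
  have h1 := Frame.ratio_smul (genericPoint_mem hp') _ _ w hw l
  rw [Frame.ratio_res, Frame.ratio_res] at h1
  rw [h1]
  have h2 : localRatio L p = e'.ratio (genericPoint_mem (exists_frame L p).choose_spec.1) := rfl
  rw [h2, mul_div_cancel_right]
  exact ratUnit_mem_unitGroup hp' _ _

end CoxFrames

/-! ### The Cox ring inside a ring of Laurent polynomials. -/

section CoxAlgebra

variable {P : Scheme.{u}} [IsIntegral P] {s : ℕ} {L : Fin s → LineBundle P}

/-- Sections of tensor products of line bundles, as rational functions. -/
def sectionValue (m : Fin s → ℤ) : tensorSections L m →+ P.functionField :=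
  (ratFun genericPoint_mem_refOpen).toAddMonoidHom.comp
    { toFun := fun f => f.1 (refOpen L) (refFrame L)
      map_zero' := rfl
      map_add' := fun _ _ => rfl }

/-- The transformation rule of a section, applied over a common open set to the reference frame and
to `e`, relates the two coefficients by the monomial in the transition units. -/
lemma ratFun_tensorSections {m : Fin s → ℤ} (f : tensorSections L m) {V : P.Opens}
    (hV : genericPoint P ∈ V) (e : Frame L V) :
    ratFun hV (f.1 V e) = sectionValue m f * ((unitsMonomial (e.ratio hV) m)⁻¹ : P.functionFieldˣ) := by
  obtain ⟨W, h, h', hW, w, hw, he⟩ := e.exists_ratio_eq hV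
  have h1 := f.2.2 W ((refFrame L).res h') (e.res h) w hw
  rw [f.2.1, f.2.1] at h1
  have h2 := congrArg (ratFun hW) h1
  rw [map_mul, ratFun_resFun, ratFun_resFun] at h2
  have h3 : unitsMonomial (e.ratio hV) m = ratUnit hW (∏ l, w l ^ m l) := by
    rw [he, map_prod, unitsMonomial]
    exact Finset.prod_congr rfl fun l _ => (map_zpow ..).symm
  have h4 : sectionValue m f = ratFun (h' hW) (f.1 (refOpen L) (refFrame L)) := rfl
  rw [h4, h2, h3, mul_comm, ← mul_assoc]
  exact (Units.inv_mul_cancel_left (ratUnit hW (∏ l, w l ^ m l)) _).symm.trans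
    (mul_assoc ..).symm

lemma sectionValue_injective (m : Fin s → ℤ) :
    Function.Injective (sectionValue (L := L) m) := by
  rw [injective_iff_map_eq_zero]
  intro f hf
  ext V e
  rcases isEmpty_or_nonempty V with hV | ⟨⟨x, hx⟩⟩
  · have : V = ⊥ := by
      exact eq_bot_iff.2 fun x hx => hV.false ⟨x, hx⟩
    subst this
    exact Subsingleton.elim _ _
  · apply ratFun_injective (genericPoint_mem hx)
    rw [ratFun_tensorSections, hf, zero_mul]
    exact (map_zero _).symm

lemma isSectionAt_sectionValue {m : Fin s → ℤ} (f : tensorSections L m) (x : P) :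
    IsSectionAt localRing (localRatio L) m (sectionValue m f) x := by
  have h := (exists_frame L x).choose_spec.1
  have := ratFun_tensorSections f (genericPoint_mem h) (exists_frame L x).choose_spec.2.some
  unfold IsSectionAt localRatio
  rw [← this]
  exact ratFun_mem_localRing h _ _

/-- The coefficient with respect to a frame must be `x` divided by the monomial in its ratios. This
quotient is regular at each point by hypothesis, hence regular on the open set, and the rules of
restriction and change of frame may be checked in the function field. -/
lemma exists_sectionValue_eq {m : Fin s → ℤ} {x : P.functionField}
    (hx : ∀ p, IsSectionAt localRing (localRatio L) m x p) : ∃ f, sectionValue (L := L) m f = x := by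
  have key : ∀ (V : P.Opens) (e : Frame L V), ∃ a : Γ(P, V), ∀ hV : genericPoint P ∈ V,
      ratFun hV a = x * ((unitsMonomial (e.ratio hV) m)⁻¹ : P.functionFieldˣ) := by
    intro V e
    by_cases hV : genericPoint P ∈ V
    · obtain ⟨a, ha⟩ := exists_ratFun_eq hV
        (x := x * ((unitsMonomial (e.ratio hV) m)⁻¹ : P.functionFieldˣ)) fun p hp => by
          have h1 := unitsMonomial_mem_unitGroup (e.ratio_div_localRatio_mem hV hp) m
          rw [← Subring.mul_mem_iff_of_mem_unitGroup h1, unitsMonomial_div, mul_assoc,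
            ← Units.val_mul, div_eq_mul_inv, inv_mul_cancel_left]
          exact hx p
      exact ⟨a, fun _ => ha⟩
    · exact ⟨0, fun h => absurd h hV⟩
  -- An open set that misses the generic point is empty, so all identities hold there trivially.
  have hsub : ∀ V : P.Opens, genericPoint P ∉ V → Subsingleton Γ(P, V) := by
    intro V hV
    have : V = ⊥ := by
      exact eq_bot_iff.2 fun x hx => hV (genericPoint_mem hx)
    subst this
    infer_instance
  choose f hf using key
  refine ⟨⟨f, fun U V h e => ?_, fun V e e' w hw => ?_⟩, ?_⟩
  · by_cases hV : genericPoint P ∈ V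
    · apply ratFun_injective hV
      rw [ratFun_resFun, hf, hf, Frame.ratio_res]
    · exact (hsub V hV).elim _ _
  · by_cases hV : genericPoint P ∈ V
    · apply ratFun_injective hV
      rw [map_mul, hf, hf]
      have h1 : unitsMonomial (e'.ratio hV) m =
          ratUnit hV (∏ l, w l ^ m l) * unitsMonomial (e.ratio hV) m := by
        rw [map_prod, unitsMonomial, unitsMonomial, ← Finset.prod_mul_distrib]
        refine Finset.prod_congr rfl fun l _ => ?_
        rw [Frame.ratio_smul hV e e' w hw, mul_zpow, map_zpow]
      have h2 : ratFun hV ((∏ l, w l ^ m l : Γ(P, V)ˣ) : Γ(P, V)) =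
        ratUnit hV (∏ l, w l ^ m l) := rfl
      rw [h1, h2, mul_left_comm, ← Units.val_mul, mul_inv, mul_inv_cancel_left]
    · exact (hsub V hV).elim _ _
  · exact (hf _ _ genericPoint_mem_refOpen).trans (by simp [Frame.ratio_refFrame, unitsMonomial])

variable {k : Type u} [Field k] (p : P ⟶ Spec (.of k))

/-- Constants, as rational functions. -/
def constRatFun : k →+* P.functionField :=
  (ratFun (U := ⊤) trivial).comp ((Scheme.ΓSpecIso (.of k)).inv ≫ p.appTop).hom

/-- The Cox ring as a ring of Laurent polynomials with rational functions as coefficients. -/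
def coxRingHom : CoxRing p L →+* AddMonoidAlgebra P.functionField (Fin s → ℤ) :=
  DirectSum.toSemiring
    (fun m => (AddMonoidAlgebra.singleAddHom m).comp (sectionValue (L := L) m))
    (by
      change AddMonoidAlgebra.single 0 (ratFun _ 1) = _
      rw [map_one, AddMonoidAlgebra.one_def])
    (fun {m m'} f g => by
      change AddMonoidAlgebra.single _ (ratFun _ _) =
        AddMonoidAlgebra.single _ (ratFun _ _) * AddMonoidAlgebra.single _ (ratFun _ _)
      rw [AddMonoidAlgebra.single_mul_single, ← map_mul]
      rfl)

lemma coxRingHom_of (m : Fin s → ℤ) (f : tensorSections L m) :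
    coxRingHom p (L := L) (DirectSum.of (fun m => tensorSections L m) m f) =
      AddMonoidAlgebra.single m (sectionValue m f) :=
  DirectSum.toSemiring_of ..

lemma coeff_coxRingHom (x : DirectSum (Fin s → ℤ) fun m => tensorSections L m) (m : Fin s → ℤ) :
    (coxRingHom p (L := L) x).coeff m = sectionValue m (x m) := by
  induction x using DirectSum.induction_on with
  | zero =>
    rw [show coxRingHom p (L := L) (0 : DirectSum (Fin s → ℤ) fun m => tensorSections L m) = 0 from
      map_zero _]
    simp
  | of m' f =>
    rw [coxRingHom_of, AddMonoidAlgebra.coeff_single]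
    by_cases h : m' = m
    · subst h
      simp
    · rw [Finsupp.single_eq_of_ne' h, DirectSum.of_eq_of_ne _ _ _ (Ne.symm h), map_zero]
  | add x y hx hy =>
    rw [show coxRingHom p (L := L) (x + y) = coxRingHom p (L := L) x + coxRingHom p (L := L) y from
      map_add _ _ _]
    simp [hx, hy]

/-- The Cox ring is finitely generated if the corresponding ring of Laurent polynomials is. -/
theorem finiteType_coxRing
    (h : letI := (constRatFun p).toAlgebra
      ∀ R : Subalgebra k (AddMonoidAlgebra P.functionField (Fin s → ℤ)),
        (∀ F, F ∈ R ↔ ∀ m x, IsSectionAt localRing (localRatio L) m (F.coeff m) x) → R.FG) :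
    Algebra.FiniteType k (CoxRing p L) := by
  let := (constRatFun p).toAlgebra
  let Θ : CoxRing p L →ₐ[k] AddMonoidAlgebra P.functionField (Fin s → ℤ) :=
    { coxRingHom p (L := L) with
      commutes' := fun c => by
        refine (coxRingHom_of p 0 _).trans ?_
        change AddMonoidAlgebra.single 0 (ratFun _ (resFun _ _)) = _
        rw [ratFun_resFun]
        rfl }
  have hΘ : ∀ (x : DirectSum (Fin s → ℤ) fun m => tensorSections L m) m,
      (Θ x).coeff m = sectionValue m (x m) := coeff_coxRingHom p
  have hinj : Function.Injective Θ := by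
    intro x y hxy
    refine DFinsupp.ext fun m => sectionValue_injective m ?_
    exact (hΘ x m).symm.trans ((congrArg (fun F => F.coeff m) hxy).trans (hΘ y m))
  have hR := h Θ.range fun F => by
    constructor
    · rintro ⟨x, rfl⟩ m q
      refine (hΘ x m).symm ▸ ?_
      exact isSectionAt_sectionValue _ _
    · intro hF
      choose f hf using fun m => exists_sectionValue_eq (hF m)
      refine ⟨∑ m ∈ F.coeff.support,
        (show CoxRing p L from DirectSum.of (fun m => tensorSections L m) m (f m)), ?_⟩
      change Θ _ = _
      rw [map_sum]
      conv_rhs => rw [← AddMonoidAlgebra.sum_coeff_single F]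
      refine Finset.sum_congr rfl fun m _ => ?_
      rw [← hf m]
      exact coxRingHom_of p m (f m)
  have : Algebra.FiniteType k Θ.range := (Subalgebra.fg_iff_finiteType _).1 hR
  exact this.equiv (AlgEquiv.ofInjective Θ hinj).symm

end CoxAlgebra

/-! ### Affine open subschemes as charts, and integrality. -/

section AffineCharts

variable {P : Scheme.{u}} [IsIntegral P] {W : P.Opens} (hW : IsAffineOpen W)
  (hη : genericPoint P ∈ W)

lemma fromSpec_mem_basicOpen_iff (q : PrimeSpectrum Γ(P, W)) (b : Γ(P, W)) :
    hW.fromSpec q ∈ P.basicOpen b ↔ b ∉ q.asIdeal := by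
  have := hW.fromSpec_preimage_basicOpen b
  have h2 : q ∈ hW.fromSpec ⁻¹ᵁ P.basicOpen b ↔ q ∈ PrimeSpectrum.basicOpen b :=
    iff_of_eq (congrArg (fun U : (Spec Γ(P, W)).Opens => q ∈ U) this)
  exact h2

lemma fromSpec_mem (q : PrimeSpectrum Γ(P, W)) : hW.fromSpec q ∈ W := by
  rw [← SetLike.mem_coe, ← hW.range_fromSpec]
  exact ⟨q, rfl⟩

lemma exists_fromSpec_eq {x : P} (hx : x ∈ W) : ∃ q, x = hW.fromSpec q := by
  rw [← SetLike.mem_coe, ← hW.range_fromSpec] at hx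
  obtain ⟨q, h⟩ := hx
  exact ⟨q, h.symm⟩

/-- The chart given by an affine open set. -/
def affineChart : LocalChart (K := P.functionField) localRing Γ(P, W) where
  hom := ratFun hη
  injective := ratFun_injective hη
  pt := hW.fromSpec
  mem_iff q x := by
    constructor
    · intro hx
      obtain ⟨U, hq, a, rfl⟩ := (mem_localRing_iff _ _).1 hx
      obtain ⟨b, hbU, hb⟩ := hW.exists_basicOpen_le ⟨_, hq⟩ (fromSpec_mem hW q)
      have hη' : genericPoint P ∈ P.basicOpen b := genericPoint_mem hb
      have := hW.isLocalization_basicOpen b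
      obtain ⟨N, c, hc⟩ := IsLocalization.Away.surj b (resFun hbU a)
      refine ⟨c, b ^ N, fun h => (fromSpec_mem_basicOpen_iff hW q b).1 hb
        (q.2.mem_of_pow_mem _ h), ?_⟩
      have h1 := congrArg (ratFun hη') hc
      rw [map_mul, ratFun_resFun, map_pow] at h1
      have h2 : ∀ d, ratFun hη' (algebraMap Γ(P, W) Γ(P, P.basicOpen b) d) = ratFun hη d :=
        fun d => ratFun_resFun hη' (P.basicOpen_le b) d
      rw [h2, h2] at h1
      rw [map_pow, ← h1]
    · rintro ⟨a, b, hb, h⟩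
      have hb' := (fromSpec_mem_basicOpen_iff hW q b).2 hb
      have hη' : genericPoint P ∈ P.basicOpen b := genericPoint_mem hb'
      obtain ⟨c, hc⟩ : IsUnit (resFun (P.basicOpen_le b) b) :=
        RingedSpace.isUnit_res_basicOpen _ b
      refine (mem_localRing_iff _ _).2 ⟨_, hb', resFun (P.basicOpen_le b) a * (c⁻¹ : _ˣ), ?_⟩
      have h1 : ratFun hη' (c : Γ(P, P.basicOpen b)) ≠ 0 := (c.isUnit.map (ratFun hη')).ne_zero
      rw [map_mul, ratFun_resFun, ← h, mul_assoc]
      rw [hc, ratFun_resFun] at h1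
      have h2 : ratFun hη' ((c⁻¹ : _ˣ) : Γ(P, P.basicOpen b)) * ratFun hη b = 1 := by
        rw [← ratFun_resFun hη' (P.basicOpen_le b) b, ← hc, ← map_mul, Units.inv_mul, map_one]
      rw [mul_comm (ratFun hη b), h2, mul_one]

variable {s : ℕ} (L : Fin s → LineBundle P)

/-- A frame near a point restricts to a basic open neighbourhood, and there its ratios agree with
the chosen local ones up to units. -/
lemma affineChart_isLocallyTrivial : (affineChart hW hη).IsLocallyTrivial (localRatio L) := by
  intro q
  obtain ⟨V, hV, ⟨e⟩⟩ := exists_frame L (hW.fromSpec q)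
  obtain ⟨b, hbV, hb⟩ := hW.exists_basicOpen_le ⟨_, hV⟩ (fromSpec_mem hW q)
  refine ⟨b, (fromSpec_mem_basicOpen_iff hW q b).1 hb, e.ratio (genericPoint_mem hV),
    fun q' hq' l => e.ratio_div_localRatio_mem _ ?_ l⟩
  exact hbV ((fromSpec_mem_basicOpen_iff hW q' b).2 hq')

end AffineCharts

section SpecCharts

/-- A scheme which is covered by spectra of domains, any two of which meet, is integral. -/
theorem isIntegral_of_charts {P : Scheme.{u}} {ι : Type*} [Nonempty ι] {R : ι → Type u}
    [∀ i, CommRing (R i)] [∀ i, IsDomain (R i)] (a : ∀ i, Spec (.of (R i)) ⟶ P)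
    [∀ i, IsOpenImmersion (a i)] (hcover : ∀ x, ∃ i y, a i y = x)
    (hmeet : ∀ i j, ∃ x y, a i x = a j y) : IsIntegral P := by
  have hred : ∀ i, IsReduced (Spec (.of (R i))) := fun i => inferInstance
  have hirr : ∀ i, IrreducibleSpace (Spec (.of (R i))) := fun i => inferInstance
  have : IsReduced P := by
    have (x : P) : _root_.IsReduced (P.presheaf.stalk x) := by
      obtain ⟨i, x, rfl⟩ := hcover x
      exact isReduced_of_injective _
        (asIso <| (a i).stalkMap x).commRingCatIsoToRingEquiv.injective
    exact isReduced_of_isReduced_stalk _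
  have : PreirreducibleSpace P := by
    -- A space covered by irreducible open sets which pairwise meet is irreducible.
    refine PreirreducibleSpace.of_isOpenCover (U := fun i => (a i).opensRange) ?_ ?_ fun i => ?_
    · intro i j _ h
      obtain ⟨x, y, hxy⟩ := hmeet i j
      have := h (show (a i).opensRange ⊓ (a j).opensRange ≤ _ from inf_le_left) inf_le_right
        (show a i x ∈ (a i).opensRange ⊓ (a j).opensRange from ⟨⟨x, rfl⟩, ⟨y, hxy.symm⟩⟩)
      exact this
    · refine IsOpenCover.mk (top_unique fun x _ => Opens.mem_iSup.2 ?_)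
      obtain ⟨i, y, rfl⟩ := hcover x
      exact ⟨i, y, rfl⟩
    · have : IsPreirreducible ((a i).opensRange : Set P) := by
        rw [Scheme.Hom.coe_opensRange, ← Set.image_univ]
        exact (PreirreducibleSpace.isPreirreducible_univ).image _ (a i).continuous.continuousOn
      exact Subtype.preirreducibleSpace this
  have : Nonempty P := by
    let i := Classical.arbitrary ι
    exact ⟨a i (Classical.arbitrary _)⟩
  have : IrreducibleSpace P := ⟨inferInstance⟩
  exact isIntegral_of_irreducibleSpace_of_isReduced P

variable {P : Scheme.{u}} {R : Type u} [CommRing R] (a : Spec (.of R) ⟶ P) [IsOpenImmersion a]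

/-- The ring of a chart, as the ring of functions on the chart. -/
def specSection : R ≃+* Γ(P, a ''ᵁ ⊤) :=
  ((Scheme.ΓSpecIso (.of R)).symm ≪≫ (a.appIso ⊤).symm).commRingCatIsoToRingEquiv

lemma isAffineOpen_specRange : IsAffineOpen (a ''ᵁ ⊤) :=
  (Scheme.Hom.isAffineOpen_iff_of_isOpenImmersion a).2 (isAffineOpen_top _)

lemma mem_specRange (q : PrimeSpectrum R) : a q ∈ a ''ᵁ ⊤ := ⟨q, trivial, rfl⟩

lemma exists_of_mem_specRange {x : P} (hx : x ∈ a ''ᵁ ⊤) : ∃ q : PrimeSpectrum R, a q = x := by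
  obtain ⟨q, -, h⟩ := hx
  exact ⟨q, h⟩

lemma mem_basicOpen_specSection_iff (q : PrimeSpectrum R) (b : R) :
    a q ∈ P.basicOpen (specSection a b) ↔ b ∉ q.asIdeal := by
  have h1 : a ⁻¹ᵁ P.basicOpen (specSection a b) = PrimeSpectrum.basicOpen b := by
    rw [Scheme.preimage_basicOpen]
    have : a.app (a ''ᵁ ⊤) (specSection a b) = (Spec (.of R)).presheaf.map
        (eqToHom (a.preimage_image_eq ⊤)).op ((Scheme.ΓSpecIso (.of R)).inv b) := by
      have := a.appIso_inv_app ⊤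
      exact congr($this ((Scheme.ΓSpecIso (.of R)).inv b))
    rw [this, Scheme.basicOpen_res_eq, basicOpen_eq_of_affine]
  have h2 : q ∈ a ⁻¹ᵁ P.basicOpen (specSection a b) ↔ q ∈ PrimeSpectrum.basicOpen b :=
    iff_of_eq (congrArg (fun U : (Spec (.of R)).Opens => q ∈ U) h1)
  exact h2

variable [IsIntegral P] [Nontrivial R]

lemma genericPoint_mem_specRange : genericPoint P ∈ a ''ᵁ ⊤ :=
  genericPoint_mem (mem_specRange a (Classical.arbitrary (PrimeSpectrum R)))

/-- The ring of a chart, as a ring of rational functions. -/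
def specRatFun : R →+* P.functionField :=
  (ratFun (genericPoint_mem_specRange a)).comp (specSection a).toRingHom

lemma specRatFun_injective : Function.Injective (specRatFun a) :=
  (ratFun_injective _).comp (specSection a).injective

/-- The ring map of nested charts is restriction of functions, and restriction preserves the
associated rational function. -/
lemma specRatFun_comp {R' : Type u} [CommRing R'] [Nontrivial R'] (f : R →+* R')
    (b : Spec (.of R') ⟶ P) [IsOpenImmersion b] (h : b = Spec.map (CommRingCat.ofHom f) ≫ a)
    (x : R) : specRatFun b (f x) = specRatFun a x := by
  have hle : b ''ᵁ ⊤ ≤ a ''ᵁ ⊤ := by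
    rintro _ ⟨y, -, rfl⟩
    rw [h]
    exact ⟨_, trivial, rfl⟩
  suffices specSection b (f x) = resFun hle (specSection a x) by
    change ratFun _ (specSection b (f x)) = ratFun _ (specSection a x)
    rw [this, ratFun_resFun]
  apply (b.appIso ⊤).commRingCatIsoToRingEquiv.injective
  have h1 : (b.appIso ⊤).commRingCatIsoToRingEquiv (specSection b (f x)) =
      (Scheme.ΓSpecIso (.of R')).inv (f x) :=
    (b.appIso ⊤).commRingCatIsoToRingEquiv.apply_symm_apply _
  rw [h1]
  change _ = (b.appIso ⊤).hom (resFun hle (specSection a x))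
  rw [Scheme.Hom.appIso_hom']
  have h2 : ∀ (U : P.Opens) (hU : b ''ᵁ ⊤ ≤ U) (z : Γ(P, U)),
      b.appLE (b ''ᵁ ⊤) ⊤ (b.preimage_image_eq ⊤).ge (resFun hU z) =
        b.appLE U ⊤ ((b.preimage_image_eq ⊤).ge.trans (b.preimage_mono hU)) z := by
    intro U hU z
    have := Scheme.Hom.map_appLE b (b.preimage_image_eq ⊤).ge (homOfLE hU).op
    exact congr($this z)
  rw [h2]
  subst h
  have h3 : (specSection a x) = (a.appIso ⊤).inv ((Scheme.ΓSpecIso (.of R)).inv x) := rfl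
  rw [h3]
  have h4 : (Spec.map (CommRingCat.ofHom f) ≫ a).appLE (a ''ᵁ ⊤) ⊤
      (((Spec.map (CommRingCat.ofHom f) ≫ a).preimage_image_eq ⊤).ge.trans
        ((Spec.map (CommRingCat.ofHom f) ≫ a).preimage_mono hle)) =
      a.appLE (a ''ᵁ ⊤) ⊤ (a.preimage_image_eq ⊤).ge ≫ (Spec.map (CommRingCat.ofHom f)).appLE ⊤ ⊤ le_rfl :=
    (Scheme.Hom.appLE_comp_appLE ..).symm
  rw [h4, ← Scheme.Hom.appIso_hom']
  change _ = (Spec.map (CommRingCat.ofHom f)).appLE ⊤ ⊤ le_rfl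
    ((a.appIso ⊤).hom ((a.appIso ⊤).inv ((Scheme.ΓSpecIso (.of R)).inv x)))
  have h5 : (a.appIso ⊤).hom ((a.appIso ⊤).inv ((Scheme.ΓSpecIso (.of R)).inv x)) =
      (Scheme.ΓSpecIso (.of R)).inv x := congr($((a.appIso ⊤).inv_hom_id) _)
  rw [h5]
  have h6 := Scheme.ΓSpecIso_inv_naturality (CommRingCat.ofHom f)
  have h7 : (Spec.map (CommRingCat.ofHom f)).appLE ⊤ ⊤ le_rfl =
      (Spec.map (CommRingCat.ofHom f)).appTop := Scheme.Hom.appLE_eq_app _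
  rw [h7]
  exact congr($h6 x)

end SpecCharts

/-! ### Sections of a vector bundle as vectors of rational functions. -/

namespace VectorBundle

variable {X : Scheme.{u}} {r : ℕ} (E : VectorBundle X r)

lemma subsingleton_of_genericPoint_notMem [IsIntegral X] {V : X.Opens} (hV : genericPoint X ∉ V) :
    Subsingleton Γ(X, V) ∧ Subsingleton Γ(E.sheaf, V) := by
  have : V = ⊥ := eq_bot_iff.2 fun x hx => hV (genericPoint_mem hx)
  subst this
  have h : Subsingleton Γ(X, ⊥) := inferInstance
  refine ⟨h, ⟨fun s t => ?_⟩⟩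
  rw [← one_smul Γ(X, ⊥) s, ← one_smul Γ(X, ⊥) t, Subsingleton.elim (1 : Γ(X, ⊥)) 0, zero_smul,
    zero_smul]

lemma eq_of_locally_eq {V : X.Opens} {s t : Γ(E.sheaf, V)}
    (h : ∀ x ∈ V, ∃ (W : X.Opens) (hW : W ≤ V), x ∈ W ∧ resSec E.sheaf hW s = resSec E.sheaf hW t) :
    s = t := by
  choose W hW hx hs using fun x : V => h x.1 x.2
  exact TopCat.Sheaf.eq_of_locally_eq' ⟨E.sheaf.presheaf, E.sheaf.isSheaf⟩ W V
    (fun x => homOfLE (hW x)) (fun x hxV => Opens.mem_iSup.2 ⟨⟨x, hxV⟩, hx _⟩) s t hs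

variable [IsIntegral X]

/-- An open set where the bundle is free. -/
def refOpen : X.Opens := (E.locallyFree (genericPoint X)).choose

lemma genericPoint_mem_refOpen : genericPoint X ∈ E.refOpen :=
  (E.locallyFree (genericPoint X)).choose_spec.1

/-- A frame of the bundle over the reference open set. -/
def refFrame : Fin r → Γ(E.sheaf, E.refOpen) :=
  (E.locallyFree (genericPoint X)).choose_spec.2.choose

lemma isFrame_refFrame : IsFrame E.sheaf E.refOpen E.refFrame :=
  (E.locallyFree (genericPoint X)).choose_spec.2.choose_spec

variable {V : X.Opens} (hV : genericPoint X ∈ V)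

/-- The coordinates of a section with respect to the reference frame. -/
def coords (s : Γ(E.sheaf, V)) : Fin r → X.functionField := fun i =>
  ratFun (U := V ⊓ E.refOpen) ⟨hV, E.genericPoint_mem_refOpen⟩
    (((E.isFrame_refFrame _ inf_le_right).2 (resSec E.sheaf inf_le_left s)).choose i)

variable {E hV} in
lemma coords_eq {s : Γ(E.sheaf, V)} {W : X.Opens} (h : W ≤ V) (h' : W ≤ E.refOpen)
    (hW : genericPoint X ∈ W) {c : Fin r → Γ(X, W)}
    (hc : resSec E.sheaf h s = ∑ i, c i • resSec E.sheaf h' (E.refFrame i)) :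
    E.coords hV s = fun i => ratFun hW (c i) := by
  have h1 := ((E.isFrame_refFrame (V ⊓ E.refOpen) inf_le_right).2
    (resSec E.sheaf inf_le_left s)).choose_spec
  have h2 := congrArg (resSec E.sheaf (le_inf h h')) h1
  simp only [map_sum, map_smulₛₗ, resSec_resSec] at h2
  rw [hc] at h2
  have h3 := (E.isFrame_refFrame W h').1 h2
  ext i
  rw [← congrFun h3 i, ratFun_resFun]
  rfl

variable {E} in
lemma exists_coords_eq (s : Γ(E.sheaf, V)) :
    ∃ (W : X.Opens) (_ : W = V ⊓ E.refOpen) (h : W ≤ V) (h' : W ≤ E.refOpen)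
      (hW : genericPoint X ∈ W) (c : Fin r → Γ(X, W)),
      resSec E.sheaf h s = ∑ i, c i • resSec E.sheaf h' (E.refFrame i) ∧
      E.coords hV s = fun i => ratFun hW (c i) :=
  ⟨V ⊓ E.refOpen, rfl, inf_le_left, inf_le_right, ⟨hV, E.genericPoint_mem_refOpen⟩, _,
    ((E.isFrame_refFrame _ inf_le_right).2 (resSec E.sheaf inf_le_left s)).choose_spec.symm, rfl⟩

lemma coords_add (s t : Γ(E.sheaf, V)) : E.coords hV (s + t) = E.coords hV s + E.coords hV t := by
  obtain ⟨W, rfl, h, h', hW, c, hc, hs⟩ := exists_coords_eq hV s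
  obtain ⟨W', rfl, h1, h1', hW', c', hc', ht⟩ := exists_coords_eq hV t
  rw [hs, ht, coords_eq h h' hW (c := c + c')]
  · ext i; simp
  · rw [map_add, hc, hc']
    simp [add_smul, Finset.sum_add_distrib]

lemma coords_smul (a : Γ(X, V)) (s : Γ(E.sheaf, V)) :
    E.coords hV (a • s) = ratFun hV a • E.coords hV s := by
  obtain ⟨W, rfl, h, h', hW, c, hc, hs⟩ := exists_coords_eq hV s
  rw [hs, coords_eq h h' hW (c := fun i => resFun h a * c i)]
  · ext i
    simp [ratFun_resFun]
  · rw [map_smulₛₗ, hc, Finset.smul_sum]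
    simp [mul_smul]

lemma coords_zero : E.coords hV 0 = 0 := by
  have := E.coords_smul hV 0 0
  rwa [zero_smul, map_zero, zero_smul] at this

/-- The coordinates, as an additive map. -/
def coordsHom : Γ(E.sheaf, V) →+ (Fin r → X.functionField) where
  toFun := E.coords hV
  map_zero' := E.coords_zero hV
  map_add' := E.coords_add hV

lemma coords_sum {ι : Type*} (S : Finset ι) (s : ι → Γ(E.sheaf, V)) :
    E.coords hV (∑ i ∈ S, s i) = ∑ i ∈ S, E.coords hV (s i) :=
  map_sum (E.coordsHom hV) s S

lemma coords_resSec {W : X.Opens} (hW : genericPoint X ∈ W) (h : W ≤ V) (s : Γ(E.sheaf, V)) :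
    E.coords hW (resSec E.sheaf h s) = E.coords (h hW) s := by
  obtain ⟨W', rfl, h1, h1', hW', c, hc, hs⟩ := exists_coords_eq hW (resSec E.sheaf h s)
  rw [hs, coords_eq (h1.trans h) h1' hW' (c := c)]
  rw [← hc, resSec_resSec]

/-- A locally free sheaf on an integral scheme is torsion-free: if a section vanishes over the
reference open set, so do its coefficients in any local frame, because functions embed in the
function field. -/
lemma coords_injective : Function.Injective (E.coords hV) := by
  suffices ∀ s, E.coords hV s = 0 → s = 0 from
    (injective_iff_map_eq_zero (E.coordsHom hV)).2 this
  intro s hs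
  obtain ⟨W, rfl, h, h', hW, c, hc, hs'⟩ := exists_coords_eq hV s
  rw [hs] at hs'
  have hc0 : c = 0 := funext fun i => (ratFun_injective hW) ((congrFun hs' i).symm.trans
    (map_zero _).symm)
  subst hc0
  simp only [Pi.zero_apply, zero_smul, Finset.sum_const_zero] at hc
  refine E.eq_of_locally_eq fun x hx => ?_
  obtain ⟨U, hU, e, he⟩ := E.locallyFree x
  refine ⟨V ⊓ U, inf_le_left, ⟨hx, hU⟩, ?_⟩
  obtain ⟨d, hd⟩ := (he (V ⊓ U) inf_le_right).2 (resSec E.sheaf inf_le_left s)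
  rw [← hd, map_zero]
  have hη : genericPoint X ∈ (V ⊓ U) ⊓ E.refOpen :=
    ⟨⟨hV, genericPoint_mem hU⟩, E.genericPoint_mem_refOpen⟩
  have hd1 := congrArg (resSec E.sheaf (inf_le_left : (V ⊓ U) ⊓ E.refOpen ≤ V ⊓ U)) hd
  have hle : (V ⊓ U) ⊓ E.refOpen ≤ V ⊓ E.refOpen := inf_le_inf_right _ inf_le_left
  have hs1 := congrArg (resSec E.sheaf hle) hc
  rw [resSec_resSec] at hd1 hs1
  rw [hs1, map_zero] at hd1
  simp only [map_sum, map_smulₛₗ, resSec_resSec] at hd1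
  have hd2 := (he _ (inf_le_left.trans inf_le_right)).1 (a₂ := 0) (by simpa using hd1)
  have hd3 : d = 0 := funext fun i => by
    apply ratFun_injective (⟨hV, genericPoint_mem hU⟩ : genericPoint X ∈ V ⊓ U)
    have := congrArg (ratFun hη) (congrFun hd2 i)
    rw [ratFun_resFun] at this
    rw [this]
    simp
  simp [hd3]

/-- The vector `v` is the value of a section of the bundle near `x`. -/
def IsLocalSection (x : X) (v : Fin r → X.functionField) : Prop :=
  ∃ (V : X.Opens) (hx : x ∈ V) (s : Γ(E.sheaf, V)), E.coords (genericPoint_mem hx) s = v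

lemma isLocalSection_coords {x : X} (hx : x ∈ V) (s : Γ(E.sheaf, V)) :
    E.IsLocalSection x (E.coords hV s) := ⟨V, hx, s, rfl⟩

/-- Local sections with the same generic value agree on overlaps by injectivity of coordinates, so
they glue. -/
lemma exists_coords_eq_of_isLocalSection {v : Fin r → X.functionField}
    (hv : ∀ x ∈ V, E.IsLocalSection x v) : ∃ s, E.coords hV s = v := by
  have hv' : ∀ p : V, ∃ (W : X.Opens) (_ : W ≤ V) (hp : p.1 ∈ W) (s : Γ(E.sheaf, W)),
      E.coords (genericPoint_mem hp) s = v := by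
    intro p
    obtain ⟨W, hp, s, hs⟩ := hv p.1 p.2
    exact ⟨W ⊓ V, inf_le_right, ⟨hp, p.2⟩, resSec E.sheaf inf_le_left s,
      (E.coords_resSec _ _ _).trans hs⟩
  choose W hWV hpW s hs using hv'
  let F : TopCat.Sheaf Ab X := ⟨E.sheaf.presheaf, E.sheaf.isSheaf⟩
  have hcompat : TopCat.Presheaf.IsCompatible F.1 W s := by
    intro p q
    have hη : genericPoint X ∈ W p ⊓ W q := ⟨genericPoint_mem (hpW p), genericPoint_mem (hpW q)⟩
    apply E.coords_injective hη
    exact (E.coords_resSec hη inf_le_left _).trans ((hs p).trans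
      ((hs q).symm.trans (E.coords_resSec hη inf_le_right _).symm))
  obtain ⟨b, hb, -⟩ := F.existsUnique_gluing' W V (fun p => homOfLE (hWV p))
    (fun p hp => Opens.mem_iSup.2 ⟨⟨p, hp⟩, hpW _⟩) s hcompat
  refine ⟨b, ?_⟩
  let p : V := ⟨genericPoint X, hV⟩
  have := hs p
  rw [← hb p] at this
  rw [← this]
  exact (E.coords_resSec (hpW p) (hWV p) b).symm

lemma coords_sum_smul {W : X.Opens} (hW : genericPoint X ∈ W) (h : W ≤ V) (c : Fin r → Γ(X, W))
    (e : Fin r → Γ(E.sheaf, V)) :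
    E.coords hW (∑ i, c i • resSec E.sheaf h (e i)) =
      ∑ i, ratFun hW (c i) • E.coords (h hW) (e i) := by
  rw [coords_sum]
  simp only [coords_smul, coords_resSec]

variable {E hV} in
-- The frame generates the reference frame over the common open set, so its `r` coordinate vectors
-- span the `r`-dimensional space and are independent.
lemma linearIndependent_coords {e : Fin r → Γ(E.sheaf, V)} (he : IsFrame E.sheaf V e) :
    LinearIndependent X.functionField fun i => E.coords hV (e i) := by
  have hspan : ⊤ ≤ Submodule.span X.functionField (Set.range fun i => E.coords hV (e i)) := by
    have hη : genericPoint X ∈ V ⊓ E.refOpen := ⟨hV, E.genericPoint_mem_refOpen⟩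
    rw [← (Pi.basisFun X.functionField (Fin r)).span_eq, Submodule.span_le]
    rintro _ ⟨i, rfl⟩
    obtain ⟨c, hc⟩ := (he (V ⊓ E.refOpen) inf_le_left).2 (resSec E.sheaf inf_le_right (E.refFrame i))
    have h1 : E.coords hη (resSec E.sheaf inf_le_right (E.refFrame i)) = Pi.single i 1 := by
      rw [coords_resSec, coords_eq le_rfl le_rfl E.genericPoint_mem_refOpen (c := Pi.single i 1)]
      · ext j
        by_cases h : j = i
        · subst h; simp
        · simp [h]
      · rw [Finset.sum_eq_single i]
        · simp
        · intro j _ hj; simp [hj]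
        · simp
    rw [← hc, E.coords_sum_smul hη inf_le_left] at h1
    rw [Pi.basisFun_apply, ← h1]
    exact sum_mem fun j _ => Submodule.smul_mem _ _ (Submodule.subset_span ⟨j, rfl⟩)
  exact linearIndependent_of_top_le_span_of_card_eq_finrank hspan (by simp)

variable {E hV} in
lemma isLocalSection_iff {e : Fin r → Γ(E.sheaf, V)} (he : IsFrame E.sheaf V e) {x : X} (hx : x ∈ V)
    (c : Fin r → X.functionField) :
    E.IsLocalSection x (∑ i, c i • E.coords hV (e i)) ↔ ∀ i, c i ∈ localRing x := by
  constructor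
  · rintro ⟨W, hxW, s, hs⟩
    have hη : genericPoint X ∈ W ⊓ V := ⟨genericPoint_mem hxW, hV⟩
    obtain ⟨d, hd⟩ := (he (W ⊓ V) inf_le_right).2 (resSec E.sheaf inf_le_left s)
    have h1 := congrArg (E.coords hη) hd
    rw [E.coords_sum_smul hη inf_le_right, coords_resSec, hs, ← sub_eq_zero,
      ← Finset.sum_sub_distrib] at h1
    simp only [← sub_smul] at h1
    have h2 := Fintype.linearIndependent_iff.1 (linearIndependent_coords (hV := hV) he) _ h1
    intro i
    rw [← sub_eq_zero.1 (h2 i)]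
    exact ratFun_mem_localRing (U := W ⊓ V) ⟨hxW, hx⟩ hη _
  · intro hc
    have : ∀ i, ∃ (U : X.Opens) (hp : x ∈ U) (a : Γ(X, U)), ratFun (genericPoint_mem hp) a = c i :=
      fun i => (mem_localRing_iff x _).1 (hc i)
    choose U hU a ha using this
    let W : X.Opens := Finset.univ.inf U ⊓ V
    have hxW : x ∈ W := by
      refine ⟨?_, hx⟩
      rw [Opens.coe_finset_inf]
      simp [hU]
    have hWU : ∀ i, W ≤ U i := fun i => inf_le_left.trans (Finset.inf_le (Finset.mem_univ i))
    refine ⟨W, hxW, ∑ i, resFun (hWU i) (a i) • resSec E.sheaf inf_le_right (e i), ?_⟩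
    rw [E.coords_sum_smul _ inf_le_right]
    simp only [ratFun_resFun, ha]

variable {E hV} in
-- The coefficients of a section are unique over the function field, so the ones found at different
-- points coincide as rational functions; being regular at every point, they are functions on the
-- open set.
lemma isFrame_of_isLocalSection {e : Fin r → Γ(E.sheaf, V)}
    (hli : LinearIndependent X.functionField fun i => E.coords hV (e i))
    (h : ∀ x ∈ V, ∀ v, E.IsLocalSection x v → ∃ c : Fin r → X.functionField,
      (∀ i, c i ∈ localRing x) ∧ v = ∑ i, c i • E.coords hV (e i)) : IsFrame E.sheaf V e := by
  intro W hW
  by_cases hη : genericPoint X ∈ W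
  · constructor
    · intro c d hcd
      have h1 := congrArg (E.coords hη) hcd
      dsimp only at h1
      rw [E.coords_sum_smul, E.coords_sum_smul, ← sub_eq_zero, ← Finset.sum_sub_distrib] at h1
      simp only [← sub_smul] at h1
      have h2 := Fintype.linearIndependent_iff.1 hli _ h1
      exact funext fun i => ratFun_injective hη (sub_eq_zero.1 (h2 i))
    · intro s
      obtain ⟨c, -, hc⟩ := h _ hV _ (E.isLocalSection_coords hη hη s)
      have hc' : ∀ i, ∀ x ∈ W, c i ∈ localRing x := by
        intro i x hx
        obtain ⟨c', hc1, hc2⟩ := h x (hW hx) _ (E.isLocalSection_coords hη hx s)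
        rw [hc, ← sub_eq_zero, ← Finset.sum_sub_distrib] at hc2
        simp only [← sub_smul] at hc2
        have h2 := Fintype.linearIndependent_iff.1 hli _ hc2
        rw [sub_eq_zero.1 (h2 i)]
        exact hc1 i
      choose a ha using fun i => exists_ratFun_eq hη (hc' i)
      refine ⟨a, E.coords_injective hη ?_⟩
      dsimp only
      rw [E.coords_sum_smul, hc]
      simp only [ha]
  · obtain ⟨h1, h2⟩ := E.subsingleton_of_genericPoint_notMem hη
    exact ⟨fun _ _ _ => funext fun _ => h1.elim _ _, fun s => ⟨0, h2.elim _ _⟩⟩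

/-- Sections over a basic open subset of an affine open set extend after multiplication by a
function. -/
lemma exists_pow_smul_eq_coords (hVa : IsAffineOpen V) (g : Γ(X, V)) {v : Fin r → X.functionField}
    (hv : ∀ x ∈ X.basicOpen g, E.IsLocalSection x v) :
    ∃ (N : ℕ) (s : Γ(E.sheaf, V)), E.coords hV s = ratFun hV g ^ N • v := by
  have hopen : ∀ w, IsOpen {x | E.IsLocalSection x w} := by
    intro w
    rw [isOpen_iff_forall_mem_open]
    rintro x ⟨W, hx, s, hs⟩
    exact ⟨W, fun y hy => ⟨W, hy, s, hs⟩, W.2, hx⟩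
  have hsmul : ∀ (x : X) (a : X.functionField) w, a ∈ localRing x → E.IsLocalSection x w →
      E.IsLocalSection x (a • w) := by
    rintro x a w ha ⟨W, hx, s, rfl⟩
    obtain ⟨U, hxU, b, rfl⟩ := (mem_localRing_iff _ _).1 ha
    refine ⟨W ⊓ U, ⟨hx, hxU⟩, resFun (inf_le_right : W ⊓ U ≤ U) b •
      resSec E.sheaf (inf_le_left : W ⊓ U ≤ W) s, ?_⟩
    rw [coords_smul, coords_resSec, ratFun_resFun]
  have hmono : ∀ {N M : ℕ} {x : X}, x ∈ V → N ≤ M → E.IsLocalSection x (ratFun hV g ^ N • v) →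
      E.IsLocalSection x (ratFun hV g ^ M • v) := by
    intro N M x hx hNM h
    rw [← Nat.sub_add_cancel hNM, pow_add, mul_smul]
    refine hsmul x _ _ ?_ h
    rw [← map_pow]
    exact ratFun_mem_localRing hx hV _
  suffices ∃ N, ∀ x ∈ V, E.IsLocalSection x (ratFun hV g ^ N • v) by
    obtain ⟨N, hN⟩ := this
    exact ⟨N, E.exists_coords_eq_of_isLocalSection hV hN⟩
  have hcpt : IsCompact (V : Set X) := hVa.isCompact
  -- Near each point some power of `g` suffices. The open sets where the `N`th power works increase
  -- with `N`, so by compactness a single exponent works on all of `V`.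
  have hcov : (V : Set X) ⊆ ⋃ N : ℕ, {x | x ∈ V ∧ E.IsLocalSection x (ratFun hV g ^ N • v)} := by
    intro x hx
    obtain ⟨U, hxU, e, he⟩ := E.locallyFree x
    obtain ⟨h, hhU, hxh⟩ := hVa.exists_basicOpen_le ⟨x, hxU⟩ hx
    have he' := he.res hhU
    have hηh : genericPoint X ∈ X.basicOpen h := genericPoint_mem hxh
    obtain ⟨c, hc⟩ : ∃ c : Fin r → X.functionField,
        ∑ i, c i • E.coords hηh (resSec E.sheaf hhU (e i)) = v := by
      have := (linearIndependent_coords (hV := hηh) he').span_eq_top_of_card_eq_finrank' (by simp)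
      exact (Submodule.mem_span_range_iff_exists_fun _).1 (this ▸ Submodule.mem_top)
    -- The coefficients in a frame over the basic open set of `h` are regular where both `g` and `h`
    -- are invertible, so a power of the product clears their denominators.
    have key : ∀ i, ∃ N : ℕ, ∃ a : Γ(X, V), c i * ratFun hV (g * h) ^ N = ratFun hV a := by
      intro i
      refine ((affineChart hVa hV).forall_mem_iff (g * h) (c i)).1 fun q hq => ?_
      have h1 := (fromSpec_mem_basicOpen_iff hVa q (g * h)).2 hq
      rw [Scheme.basicOpen_mul] at h1
      have h2 := hv _ h1.1
      rw [← hc] at h2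
      exact (isLocalSection_iff he' h1.2 c).1 h2 i
    choose N a ha using key
    let M := Finset.univ.sup N
    refine Set.mem_iUnion.2 ⟨M, hx, ?_⟩
    rw [← hc, Finset.smul_sum]
    simp only [← mul_smul]
    refine (isLocalSection_iff he' hxh _).2 fun i => ?_
    have h3 : ratFun hV g ^ M * c i = ratFun hV g ^ (M - N i) * (ratFun hV g ^ N i * c i) := by
      rw [← mul_assoc, ← pow_add, Nat.sub_add_cancel (Finset.le_sup (Finset.mem_univ i))]
    rw [h3]
    refine (localRing x).mul_mem ?_ ?_
    · rw [← map_pow]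
      exact ratFun_mem_localRing hx hV _
    -- Over the basic open set of `h` the power of `h` can be divided out again, and only the power
    -- of `g` remains.
    · have hu : IsUnit (resFun (X.basicOpen_le h) h) := RingedSpace.isUnit_res_basicOpen _ h
      obtain ⟨w, hw⟩ := hu
      have h4 : ratFun hV g ^ N i * c i =
          ratFun hηh (resFun (X.basicOpen_le h) (a i) * ((w⁻¹ : _ˣ) : Γ(X, X.basicOpen h)) ^ N i) := by
        have h5 : ratFun hηh ((w⁻¹ : _ˣ) : Γ(X, X.basicOpen h)) * ratFun hV h = 1 := by
          rw [← ratFun_resFun hηh (X.basicOpen_le h) h, ← hw, ← map_mul, Units.inv_mul, map_one]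
        rw [map_mul, ratFun_resFun, ← ha, map_mul, map_pow, mul_pow]
        calc _ = c i * (ratFun hV g ^ N i) * (ratFun hηh ((w⁻¹ : _ˣ) : Γ(X, X.basicOpen h)) *
              ratFun hV h) ^ N i := by rw [h5]; ring
          _ = _ := by rw [mul_pow]; ring
      rw [h4]
      exact ratFun_mem_localRing hxh hηh _
  obtain ⟨N, hN⟩ := hcpt.elim_directed_cover _
    (fun N => V.2.inter (hopen _)) hcov (by
      intro N M
      exact ⟨max N M, fun x hx => ⟨hx.1, hmono hx.1 (le_max_left _ _) hx.2⟩,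
        fun x hx => ⟨hx.1, hmono hx.1 (le_max_right _ _) hx.2⟩⟩)
  exact ⟨N, fun x hx => (hN hx).2⟩

end VectorBundle

/-! ### Supporting hyperplanes and the zero cone of a fan. -/

section Cones

variable {n : ℕ}

lemma continuous_sum_mul (v : Fin n → ℝ) : Continuous fun a : Fin n → ℝ => ∑ i, a i * v i := by
  fun_prop

/-- A strongly convex rational cone has a supporting hyperplane which meets it only at the origin. -/
lemma exists_pairing_pos (S : Finset (Fin n → ℤ))
    (hS : ∀ v ∈ PointedCone.hull ℝ ((fun w : Fin n → ℤ => fun i => (w i : ℝ)) '' S),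
      -v ∈ PointedCone.hull ℝ ((fun w : Fin n → ℤ => fun i => (w i : ℝ)) '' S) → v = 0) :
    ∃ u : Fin n → ℤ, ∀ v ∈ ((fun w : Fin n → ℤ => fun i => (w i : ℝ)) '' S), v ≠ 0 →
      0 < pairing u v := by
  set T := ((fun w : Fin n → ℤ => fun i => (w i : ℝ)) '' S) with hT
  set σ := PointedCone.hull ℝ T with hσ
  have hTfin : T.Finite := S.finite_toSet.image _
  have hGfin : (T \ {0}).Finite := hTfin.sdiff
  have hsmul : ∀ (a : ℝ), 0 ≤ a → ∀ v ∈ σ, a • v ∈ σ := fun a ha v hv =>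
    Submodule.smul_mem σ (⟨a, ha⟩ : {c : ℝ // 0 ≤ c}) hv
  have hconv : Convex ℝ {v | v ∈ σ ∧ v ≠ 0} := by
    -- If a convex combination were zero, strong convexity would make both terms vanish, hence both
    -- coefficients, contradicting that they add up to one.
    rintro x ⟨hx, hx0⟩ y ⟨hy, hy0⟩ a b ha hb hab
    refine ⟨add_mem (hsmul a ha x hx) (hsmul b hb y hy), fun h => ?_⟩
    have h1 : a • x = 0 := by
      refine hS _ (hsmul a ha x hx) ?_
      rw [neg_eq_of_add_eq_zero_right h]
      exact hsmul b hb y hy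
    have h2 : b • y = 0 := by rwa [h1, zero_add] at h
    have ha0 : a = 0 := (smul_eq_zero.1 h1).resolve_right hx0
    have hb0 : b = 0 := (smul_eq_zero.1 h2).resolve_right hy0
    rw [ha0, hb0] at hab
    norm_num at hab
  have h0 : (0 : Fin n → ℝ) ∉ convexHull ℝ (T \ {0}) := by
    intro h
    have : convexHull ℝ (T \ {0}) ⊆ {v | v ∈ σ ∧ v ≠ 0} :=
      convexHull_min (fun v hv => ⟨PointedCone.subset_hull hv.1, hv.2⟩) hconv
    exact (this h).2 rfl
  obtain ⟨f, b, hf0, hf⟩ := geometric_hahn_banach_point_closed (convex_convexHull ℝ _)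
    (hGfin.isCompact_convexHull (𝕜 := ℝ)).isClosed h0
  rw [map_zero] at hf0
  have hfsum : ∀ v, f v = ∑ i, f (Pi.single i 1) * v i := by
    intro v
    conv_lhs => rw [← Finset.univ_sum_single v, map_sum]
    refine Finset.sum_congr rfl fun i _ => ?_
    have : (Pi.single i (v i) : Fin n → ℝ) = v i • Pi.single i 1 := by
      rw [← Pi.single_smul', smul_eq_mul, mul_one]
    rw [this, map_smul, smul_eq_mul, mul_comm]
  -- Being positive on finitely many vectors is an open condition on a functional, so the real
  -- functional given by separation can be replaced by a rational one.
  let O : Set (Fin n → ℝ) := ⋂ v ∈ T \ {0}, {a | 0 < ∑ i, a i * v i}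
  have hO : IsOpen O := hGfin.isOpen_biInter fun v _ =>
    isOpen_lt continuous_const (continuous_sum_mul v)
  have hO' : O.Nonempty := ⟨fun i => f (Pi.single i (1 : ℝ)), Set.mem_iInter₂.2 fun v hv => by
    change 0 < ∑ i, f (Pi.single i (1 : ℝ)) * v i
    rw [← hfsum]
    exact hf0.trans (hf v (subset_convexHull ℝ _ hv))⟩
  have hdense : DenseRange (Pi.map fun (_ : Fin n) (q : ℚ) => (q : ℝ)) :=
    DenseRange.piMap fun _ => Rat.denseRange_cast
  obtain ⟨q, hq⟩ := hdense.exists_mem_open hO hO'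
  -- Multiplication by the product of all the denominators makes the functional integral and keeps
  -- the signs.
  refine ⟨fun i => (q i).num * ∏ j ∈ Finset.univ.erase i, ((q j).den : ℤ), fun v hv hv0 => ?_⟩
  have h1 : 0 < ∑ i, (q i : ℝ) * v i := Set.mem_iInter₂.1 hq v ⟨hv, hv0⟩
  have h2 : 0 < ∏ j, ((q j).den : ℝ) := Finset.prod_pos fun j _ => by
    exact_mod_cast (q j).den_pos
  have h3 : pairing (fun i => (q i).num * ∏ j ∈ Finset.univ.erase i, ((q j).den : ℤ)) v =
      (∏ j, ((q j).den : ℝ)) * ∑ i, (q i : ℝ) * v i := by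
    rw [Finset.mul_sum]
    change ∑ i, (((q i).num * ∏ j ∈ Finset.univ.erase i, ((q j).den : ℤ) : ℤ) : ℝ) * v i = _
    refine Finset.sum_congr rfl fun i _ => ?_
    rw [← Finset.mul_prod_erase _ (fun j => ((q j).den : ℝ)) (Finset.mem_univ i)]
    have h4 : ((q i).num : ℝ) = (q i : ℝ) * (q i).den := by
      have := Rat.mul_den_eq_num (q i)
      exact_mod_cast this.symm
    push_cast
    rw [h4]
    ring
  rw [h3]
  exact mul_pos h2 h1

/-- A functional which is positive on the nonzero generators is positive on every nonzero element of
the cone, by induction over nonnegative combinations. -/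
lemma Fan.exists_bot_face (Δ : Fan n) {σ : PointedCone ℝ (Fin n → ℝ)} (hσ : σ ∈ Δ.cones) :
    ∃ u ∈ dualMonoid σ, ∀ v, v ∈ (⊥ : PointedCone ℝ (Fin n → ℝ)) ↔ v ∈ σ ∧ pairing u v = 0 := by
  obtain ⟨S, hS⟩ := Δ.rational σ hσ
  obtain ⟨u, hu⟩ := exists_pairing_pos S (by rw [← hS]; exact Δ.stronglyConvex σ hσ)
  have key : ∀ v ∈ σ, v = 0 ∨ 0 < pairing u v := by
    intro v hv
    rw [hS] at hv
    induction hv using Submodule.span_induction with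
    | mem x hx =>
      by_cases h : x = 0
      · exact .inl h
      · exact .inr (hu x hx h)
    | zero => exact .inl rfl
    | add x y _ _ hx hy =>
      rcases hx with rfl | hx
      · simpa using hy
      · rcases hy with rfl | hy
        · simpa using Or.inr hx
        · right
          rw [map_add]
          exact add_pos hx hy
    | smul a x _ hx =>
      have h1 : a • x = (a : ℝ) • x := rfl
      rw [h1, map_smul]
      rcases hx with rfl | hx
      · simp
      · rcases a.2.eq_or_lt with ha | ha
        · left
          rw [← ha, zero_smul]
        · exact .inr (mul_pos ha hx)
  refine ⟨u, fun v hv => ?_, fun v => ?_⟩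
  · rcases key v hv with rfl | h
    · simp
    · exact h.le
  · rw [Submodule.mem_bot]
    constructor
    · rintro rfl
      exact ⟨zero_mem _, map_zero _⟩
    · rintro ⟨hv, h0⟩
      exact (key v hv).resolve_right h0.not_gt

/-- The zero cone of a fan. -/
def Fan.zeroCone (Δ : Fan n) : Δ.Cone :=
  ⟨⊥, by
    obtain ⟨σ, hσ⟩ := Δ.nonempty
    obtain ⟨u, hu, h⟩ := Δ.exists_bot_face hσ
    exact Δ.face_mem σ hσ _ ⟨u, hu, h⟩⟩

lemma Fan.zeroCone_le (Δ : Fan n) (σ : Δ.Cone) : Δ.zeroCone ≤ σ := bot_le (a := σ.1)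

lemma Fan.mem_dualMonoid_zeroCone (Δ : Fan n) (u : Fin n → ℤ) : u ∈ dualMonoid Δ.zeroCone.1 := by
  intro v hv
  rw [(Submodule.mem_bot _).1 hv, map_zero]

end Cones

/-! ### Integrality of the toric variety and its charts. -/

section ToricVarieties

variable {n : ℕ} (Δ : Fan n) (k : Type u) [Field k]

instance (σ : Δ.Cone) : IsDomain (Δ.CoordRing k σ) := by
  have : UniqueSums (dualMonoid σ.1) := UniqueSums.of_injective_addHom
    (dualMonoid σ.1).subtype.toAddHom Subtype.val_injective inferInstance
  have : NoZeroDivisors (Δ.CoordRing k σ) :=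
    inferInstanceAs (NoZeroDivisors (AddMonoidAlgebra k (dualMonoid σ.1)))
  have : Nontrivial (Δ.CoordRing k σ) :=
    inferInstanceAs (Nontrivial (AddMonoidAlgebra k (dualMonoid σ.1)))
  exact NoZeroDivisors.to_isDomain _

lemma Fan.chartι_comp {τ σ : Δ.Cone} (h : τ ≤ σ) :
    Δ.chartι k τ = Spec.map (CommRingCat.ofHom (coordMap k h).toRingHom) ≫ Δ.chartι k σ :=
  (colimit.w (Δ.chartFunctor k) (homOfLE h)).symm

lemma Fan.exists_chartι_eq (x : Δ.toricVariety k) : ∃ (σ : Δ.Cone) (y : _), Δ.chartι k σ y = x :=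
  Scheme.IsLocallyDirected.ι_jointly_surjective (Δ.chartFunctor k) x

/-- The coordinate rings are domains, and any two charts meet because both contain the chart of the
zero cone. -/
instance : IsIntegral (Δ.toricVariety k) :=
  have : Nonempty Δ.Cone := ⟨Δ.zeroCone⟩
  isIntegral_of_charts (fun σ => Δ.chartι k σ) (Δ.exists_chartι_eq k) fun σ τ => by
    let y : Spec (.of (Δ.CoordRing k Δ.zeroCone)) := Classical.arbitrary _
    refine ⟨Spec.map (CommRingCat.ofHom (Fan.coordMap k (Δ.zeroCone_le σ)).toRingHom) y,
      Spec.map (CommRingCat.ofHom (Fan.coordMap k (Δ.zeroCone_le τ)).toRingHom) y, ?_⟩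
    rw [← Scheme.Hom.comp_apply, ← Scheme.Hom.comp_apply, ← Δ.chartι_comp, ← Δ.chartι_comp]

lemma Fan.isAffineOpen_chart (σ : Δ.Cone) : IsAffineOpen (Δ.chart k σ) :=
  isAffineOpen_specRange (Δ.chartι k σ)

lemma Fan.genericPoint_mem_chart (σ : Δ.Cone) : genericPoint (Δ.toricVariety k) ∈ Δ.chart k σ :=
  genericPoint_mem_specRange (Δ.chartι k σ)

lemma Fan.coord_bijective (σ : Δ.Cone) : Function.Bijective (Δ.coord k σ) :=
  (specSection (Δ.chartι k σ)).bijective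

variable {Δ} in
lemma Fan.resFun_coord {τ σ : Δ.Cone} (h : τ ≤ σ) (a : Δ.CoordRing k σ) :
    resFun (Fan.chart_mono k h) (Δ.coord k σ a) = Δ.coord k τ (coordMap k h a) := by
  apply ratFun_injective (Δ.genericPoint_mem_chart k τ)
  rw [ratFun_resFun]
  exact (specRatFun_comp (Δ.chartι k σ) (coordMap k h).toRingHom (Δ.chartι k τ)
    (Δ.chartι_comp k h) a).symm

variable {Δ} in
lemma Fan.basicOpen_coord {τ σ : Δ.Cone} (h : τ ≤ σ) (u : dualMonoid σ.1)
    (hu : ∀ v, v ∈ τ.1 ↔ v ∈ σ.1 ∧ pairing u.1 v = 0) :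
    (Δ.toricVariety k).basicOpen (Δ.coord k σ (.single u 1)) = Δ.chart k τ := by
  have hr := Δ.range_chartFunctor_map k (homOfLE h) u hu
  ext x
  constructor
  · intro hx
    obtain ⟨q, rfl⟩ := exists_of_mem_specRange (Δ.chartι k σ) (Scheme.basicOpen_le _ _ hx)
    have h1 := (mem_basicOpen_specSection_iff (Δ.chartι k σ) q _).1 hx
    have h2 : q ∈ Set.range ((Δ.chartFunctor k).map (homOfLE h)) := by
      rw [hr]
      exact h1
    obtain ⟨y, rfl⟩ := h2
    refine ⟨y, trivial, ?_⟩
    rw [Δ.chartι_comp k h]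
    rfl
  · rintro ⟨y, -, rfl⟩
    rw [Δ.chartι_comp k h]
    refine (mem_basicOpen_specSection_iff (Δ.chartι k σ) _ _).2 ?_
    have h2 : (Δ.chartFunctor k).map (homOfLE h) y ∈
        Set.range ((Δ.chartFunctor k).map (homOfLE h)) := ⟨y, rfl⟩
    rw [hr] at h2
    exact h2

end ToricVarieties

/-! ### Independence of characters. -/

section Characters

variable {k : Type u} [Field k] {n : ℕ}

/-- On one coordinate of the torus, equality of two distinct characters would make all elements of
`kˣ` roots of unity of a fixed positive order, of which a field has only finitely many. -/
lemma character_injective [Infinite k] :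
    Function.Injective (character k : (Fin n → ℤ) → ((Fin n → kˣ) →* kˣ)) := by
  classical
  intro u u' h
  ext i
  by_contra hne
  have key : ∀ a : kˣ, a ^ (u i - u' i) = 1 := by
    intro a
    have h1 := DFunLike.congr_fun h (Pi.mulSingle i a)
    have h2 : ∀ w : Fin n → ℤ, character k w (Pi.mulSingle i a) = a ^ w i := by
      intro w
      change ∏ j, (Pi.mulSingle i a : Fin n → kˣ) j ^ w j = _
      rw [Finset.prod_eq_single i]
      · simp
      · intro j _ hj
        simp [hj]
      · simp
    rw [h2, h2] at h1
    rw [zpow_sub, h1, mul_inv_cancel]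
  have h1 : 0 < (u i - u' i).natAbs := Int.natAbs_pos.2 (sub_ne_zero.2 hne)
  have key' : ∀ a : kˣ, a ^ (u i - u' i).natAbs = 1 := by
    intro a
    rcases Int.natAbs_eq (u i - u' i) with h | h
    · rw [← zpow_natCast, ← h]
      exact key a
    · have := key a
      rw [h, zpow_neg, inv_eq_one, zpow_natCast] at this
      exact this
  have : NeZero (u i - u' i).natAbs := ⟨h1.ne'⟩
  have hfin : Finite (rootsOfUnity (u i - u' i).natAbs k) := inferInstance
  have hall : rootsOfUnity (u i - u' i).natAbs k = ⊤ :=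
    eq_top_iff.2 fun a _ => (mem_rootsOfUnity _ _).2 (key' a)
  rw [hall] at hfin
  have h2 : Finite kˣ := Finite.of_equiv _ Subgroup.topEquiv.toEquiv
  have h3 : Finite k := by
    have := Set.finite_range (fun a : kˣ => (a : k))
    have h4 : (Set.univ : Set k) ⊆ insert 0 (Set.range fun a : kˣ => (a : k)) := by
      intro a _
      by_cases ha : a = 0
      · exact .inl ha
      · exact .inr ⟨Units.mk0 a ha, rfl⟩
    exact Set.finite_univ_iff.1 ((this.insert 0).subset h4)
  exact not_finite k

/-- Linear functionals reduce the relation to scalar coefficients, where it contradicts the linear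
independence of distinct characters. -/
lemma eq_zero_of_sum_character_smul [Infinite k] {R V : Type*} [CommRing R] [AddCommGroup V]
    [Module R V] (κ : k →+* R) (c : (Fin n → ℤ) →₀ V)
    (h : ∀ t, (c.sum fun u x => κ (character k u t : k) • x) = 0) : c = 0 := by
  let : Module k V := Module.compHom V κ
  ext u
  refine (Module.forall_dual_apply_eq_zero_iff k _).1 fun φ => ?_
  have hli : LinearIndependent k fun (u : Fin n → ℤ) (t : Fin n → kˣ) => (character k u t : k) :=
    (linearIndependent_monoidHom (Fin n → kˣ) k).comp
      (fun u => (Units.coeHom k).comp (character k u)) fun u u' huu' =>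
        character_injective (MonoidHom.ext fun t => Units.ext (DFunLike.congr_fun huu' t))
  have h1 := linearIndependent_iff.1 hli (c.mapRange φ (map_zero φ)) (by
    ext t
    have h2 := congrArg φ (h t)
    rw [map_zero, Finsupp.sum, map_sum] at h2
    rw [Finsupp.linearCombination_apply, Finsupp.sum_mapRange_index (by simp), Finsupp.sum,
      Finset.sum_apply, Pi.zero_apply, ← h2]
    refine Finset.sum_congr rfl fun v _ => ?_
    rw [Pi.smul_apply, smul_eq_mul, mul_comm]
    exact (map_smul φ (character k v t : k) (c v)).symm)
  exact DFunLike.congr_fun h1 u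

end Characters

/-! ### Weight decomposition of sections. -/

section Weights

variable {k : Type u} [Field k] {n : ℕ} {Δ : Fan n} {r : ℕ} (E : ToricVectorBundle k Δ r)
  (σ : Δ.Cone)

variable (Δ k) in
/-- The constants in the coordinate ring of a chart. -/
def Fan.const : k →+* Γ(Δ.toricVariety k, Δ.chart k σ) :=
  (Δ.coord k σ).comp AddMonoidAlgebra.singleZeroRingHom

namespace ToricVectorBundle

/-- The sections of weight `u` over a chart. -/
def IsWeight (u : Fin n → ℤ) (s : Γ(E.sheaf, Δ.chart k σ)) : Prop :=
  ∀ t, E.act σ t s = Δ.const k σ (character k u t : k) • s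

variable {E σ}

lemma act_const_smul (t : Fin n → kˣ) (a : k) (s : Γ(E.sheaf, Δ.chart k σ)) :
    E.act σ t (Δ.const k σ a • s) = Δ.const k σ a • E.act σ t s := by
  have := E.act_smul σ t 0 a s
  have h : character k (0 : Fin n → ℤ) t = 1 := by simp [character]
  rw [ZeroMemClass.coe_zero, h, inv_one, Units.val_one, one_mul] at this
  exact this

lemma character_add (u v : Fin n → ℤ) (t : Fin n → kˣ) :
    character k (u + v) t = character k u t * character k v t := by
  simp [character, zpow_add, Finset.prod_mul_distrib]

/-- The torus acts on `χ^v` by the inverse of the character, so multiplication by `χ^v` lowers the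
weight by `v`. -/
lemma IsWeight.coord_smul {w u : Fin n → ℤ} {s : Γ(E.sheaf, Δ.chart k σ)} (hs : E.IsWeight σ w s)
    (v : dualMonoid σ.1) (hv : u + v.1 = w) (a : k) :
    E.IsWeight σ u (Δ.coord k σ (.single v a) • s) := by
  intro t
  rw [E.act_smul, hs t, smul_smul, smul_smul]
  congr 1
  change _ * Δ.coord k σ (.single 0 _) = Δ.coord k σ (.single 0 _) * _
  rw [← map_mul, ← map_mul, AddMonoidAlgebra.single_mul_single, AddMonoidAlgebra.single_mul_single,
    add_zero, zero_add]
  congr 2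
  rw [← hv, character_add, Units.val_mul]
  have := (character k v.1 t).inv_mul
  linear_combination (a * (character k u t : k)) * this

lemma IsWeight.resSec {τ : Δ.Cone} (h : τ ≤ σ) {u : Fin n → ℤ} {s : Γ(E.sheaf, Δ.chart k σ)}
    (hs : E.IsWeight σ u s) : E.IsWeight τ u (resSec E.sheaf (Fan.chart_mono k h) s) := by
  intro t
  rw [E.act_res h, hs t, map_smulₛₗ]
  congr 1
  change resFun _ (Δ.coord k σ _) = Δ.coord k τ _
  rw [Fan.resFun_coord k h]
  congr 1
  exact Fan.coordMap_single h 0 _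

variable [Infinite k]

lemma eq_zero_of_isWeight {c : (Fin n → ℤ) →₀ Γ(E.sheaf, Δ.chart k σ)}
    (hc : ∀ u, E.IsWeight σ u (c u)) (h : (c.sum fun _ x => x) = 0) : c = 0 := by
  refine eq_zero_of_sum_character_smul (Δ.const k σ) c fun t => ?_
  have := congrArg (E.act σ t) h
  rw [map_zero, Finsupp.sum, map_sum] at this
  rw [← this]
  exact Finset.sum_congr rfl fun u _ => (hc u t).symm

/-- The coefficients of the Laurent polynomial describing the orbit of `s` are weight vectors, by
comparison of coefficients in `t' · (t · s) = (t' t) · s`. -/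
lemma exists_isWeight_sum_eq (s : Γ(E.sheaf, Δ.chart k σ)) :
    ∃ c : (Fin n → ℤ) →₀ Γ(E.sheaf, Δ.chart k σ), (∀ u, E.IsWeight σ u (c u)) ∧
      (c.sum fun _ x => x) = s := by
  obtain ⟨c, hc⟩ := E.act_algebraic σ s
  have hc' : ∀ t, E.act σ t s = c.sum fun u x => Δ.const k σ (character k u t : k) • x := hc
  refine ⟨c, fun u t' => ?_, ?_⟩
  · have h0 : ∀ u, (0 : Γ(E.sheaf, Δ.chart k σ)) =
        E.act σ t' 0 - Δ.const k σ (character k u t' : k) • 0 := by simp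
    -- The defect of each coefficient from being a weight vector for `t'`; these defects satisfy a
    -- relation among characters of `t`, so they vanish.
    let d : (Fin n → ℤ) →₀ Γ(E.sheaf, Δ.chart k σ) := Finsupp.onFinset c.support
      (fun u => E.act σ t' (c u) - Δ.const k σ (character k u t' : k) • c u) (by
        intro u hu
        rw [Finsupp.mem_support_iff]
        intro h
        rw [h, ← h0] at hu
        exact hu rfl)
    have hd : d = 0 := by
      refine eq_zero_of_sum_character_smul (Δ.const k σ) d fun t => ?_
      rw [Finsupp.onFinset_sum _ (fun u => smul_zero _)]
      simp only [smul_sub, Finset.sum_sub_distrib]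
      rw [sub_eq_zero]
      have h1 : E.act σ t' (E.act σ t s) = E.act σ (t' * t) s := by
        rw [map_mul]; rfl
      rw [hc', hc', Finsupp.sum, map_sum] at h1
      simp only [act_const_smul] at h1
      rw [h1, Finsupp.sum]
      refine Finset.sum_congr rfl fun u _ => ?_
      rw [map_mul, Units.val_mul, map_mul, mul_smul, smul_comm]
    have := DFunLike.congr_fun hd u
    exact sub_eq_zero.1 this
  · have := hc' 1
    rw [map_one] at this
    simp only [map_one, Units.val_one, one_smul] at this
    exact this.symm

/-- The components of a section in the spaces of weight vectors. -/
def weights (s : Γ(E.sheaf, Δ.chart k σ)) : (Fin n → ℤ) →₀ Γ(E.sheaf, Δ.chart k σ) :=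
  (exists_isWeight_sum_eq s).choose

lemma isWeight_weights (s : Γ(E.sheaf, Δ.chart k σ)) (u : Fin n → ℤ) :
    E.IsWeight σ u (weights s u) := (exists_isWeight_sum_eq s).choose_spec.1 u

lemma sum_weights (s : Γ(E.sheaf, Δ.chart k σ)) : ((weights s).sum fun _ x => x) = s :=
  (exists_isWeight_sum_eq s).choose_spec.2

lemma weights_eq {c : (Fin n → ℤ) →₀ Γ(E.sheaf, Δ.chart k σ)}
    (hc : ∀ u, E.IsWeight σ u (c u)) {s} (h : (c.sum fun _ x => x) = s) : weights s = c := by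
  rw [← sub_eq_zero]
  refine eq_zero_of_isWeight (fun u t => ?_) ?_
  · rw [Finsupp.sub_apply, map_sub, isWeight_weights s u t, hc u t, smul_sub]
  · rw [Finsupp.sum_sub_index (fun _ _ _ => rfl), sum_weights, h, sub_self]

lemma weights_add (s s' : Γ(E.sheaf, Δ.chart k σ)) :
    weights (s + s') = weights s + weights s' := by
  refine weights_eq (fun u t => ?_) ?_
  · rw [Finsupp.add_apply, map_add, isWeight_weights s u t, isWeight_weights s' u t, smul_add]
  · rw [Finsupp.sum_add_index' (fun _ => rfl) (fun _ _ _ => rfl), sum_weights, sum_weights]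

lemma IsWeight.weights_eq {u : Fin n → ℤ} {s : Γ(E.sheaf, Δ.chart k σ)} (hs : E.IsWeight σ u s) :
    weights s = Finsupp.single u s := by
  classical
  refine ToricVectorBundle.weights_eq (fun v => ?_) (Finsupp.sum_single_index rfl)
  rw [Finsupp.single_apply]
  split_ifs with h
  · exact h ▸ hs
  · intro t
    rw [map_zero, smul_zero]

open Classical in
variable (σ) in
/-- The term of degree `d` of an element of the coordinate ring. -/
def coordPart (d : Fin n → ℤ) (a : Δ.CoordRing k σ) : Δ.CoordRing k σ :=
  if h : d ∈ dualMonoid σ.1 then .single ⟨d, h⟩ (a.coeff ⟨d, h⟩) else 0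

/-- The term of degree `v` of the function contributes to weight `w - v`; weight `u` therefore picks
out degree `w - u`. -/
lemma IsWeight.weights_coord_smul {w : Fin n → ℤ} {s : Γ(E.sheaf, Δ.chart k σ)}
    (hs : E.IsWeight σ w s) (a : Δ.CoordRing k σ) (u : Fin n → ℤ) :
    weights (Δ.coord k σ a • s) u = Δ.coord k σ (coordPart σ (w - u) a) • s := by
  classical
  induction a using AddMonoidAlgebra.induction_linear with
  | zero =>
    have h1 : weights (0 : Γ(E.sheaf, Δ.chart k σ)) = 0 := by
      have := weights_add (0 : Γ(E.sheaf, Δ.chart k σ)) 0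
      rw [add_zero] at this
      exact left_eq_add.1 this
    simp [coordPart, h1]
  | add x y hx hy =>
    rw [map_add, add_smul, weights_add, Finsupp.add_apply, hx, hy, ← add_smul, ← map_add]
    congr 2
    unfold coordPart
    split_ifs
    · rw [← AddMonoidAlgebra.single_add]
      rfl
    · simp
  | single v a =>
    rw [(hs.coord_smul v (sub_add_cancel w v.1) a).weights_eq, Finsupp.single_apply]
    by_cases h : w - v.1 = u
    · have h1 : w - u = v.1 := by rw [← h]; abel
      rw [if_pos h, coordPart, dif_pos (h1 ▸ v.2)]
      have h2 : (⟨w - u, h1 ▸ v.2⟩ : dualMonoid σ.1) = v := Subtype.ext h1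
      rw [h2]
      simp
    · rw [if_neg h, coordPart]
      split_ifs with h1
      · have h2 : v ≠ ⟨w - u, h1⟩ := fun h3 => h (by rw [h3]; exact sub_sub_cancel w u)
        rw [show (AddMonoidAlgebra.single v a : Δ.CoordRing k σ).coeff ⟨w - u, h1⟩ = 0 by
          simp [h2]]
        simp
      · simp

end ToricVectorBundle

end Weights

/-! ### The distinguished point of a chart. -/

section DistinguishedPoint

variable {n : ℕ} (Δ : Fan n) (k : Type u) [Field k] (σ : Δ.Cone)

open Classical in
/-- The evaluation of functions at the distinguished point of the chart of a cone. -/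
def Fan.evalDistinguished : Δ.CoordRing k σ →ₐ[k] k :=
  AddMonoidAlgebra.lift k k (dualMonoid σ.1)
    -- The characters with both `v` and `-v` in the dual monoid are invertible on the chart and take
    -- the value `1`; all the others vanish at the point.
    { toFun := fun v => if -v.toAdd.1 ∈ dualMonoid σ.1 then 1 else 0
      map_one' := by simp [(dualMonoid σ.1).zero_mem]
      map_mul' := fun v w => by
        have h1 : -(v * w).toAdd.1 = -v.toAdd.1 + -w.toAdd.1 := by
          rw [toAdd_mul, AddSubmonoid.coe_add, neg_add]
        rw [h1]
        by_cases hv : -v.toAdd.1 ∈ dualMonoid σ.1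
        · by_cases hw : -w.toAdd.1 ∈ dualMonoid σ.1
          · rw [if_pos hv, if_pos hw, if_pos (add_mem hv hw), mul_one]
          · rw [if_neg hw, mul_zero, if_neg]
            intro h
            apply hw
            have := add_mem h v.toAdd.2
            rwa [show -v.toAdd.1 + -w.toAdd.1 + v.toAdd.1 = -w.toAdd.1 by abel] at this
        · rw [if_neg hv, zero_mul, if_neg]
          intro h
          apply hv
          have := add_mem h w.toAdd.2
          rwa [show -v.toAdd.1 + -w.toAdd.1 + w.toAdd.1 = -v.toAdd.1 by abel] at this }

/-- Only the terms with invertible character contribute to the value at the distinguished point. -/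
lemma Fan.exists_coeff_ne_zero {a : Δ.CoordRing k σ} (ha : Δ.evalDistinguished k σ a ≠ 0) :
    ∃ v : dualMonoid σ.1, -v.1 ∈ dualMonoid σ.1 ∧ a.coeff v ≠ 0 := by
  classical
  by_contra! h
  apply ha
  rw [Fan.evalDistinguished, AddMonoidAlgebra.lift_apply]
  refine Finset.sum_eq_zero fun v hv => ?_
  have : -v.1 ∉ dualMonoid σ.1 := fun hv' => (Finsupp.mem_support_iff.1 hv) (h v hv')
  change _ • (if -v.1 ∈ dualMonoid σ.1 then (1 : k) else 0) = 0
  rw [if_neg this, smul_zero]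

/-- The coordinate ring of a chart is the ring of functions on the chart. -/
def Fan.coordEquiv : Δ.CoordRing k σ ≃+* Γ(Δ.toricVariety k, Δ.chart k σ) :=
  specSection (Δ.chartι k σ)

/-- The distinguished point of the chart of a cone. -/
def Fan.distinguished : PrimeSpectrum Γ(Δ.toricVariety k, Δ.chart k σ) :=
  ⟨RingHom.ker ((Δ.evalDistinguished k σ).toRingHom.comp (Δ.coordEquiv k σ).symm.toRingHom),
    RingHom.ker_isPrime _⟩

lemma Fan.exists_of_notMem_distinguished {b : Γ(Δ.toricVariety k, Δ.chart k σ)}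
    (hb : b ∉ (Δ.distinguished k σ).asIdeal) :
    ∃ a : Δ.CoordRing k σ, Δ.coord k σ a = b ∧
      ∃ v : dualMonoid σ.1, -v.1 ∈ dualMonoid σ.1 ∧ a.coeff v ≠ 0 :=
  ⟨(Δ.coordEquiv k σ).symm b, (Δ.coordEquiv k σ).apply_symm_apply b,
    Δ.exists_coeff_ne_zero k σ hb⟩

end DistinguishedPoint

namespace LocalChart

variable {K P : Type*} [Field K] {O : P → Subring K} {S : Type*} [CommRing S] (C : LocalChart O S)

/-- The regular functions at a point of a chart which vanish at that point. -/
def vanishing (q : PrimeSpectrum S) : AddSubgroup K where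
  carrier := {z | ∃ a b, a ∈ q.asIdeal ∧ b ∉ q.asIdeal ∧ z * C.hom b = C.hom a}
  zero_mem' := ⟨0, 1, zero_mem _, fun h => q.2.ne_top ((Ideal.eq_top_iff_one _).2 h), by simp⟩
  add_mem' := by
    rintro z z' ⟨a, b, ha, hb, h⟩ ⟨a', b', ha', hb', h'⟩
    refine ⟨a * b' + a' * b, b * b', add_mem (Ideal.mul_mem_right _ _ ha)
      (Ideal.mul_mem_right _ _ ha'), fun hbb => (q.2.mem_or_mem hbb).elim hb hb', ?_⟩
    rw [map_add, map_mul, map_mul, map_mul, ← h, ← h']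
    ring
  neg_mem' := by
    rintro z ⟨a, b, ha, hb, h⟩
    exact ⟨-a, b, neg_mem ha, hb, by rw [map_neg, ← h, neg_mul]⟩

variable {C}

lemma inv_mem_of_notMem_vanishing {q : PrimeSpectrum S} {z : K} (hz : z ∈ O (C.pt q))
    (h : z ∉ C.vanishing q) : z ≠ 0 ∧ z⁻¹ ∈ O (C.pt q) := by
  have h0 : z ≠ 0 := by
    rintro rfl
    exact h (zero_mem _)
  obtain ⟨a, b, hb, hab⟩ := (C.mem_iff q z).1 hz
  have ha : a ∉ q.asIdeal := fun ha => h ⟨a, b, ha, hb, hab⟩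
  refine ⟨h0, (C.mem_iff q _).2 ⟨b, a, ha, ?_⟩⟩
  rw [← hab, ← mul_assoc, inv_mul_cancel₀ h0, one_mul]

lemma notMem_vanishing_of_mul_eq_one {q : PrimeSpectrum S} {z w : K} (hw : w ∈ O (C.pt q))
    (h : w * z = 1) : z ∉ C.vanishing q := by
  rintro ⟨a, b, ha, hb, hab⟩
  obtain ⟨c, d, hd, hcd⟩ := (C.mem_iff q w).1 hw
  have h1 : C.hom (b * d) = C.hom (a * c) := by
    rw [map_mul, map_mul, ← hab, ← hcd]
    linear_combination - (C.hom b * C.hom d) * h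
  have h2 := C.injective h1
  exact (q.2.mem_or_mem (h2 ▸ Ideal.mul_mem_right c _ ha)).elim hb hd

end LocalChart

/-! ### Local coordinates at a point and frames from spanning sections. -/

namespace VectorBundle

variable {X : Scheme.{u}} [IsIntegral X] {r : ℕ} (E : VectorBundle X r) {V : X.Opens}
  (hVa : IsAffineOpen V) (hV : genericPoint X ∈ V)

/-- The coordinates with respect to a local frame at a point of an affine open set. -/
lemma exists_localCoords (q : PrimeSpectrum Γ(X, V)) :
    ∃ c : (Fin r → X.functionField) →ₗ[X.functionField] (Fin r → X.functionField),
      Function.Injective c ∧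
      (∀ s : Γ(E.sheaf, V), ∀ i, c (E.coords hV s) i ∈ localRing (hVa.fromSpec q)) ∧
      ∀ i, ∃ g ∉ q.asIdeal, ∃ s : Γ(E.sheaf, V), c (E.coords hV s) = Pi.single i (ratFun hV g) := by
  obtain ⟨U, hxU, e, he⟩ := E.locallyFree (hVa.fromSpec q)
  obtain ⟨g, hgU, hxg⟩ := hVa.exists_basicOpen_le ⟨_, hxU⟩ (fromSpec_mem hVa q)
  have he' := he.res hgU
  have hη : genericPoint X ∈ X.basicOpen g := genericPoint_mem hxg
  have hli := linearIndependent_coords (hV := hη) he'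
  let b := Module.Basis.mk hli (hli.span_eq_top_of_card_eq_finrank' (by simp)).ge
  have hb : ∀ i, b i = E.coords hη (resSec E.sheaf hgU (e i)) := fun i =>
    Module.Basis.mk_apply ..
  refine ⟨b.equivFun.toLinearMap, b.equivFun.injective, fun s => ?_, fun i => ?_⟩
  · refine (isLocalSection_iff (hV := hη) he' hxg _).1 ?_
    simp only [← hb]
    change E.IsLocalSection _ (∑ i, b.equivFun (E.coords hV s) i • b i)
    rw [b.sum_equivFun]
    exact E.isLocalSection_coords hV (fromSpec_mem hVa q) s
  -- A member of the local frame extends to the affine open set after multiplication by a power of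
  -- `g`, which does not vanish at the point.
  · obtain ⟨N, s, hs⟩ := E.exists_pow_smul_eq_coords hV hVa g (v := b i) fun x hx => by
      rw [hb]
      exact E.isLocalSection_coords hη hx _
    refine ⟨g ^ N, fun h => (fromSpec_mem_basicOpen_iff hVa q g).1 hxg (q.2.mem_of_pow_mem _ h),
      s, ?_⟩
    rw [hs, map_smul, map_pow]
    change _ • b.equivFun (b i) = _
    ext j
    rw [Pi.smul_apply, b.equivFun_self]
    simp [Pi.single_apply, eq_comm]

variable {E hV} in
-- A local section extends over the affine open set after multiplication by a function invertible at
-- the point, so generation by global sections implies generation at each point.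
lemma isFrame_of_spanning (hVa : IsAffineOpen V) {e : Fin r → Γ(E.sheaf, V)}
    (hli : LinearIndependent X.functionField fun i => E.coords hV (e i))
    (h : ∀ s : Γ(E.sheaf, V), ∃ c : Fin r → Γ(X, V), s = ∑ i, c i • e i) :
    IsFrame E.sheaf V e := by
  refine isFrame_of_isLocalSection hli fun x hx v hv => ?_
  obtain ⟨W, hxW, s, rfl⟩ := hv
  obtain ⟨g, hgW, hxg⟩ := hVa.exists_basicOpen_le ⟨_, hxW⟩ hx
  obtain ⟨N, t, ht⟩ := E.exists_pow_smul_eq_coords hV hVa g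
    (v := E.coords (genericPoint_mem hxW) s) fun y hy => E.isLocalSection_coords _ (hgW hy) s
  obtain ⟨c, hc⟩ := h t
  obtain ⟨q, rfl⟩ := exists_fromSpec_eq hVa hx
  have hg : g ∉ q.asIdeal := (fromSpec_mem_basicOpen_iff hVa q g).1 hxg
  have hg0 : ratFun hV g ^ N ≠ 0 := by
    refine pow_ne_zero _ ((map_ne_zero_iff _ (ratFun_injective hV)).2 ?_)
    rintro rfl
    exact hg (zero_mem _)
  refine ⟨fun i => ratFun hV (c i) * (ratFun hV g ^ N)⁻¹, fun i => ?_, ?_⟩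
  · refine ((affineChart hVa hV).mem_iff q _).2 ⟨c i, g ^ N,
      fun h => hg (q.2.mem_of_pow_mem _ h), ?_⟩
    change _ * ratFun hV (g ^ N) = ratFun hV (c i)
    rw [map_pow, mul_assoc, inv_mul_cancel₀ hg0, mul_one]
  · have h1 : E.coords hV t = ∑ i, ratFun hV (c i) • E.coords hV (e i) := by
      rw [hc, coords_sum]
      simp only [coords_smul]
    have h2 : E.coords (genericPoint_mem hxW) s = (ratFun hV g ^ N)⁻¹ • E.coords hV t := by
      rw [ht, smul_smul, inv_mul_cancel₀ hg0, one_smul]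
    rw [h2, h1, Finset.smul_sum]
    simp only [smul_smul, mul_comm]

end VectorBundle

/-! ### Frames of weight vectors. -/

section EigenFrames

variable {k : Type u} [Field k] {n : ℕ} {Δ : Fan n}

/-- The determinant of two vectors. -/
def det₂ {K : Type*} [Field K] (v w : Fin 2 → K) : K := v 0 * w 1 - v 1 * w 0

lemma linearIndependent_iff_det₂_ne_zero {K : Type*} [Field K] {v : Fin 2 → Fin 2 → K} :
    LinearIndependent K v ↔ det₂ (v 0) (v 1) ≠ 0 := by
  have h := Matrix.linearIndependent_rows_iff_isUnit (A := Matrix.of v)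
  rw [Matrix.isUnit_iff_isUnit_det, Matrix.det_fin_two, isUnit_iff_ne_zero] at h
  exact h

namespace ToricVectorBundle

variable {E : ToricVectorBundle k Δ 2} {σ : Δ.Cone}

variable (E σ) in
/-- The coordinates of the sections over a chart of a toric variety. -/
abbrev chartCoords : Γ(E.sheaf, Δ.chart k σ) → (Fin 2 → (Δ.toricVariety k).functionField) :=
  E.toVectorBundle.coords (Δ.genericPoint_mem_chart k σ)

variable [Infinite k]

/-- If all the weight components had image in the subgroup, so would their sum. -/
lemma exists_isWeight_notMem {V : Type*} [AddCommGroup V] (φ : Γ(E.sheaf, Δ.chart k σ) →+ V)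
    (H : AddSubgroup V) {s : Γ(E.sheaf, Δ.chart k σ)} (hs : φ s ∉ H) :
    ∃ u s', E.IsWeight σ u s' ∧ φ s' ∉ H := by
  by_contra! h
  apply hs
  rw [← sum_weights s, Finsupp.sum, map_sum]
  exact sum_mem fun u _ => h u _ (isWeight_weights s u)

/-- Weight vectors are chosen whose values form a basis of the fibre at the distinguished point,
detected by a determinant. Cramer's rule then expresses every section in terms of them after
multiplication by a function not vanishing at the point. -/
lemma exists_isWeight_smul_eq : ∃ (μ : Fin 2 → Fin n → ℤ) (s : Fin 2 → Γ(E.sheaf, Δ.chart k σ)),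
    (∀ i, E.IsWeight σ (μ i) (s i)) ∧
    LinearIndependent (Δ.toricVariety k).functionField (fun i => E.chartCoords σ (s i)) ∧
    ∀ m, ∃ b ∉ (Δ.distinguished k σ).asIdeal, ∃ a : Fin 2 → Γ(Δ.toricVariety k, Δ.chart k σ),
      b • m = ∑ i, a i • s i := by
  set hV := Δ.genericPoint_mem_chart k σ
  have hVa := Δ.isAffineOpen_chart k σ
  set q := Δ.distinguished k σ
  set C := affineChart hVa hV
  obtain ⟨c, hcinj, hc, hcs⟩ := E.toVectorBundle.exists_localCoords hVa hV q
  obtain ⟨g₀, hg₀, m₀, hm₀⟩ := hcs 0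
  obtain ⟨g₁, hg₁, m₁, hm₁⟩ := hcs 1
  let F : Γ(E.sheaf, Δ.chart k σ) →+ (Fin 2 → (Δ.toricVariety k).functionField) :=
    c.toAddMonoidHom.comp (E.toVectorBundle.coordsHom hV)
  have hF : ∀ s, F s = c (E.chartCoords σ s) := fun _ => rfl
  let φ : (Fin 2 → (Δ.toricVariety k).functionField) →
      Γ(E.sheaf, Δ.chart k σ) →+ (Δ.toricVariety k).functionField := fun w =>
    { toFun := fun s => det₂ (F s) w
      map_zero' := by simp [det₂]
      map_add' := fun s t => by simp only [det₂, map_add, Pi.add_apply]; ring }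
  let ψ : (Fin 2 → (Δ.toricVariety k).functionField) →
      Γ(E.sheaf, Δ.chart k σ) →+ (Δ.toricVariety k).functionField := fun w =>
    { toFun := fun s => det₂ w (F s)
      map_zero' := by simp [det₂]
      map_add' := fun s t => by simp only [det₂, map_add, Pi.add_apply]; ring }
  have h0 : φ (F m₁) m₀ ∉ C.vanishing q := by
    have h1 : φ (F m₁) m₀ = C.hom (g₀ * g₁) := by
      change det₂ (F m₀) (F m₁) = _
      rw [hF, hF, hm₀, hm₁, map_mul]
      simp [det₂]
      rfl
    have h2 : g₀ * g₁ ∉ q.asIdeal := fun h => (q.2.mem_or_mem h).elim hg₀ hg₁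
    have h3 : C.hom (g₀ * g₁) ≠ 0 := C.hom_ne_zero (by
      intro h
      rw [h] at h2
      exact h2 (zero_mem _))
    rw [h1]
    refine LocalChart.notMem_vanishing_of_mul_eq_one (w := (C.hom (g₀ * g₁))⁻¹) ?_
      (inv_mul_cancel₀ h3)
    exact (C.mem_iff q _).2 ⟨1, _, h2, by rw [inv_mul_cancel₀ h3, map_one]⟩
  -- The determinant is additive in each argument, so first one section and then the other can be
  -- replaced by a weight component without making it vanish at the point.
  obtain ⟨u₀, s₀, hs₀, h0'⟩ := exists_isWeight_notMem _ _ h0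
  have h1 : ψ (F s₀) m₁ ∉ C.vanishing q := h0'
  obtain ⟨u₁, s₁, hs₁, h1'⟩ := exists_isWeight_notMem _ _ h1
  have hdet : ∀ s t, det₂ (F s) (F t) ∈ localRing (hVa.fromSpec q) := fun s t =>
    sub_mem (mul_mem (hc s 0) (hc t 1)) (mul_mem (hc s 1) (hc t 0))
  obtain ⟨hD0, hD⟩ := LocalChart.inv_mem_of_notMem_vanishing (C := C) (hdet s₀ s₁) h1'
  set D := det₂ (F s₀) (F s₁) with hDdef
  refine ⟨![u₀, u₁], ![s₀, s₁], ?_, ?_, fun m => ?_⟩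
  · rw [Fin.forall_fin_two]
    exact ⟨hs₀, hs₁⟩
  · refine LinearIndependent.of_comp c ?_
    exact linearIndependent_iff_det₂_ne_zero.2 hD0
  · obtain ⟨a₀, b₀, hb₀, h₀⟩ := (C.mem_iff q _).1 (mul_mem (hdet m s₁) hD)
    obtain ⟨a₁, b₁, hb₁, h₁⟩ := (C.mem_iff q _).1 (mul_mem (hdet s₀ m) hD)
    refine ⟨b₀ * b₁, fun h => (q.2.mem_or_mem h).elim hb₀ hb₁, ![a₀ * b₁, a₁ * b₀], ?_⟩
    -- By Cramer's rule the coefficients lie in the local ring, since the inverse of the determinant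
    -- does.
    have hcramer : F m = (det₂ (F m) (F s₁) * D⁻¹) • F s₀ + (det₂ (F s₀) (F m) * D⁻¹) • F s₁ := by
      ext i
      rw [Pi.add_apply, Pi.smul_apply, Pi.smul_apply, smul_eq_mul, smul_eq_mul]
      have h2 : det₂ (F s₀) (F s₁) * D⁻¹ = 1 := mul_inv_cancel₀ hD0
      generalize D⁻¹ = z at h2 ⊢
      unfold det₂ at h2 ⊢
      fin_cases i
      · dsimp only [Fin.zero_eta, Fin.isValue]
        linear_combination (- F m 0) * h2
      · dsimp only [Fin.mk_one, Fin.isValue]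
        linear_combination (- F m 1) * h2
    apply E.toVectorBundle.coords_injective hV
    apply hcinj
    rw [Fin.sum_univ_two, VectorBundle.coords_add, VectorBundle.coords_smul,
      VectorBundle.coords_smul, VectorBundle.coords_smul, map_add, map_smul, map_smul, map_smul]
    change C.hom (b₀ * b₁) • F m = C.hom (a₀ * b₁) • F s₀ + C.hom (a₁ * b₀) • F s₁
    rw [hcramer, map_mul, map_mul, map_mul, ← h₀, ← h₁, smul_add, smul_smul, smul_smul]
    congr 2 <;> ring

/-- This is a graded form of Nakayama's lemma. A relation `b • m = ∑ a i • s i` near the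
distinguished point has `b` with a nonzero term in an invertible character; the matching weight
component is a relation where `m` is multiplied by a unit. -/
theorem exists_weightFrame : ∃ (μ : Fin 2 → Fin n → ℤ) (s : Fin 2 → Γ(E.sheaf, Δ.chart k σ)),
    (∀ i, E.IsWeight σ (μ i) (s i)) ∧ IsFrame E.sheaf (Δ.chart k σ) s := by
  obtain ⟨μ, s, hs, hli, hspan⟩ := exists_isWeight_smul_eq (E := E) (σ := σ)
  refine ⟨μ, s, hs, VectorBundle.isFrame_of_spanning (Δ.isAffineOpen_chart k σ) hli fun m => ?_⟩
  have key : ∀ u m, E.IsWeight σ u m →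
      m ∈ Submodule.span Γ(Δ.toricVariety k, Δ.chart k σ) (Set.range s) := by
    intro u m hm
    obtain ⟨b, hb, a, hba⟩ := hspan m
    obtain ⟨b, rfl, v, hv, hbv⟩ := Δ.exists_of_notMem_distinguished k σ hb
    choose a' ha' using fun i => (Δ.coord_bijective k σ).2 (a i)
    -- In weight `u - v` the left side retains just the term of degree `v` of `b`.
    have h1 := congrArg (fun m => weights m (u - v.1)) hba
    simp only [Fin.sum_univ_two, weights_add, Finsupp.add_apply, ← ha'] at h1
    rw [hm.weights_coord_smul, (hs 0).weights_coord_smul, (hs 1).weights_coord_smul,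
      sub_sub_cancel, coordPart, dif_pos v.2] at h1
    have h2 := congrArg (Δ.coord k σ (.single ⟨-v.1, hv⟩ (b.coeff v)⁻¹) • ·) h1
    have h3 : (AddMonoidAlgebra.single ⟨-v.1, hv⟩ (b.coeff v)⁻¹ : Δ.CoordRing k σ) *
        .single ⟨v.1, v.2⟩ (b.coeff ⟨v.1, v.2⟩) = 1 := by
      rw [AddMonoidAlgebra.single_mul_single, inv_mul_cancel₀ hbv, AddMonoidAlgebra.one_def]
      congr 1
      exact Subtype.ext (neg_add_cancel v.1)
    rw [smul_smul, ← map_mul, h3, map_one, one_smul] at h2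
    rw [h2]
    exact Submodule.smul_mem _ _ (add_mem (Submodule.smul_mem _ _ (Submodule.subset_span ⟨0, rfl⟩))
      (Submodule.smul_mem _ _ (Submodule.subset_span ⟨1, rfl⟩)))
  have hm : m ∈ Submodule.span Γ(Δ.toricVariety k, Δ.chart k σ) (Set.range s) := by
    rw [← sum_weights m]
    exact sum_mem fun u _ => key u _ (isWeight_weights m u)
  obtain ⟨c, hc⟩ := (Submodule.mem_span_range_iff_exists_fun _).1 hm
  exact ⟨c, hc.symm⟩

end ToricVectorBundle

end EigenFrames

/-! ### Invariant sections over the torus. -/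

section InvariantFrames

lemma det₂_smul_smul {K : Type*} [Field K] (a b : K) (v w : Fin 2 → K) :
    det₂ (a • v) (b • w) = a * b * det₂ v w := by
  simp only [det₂, Pi.smul_apply, smul_eq_mul]
  ring

variable {n : ℕ} (Δ : Fan n) (k : Type u) [Field k]

/-- The characters of the torus, as functions on the chart of the zero cone. -/
def Fan.torusMonomial : Multiplicative (Fin n → ℤ) →* Γ(Δ.toricVariety k, Δ.chart k Δ.zeroCone) where
  toFun u := Δ.coord k Δ.zeroCone (.single ⟨u.toAdd, Δ.mem_dualMonoid_zeroCone _⟩ 1)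
  map_one' := by
    rw [← map_one (Δ.coord k Δ.zeroCone)]
    rfl
  map_mul' u v := by
    rw [← map_mul, AddMonoidAlgebra.single_mul_single, mul_one]
    rfl

namespace ToricVectorBundle

variable {Δ k} [Infinite k] (E : ToricVectorBundle k Δ 2)

/-- The frames of weight vectors of a toric vector bundle of rank two, compared with a frame of
invariant sections over the torus. -/
theorem exists_invariantFrame : ∃ ε : Fin 2 → Γ(E.sheaf, Δ.chart k Δ.zeroCone),
    IsFrame E.sheaf (Δ.chart k Δ.zeroCone) ε ∧ ∀ σ : Δ.Cone,
    ∃ (μ : Fin 2 → Fin n → ℤ) (s : Fin 2 → Γ(E.sheaf, Δ.chart k σ)) (p : Fin 2 → k × k),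
      IsFrame E.sheaf (Δ.chart k σ) s ∧ (p 0).1 * (p 1).2 - (p 1).1 * (p 0).2 ≠ 0 ∧
      ∀ i, Δ.torusMonomial k (.ofAdd (μ i)) •
        resSec E.sheaf (Fan.chart_mono k (Δ.zeroCone_le σ)) (s i) =
          Δ.const k Δ.zeroCone (p i).1 • ε 0 + Δ.const k Δ.zeroCone (p i).2 • ε 1 := by
  obtain ⟨μ₀, s₀, hs₀, hfr₀⟩ := exists_weightFrame (E := E) (σ := Δ.zeroCone)
  -- All characters are invertible on the torus, so weight vectors can be moved to weight zero.
  set ε : Fin 2 → Γ(E.sheaf, Δ.chart k Δ.zeroCone) := fun i =>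
    Δ.torusMonomial k (.ofAdd (μ₀ i)) • s₀ i with hε
  have hV := Δ.genericPoint_mem_chart k Δ.zeroCone
  have hεw : ∀ i, E.IsWeight Δ.zeroCone 0 (ε i) := fun i =>
    (hs₀ i).coord_smul _ (zero_add _) 1
  have hinv : ∀ u : Fin n → ℤ, Δ.torusMonomial k (.ofAdd (-u)) * Δ.torusMonomial k (.ofAdd u) = 1 := by
    intro u
    rw [← map_mul, ← ofAdd_add, neg_add_cancel, ofAdd_zero, map_one]
  have hχ : ∀ u, ratFun hV (Δ.torusMonomial k u) ≠ 0 := by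
    intro u h
    have h1 := congrArg (ratFun hV) (hinv u.toAdd)
    rw [map_mul, ofAdd_toAdd, h, mul_zero, map_one] at h1
    exact zero_ne_one h1
  have hspan : ∀ m : Γ(E.sheaf, Δ.chart k Δ.zeroCone), ∃ a : Fin 2 → Δ.CoordRing k Δ.zeroCone,
      m = Δ.coord k Δ.zeroCone (a 0) • ε 0 + Δ.coord k Δ.zeroCone (a 1) • ε 1 := by
    intro m
    obtain ⟨c, hc⟩ := (hfr₀ _ le_rfl).2 m
    choose a ha using fun i => (Δ.coord_bijective k Δ.zeroCone).2
      (c i * Δ.torusMonomial k (.ofAdd (-μ₀ i)))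
    refine ⟨a, ?_⟩
    rw [ha, ha, hε, smul_smul, smul_smul, mul_assoc, mul_assoc, hinv, hinv, mul_one, mul_one, ← hc]
    simp only [resSec_self, Fin.sum_univ_two]
  -- The weight-zero component of an expression in invariant sections keeps only the constant terms
  -- of its coefficients.
  have hcoords : ∀ m : Γ(E.sheaf, Δ.chart k Δ.zeroCone), E.IsWeight Δ.zeroCone 0 m →
      ∃ p : k × k, m = Δ.const k Δ.zeroCone p.1 • ε 0 + Δ.const k Δ.zeroCone p.2 • ε 1 := by
    intro m hm
    obtain ⟨a, ha⟩ := hspan m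
    refine ⟨((a 0).coeff 0, (a 1).coeff 0), ?_⟩
    have h1 := congrArg (fun m => weights m 0) ha
    simp only [weights_add, Finsupp.add_apply] at h1
    rw [hm.weights_eq, Finsupp.single_eq_same, (hεw 0).weights_coord_smul,
      (hεw 1).weights_coord_smul] at h1
    have h2 : ∀ b : Δ.CoordRing k Δ.zeroCone, coordPart Δ.zeroCone (0 - 0) b =
        .single 0 (b.coeff 0) := by
      intro b
      simp only [sub_zero]
      rw [coordPart, dif_pos (zero_mem _)]
      rfl
    rw [h2, h2] at h1
    exact h1
  have hli := VectorBundle.linearIndependent_coords (hV := hV) hfr₀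
  have hframe : IsFrame E.sheaf (Δ.chart k Δ.zeroCone) ε := by
    refine VectorBundle.isFrame_of_spanning (Δ.isAffineOpen_chart k _) (hV := hV) ?_ fun m => ?_
    · have h1 := linearIndependent_iff_det₂_ne_zero.1 hli
      refine linearIndependent_iff_det₂_ne_zero.2 ?_
      simp only [hε, VectorBundle.coords_smul]
      rw [det₂_smul_smul]
      exact mul_ne_zero (mul_ne_zero (hχ _) (hχ _)) h1
    · obtain ⟨a, ha⟩ := hspan m
      exact ⟨fun i => Δ.coord k Δ.zeroCone (a i), by rw [Fin.sum_univ_two]; exact ha⟩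
  refine ⟨ε, hframe, fun σ => ?_⟩
  obtain ⟨μ, s, hs, hfr⟩ := exists_weightFrame (E := E) (σ := σ)
  choose p hp using fun i => hcoords _ (((hs i).resSec (Δ.zeroCone_le σ)).coord_smul (u := 0)
    ⟨μ i, Δ.mem_dualMonoid_zeroCone _⟩ (zero_add _) 1)
  refine ⟨μ, s, p, hfr, fun h0 => ?_, hp⟩
  have hli' := linearIndependent_iff_det₂_ne_zero.1
    (VectorBundle.linearIndependent_coords (hV := hV) (hfr.res (Fan.chart_mono k (Δ.zeroCone_le σ))))
  apply hli'
  have h1 : ∀ i, ratFun hV (Δ.torusMonomial k (.ofAdd (μ i))) •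
      E.toVectorBundle.coords hV (resSec E.sheaf (Fan.chart_mono k (Δ.zeroCone_le σ)) (s i)) =
      ratFun hV (Δ.const k Δ.zeroCone (p i).1) • E.toVectorBundle.coords hV (ε 0) +
      ratFun hV (Δ.const k Δ.zeroCone (p i).2) • E.toVectorBundle.coords hV (ε 1) := by
    intro i
    rw [← VectorBundle.coords_smul, ← VectorBundle.coords_smul, ← VectorBundle.coords_smul,
      ← VectorBundle.coords_add]
    exact congrArg _ (hp i)
  refine (mul_eq_zero.1 ?_).resolve_left (mul_ne_zero (hχ (.ofAdd (μ 0))) (hχ (.ofAdd (μ 1))))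
  rw [← det₂_smul_smul, h1, h1]
  -- The determinant of the restricted frame is, up to invertible characters, the determinant of the
  -- coefficients times that of `ε`, so the former cannot vanish.
  have h3 : ∀ (a b c d : (Δ.toricVariety k).functionField) v w,
      det₂ (a • v + b • w) (c • v + d • w) = (a * d - c * b) * det₂ v w := by
    intro a b c d v w
    simp only [det₂, Pi.add_apply, Pi.smul_apply, smul_eq_mul]
    ring
  rw [h3, ← map_mul, ← map_mul, ← map_mul, ← map_mul, ← map_sub, ← map_sub, h0, map_zero, map_zero,
    zero_mul]

end ToricVectorBundle

end InvariantFrames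

/-! ### Charts of the projectivization and their overlaps. -/

section SymDomain

variable {A M : Type u} [CommRing A] [AddCommGroup M] [Module A M]

lemma isDomain_symmetricAlgebra [IsDomain A] {ι : Type*} (b : Module.Basis ι A M) :
    IsDomain (SymmetricAlgebra A M) :=
  (SymmetricAlgebra.equivMvPolynomial b).toMulEquiv.isDomain _

lemma ι_basis_ne_zero [Nontrivial A] {ι : Type*} (b : Module.Basis ι A M) (i : ι) :
    SymmetricAlgebra.ι A M (b i) ≠ 0 := by
  intro h
  have := congrArg (SymmetricAlgebra.equivMvPolynomial b) h
  rw [SymmetricAlgebra.equivMvPolynomial_ι_apply, map_zero] at this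
  exact MvPolynomial.X_ne_zero i this

lemma isDomain_away [IsDomain (SymmetricAlgebra A M)] {s : SymmetricAlgebra A M} (hs : s ≠ 0) :
    IsDomain (HomogeneousLocalization.Away (symGrading A M) s) := by
  have h1 : IsDomain (Localization (Submonoid.powers s)) :=
    IsLocalization.isDomain_localization (powers_le_nonZeroDivisors_of_noZeroDivisors hs)
  have hinj := HomogeneousLocalization.val_injective (𝒜 := symGrading A M) (Submonoid.powers s)
  exact hinj.isDomain (algebraMap (HomogeneousLocalization.Away (symGrading A M) s)
    (Localization (Submonoid.powers s)))

/-- The charts of `Proj (Sym_A M)` given by the members of a basis of `M` cover it. -/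
lemma exists_mem_basicOpen_ι {ι : Type*} (b : Module.Basis ι A M) (x : projSym A M) :
    ∃ i, x ∈ Proj.basicOpen (symGrading A M) (SymmetricAlgebra.ι A M (b i)) := by
  have h := Proj.iSup_basicOpen_eq_top (symGrading A M) (fun i => SymmetricAlgebra.ι A M (b i)) (by
    refine irrelevant_le_span.trans (Ideal.span_le.2 ?_)
    rintro _ ⟨m, rfl⟩
    have hm := b.mem_span m
    induction hm using Submodule.span_induction with
    | mem x hx =>
      obtain ⟨i, rfl⟩ := hx
      exact Ideal.subset_span ⟨i, rfl⟩
    | zero => rw [map_zero]; exact zero_mem _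
    | add x y _ _ hx hy => rw [map_add]; exact add_mem hx hy
    | smul a x _ hx =>
      rw [map_smul, Algebra.smul_def]
      exact Ideal.mul_mem_left _ _ hx)
  have hx : x ∈ (⊤ : (projSym A M).Opens) := trivial
  rw [← h] at hx
  exact Opens.mem_iSup.1 hx

/-- Symmetric powers are generated in degree one, so a homogeneous fraction of degree zero is built
from scalars and fractions `m / s` by sums and products. -/
lemma away_subring_eq_top {s : SymmetricAlgebra A M} (hs : s ∈ symGrading A M 1)
    {S : Subring (HomogeneousLocalization.Away (symGrading A M) s)}
    (h0 : ∀ a, awayAlgebraMap s a ∈ S) (h1 : ∀ m, awayFrac hs m ∈ S) : S = ⊤ := by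
  have key : ∀ (n : ℕ) (x : SymmetricAlgebra A M) (hx : x ∈ symGrading A M (n • 1)),
      HomogeneousLocalization.Away.mk _ hs n x hx ∈ S := by
    intro n x hx
    have hx' : x ∈ LinearMap.range (SymmetricAlgebra.ι A M) ^ n := by
      rw [smul_eq_mul, mul_one] at hx; exact hx
    induction hx' using Submodule.pow_induction_on_left' with
    | algebraMap r =>
      have : HomogeneousLocalization.Away.mk (symGrading A M) hs 0
          (algebraMap A _ r) hx = awayAlgebraMap _ r := by
        apply HomogeneousLocalization.val_injective
        rw [HomogeneousLocalization.Away.val_mk, val_awayAlgebraMap,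
          ← Localization.mk_one_eq_algebraMap]
        congr 1
        ext
        exact pow_zero _
      rw [this]
      exact h0 r
    | add x y i hx' hy' ihx ihy =>
      have hx'' : x ∈ symGrading A M (i • 1) := by rw [smul_eq_mul, mul_one]; exact hx'
      have hy'' : y ∈ symGrading A M (i • 1) := by rw [smul_eq_mul, mul_one]; exact hy'
      have : HomogeneousLocalization.Away.mk (symGrading A M) hs i (x + y) hx =
          .mk _ hs i x hx'' + .mk _ hs i y hy'' := by
        apply HomogeneousLocalization.val_injective
        rw [HomogeneousLocalization.val_add, HomogeneousLocalization.Away.val_mk,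
          HomogeneousLocalization.Away.val_mk, HomogeneousLocalization.Away.val_mk,
          Localization.add_mk_self]
      rw [this]
      exact add_mem (ihx hx'') (ihy hy'')
    | mem_mul m' hm i x hx' ih =>
      obtain ⟨m', rfl⟩ := hm
      have hx'' : x ∈ symGrading A M (i • 1) := by rw [smul_eq_mul, mul_one]; exact hx'
      have : HomogeneousLocalization.Away.mk (symGrading A M) hs i.succ
          (SymmetricAlgebra.ι A M m' * x) hx =
          awayFrac hs m' * .mk _ hs i x hx'' := by
        apply HomogeneousLocalization.val_injective
        rw [HomogeneousLocalization.val_mul, HomogeneousLocalization.Away.val_mk,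
          HomogeneousLocalization.Away.val_mk, val_awayFrac, Localization.mk_mul]
        congr 1
        ext
        exact pow_succ' _ _
      rw [this]
      exact mul_mem (h1 m') (ih hx'')
  refine eq_top_iff.2 fun x _ => ?_
  obtain ⟨n, y, hy, rfl⟩ := HomogeneousLocalization.Away.mk_surjective _ hs x
  exact key n y hy

lemma awayMap_awayAlgebraMap' {s t : SymmetricAlgebra A M} {i : ℕ} (ht : t ∈ symGrading A M i)
    (a : A) : HomogeneousLocalization.awayMap (symGrading A M) ht rfl (awayAlgebraMap s a) =
      awayAlgebraMap (s * t) a := by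
  apply HomogeneousLocalization.val_injective
  rw [HomogeneousLocalization.val_awayMap, val_awayAlgebraMap, val_awayAlgebraMap]
  exact IsLocalization.lift_eq _ _

end SymDomain

section ProjCharts

namespace VectorBundle

variable {X : Scheme.{u}} {r : ℕ} (E : VectorBundle X r)

/-- The inclusion of the part of the projectivization which lies over an open set where the bundle
is free. -/
def projι (U : E.FreeOpen) : projSym Γ(X, U.1) Γ(E.sheaf, U.1) ⟶ E.projectivization :=
  colimit.ι E.projGluing.functor U

instance (U : E.FreeOpen) : IsOpenImmersion (E.projι U) :=
  E.projGluing.cover.map_prop U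

lemma exists_projι_eq {U : E.FreeOpen} {x : E.projectivization} (hx : E.projection x ∈ U.1) :
    ∃ y, E.projι U y = x := by
  have h : E.projection x ∈ Set.range U.2.1.fromSpec := by
    rw [U.2.1.range_fromSpec]
    exact hx
  exact (Set.ext_iff.1 (E.projGluing.preimage_toBase_eq_range_ι U) x).1 h

lemma projι_projection (U : E.FreeOpen) :
    E.projι U ≫ E.projection =
      projSymStructure Γ(X, U.1) Γ(E.sheaf, U.1) ≫ U.2.1.fromSpec :=
  E.projGluing.ι_toBase U

/-- The charts of the projectivization. -/
def projChart (U : E.FreeOpen) {s : SymmetricAlgebra Γ(X, U.1) Γ(E.sheaf, U.1)} {i : ℕ}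
    (hs : s ∈ symGrading Γ(X, U.1) Γ(E.sheaf, U.1) i) (hi : 0 < i) :
    Spec (.of (HomogeneousLocalization.Away (symGrading Γ(X, U.1) Γ(E.sheaf, U.1)) s)) ⟶
      E.projectivization :=
  Proj.awayι _ s hs hi ≫ E.projι U

instance (U : E.FreeOpen) {s : SymmetricAlgebra Γ(X, U.1) Γ(E.sheaf, U.1)} {i : ℕ}
    (hs : s ∈ symGrading Γ(X, U.1) Γ(E.sheaf, U.1) i) (hi : 0 < i) :
    IsOpenImmersion (E.projChart U hs hi) :=
  inferInstanceAs (IsOpenImmersion (Proj.awayι _ s hs hi ≫ E.projι U))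

lemma projChart_projection (U : E.FreeOpen) {s : SymmetricAlgebra Γ(X, U.1) Γ(E.sheaf, U.1)} {i : ℕ}
    (hs : s ∈ symGrading Γ(X, U.1) Γ(E.sheaf, U.1) i) (hi : 0 < i) :
    E.projChart U hs hi ≫ E.projection =
      Spec.map (CommRingCat.ofHom (awayAlgebraMap s)) ≫ U.2.1.fromSpec := by
  rw [projChart, Category.assoc, projι_projection, ← Category.assoc, awayι_projSymStructure hs hi]

lemma projChart_mul (U : E.FreeOpen) {s t : SymmetricAlgebra Γ(X, U.1) Γ(E.sheaf, U.1)} {i j : ℕ}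
    (hs : s ∈ symGrading Γ(X, U.1) Γ(E.sheaf, U.1) i) (hi : 0 < i)
    (ht : t ∈ symGrading Γ(X, U.1) Γ(E.sheaf, U.1) j) :
    E.projChart U (SetLike.mul_mem_graded hs ht) (hi.trans_le (Nat.le_add_right _ _)) =
      Spec.map (CommRingCat.ofHom (HomogeneousLocalization.awayMap _ ht rfl)) ≫
        E.projChart U hs hi := by
  rw [projChart, projChart, ← Category.assoc, Proj.SpecMap_awayMap_awayι]

lemma projChart_mul' (U : E.FreeOpen) {s t : SymmetricAlgebra Γ(X, U.1) Γ(E.sheaf, U.1)} {i j : ℕ}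
    (hs : s ∈ symGrading Γ(X, U.1) Γ(E.sheaf, U.1) i)
    (ht : t ∈ symGrading Γ(X, U.1) Γ(E.sheaf, U.1) j) (hj : 0 < j) :
    E.projChart U (SetLike.mul_mem_graded hs ht) (hj.trans_le (Nat.le_add_left _ _)) =
      Spec.map (CommRingCat.ofHom (HomogeneousLocalization.awayMap _ hs (mul_comm _ _))) ≫
        E.projChart U ht hj := by
  rw [projChart, projChart, ← Category.assoc, Proj.SpecMap_awayMap_awayι]
  rfl

lemma projFunctor_map_projι {V U : E.FreeOpen} (h : V ≤ U) :
    Proj.map (symMap (resFun h) (resSec E.sheaf h)) (irrelevant_le_map_symMap _ _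
      (E.freeBasis (le_refl U)) (E.freeBasis h) (E.resSec_freeBasis h)) ≫ E.projι U = E.projι V :=
  colimit.w E.projGluing.functor (homOfLE h)

lemma symMap_mem {V U : E.FreeOpen} (h : V ≤ U)
    {s : SymmetricAlgebra Γ(X, U.1) Γ(E.sheaf, U.1)} {i : ℕ}
    (hs : s ∈ symGrading Γ(X, U.1) Γ(E.sheaf, U.1) i) :
    symMap (resFun h) (resSec E.sheaf h) s ∈ symGrading Γ(X, V.1) Γ(E.sheaf, V.1) i :=
  (symMap (resFun h) (resSec E.sheaf h)).map_mem hs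

lemma projChart_res {V U : E.FreeOpen} (h : V ≤ U)
    {s : SymmetricAlgebra Γ(X, U.1) Γ(E.sheaf, U.1)} {i : ℕ}
    (hs : s ∈ symGrading Γ(X, U.1) Γ(E.sheaf, U.1) i) (hi : 0 < i) :
    E.projChart V (E.symMap_mem h hs) hi =
      Spec.map (CommRingCat.ofHom
        (HomogeneousLocalization.Away.map (symMap (resFun h) (resSec E.sheaf h)) s)) ≫
        E.projChart U hs hi := by
  have h1 := Proj.awayι_comp_map (symMap (resFun h) (resSec E.sheaf h))
    (irrelevant_le_map_symMap _ _ (E.freeBasis (le_refl U)) (E.freeBasis h) (E.resSec_freeBasis h))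
    hi s hs
  have h2 := E.projFunctor_map_projι h
  have h3 : E.projChart V (E.symMap_mem h hs) hi =
    Proj.awayι (symGrading Γ(X, V.1) Γ(E.sheaf, V.1)) _ (E.symMap_mem h hs) hi ≫ E.projι V := rfl
  rw [← h2, ← Category.assoc] at h3
  rw [h3]
  have h4 := congrArg (fun f => f ≫ E.projι U) h1
  refine h4.trans ?_
  rw [Category.assoc]
  rfl

end VectorBundle

end ProjCharts

lemma symMap_ι {A B M N : Type u} [CommRing A] [AddCommGroup M] [Module A M] [CommRing B]
    [AddCommGroup N] [Module B N] (φ : A →+* B) (ψ : M →ₛₗ[φ] N) (m : M) :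
    symMap φ ψ (SymmetricAlgebra.ι A M m) = SymmetricAlgebra.ι B N (ψ m) :=
  symMapRingHom_ι φ ψ m

section

variable {A M : Type u} [CommRing A] [AddCommGroup M] [Module A M]

lemma val_awayMap_awayFrac_mul {s t x : SymmetricAlgebra A M} (hs : s ∈ symGrading A M 1) {i : ℕ}
    (ht : t ∈ symGrading A M i) (hx : x = s * t) (m : M) :
    (HomogeneousLocalization.awayMap (symGrading A M) ht hx (awayFrac hs m)).val *
      algebraMap _ _ s = algebraMap _ (Localization.Away x) (SymmetricAlgebra.ι A M m) := by
  have hu : IsUnit (algebraMap (SymmetricAlgebra A M) (Localization.Away x) s) := by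
    have := IsLocalization.Away.algebraMap_isUnit (S := Localization.Away x) x
    have h : algebraMap (SymmetricAlgebra A M) (Localization.Away x) x =
        algebraMap _ _ s * algebraMap _ _ t := (congrArg _ hx).trans (map_mul _ s t)
    rw [h] at this
    exact isUnit_of_mul_isUnit_left this
  rw [HomogeneousLocalization.val_awayMap, val_awayFrac]
  have h1 : ∀ y, Localization.awayLift (algebraMap (SymmetricAlgebra A M) (Localization.Away x)) s hu
      (algebraMap _ _ y) = algebraMap _ _ y := fun y => IsLocalization.Away.lift_eq _ hu y
  change Localization.awayLift (algebraMap (SymmetricAlgebra A M) (Localization.Away x)) s hu _ * _ = _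
  rw [← h1 s, ← map_mul, ← h1, ← Localization.mk_one_eq_algebraMap,
    ← Localization.mk_one_eq_algebraMap, Localization.mk_mul, mul_one]
  congr 1
  rw [Localization.mk_eq_mk_iff, Localization.r_iff_exists]
  exact ⟨1, by simp [mul_comm]⟩

end

section

variable {A B M N : Type u} [CommRing A] [AddCommGroup M] [Module A M] [CommRing B]
  [AddCommGroup N] [Module B N] (φ : A →+* B) (ψ : M →ₛₗ[φ] N)

/-- The map of degree-zero localizations induced by a semilinear map. -/
def awayRes {s : SymmetricAlgebra A M} {s' : SymmetricAlgebra B N} (h : symMap φ ψ s = s') :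
    HomogeneousLocalization.Away (symGrading A M) s →+*
      HomogeneousLocalization.Away (symGrading B N) s' := by
  subst h
  exact HomogeneousLocalization.Away.map (symMap φ ψ) s

lemma awayRes_awayAlgebraMap {s : SymmetricAlgebra A M} {s' : SymmetricAlgebra B N}
    (h : symMap φ ψ s = s') (a : A) :
    awayRes φ ψ h (awayAlgebraMap s a) = awayAlgebraMap s' (φ a) := by
  subst h
  exact awayMap_awayAlgebraMap φ ψ s a

lemma awayRes_awayFrac {s : SymmetricAlgebra A M} {s' : SymmetricAlgebra B N}
    (h : symMap φ ψ s = s') (hs : s ∈ symGrading A M 1) (hs' : s' ∈ symGrading B N 1) (m : M) :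
    awayRes φ ψ h (awayFrac hs m) = awayFrac hs' (ψ m) := by
  subst h
  exact awayMap_awayFrac φ ψ hs m

end

section

variable {A M : Type u} [CommRing A] [AddCommGroup M] [Module A M] {m m' : M} {K : Type*} [Field K]
  {f : HomogeneousLocalization.Away (symGrading A M) (SymmetricAlgebra.ι A M m) →+* K}
  {f' : HomogeneousLocalization.Away (symGrading A M) (SymmetricAlgebra.ι A M m') →+* K}
  (g : HomogeneousLocalization.Away (symGrading A M)
    (SymmetricAlgebra.ι A M m * SymmetricAlgebra.ι A M m') →+* K)
  (h : ∀ x, g (HomogeneousLocalization.awayMap _ (ι_mem_symGrading m') rfl x) = f x)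
  (h' : ∀ x, g (HomogeneousLocalization.awayMap _ (ι_mem_symGrading m) (mul_comm _ _) x) = f' x)

include h h' in
-- On the overlap of the two charts this is `(x / m') * (m' / m) = x / m`, checked after
-- multiplication by the unit `m`.
lemma awayFrac_mul_awayFrac_eq (x : M) :
    f' (awayFrac (ι_mem_symGrading m') x) * f (awayFrac (ι_mem_symGrading m) m') =
      f (awayFrac (ι_mem_symGrading m) x) := by
  rw [← h, ← h, ← h', ← map_mul]
  congr 1
  apply HomogeneousLocalization.val_injective
  have hu : IsUnit (algebraMap (SymmetricAlgebra A M) (Localization.Away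
      (SymmetricAlgebra.ι A M m * SymmetricAlgebra.ι A M m')) (SymmetricAlgebra.ι A M m)) := by
    have := IsLocalization.Away.algebraMap_isUnit
      (S := Localization.Away (SymmetricAlgebra.ι A M m * SymmetricAlgebra.ι A M m'))
      (SymmetricAlgebra.ι A M m * SymmetricAlgebra.ι A M m')
    rw [map_mul] at this
    exact isUnit_of_mul_isUnit_left this
  refine hu.mul_right_cancel ?_
  rw [HomogeneousLocalization.val_mul, mul_assoc, val_awayMap_awayFrac_mul,
    val_awayMap_awayFrac_mul, val_awayMap_awayFrac_mul]

include h h' in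
lemma awayAlgebraMap_eq_awayAlgebraMap (a : A) :
    f' (awayAlgebraMap _ a) = f (awayAlgebraMap _ a) := by
  rw [← h, ← h', awayMap_awayAlgebraMap']
  congr 1
  apply HomogeneousLocalization.val_injective
  rw [HomogeneousLocalization.val_awayMap, val_awayAlgebraMap, val_awayAlgebraMap]
  exact IsLocalization.lift_eq _ _

end

lemma exists_eq_of_eq_comp_of_eq_comp {P Q Q' Q₁ Q₁' : Scheme.{u}} {R : CommRingCat.{u}}
    [Nontrivial R] {c : Spec R ⟶ P} {f : Spec R ⟶ Q₁} {f' : Q₁ ⟶ Q} {a : Q ⟶ P} {g : Spec R ⟶ Q₁'}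
    {g' : Q₁' ⟶ Q'} {b : Q' ⟶ P} (h : c = f ≫ f' ≫ a) (h' : c = g ≫ g' ≫ b) :
    ∃ x y, a x = b y := by
  let z : Spec R := Classical.arbitrary (PrimeSpectrum R)
  refine ⟨f' (f z), g' (g z), ?_⟩
  rw [← Scheme.Hom.comp_apply, ← Scheme.Hom.comp_apply, ← h, h', Scheme.Hom.comp_apply,
    Scheme.Hom.comp_apply]

/-! ### Integrality of the projectivization. -/

namespace VectorBundle

variable {X : Scheme.{u}} [IsIntegral X] {r : ℕ} (E : VectorBundle X r)

variable {E} in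
lemma isDomain_sections {U : E.FreeOpen} (hU : genericPoint X ∈ U.1) : IsDomain Γ(X, U.1) :=
  have : Nonempty U.1 := ⟨⟨_, hU⟩⟩
  inferInstance

variable {E} in
lemma isDomain_sym {U : E.FreeOpen} (hU : genericPoint X ∈ U.1) :
    IsDomain (SymmetricAlgebra Γ(X, U.1) Γ(E.sheaf, U.1)) :=
  have := isDomain_sections hU
  isDomain_symmetricAlgebra (E.freeBasis (le_refl U))

variable {E} in
lemma isDomain_awaySym {U : E.FreeOpen} (hU : genericPoint X ∈ U.1)
    {s : SymmetricAlgebra Γ(X, U.1) Γ(E.sheaf, U.1)} (hs : s ≠ 0) :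
    IsDomain (HomogeneousLocalization.Away (symGrading Γ(X, U.1) Γ(E.sheaf, U.1)) s) :=
  have := isDomain_sym hU
  isDomain_away hs

variable {E} in
lemma exists_projChart_eq {U : E.FreeOpen} {x : E.projectivization} (hx : E.projection x ∈ U.1)
    {ι : Type*} (b : Module.Basis ι Γ(X, U.1) Γ(E.sheaf, U.1)) :
    ∃ i z, E.projChart U (ι_mem_symGrading (b i)) one_pos z = x := by
  obtain ⟨y, rfl⟩ := E.exists_projι_eq hx
  obtain ⟨i, hi⟩ := exists_mem_basicOpen_ι b y
  rw [← Proj.opensRange_awayι _ _ (ι_mem_symGrading _) one_pos] at hi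
  obtain ⟨z, hz⟩ := hi
  refine ⟨i, z, ?_⟩
  rw [← hz]
  rfl

variable {E} in
lemma projChart_res' {V U : E.FreeOpen} (h : V ≤ U)
    {s : SymmetricAlgebra Γ(X, U.1) Γ(E.sheaf, U.1)} {s' : SymmetricAlgebra Γ(X, V.1) Γ(E.sheaf, V.1)}
    (e : symMap (resFun h) (resSec E.sheaf h) s = s') {i : ℕ}
    (hs : s ∈ symGrading Γ(X, U.1) Γ(E.sheaf, U.1) i)
    (hs' : s' ∈ symGrading Γ(X, V.1) Γ(E.sheaf, V.1) i) (hi : 0 < i) :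
    E.projChart V hs' hi = Spec.map (CommRingCat.ofHom
      (awayRes (resFun h) (resSec E.sheaf h) e)) ≫ E.projChart U hs hi := by
  subst e
  exact E.projChart_res h hs hi

variable {E} in
-- Over `W` the product `t * t'` is nonzero because the symmetric algebra is a domain, so its
-- nonvanishing locus is a nonempty part of both charts.
lemma exists_projChart_eq_projChart {U U' W : E.FreeOpen} (h : W ≤ U) (h' : W ≤ U')
    (hW : genericPoint X ∈ W.1)
    {s : SymmetricAlgebra Γ(X, U.1) Γ(E.sheaf, U.1)} (hs : s ∈ symGrading _ _ 1)
    {s' : SymmetricAlgebra Γ(X, U'.1) Γ(E.sheaf, U'.1)} (hs' : s' ∈ symGrading _ _ 1)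
    {t t' : SymmetricAlgebra Γ(X, W.1) Γ(E.sheaf, W.1)}
    (ht : symMap (resFun h) (resSec E.sheaf h) s = t) (h0 : t ≠ 0)
    (ht' : symMap (resFun h') (resSec E.sheaf h') s' = t') (h0' : t' ≠ 0) :
    ∃ y y', E.projChart U hs one_pos y = E.projChart U' hs' one_pos y' := by
  have := isDomain_sym hW
  have := isDomain_awaySym hW (mul_ne_zero h0 h0')
  have h1 : t ∈ symGrading Γ(X, W.1) Γ(E.sheaf, W.1) 1 := ht ▸ E.symMap_mem h hs
  have h1' : t' ∈ symGrading Γ(X, W.1) Γ(E.sheaf, W.1) 1 := ht' ▸ E.symMap_mem h' hs'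
  have r1 := projChart_res' h ht hs h1 one_pos
  have r2 := projChart_res' h' ht' hs' h1' one_pos
  have e1 := (E.projChart_mul W h1 one_pos h1').trans (congrArg _ r1)
  have e2 := (E.projChart_mul' W h1 h1' one_pos).trans (congrArg _ r2)
  have := exists_eq_of_eq_comp_of_eq_comp e1 e2
  exact this

variable {E} in
lemma exists_projChart_freeBasis_eq {U U' : E.FreeOpen} (hU : genericPoint X ∈ U.1)
    (hU' : genericPoint X ∈ U'.1) (i i' : Fin r) : ∃ y y',
      E.projChart U (ι_mem_symGrading (E.freeBasis (le_refl U) i)) one_pos y =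
      E.projChart U' (ι_mem_symGrading (E.freeBasis (le_refl U') i')) one_pos y' := by
  have h0 : genericPoint X ∈ U.1 ⊓ U'.1 := ⟨hU, hU'⟩
  obtain ⟨W, hW, hWU⟩ := E.exists_freeOpen h0
  have := isDomain_sections hW
  have h : W ≤ U := hWU.trans inf_le_left
  have h' : W ≤ U' := hWU.trans inf_le_right
  have h1 : ∀ (U : E.FreeOpen) (h : W ≤ U) (i : Fin r), symMap (resFun h) (resSec E.sheaf h)
      (SymmetricAlgebra.ι _ _ (E.freeBasis (le_refl U) i)) =
        SymmetricAlgebra.ι _ _ (E.freeBasis h i) := by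
    intro U h i
    rw [symMap_ι, resSec_freeBasis]
  exact exists_projChart_eq_projChart h h' hW (ι_mem_symGrading _) (ι_mem_symGrading _)
    (h1 U h i) (ι_basis_ne_zero _ _) (h1 U' h' i') (ι_basis_ne_zero _ _)

variable {E} in
lemma isDomain_awaySym_freeBasis {U : E.FreeOpen} (hU : genericPoint X ∈ U.1) (i : Fin r) :
    IsDomain (HomogeneousLocalization.Away (symGrading Γ(X, U.1) Γ(E.sheaf, U.1))
      (SymmetricAlgebra.ι _ _ (E.freeBasis (le_refl U) i))) := by
  have := isDomain_sections hU
  exact isDomain_awaySym hU (ι_basis_ne_zero _ _)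

/-- The charts of the projectivization given by the frames of the bundle. -/
abbrev FreeChartIndex : Type u := {U : E.FreeOpen // genericPoint X ∈ U.1} × Fin r

/-- The coordinate ring of a chart given by a frame. -/
def FreeChartRing (j : E.FreeChartIndex) : Type u :=
  HomogeneousLocalization.Away (symGrading Γ(X, j.1.1.1) Γ(E.sheaf, j.1.1.1))
    (SymmetricAlgebra.ι _ _ (E.freeBasis (le_refl j.1.1) j.2))

instance (j : E.FreeChartIndex) : CommRing (E.FreeChartRing j) :=
  inferInstanceAs (CommRing (HomogeneousLocalization.Away _ _))

instance (j : E.FreeChartIndex) : IsDomain (E.FreeChartRing j) :=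
  isDomain_awaySym_freeBasis j.1.2 j.2

/-- The chart given by a frame. -/
def freeChart (j : E.FreeChartIndex) : Spec (.of (E.FreeChartRing j)) ⟶ E.projectivization :=
  E.projChart j.1.1 (ι_mem_symGrading (E.freeBasis (le_refl j.1.1) j.2)) one_pos

instance (j : E.FreeChartIndex) : IsOpenImmersion (E.freeChart j) :=
  inferInstanceAs (IsOpenImmersion (E.projChart _ _ _))

lemma exists_freeChart_eq (x : E.projectivization) : ∃ j y, E.freeChart j y = x := by
  obtain ⟨U, hU, -⟩ := E.exists_freeOpen (show E.projection x ∈ (⊤ : X.Opens) from trivial)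
  obtain ⟨i, z, hz⟩ := exists_projChart_eq hU (E.freeBasis (le_refl U))
  exact ⟨⟨⟨U, genericPoint_mem hU⟩, i⟩, z, hz⟩

instance [NeZero r] : IsIntegral E.projectivization := by
  have : Nonempty E.FreeChartIndex := by
    obtain ⟨U, hU, -⟩ := E.exists_freeOpen (show genericPoint X ∈ (⊤ : X.Opens) from trivial)
    exact ⟨⟨⟨U, hU⟩, 0⟩⟩
  exact isIntegral_of_charts E.freeChart E.exists_freeChart_eq
    fun j j' => exists_projChart_freeBasis_eq j.1.2 j'.1.2 j.2 j'.2

end VectorBundle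

/-! ### Rational functions on the projectivization. -/

namespace VectorBundle

variable {X : Scheme.{u}} [IsIntegral X] {r : ℕ} (E : VectorBundle X r)

section RationalFunctions

variable [NeZero r] {U V : E.FreeOpen} (hU : genericPoint X ∈ U.1) (hV : genericPoint X ∈ V.1)

/-- The functions on a chart of the projectivization, as rational functions. -/
def awayRat {s : SymmetricAlgebra Γ(X, U.1) Γ(E.sheaf, U.1)} {i : ℕ}
    (hs : s ∈ symGrading Γ(X, U.1) Γ(E.sheaf, U.1) i) (hi : 0 < i) (h0 : s ≠ 0) :
    HomogeneousLocalization.Away (symGrading Γ(X, U.1) Γ(E.sheaf, U.1)) s →+*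
      E.projectivization.functionField :=
  haveI := isDomain_awaySym hU h0
  specRatFun (E.projChart U hs hi)

variable {s t : SymmetricAlgebra Γ(X, U.1) Γ(E.sheaf, U.1)} {i j : ℕ}

lemma awayRat_comp {s' : SymmetricAlgebra Γ(X, V.1) Γ(E.sheaf, V.1)} 
    (hs : s ∈ symGrading Γ(X, U.1) Γ(E.sheaf, U.1) i) (hi : 0 < i) (h0 : s ≠ 0)
    (hs' : s' ∈ symGrading Γ(X, V.1) Γ(E.sheaf, V.1) j) (hj : 0 < j) (h0' : s' ≠ 0)
    (f : HomogeneousLocalization.Away (symGrading Γ(X, U.1) Γ(E.sheaf, U.1)) s →+*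
      HomogeneousLocalization.Away (symGrading Γ(X, V.1) Γ(E.sheaf, V.1)) s')
    (h : E.projChart V hs' hj = Spec.map (CommRingCat.ofHom f) ≫ E.projChart U hs hi) (x) :
    E.awayRat hV hs' hj h0' (f x) = E.awayRat hU hs hi h0 x := by
  have h1 := isDomain_awaySym hU h0
  have h2 := isDomain_awaySym hV h0'
  have h3 := specRatFun_comp _ _ _ h x
  delta awayRat
  with_reducible exact h3

lemma awayRat_awayRes (h : V ≤ U) {s' : SymmetricAlgebra Γ(X, V.1) Γ(E.sheaf, V.1)}
    (e : symMap (resFun h) (resSec E.sheaf h) s = s')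
    (hs : s ∈ symGrading Γ(X, U.1) Γ(E.sheaf, U.1) i)
    (hs' : s' ∈ symGrading Γ(X, V.1) Γ(E.sheaf, V.1) i) (hi : 0 < i)
    (h0 : s ≠ 0) (h0' : s' ≠ 0) (x) :
    E.awayRat hV hs' hi h0' (awayRes (resFun h) (resSec E.sheaf h) e x) =
      E.awayRat hU hs hi h0 x := 
  E.awayRat_comp hU hV hs hi h0 hs' hi h0' _ (projChart_res' h e hs hs' hi) x

lemma awayRat_mul (hs : s ∈ symGrading Γ(X, U.1) Γ(E.sheaf, U.1) i) (hi : 0 < i)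
    (ht : t ∈ symGrading Γ(X, U.1) Γ(E.sheaf, U.1) j) (h0 : s ≠ 0) (h0' : s * t ≠ 0) (x) :
    E.awayRat hU (SetLike.mul_mem_graded hs ht) (hi.trans_le (Nat.le_add_right _ _)) h0'
      (HomogeneousLocalization.awayMap _ ht rfl x) = E.awayRat hU hs hi h0 x :=
  E.awayRat_comp hU hU hs hi h0 _ _ h0' _ (E.projChart_mul U hs hi ht) x

lemma awayRat_mul' (hs : s ∈ symGrading Γ(X, U.1) Γ(E.sheaf, U.1) i)
    (ht : t ∈ symGrading Γ(X, U.1) Γ(E.sheaf, U.1) j) (hj : 0 < j) (h0 : t ≠ 0) (h0' : s * t ≠ 0)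
    (x) : E.awayRat hU (SetLike.mul_mem_graded hs ht) (hj.trans_le (Nat.le_add_left _ _)) h0'
      (HomogeneousLocalization.awayMap _ hs (mul_comm _ _) x) = E.awayRat hU ht hj h0 x :=
  E.awayRat_comp hU hU ht hj h0 _ _ h0' _ (E.projChart_mul' U hs ht hj) x

variable {E hU hV}
variable {m m' : Γ(E.sheaf, U.1)}

lemma awayRat_awayFrac_mul (hm : SymmetricAlgebra.ι Γ(X, U.1) Γ(E.sheaf, U.1) m ≠ 0)
    (hm' : SymmetricAlgebra.ι Γ(X, U.1) Γ(E.sheaf, U.1) m' ≠ 0) (x : Γ(E.sheaf, U.1)) :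
    E.awayRat hU (ι_mem_symGrading m') one_pos hm' (awayFrac (ι_mem_symGrading m') x) *
      E.awayRat hU (ι_mem_symGrading m) one_pos hm (awayFrac (ι_mem_symGrading m) m') =
      E.awayRat hU (ι_mem_symGrading m) one_pos hm (awayFrac (ι_mem_symGrading m) x) := by
  have h0 : SymmetricAlgebra.ι Γ(X, U.1) Γ(E.sheaf, U.1) m *
      SymmetricAlgebra.ι Γ(X, U.1) Γ(E.sheaf, U.1) m' ≠ 0 :=
    have := isDomain_sym hU
    mul_ne_zero hm hm'
  have h1 := E.awayRat_mul hU (ι_mem_symGrading m) one_pos (ι_mem_symGrading m') hm h0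
  have h2 := E.awayRat_mul' hU (ι_mem_symGrading m) (ι_mem_symGrading m') one_pos hm' h0
  with_reducible exact awayFrac_mul_awayFrac_eq _ h1 h2 x

lemma awayRat_awayAlgebraMap_eq (hm : SymmetricAlgebra.ι Γ(X, U.1) Γ(E.sheaf, U.1) m ≠ 0)
    (hm' : SymmetricAlgebra.ι Γ(X, U.1) Γ(E.sheaf, U.1) m' ≠ 0) (a : Γ(X, U.1)) :
    E.awayRat hU (ι_mem_symGrading m') one_pos hm' (awayAlgebraMap (SymmetricAlgebra.ι _ _ m') a) =
      E.awayRat hU (ι_mem_symGrading m) one_pos hm (awayAlgebraMap (SymmetricAlgebra.ι _ _ m) a) := by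
  have h0 : SymmetricAlgebra.ι Γ(X, U.1) Γ(E.sheaf, U.1) m *
      SymmetricAlgebra.ι Γ(X, U.1) Γ(E.sheaf, U.1) m' ≠ 0 :=
    have := isDomain_sym hU
    mul_ne_zero hm hm'
  have h1 := E.awayRat_mul hU (ι_mem_symGrading m) one_pos (ι_mem_symGrading m') hm h0
  have h2 := E.awayRat_mul' hU (ι_mem_symGrading m) (ι_mem_symGrading m') one_pos hm' h0
  with_reducible exact awayAlgebraMap_eq_awayAlgebraMap _ h1 h2 a

lemma awayRat_resSec (h : V ≤ U) (hm : SymmetricAlgebra.ι Γ(X, U.1) Γ(E.sheaf, U.1) m ≠ 0)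
    (hm' : SymmetricAlgebra.ι Γ(X, V.1) Γ(E.sheaf, V.1) (resSec E.sheaf h m) ≠ 0)
    (x : Γ(E.sheaf, U.1)) :
    E.awayRat hV (ι_mem_symGrading (resSec E.sheaf h m)) one_pos hm'
      (awayFrac (ι_mem_symGrading (resSec E.sheaf h m)) (resSec E.sheaf h x)) =
      E.awayRat hU (ι_mem_symGrading m) one_pos hm (awayFrac (ι_mem_symGrading m) x) := by
  have e := symMap_ι (resFun h) (resSec E.sheaf h) m
  have h1 := E.awayRat_awayRes hU hV h e (ι_mem_symGrading m) (ι_mem_symGrading _) one_pos hm hm'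
    (awayFrac (ι_mem_symGrading m) x)
  have h2 := awayRes_awayFrac (resFun h) (resSec E.sheaf h) e (ι_mem_symGrading m)
    (ι_mem_symGrading _) x
  have h3 := (congrArg (E.awayRat hV (ι_mem_symGrading (resSec E.sheaf h m)) one_pos hm') h2).symm
  have := h3.trans h1
  exact this

lemma awayRat_resFun (h : V ≤ U) (hm : SymmetricAlgebra.ι Γ(X, U.1) Γ(E.sheaf, U.1) m ≠ 0)
    (hm' : SymmetricAlgebra.ι Γ(X, V.1) Γ(E.sheaf, V.1) (resSec E.sheaf h m) ≠ 0) (a : Γ(X, U.1)) :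
    E.awayRat hV (ι_mem_symGrading (resSec E.sheaf h m)) one_pos hm'
      (awayAlgebraMap (SymmetricAlgebra.ι _ _ (resSec E.sheaf h m)) (resFun h a)) =
      E.awayRat hU (ι_mem_symGrading m) one_pos hm (awayAlgebraMap (SymmetricAlgebra.ι _ _ m) a) := by
  have e := symMap_ι (resFun h) (resSec E.sheaf h) m
  have h1 := E.awayRat_awayRes hU hV h e (ι_mem_symGrading m) (ι_mem_symGrading _) one_pos hm hm'
    (awayAlgebraMap (SymmetricAlgebra.ι _ _ m) a)
  have h2 := awayRes_awayAlgebraMap (resFun h) (resSec E.sheaf h) e a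
  have h3 := (congrArg (E.awayRat hV (ι_mem_symGrading (resSec E.sheaf h m)) one_pos hm') h2).symm
  have := h3.trans h1
  exact this

end RationalFunctions

end VectorBundle

/-! ### Rings spanned by monomials in the characters and one coordinate. -/

section MonomialRange

variable {n : ℕ} {k K : Type*} [Field k] [Field K] [Algebra k K]
  {χ : Multiplicative (Fin n → ℤ) →* Kˣ} {z : K} {D : AddSubmonoid (Fin n → ℤ)} {μ : Fin n → ℤ}
  {R : Type*} [CommRing R] {θ : R →+* K} {α : AddMonoidAlgebra k D →+* R} {τ : R}

/-- The ring generated by the characters in `D` and by `χ^μ z` is spanned by monomials. -/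
lemma mem_range_iff_toricHom
    (hgen : ∀ S : Subring R, (∀ a, α a ∈ S) → τ ∈ S → S = ⊤)
    (hα : ∀ u c, θ (α (.single u c)) = c • (χ (.ofAdd u.1) : K))
    (hτ : θ τ = χ (.ofAdd μ) * z) (x : K) :
    x ∈ θ.range ↔ ∃ F : AddMonoidAlgebra k ((Fin n → ℤ) × ℕ),
      (∀ g ∈ F.coeff.support, g.1 - g.2 • μ ∈ D) ∧ toricHom χ z F = x := by
  have hμ : ∀ l : ℕ, (χ (.ofAdd (l • μ)) : K) = χ (.ofAdd μ) ^ l := by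
    intro l
    rw [ofAdd_nsmul, map_pow, Units.val_pow_eq_pow_val]
  constructor
  · rintro ⟨b, rfl⟩
    -- The exponents of the products of characters in `D` with powers of `χ^μ z`.
    let D' : AddSubmonoid ((Fin n → ℤ) × ℕ) :=
      { carrier := {g | g.1 - g.2 • μ ∈ D}
        zero_mem' := by
          change (0 : Fin n → ℤ) - 0 • μ ∈ D
          rw [zero_smul, sub_zero]
          exact D.zero_mem
        add_mem' := by
          intro g g' hg hg'
          have := D.add_mem hg hg'
          change g.1 + g'.1 - (g.2 + g'.2) • μ ∈ D
          convert this using 1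
          rw [add_smul]
          abel }
    let ψ := (toricHom (k := k) χ z).comp (AddMonoidAlgebra.mapDomainAlgHom k k D'.subtype)
    have hψ : ∀ g c, ψ (.single g c) = c • ((χ (.ofAdd g.1.1) : K) * z ^ g.1.2) := by
      intro g c
      change toricHom χ z (AddMonoidAlgebra.mapDomain _ (.single g c)) = _
      rw [AddMonoidAlgebra.mapDomain_single]
      exact toricHom_single _ _ _ _
    have h : ψ.toRingHom.range.comap θ = ⊤ := by
      refine hgen _ (fun a => ?_) ⟨.single ⟨(μ, 1), ?_⟩ 1, ?_⟩
      · induction a using AddMonoidAlgebra.induction_linear with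
        | zero => rw [map_zero]; exact zero_mem _
        | add a b ha hb => rw [map_add]; exact add_mem ha hb
        | single u c =>
          refine ⟨.single ⟨(u.1, 0), ?_⟩ c, ?_⟩
          · change u.1 - 0 • μ ∈ D
            rw [zero_smul, sub_zero]
            exact u.2
          · refine (hψ _ _).trans ?_
            rw [pow_zero, mul_one, hα]
      · change μ - 1 • μ ∈ D
        rw [one_smul, sub_self]
        exact D.zero_mem
      · refine (hψ _ _).trans ?_
        rw [one_smul, pow_one, hτ]
    obtain ⟨F, hF⟩ : b ∈ ψ.toRingHom.range.comap θ := h ▸ Subring.mem_top b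
    refine ⟨AddMonoidAlgebra.mapDomain D'.subtype F, fun g hg => ?_, hF⟩
    classical
    obtain ⟨g', -, rfl⟩ := Finset.mem_image.1 (Finsupp.mapDomain_support hg)
    exact g'.2
  · rintro ⟨F, hF, rfl⟩
    rw [← AddMonoidAlgebra.sum_coeff_single F, Finsupp.sum, map_sum]
    refine sum_mem fun g hg => ⟨α (.single ⟨_, hF g hg⟩ (F.coeff g)) * τ ^ g.2, ?_⟩
    rw [map_mul, map_pow, hα, hτ, toricHom_single, mul_pow, smul_mul_assoc, ← mul_assoc, ← hμ,
      ← Units.val_mul, ← map_mul, ← ofAdd_add, sub_add_cancel]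

/-- The characters in `D` and an element `z` which is transcendental over them. -/
lemma toricHom_injective {A : Type*} [CommRing A] (hθ : Function.Injective θ) {β : AddMonoidAlgebra k D →+* A}
    (hβ : Function.Injective β) (ev : R →+* Polynomial A)
    (hev : ∀ a, ev (α a) = Polynomial.C (β a)) (hev' : ev τ = Polynomial.X) (hD : ∀ u, u ∈ D)
    (hα : ∀ u c, θ (α (.single u c)) = c • (χ (.ofAdd u.1) : K)) (hτ : θ τ = z) :
    Function.Injective (toricHom (k := k) χ z) := by
  -- The evaluation `ev` recovers the coefficients of `F` by powers of `z`, so an element mapping to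
  -- zero has no coefficients.
  have key : ∀ F : AddMonoidAlgebra k ((Fin n → ℤ) × ℕ), ∃ b, θ b = toricHom χ z F ∧
      ∀ l, ∃ a : AddMonoidAlgebra k D, (ev b).coeff l = β a ∧ ∀ u, a.coeff u = F.coeff (u.1, l) := by
    intro F
    induction F using AddMonoidAlgebra.induction_linear with
    | zero => exact ⟨0, by simp, fun l => ⟨0, by simp, fun u => rfl⟩⟩
    | add F G hF hG =>
      obtain ⟨b, hb, hb'⟩ := hF
      obtain ⟨c, hc, hc'⟩ := hG
      refine ⟨b + c, by rw [map_add, map_add, hb, hc], fun l => ?_⟩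
      obtain ⟨a, ha, ha'⟩ := hb' l
      obtain ⟨d, hd, hd'⟩ := hc' l
      refine ⟨a + d, by rw [map_add, Polynomial.coeff_add, map_add, ha, hd], fun u => ?_⟩
      rw [AddMonoidAlgebra.coeff_add, AddMonoidAlgebra.coeff_add, Finsupp.add_apply,
        Finsupp.add_apply, ha', hd']
    | single g c =>
      classical
      refine ⟨α (.single ⟨g.1, hD _⟩ c) * τ ^ g.2, ?_, fun l => ?_⟩
      · rw [map_mul, map_pow, hα, hτ, toricHom_single, smul_mul_assoc]
      · rw [map_mul, map_pow, hev, hev', Polynomial.coeff_C_mul_X_pow]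
        refine ⟨if l = g.2 then .single ⟨g.1, hD _⟩ c else 0, by split_ifs <;> simp, fun u => ?_⟩
        obtain ⟨g, m⟩ := g
        rw [AddMonoidAlgebra.coeff_single, Finsupp.single_apply]
        split_ifs with h1 h2 h2
        · subst h1
          rw [Prod.mk.injEq] at h2
          rw [AddMonoidAlgebra.coeff_single, Finsupp.single_apply, if_pos (Subtype.ext h2.1)]
        · subst h1
          rw [AddMonoidAlgebra.coeff_single, Finsupp.single_apply, if_neg]
          rintro rfl
          exact h2 rfl
        · rw [Prod.mk.injEq] at h2
          exact absurd h2.2.symm h1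
        · rfl
  rw [injective_iff_map_eq_zero]
  intro F hF
  obtain ⟨b, hb, hb'⟩ := key F
  rw [hF, map_eq_zero_iff θ hθ] at hb
  subst hb
  ext ⟨u, l⟩
  obtain ⟨a, ha, ha'⟩ := hb' l
  rw [map_zero, Polynomial.coeff_zero, eq_comm, map_eq_zero_iff β hβ] at ha
  subst ha
  exact (ha' ⟨u, hD u⟩).symm

lemma exists_frac_toricHom
    (hrange : ∀ x, x ∈ θ.range ↔ ∃ F, toricHom (k := k) χ z F = x)
    (hfrac : ∀ x, ∃ a b, θ b ≠ 0 ∧ x * θ b = θ a) (x : K) :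
    ∃ a b : AddMonoidAlgebra k ((Fin n → ℤ) × ℕ), b ≠ 0 ∧ x * toricHom χ z b = toricHom χ z a := by
  obtain ⟨a, b, hb, hab⟩ := hfrac x
  obtain ⟨F, hF⟩ := (hrange (θ a)).1 ⟨a, rfl⟩
  obtain ⟨G, hG⟩ := (hrange (θ b)).1 ⟨b, rfl⟩
  refine ⟨F, G, ?_, by rw [hF, hG, hab]⟩
  rintro rfl
  rw [map_zero] at hG
  exact hb hG.symm

end MonomialRange

/-- The chart of `Proj (Sym M)` given by a member of a basis with two members is an affine line. -/
lemma exists_awayEval {A M : Type u} [CommRing A] [AddCommGroup M] [Module A M]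
    (b : Module.Basis (Fin 2) A M) :
    ∃ ev : HomogeneousLocalization.Away (symGrading A M) (SymmetricAlgebra.ι A M (b 0)) →+*
      Polynomial A, (∀ a, ev (awayAlgebraMap _ a) = Polynomial.C a) ∧
      ev (awayFrac (ι_mem_symGrading (b 0)) (b 1)) = Polynomial.X := by
  let Λ : SymmetricAlgebra A M →ₐ[A] Polynomial A :=
    -- Dehomogenization with respect to `b 0`.
    SymmetricAlgebra.lift (b.constr A ![1, Polynomial.X])
  have hΛ : ∀ i, Λ (SymmetricAlgebra.ι A M (b i)) = ![1, Polynomial.X] i := fun i =>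
    (SymmetricAlgebra.lift_ι_apply _ _).trans (b.constr_basis A _ i)
  have h0 : Λ.toRingHom (SymmetricAlgebra.ι A M (b 0)) = 1 := hΛ 0
  have hu : IsUnit (Λ.toRingHom (SymmetricAlgebra.ι A M (b 0))) := by
    rw [h0]
    exact isUnit_one
  let l : Localization.Away (SymmetricAlgebra.ι A M (b 0)) →+* Polynomial A :=
    IsLocalization.Away.lift (SymmetricAlgebra.ι A M (b 0)) hu
  have hl : ∀ x, l (algebraMap _ _ x) = Λ.toRingHom x := fun x => IsLocalization.Away.lift_eq _ hu x
  refine ⟨l.comp (algebraMap _ _), fun a => ?_, ?_⟩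
  · change l (awayAlgebraMap _ a).val = _
    rw [val_awayAlgebraMap, hl]
    exact Λ.commutes a
  · change l (awayFrac (ι_mem_symGrading (b 0)) (b 1)).val = _
    rw [val_awayFrac]
    have h1 : l (Localization.mk (SymmetricAlgebra.ι A M (b 1))
        ⟨SymmetricAlgebra.ι A M (b 0), Submonoid.mem_powers _⟩) *
        l (algebraMap _ _ (SymmetricAlgebra.ι A M (b 0))) =
        l (algebraMap _ _ (SymmetricAlgebra.ι A M (b 1))) := by
      rw [← map_mul, ← Localization.mk_one_eq_algebraMap, ← Localization.mk_one_eq_algebraMap,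
        Localization.mk_mul, mul_one]
      congr 1
      rw [Localization.mk_eq_mk_iff, Localization.r_iff_exists]
      exact ⟨1, by simp [mul_comm]⟩
    rw [hl, hl, h0, mul_one] at h1
    exact h1.trans (hΛ 1)

/-! ### Charts given by open immersions of spectra, with one fibre coordinate. -/

section SpecCharts

variable {P : Scheme.{u}} {R : Type u} [CommRing R] (a : Spec (.of R) ⟶ P) [IsOpenImmersion a]
  [IsIntegral P] [Nontrivial R]

lemma notMem_iff_of_eq_fromSpec {q : PrimeSpectrum R} {q' : PrimeSpectrum Γ(P, a ''ᵁ ⊤)}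
    (h : a q = (isAffineOpen_specRange a).fromSpec q') (b : R) :
    specSection a b ∉ q'.asIdeal ↔ b ∉ q.asIdeal := by
  rw [← fromSpec_mem_basicOpen_iff (isAffineOpen_specRange a), ← mem_basicOpen_specSection_iff a, h]

/-- The chart given by an open immersion of an affine scheme. -/
def specChart : LocalChart (K := P.functionField) localRing R where
  hom := specRatFun a
  injective := specRatFun_injective a
  pt := a
  mem_iff q x := by
    obtain ⟨q', hq'⟩ := exists_fromSpec_eq (isAffineOpen_specRange a) (mem_specRange a q)
    have h := (affineChart (isAffineOpen_specRange a) (genericPoint_mem_specRange a)).mem_iff q' x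
    have h2 := notMem_iff_of_eq_fromSpec a hq'
    rw [hq']
    refine h.trans ⟨?_, ?_⟩
    · rintro ⟨c, d, hd, hcd⟩
      refine ⟨(specSection a).symm c, (specSection a).symm d, ?_, ?_⟩
      · rwa [← h2, RingEquiv.apply_symm_apply]
      · have h3 : ∀ c, specRatFun a ((specSection a).symm c) =
            ratFun (genericPoint_mem_specRange a) c := fun c =>
          congrArg (ratFun (genericPoint_mem_specRange a)) ((specSection a).apply_symm_apply c)
        rw [h3, h3]
        exact hcd
    · rintro ⟨c, d, hd, hcd⟩
      exact ⟨specSection a c, specSection a d, (h2 d).2 hd, hcd⟩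

lemma specChart_isLocallyTrivial {s : ℕ} (L : Fin s → LineBundle P) :
    (specChart a).IsLocallyTrivial (localRatio L) := by
  intro q
  obtain ⟨q', hq'⟩ := exists_fromSpec_eq (isAffineOpen_specRange a) (mem_specRange a q)
  obtain ⟨b, hb, u, hu⟩ := affineChart_isLocallyTrivial (isAffineOpen_specRange a)
    (genericPoint_mem_specRange a) L q'
  refine ⟨(specSection a).symm b, ?_, u, fun q₁ hq₁ => ?_⟩
  · rwa [← notMem_iff_of_eq_fromSpec a hq', RingEquiv.apply_symm_apply]
  · obtain ⟨q₁', hq₁'⟩ := exists_fromSpec_eq (isAffineOpen_specRange a) (mem_specRange a q₁)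
    have h1 := hu q₁' (by
      rwa [← notMem_iff_of_eq_fromSpec a hq₁', RingEquiv.apply_symm_apply] at hq₁)
    have h2 : (specChart a).pt q₁ =
        (affineChart (isAffineOpen_specRange a) (genericPoint_mem_specRange a)).pt q₁' := hq₁'
    rw [h2]
    exact h1

lemma exists_specRatFun_frac (x : P.functionField) :
    ∃ b c, specRatFun a c ≠ 0 ∧ x * specRatFun a c = specRatFun a b := by
  have hη := genericPoint_mem_specRange a
  have : Nonempty (a ''ᵁ ⊤) := ⟨⟨_, hη⟩⟩
  have := functionField_isFractionRing_of_isAffineOpen P (a ''ᵁ ⊤) (isAffineOpen_specRange a)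
  obtain ⟨b, c, hc, h⟩ := IsFractionRing.div_surjective (A := Γ(P, a ''ᵁ ⊤)) x
  have hc0 : ratFun hη c ≠ 0 :=
    (map_ne_zero_iff _ (ratFun_injective hη)).2 (nonZeroDivisors.ne_zero hc)
  have h3 : ∀ c, specRatFun a ((specSection a).symm c) = ratFun hη c := fun c =>
    congrArg (ratFun hη) ((specSection a).apply_symm_apply c)
  refine ⟨(specSection a).symm b, (specSection a).symm c, by rwa [h3], ?_⟩
  rw [h3, h3, ← h]
  exact div_mul_cancel₀ _ hc0

end SpecCharts

/-- An affine open subscheme whose coordinate ring is generated by the image of a ring `A` and one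
element. -/
structure CoordChart (P : Scheme.{u}) (A : Type u) [CommRing A] where
  ring : Type u
  [commRing : CommRing ring]
  [isDomain : IsDomain ring]
  map : Spec (.of ring) ⟶ P
  [isOpenImmersion : IsOpenImmersion map]
  base : A →+* ring
  coord : ring
  generates : ∀ S : Subring ring, (∀ a, base a ∈ S) → coord ∈ S → S = ⊤

attribute [instance] CoordChart.commRing CoordChart.isDomain CoordChart.isOpenImmersion

section

variable {P : Scheme.{u}} {A M : Type u} [CommRing A] [AddCommGroup M] [Module A M]
  (b : Module.Basis (Fin 2) A M) {i j : Fin 2} (hij : i ≠ j)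
  (hdom : IsDomain (HomogeneousLocalization.Away (symGrading A M) (SymmetricAlgebra.ι A M (b i))))
  (a : Spec (.of (HomogeneousLocalization.Away (symGrading A M) (SymmetricAlgebra.ι A M (b i)))) ⟶ P)
  [IsOpenImmersion a]

/-- The chart of `Proj (Sym M)` where `b i` does not vanish. -/
def symCoordChart : CoordChart P A where
  ring := HomogeneousLocalization.Away (symGrading A M) (SymmetricAlgebra.ι A M (b i))
  isDomain := hdom
  map := a
  base := awayAlgebraMap _
  coord := awayFrac (ι_mem_symGrading (b i)) (b j)
  generates S' h0 h1 := by
    refine away_subring_eq_top (ι_mem_symGrading (b i)) h0 fun m => ?_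
    have h : ∀ l, awayFrac (ι_mem_symGrading (b i)) (b l) ∈ S' := by
      intro l
      rcases eq_or_ne l i with rfl | hl
      · rw [awayFrac_self _ _ rfl]
        exact one_mem _
      -- There are just two indices, so every fraction of a basis member by `b i` is `1` or the
      -- coordinate.
      · obtain rfl : l = j := by omega
        exact h1
    rw [← b.sum_repr m, Fin.sum_univ_two, awayFrac_add, awayFrac_smul, awayFrac_smul]
    exact add_mem (mul_mem (h0 _) (h _)) (mul_mem (h0 _) (h _))

lemma symCoordChart_map_comp {Q : Scheme.{u}} (f : P ⟶ Q) (g : Spec (.of A) ⟶ Q)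
    (h : a ≫ f = Spec.map (CommRingCat.ofHom (awayAlgebraMap (SymmetricAlgebra.ι A M (b i)))) ≫ g) :
    (symCoordChart b hij hdom a).map ≫ f =
      Spec.map (CommRingCat.ofHom (symCoordChart b hij hdom a).base) ≫ g :=
  h

lemma specRatFun_symCoordChart_base [IsIntegral P] (x : A) :
    specRatFun (symCoordChart b hij hdom a).map ((symCoordChart b hij hdom a).base x) =
      specRatFun a (awayAlgebraMap _ x) :=
  rfl

lemma specRatFun_symCoordChart_coord [IsIntegral P] :
    specRatFun (symCoordChart b hij hdom a).map (symCoordChart b hij hdom a).coord =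
      specRatFun a (awayFrac (ι_mem_symGrading (b i)) (b j)) :=
  rfl

lemma exists_symCoordChart_map_eq {x : P} (h : ∃ q, a q = x) :
    ∃ q, x = (symCoordChart b hij hdom a).map q := by
  obtain ⟨q, hq⟩ := h
  exact ⟨q, hq.symm⟩

omit [IsOpenImmersion a] in
/-- The points of the chart where `b i` does not vanish at which `b j` does not vanish either. -/
lemma exists_eq_of_notMem
    {c : Spec (.of (HomogeneousLocalization.Away (symGrading A M)
      (SymmetricAlgebra.ι A M (b i) * SymmetricAlgebra.ι A M (b j)))) ⟶ P}
    {a' : Spec (.of (HomogeneousLocalization.Away (symGrading A M) (SymmetricAlgebra.ι A M (b j)))) ⟶ P}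
    (h : c = Spec.map (CommRingCat.ofHom (HomogeneousLocalization.awayMap _
      (ι_mem_symGrading (A := A) (b j)) rfl)) ≫ a)
    (h' : c = Spec.map (CommRingCat.ofHom (HomogeneousLocalization.awayMap _
      (ι_mem_symGrading (A := A) (b i)) (mul_comm _ _))) ≫ a')
    {q : PrimeSpectrum (HomogeneousLocalization.Away (symGrading A M) (SymmetricAlgebra.ι A M (b i)))}
    (hq : awayFrac (ι_mem_symGrading (A := A) (b i)) (b j) ∉ q.asIdeal) : ∃ q', a' q' = a q := by
  have he : HomogeneousLocalization.Away.isLocalizationElem (𝒜 := symGrading A M)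
      (ι_mem_symGrading (A := A) (b i)) (ι_mem_symGrading (A := A) (b j)) = awayFrac (ι_mem_symGrading (A := A) (b i)) (b j) := by
    apply HomogeneousLocalization.val_injective
    rw [HomogeneousLocalization.Away.val_mk, val_awayFrac]
    congr 1
    · exact pow_one _
    · ext
      exact pow_one _
  let φ := HomogeneousLocalization.awayMap (symGrading A M) (ι_mem_symGrading (A := A) (b j))
    (rfl : SymmetricAlgebra.ι A M (b i) * SymmetricAlgebra.ι A M (b j) =
      SymmetricAlgebra.ι A M (b i) * SymmetricAlgebra.ι A M (b j))
  let := φ.toAlgebra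
  -- The ring of the overlap is the localization of the ring of the chart at the coordinate.
  have hloc := HomogeneousLocalization.Away.isLocalization_mul (𝒜 := symGrading A M)
    (ι_mem_symGrading (A := A) (b i)) (ι_mem_symGrading (A := A) (b j)) rfl one_ne_zero
  rw [he] at hloc
  have hr := PrimeSpectrum.localization_away_comap_range (HomogeneousLocalization.Away
    (symGrading A M) (SymmetricAlgebra.ι A M (b i) * SymmetricAlgebra.ι A M (b j)))
    (awayFrac (ι_mem_symGrading (A := A) (b i)) (b j))
  obtain ⟨z, hz⟩ : q ∈ Set.range (PrimeSpectrum.comap φ) := by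
    refine hr.symm ▸ ?_
    exact hq
  subst hz
  have h1 := congrArg (fun f : Spec (.of (HomogeneousLocalization.Away (symGrading A M)
    (SymmetricAlgebra.ι A M (b i) * SymmetricAlgebra.ι A M (b j)))) ⟶ P => f z) (h.symm.trans h')
  exact ⟨Spec.map (CommRingCat.ofHom (HomogeneousLocalization.awayMap _
      (ι_mem_symGrading (A := A) (b i)) (mul_comm _ _))) z, h1.symm⟩

lemma exists_symCoordChart_eval (h : (0 : Fin 2) ≠ 1)
    (hdom : IsDomain (HomogeneousLocalization.Away (symGrading A M) (SymmetricAlgebra.ι A M (b 0))))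
    (a : Spec (.of (HomogeneousLocalization.Away (symGrading A M)
      (SymmetricAlgebra.ι A M (b 0)))) ⟶ P) [IsOpenImmersion a] :
    ∃ ev : (symCoordChart b h hdom a).ring →+* Polynomial A,
      (∀ x, ev ((symCoordChart b h hdom a).base x) = Polynomial.C x) ∧
      ev (symCoordChart b h hdom a).coord = Polynomial.X :=
  exists_awayEval b

end
namespace VectorBundle

variable {X : Scheme.{u}} [IsIntegral X]

section

variable {r : ℕ} (E : VectorBundle X r) [NeZero r] {U V : E.FreeOpen} (hU : genericPoint X ∈ U.1)
  (hV : genericPoint X ∈ V.1) {m m' : Γ(E.sheaf, U.1)} {m₀ : Γ(E.sheaf, V.1)}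
  (hm : SymmetricAlgebra.ι Γ(X, U.1) Γ(E.sheaf, U.1) m ≠ 0)
  (hm' : SymmetricAlgebra.ι Γ(X, U.1) Γ(E.sheaf, U.1) m' ≠ 0)
  (hm₀ : SymmetricAlgebra.ι Γ(X, V.1) Γ(E.sheaf, V.1) m₀ ≠ 0)

/-- The functions on the base, as rational functions on the projectivization. -/
def baseRat : Γ(X, U.1) →+* E.projectivization.functionField :=
  (E.awayRat hU (ι_mem_symGrading m) one_pos hm).comp (awayAlgebraMap (SymmetricAlgebra.ι _ _ m))

lemma baseRat_apply (a : Γ(X, U.1)) : E.baseRat hU hm a =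
    E.awayRat hU (ι_mem_symGrading m) one_pos hm (awayAlgebraMap (SymmetricAlgebra.ι _ _ m) a) := by
  delta baseRat
  rw [RingHom.comp_apply]

/-- The rational function `x / m` on the projectivization, for sections `x` and `m`. -/
def fracRat (x : Γ(E.sheaf, U.1)) : E.projectivization.functionField :=
  E.awayRat hU (ι_mem_symGrading m) one_pos hm (awayFrac (ι_mem_symGrading m) x)

lemma fracRat_self : E.fracRat hU hm m = 1 := by
  rw [fracRat, awayFrac_self _ m rfl, map_one]

lemma fracRat_add (x y : Γ(E.sheaf, U.1)) :
    E.fracRat hU hm (x + y) = E.fracRat hU hm x + E.fracRat hU hm y := by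
  have h := congrArg (E.awayRat hU (ι_mem_symGrading m) one_pos hm)
    (awayFrac_add (ι_mem_symGrading m) x y)
  rw [map_add] at h
  delta fracRat
  with_reducible exact h

lemma fracRat_smul (a : Γ(X, U.1)) (x : Γ(E.sheaf, U.1)) :
    E.fracRat hU hm (a • x) = E.baseRat hU hm a * E.fracRat hU hm x := by
  have h := congrArg (E.awayRat hU (ι_mem_symGrading m) one_pos hm)
    (awayFrac_smul (ι_mem_symGrading m) x a)
  rw [map_mul] at h
  rw [baseRat_apply]
  delta fracRat
  with_reducible exact h

lemma fracRat_mul (x : Γ(E.sheaf, U.1)) :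
    E.fracRat hU hm' x * E.fracRat hU hm m' = E.fracRat hU hm x := by
  have h := awayRat_awayFrac_mul (hU := hU) hm hm' x
  delta fracRat
  with_reducible exact h

include hm' in
lemma fracRat_ne_zero : E.fracRat hU hm m' ≠ 0 := by
  intro h
  have h1 := E.fracRat_mul hU hm hm' m
  rw [h, mul_zero, fracRat_self] at h1
  exact zero_ne_one h1

lemma baseRat_eq (a : Γ(X, U.1)) : E.baseRat hU hm' a = E.baseRat hU hm a := by
  have h := awayRat_awayAlgebraMap_eq (hU := hU) hm hm' a
  rw [baseRat_apply, baseRat_apply]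
  with_reducible exact h

variable (h : V ≤ U)
  (hr : SymmetricAlgebra.ι Γ(X, V.1) Γ(E.sheaf, V.1) (resSec E.sheaf h m) ≠ 0)

include hr

lemma baseRat_resFun (a : Γ(X, U.1)) :
    E.baseRat hV hm₀ (resFun h a) = E.baseRat hU hm a := by
  have h1 := E.baseRat_eq hV hr hm₀ (resFun h a)
  have h2 := awayRat_resFun (hU := hU) (hV := hV) h hm hr a
  rw [h1, baseRat_apply, baseRat_apply]
  with_reducible exact h2

lemma fracRat_resSec (x : Γ(E.sheaf, U.1)) :
    E.fracRat hU hm x * E.fracRat hV hm₀ (resSec E.sheaf h m) =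
      E.fracRat hV hm₀ (resSec E.sheaf h x) := by
  have h1 : E.fracRat hV hr (resSec E.sheaf h x) = E.fracRat hU hm x := by
    have h2 := awayRat_resSec (hU := hU) (hV := hV) h hm hr x
    delta fracRat
    with_reducible exact h2
  rw [← h1]
  exact E.fracRat_mul hV hm₀ hr _

end

section

variable (E : VectorBundle X 2) {U : E.FreeOpen} (hU : genericPoint X ∈ U.1)
  (b : Module.Basis (Fin 2) Γ(X, U.1) Γ(E.sheaf, U.1)) {i j : Fin 2} (hij : i ≠ j)

variable {E} in
include hU in
lemma ι_basis_ne_zero' (i : Fin 2) : SymmetricAlgebra.ι Γ(X, U.1) Γ(E.sheaf, U.1) (b i) ≠ 0 :=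
  have := isDomain_sections hU
  ι_basis_ne_zero b i

/-- The chart of the projectivization where the section `b i` does not vanish. -/
def coordChart : CoordChart E.projectivization Γ(X, U.1) :=
  symCoordChart b hij (isDomain_awaySym hU (ι_basis_ne_zero' hU b i))
    (E.projChart U (ι_mem_symGrading (b i)) one_pos)

lemma coordChart_map_projection :
    (E.coordChart hU b hij).map ≫ E.projection =
      Spec.map (CommRingCat.ofHom (E.coordChart hU b hij).base) ≫ U.2.1.fromSpec := by
  have h := symCoordChart_map_comp b hij (isDomain_awaySym hU (ι_basis_ne_zero' hU b i)) _ _ _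
    (E.projChart_projection U (ι_mem_symGrading (b i)) one_pos)
  delta coordChart
  with_reducible exact h

lemma specRatFun_coordChart_base (a : Γ(X, U.1)) :
    specRatFun (E.coordChart hU b hij).map ((E.coordChart hU b hij).base a) =
      E.baseRat hU (ι_basis_ne_zero' hU b i) a := by
  have h := specRatFun_symCoordChart_base b hij (isDomain_awaySym hU (ι_basis_ne_zero' hU b i))
    (E.projChart U (ι_mem_symGrading (b i)) one_pos) a
  rw [baseRat_apply]
  delta coordChart awayRat
  with_reducible exact h

lemma specRatFun_coordChart_coord :
    specRatFun (E.coordChart hU b hij).map (E.coordChart hU b hij).coord =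
      E.fracRat hU (ι_basis_ne_zero' hU b i) (b j) := by
  have h := specRatFun_symCoordChart_coord b hij (isDomain_awaySym hU (ι_basis_ne_zero' hU b i))
    (E.projChart U (ι_mem_symGrading (b i)) one_pos)
  delta fracRat coordChart awayRat
  with_reducible exact h

lemma exists_coordChart_map_eq {x : E.projectivization}
    (h : ∃ q, E.projChart U (ι_mem_symGrading (b i)) one_pos q = x) :
    ∃ q, x = (E.coordChart hU b hij).map q := by
  have h := exists_symCoordChart_map_eq b hij (isDomain_awaySym hU (ι_basis_ne_zero' hU b i))
    (E.projChart U (ι_mem_symGrading (b i)) one_pos) h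
  delta coordChart
  with_reducible exact h

lemma exists_coordChart_eq {x : E.projectivization} (hx : E.projection x ∈ U.1) :
    (∃ q, x = (E.coordChart hU b hij).map q) ∨ ∃ q, x = (E.coordChart hU b hij.symm).map q := by
  obtain ⟨l, h⟩ := exists_projChart_eq hx b
  obtain rfl | rfl : l = i ∨ l = j := by omega
  · exact Or.inl (E.exists_coordChart_map_eq hU b hij h)
  · exact Or.inr (E.exists_coordChart_map_eq hU b hij.symm h)

lemma exists_coordChart_eq_of_notMem {q : PrimeSpectrum (E.coordChart hU b hij).ring}
    (hq : (E.coordChart hU b hij).coord ∉ q.asIdeal) :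
    ∃ q', (E.coordChart hU b hij).map q = (E.coordChart hU b hij.symm).map q' := by
  have h1 := E.projChart_mul U (ι_mem_symGrading (b i)) one_pos (ι_mem_symGrading (b j))
  have h2 := E.projChart_mul' U (ι_mem_symGrading (b i)) (ι_mem_symGrading (b j)) one_pos
  exact E.exists_coordChart_map_eq hU b hij.symm (exists_eq_of_notMem b _ h1 h2 hq)

lemma exists_coordChart_eval (h : (0 : Fin 2) ≠ 1) :
    ∃ ev : (E.coordChart hU b h).ring →+* Polynomial Γ(X, U.1),
      (∀ a, ev ((E.coordChart hU b h).base a) = Polynomial.C a) ∧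
      ev (E.coordChart hU b h).coord = Polynomial.X := by
  have h := exists_symCoordChart_eval b h (isDomain_awaySym hU (ι_basis_ne_zero' hU b 0))
    (E.projChart U (ι_mem_symGrading (b 0)) one_pos)
  delta coordChart
  with_reducible exact h

end

end VectorBundle

lemma specMap_comp_specMap_comp {A B C : Type u} [CommRing A] [CommRing B] [CommRing C] (f : A →+* B)
    (g : B →+* C) {P : Scheme.{u}} (a : Spec (.of A) ⟶ P) :
    Spec.map (CommRingCat.ofHom g) ≫ Spec.map (CommRingCat.ofHom f) ≫ a =
      Spec.map (CommRingCat.ofHom (g.comp f)) ≫ a := by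
  rw [← Category.assoc, ← Spec.map_comp]
  rfl

section SpecImmersion

variable {P : Scheme.{u}} {R : Type u} [CommRing R] (a : Spec (.of R) ⟶ P) [IsOpenImmersion a]

lemma specRange_fromSpec : (isAffineOpen_specRange a).fromSpec =
    Spec.map (CommRingCat.ofHom (specSection a).toRingHom) ≫ a := by
  have h1 := IsAffineOpen.SpecMap_appLE_fromSpec a (isAffineOpen_specRange a)
    (isAffineOpen_top (Spec (.of R))) (a.preimage_image_eq ⊤).ge
  rw [IsAffineOpen.fromSpec_top, Scheme.isoSpec_Spec_inv] at h1
  have h2 : a.appLE (a ''ᵁ ⊤) ⊤ (a.preimage_image_eq ⊤).ge ≫ (a.appIso ⊤).inv = 𝟙 _ := by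
    rw [← Scheme.Hom.appIso_hom', Iso.hom_inv_id]
  have h3 : CommRingCat.ofHom (specSection a).toRingHom =
      (Scheme.ΓSpecIso (.of R)).inv ≫ (a.appIso ⊤).inv := rfl
  rw [h3, Spec.map_comp, Category.assoc, ← h1, ← Category.assoc, ← Spec.map_comp, h2,
    Spec.map_id]
  exact (Category.id_comp _).symm

lemma constRatFun_eq_specRatFun [IsIntegral P] [Nontrivial R] {k : Type u} [Field k]
    (p : P ⟶ Spec (.of k)) (f : k →+* R) (h : a ≫ p = Spec.map (CommRingCat.ofHom f)) (c : k) :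
    constRatFun p c = specRatFun a (f c) := by
  have h1 : resFun le_top (p.appTop ((Scheme.ΓSpecIso (.of k)).inv c)) = specSection a (f c) := by
    have e1 : a.appTop ≫ (a.appIso ⊤).inv = P.presheaf.map (homOfLE le_top).op := by
      have e0 : a.appTop = a.appLE ⊤ (a ⁻¹ᵁ ⊤) le_rfl := Scheme.Hom.app_eq_appLE a
      have e1 := Scheme.Hom.appLE_appIso_inv a (U := ⊤) (V := a ⁻¹ᵁ ⊤) le_rfl
      rw [← e0] at e1
      exact e1
    have e2 : (Scheme.ΓSpecIso (.of k)).inv ≫ p.appTop ≫ P.presheaf.map (homOfLE le_top).op =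
        CommRingCat.ofHom f ≫ (Scheme.ΓSpecIso (.of R)).inv ≫ (a.appIso ⊤).inv := by
      rw [← e1, Scheme.ΓSpecIso_inv_naturality_assoc, ← h, Scheme.Hom.comp_appTop, Category.assoc]
    exact congr($e2 c)
  have h2 := ratFun_resFun (genericPoint_mem_specRange a) le_top
    (p.appTop ((Scheme.ΓSpecIso (.of k)).inv c))
  rw [h1] at h2
  exact h2.symm

end SpecImmersion

namespace CoordChart

variable {P : Scheme.{u}} {A A' : Type u} [CommRing A] [CommRing A'] (C : CoordChart P A)
  {f : A' →+* A} (hf : Function.Surjective f)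

/-- Change of the base ring of a chart. -/
def comp : CoordChart P A' where
  ring := C.ring
  map := C.map
  base := C.base.comp f
  coord := C.coord
  generates S h0 h1 := C.generates S (hf.forall.2 h0) h1

lemma specRatFun_comp_base [IsIntegral P] (x : A') :
    specRatFun (C.comp hf).map ((C.comp hf).base x) = specRatFun C.map (C.base (f x)) := rfl

lemma specRatFun_comp_coord [IsIntegral P] :
    specRatFun (C.comp hf).map (C.comp hf).coord = specRatFun C.map C.coord := rfl

end CoordChart

/-! ### Charts of the projectivization of a toric bundle. -/

namespace ToricVectorBundle

variable {k : Type u} [Field k] {n : ℕ} {Δ : Fan n} (E : ToricVectorBundle k Δ 2)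

section

variable {σ : Δ.Cone} {s : Fin 2 → Γ(E.sheaf, Δ.chart k σ)} (hs : IsFrame E.sheaf (Δ.chart k σ) s)

/-- A chart of a toric variety, as an open set over which a bundle is free. -/
abbrev chartOpen : E.toVectorBundle.FreeOpen := ⟨Δ.chart k σ, Δ.isAffineOpen_chart k σ, s, hs⟩

/-- A frame, as a basis. -/
def frameBasis : Module.Basis (Fin 2) Γ(Δ.toricVariety k, (E.chartOpen hs).1)
    Γ(E.sheaf, (E.chartOpen hs).1) :=
  hs.basis le_rfl

lemma frameBasis_apply (i : Fin 2) : E.frameBasis hs i = s i :=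
  (hs.basis_apply le_rfl i).trans (resSec_self _ _ _)

variable {i j : Fin 2} (hij : i ≠ j)

/-- The charts of the projectivization of a toric vector bundle. -/
def toricChart : CoordChart E.projectivization (Δ.CoordRing k σ) :=
  (E.coordChart (U := E.chartOpen hs) (Δ.genericPoint_mem_chart k σ) (E.frameBasis hs) hij).comp
    (Δ.coord_bijective k σ).surjective

lemma toricChart_map_projection : (E.toricChart hs hij).map ≫ E.projection =
    Spec.map (CommRingCat.ofHom (E.toricChart hs hij).base) ≫ Δ.chartι k σ := by
  have h1 := E.coordChart_map_projection (U := E.chartOpen hs) (Δ.genericPoint_mem_chart k σ)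
    (E.frameBasis hs) hij
  have h2 : (E.chartOpen hs).2.1.fromSpec = Spec.map (CommRingCat.ofHom (Δ.coord k σ)) ≫ Δ.chartι k σ :=
    specRange_fromSpec (Δ.chartι k σ)
  exact (h1.trans (congrArg (Spec.map (CommRingCat.ofHom _) ≫ ·) h2)).trans
    (specMap_comp_specMap_comp _ _ _)

lemma projection_toricChart (q : PrimeSpectrum (E.toricChart hs hij).ring) :
    E.projection ((E.toricChart hs hij).map q) =
      Δ.chartι k σ (PrimeSpectrum.comap (E.toricChart hs hij).base q) :=
  congr($(E.toricChart_map_projection hs hij) q)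

lemma constRatFun_eq (c : k) : constRatFun E.structureMorphism c =
    specRatFun (E.toricChart hs hij).map ((E.toricChart hs hij).base (algebraMap k _ c)) := by
  refine constRatFun_eq_specRatFun (E.toricChart hs hij).map E.structureMorphism
    ((E.toricChart hs hij).base.comp (algebraMap k _)) ?_ c
  have h : Δ.chartι k σ ≫ Δ.toricStructure k =
      Spec.map (CommRingCat.ofHom (algebraMap k (Δ.CoordRing k σ))) :=
    colimit.ι_desc _ _
  rw [structureMorphism, ← Category.assoc, toricChart_map_projection, Category.assoc, h,
    ← Spec.map_comp]
  rfl

lemma exists_toricChart_eq {x : E.projectivization} (hx : E.projection x ∈ Δ.chart k σ) :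
    (∃ q, x = (E.toricChart hs hij).map q) ∨ ∃ q, x = (E.toricChart hs hij.symm).map q :=
  E.exists_coordChart_eq (U := E.chartOpen hs) (Δ.genericPoint_mem_chart k σ) (E.frameBasis hs)
    hij hx

lemma exists_toricChart_eq_of_notMem {q : PrimeSpectrum (E.toricChart hs hij).ring}
    (hq : (E.toricChart hs hij).coord ∉ q.asIdeal) :
    ∃ q', (E.toricChart hs hij).map q = (E.toricChart hs hij.symm).map q' :=
  E.exists_coordChart_eq_of_notMem (U := E.chartOpen hs) (Δ.genericPoint_mem_chart k σ)
    (E.frameBasis hs) hij hq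

/-- The locus of the chart of `σ` where `χ^u` is invertible is the chart of the face cut out by `u`.
-/
lemma projection_mem_of_notMem {τ : Δ.Cone} (h : τ ≤ σ) {u : dualMonoid σ.1}
    (hu : ∀ v, v ∈ τ.1 ↔ v ∈ σ.1 ∧ pairing u.1 v = 0)
    {q : PrimeSpectrum (E.toricChart hs hij).ring}
    (hq : (E.toricChart hs hij).base (.single u 1) ∉ q.asIdeal) :
    E.projection ((E.toricChart hs hij).map q) ∈ Δ.chart k τ := by
  rw [projection_toricChart, ← Δ.basicOpen_coord k h u hu]
  exact (mem_basicOpen_specSection_iff (Δ.chartι k σ) _ _).2 hq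

lemma exists_toricChart_eval (h : (0 : Fin 2) ≠ 1) :
    ∃ ev : (E.toricChart hs h).ring →+* Polynomial Γ(Δ.toricVariety k, Δ.chart k σ),
      (∀ a, ev ((E.toricChart hs h).base a) = Polynomial.C (Δ.coord k σ a)) ∧
      ev (E.toricChart hs h).coord = Polynomial.X := by
  obtain ⟨ev, h1, h2⟩ := E.exists_coordChart_eval (U := E.chartOpen hs)
    (Δ.genericPoint_mem_chart k σ) (E.frameBasis hs) h
  exact ⟨ev, fun a => h1 _, h2⟩

lemma specRatFun_toricChart_base_eq (a : Δ.CoordRing k σ) :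
    specRatFun (E.toricChart hs hij).map ((E.toricChart hs hij).base a) =
      E.baseRat (U := E.chartOpen hs) (Δ.genericPoint_mem_chart k σ)
        (VectorBundle.ι_basis_ne_zero' (Δ.genericPoint_mem_chart k σ) (E.frameBasis hs) i)
        (Δ.coord k σ a) := by
  have h1 := E.specRatFun_coordChart_base (U := E.chartOpen hs) (Δ.genericPoint_mem_chart k σ)
    (E.frameBasis hs) hij (Δ.coord k σ a)
  have h2 := (E.coordChart (U := E.chartOpen hs) (Δ.genericPoint_mem_chart k σ) (E.frameBasis hs)
    hij).specRatFun_comp_base (Δ.coord_bijective k σ).surjective a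
  delta toricChart
  with_reducible exact h2.trans h1

lemma specRatFun_toricChart_coord_eq :
    specRatFun (E.toricChart hs hij).map (E.toricChart hs hij).coord =
      E.fracRat (U := E.chartOpen hs) (Δ.genericPoint_mem_chart k σ)
        (VectorBundle.ι_basis_ne_zero' (Δ.genericPoint_mem_chart k σ) (E.frameBasis hs) i)
        (E.frameBasis hs j) := by
  have h1 := E.specRatFun_coordChart_coord (U := E.chartOpen hs) (Δ.genericPoint_mem_chart k σ)
    (E.frameBasis hs) hij
  have h2 := (E.coordChart (U := E.chartOpen hs) (Δ.genericPoint_mem_chart k σ) (E.frameBasis hs)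
    hij).specRatFun_comp_coord (Δ.coord_bijective k σ).surjective
  delta toricChart
  with_reducible exact h2.trans h1

end

end ToricVectorBundle

namespace ToricVectorBundle

variable {k : Type u} [Field k] {n : ℕ} {Δ : Fan n} (E : ToricVectorBundle k Δ 2)
  {ε : Fin 2 → Γ(E.sheaf, Δ.chart k Δ.zeroCone)} (hε : IsFrame E.sheaf (Δ.chart k Δ.zeroCone) ε)

/-- The functions on the torus, as rational functions on the projectivization. -/
def torusRat : Γ(Δ.toricVariety k, Δ.chart k Δ.zeroCone) →+* E.projectivization.functionField :=
  E.baseRat (U := E.chartOpen hε) (Δ.genericPoint_mem_chart k _)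
    (VectorBundle.ι_basis_ne_zero' (Δ.genericPoint_mem_chart k _) (E.frameBasis hε) 0)

/-- The rational function `x / ε 0` on the projectivization. -/
def torusFrac (x : Γ(E.sheaf, Δ.chart k Δ.zeroCone)) : E.projectivization.functionField :=
  E.fracRat (U := E.chartOpen hε) (Δ.genericPoint_mem_chart k _)
    (VectorBundle.ι_basis_ne_zero' (Δ.genericPoint_mem_chart k _) (E.frameBasis hε) 0) x

lemma torusFrac_zero : E.torusFrac hε (ε 0) = 1 := by
  have h := E.fracRat_self (U := E.chartOpen hε) (Δ.genericPoint_mem_chart k _)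
    (VectorBundle.ι_basis_ne_zero' (Δ.genericPoint_mem_chart k _) (E.frameBasis hε) 0)
  exact (congrArg (E.torusFrac hε) (E.frameBasis_apply hε 0).symm).trans h

lemma torusFrac_add (x y : Γ(E.sheaf, Δ.chart k Δ.zeroCone)) :
    E.torusFrac hε (x + y) = E.torusFrac hε x + E.torusFrac hε y :=
  E.fracRat_add (U := E.chartOpen hε) _ _ x y

lemma torusFrac_smul (a : Γ(Δ.toricVariety k, Δ.chart k Δ.zeroCone))
    (x : Γ(E.sheaf, Δ.chart k Δ.zeroCone)) :
    E.torusFrac hε (a • x) = E.torusRat hε a * E.torusFrac hε x :=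
  E.fracRat_smul (U := E.chartOpen hε) _ _ a x

section

variable {σ : Δ.Cone} {s : Fin 2 → Γ(E.sheaf, Δ.chart k σ)} (hs : IsFrame E.sheaf (Δ.chart k σ) s)

lemma chartOpen_le : E.chartOpen hε ≤ E.chartOpen hs := Fan.chart_mono k (Δ.zeroCone_le σ)

lemma ι_resSec_ne_zero (i : Fin 2) : SymmetricAlgebra.ι Γ(Δ.toricVariety k, (E.chartOpen hε).1)
    Γ(E.sheaf, (E.chartOpen hε).1)
    (resSec E.sheaf (E.chartOpen_le hε hs) (E.frameBasis hs i)) ≠ 0 := by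
  have h := VectorBundle.ι_basis_ne_zero' (E := E.toVectorBundle) (U := E.chartOpen hε)
    (Δ.genericPoint_mem_chart k _) (hs.basis (E.chartOpen_le hε hs)) i
  have h1 : resSec E.sheaf (E.chartOpen_le hε hs) (E.frameBasis hs i) =
      hs.basis (E.chartOpen_le hε hs) i :=
    (congrArg (resSec E.sheaf (E.chartOpen_le hε hs)) (E.frameBasis_apply hs i)).trans
      (hs.basis_apply (E.chartOpen_le hε hs) i).symm
  rw [h1]
  exact h

variable {i j : Fin 2} (hij : i ≠ j)

lemma specRatFun_toricChart_base (a : Δ.CoordRing k σ) :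
    specRatFun (E.toricChart hs hij).map ((E.toricChart hs hij).base a) =
      E.torusRat hε (Δ.coord k _ (Fan.coordMap k (Δ.zeroCone_le σ) a)) := by
  have h1 := E.specRatFun_toricChart_base_eq hs hij a
  have h2 := E.baseRat_resFun (U := E.chartOpen hs) (V := E.chartOpen hε)
    (Δ.genericPoint_mem_chart k σ) (Δ.genericPoint_mem_chart k _)
    (VectorBundle.ι_basis_ne_zero' (Δ.genericPoint_mem_chart k σ) (E.frameBasis hs) i)
    (VectorBundle.ι_basis_ne_zero' (Δ.genericPoint_mem_chart k _) (E.frameBasis hε) 0)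
    (E.chartOpen_le hε hs) (E.ι_resSec_ne_zero hε hs i) (Δ.coord k σ a)
  have h4 : resFun (E.chartOpen_le hε hs) (Δ.coord k σ a) =
      Δ.coord k _ (Fan.coordMap k (Δ.zeroCone_le σ) a) := Fan.resFun_coord k (Δ.zeroCone_le σ) a
  have h3 := h1.trans h2.symm
  rw [h4] at h3
  delta torusRat
  with_reducible exact h3

lemma specRatFun_toricChart_coord_mul :
    specRatFun (E.toricChart hs hij).map (E.toricChart hs hij).coord *
      E.torusFrac hε (resSec E.sheaf (Fan.chart_mono k (Δ.zeroCone_le σ)) (s i)) =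
      E.torusFrac hε (resSec E.sheaf (Fan.chart_mono k (Δ.zeroCone_le σ)) (s j)) := by
  have h1 := E.specRatFun_toricChart_coord_eq hs hij
  have h2 := E.fracRat_resSec (U := E.chartOpen hs) (V := E.chartOpen hε)
    (Δ.genericPoint_mem_chart k σ) (Δ.genericPoint_mem_chart k _)
    (VectorBundle.ι_basis_ne_zero' (Δ.genericPoint_mem_chart k σ) (E.frameBasis hs) i)
    (VectorBundle.ι_basis_ne_zero' (Δ.genericPoint_mem_chart k _) (E.frameBasis hε) 0)
    (E.chartOpen_le hε hs) (E.ι_resSec_ne_zero hε hs i) (E.frameBasis hs j)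
  rw [← h1, E.frameBasis_apply hs i, E.frameBasis_apply hs j] at h2
  delta torusFrac
  with_reducible exact h2

include hs in
lemma torusFrac_resSec_ne_zero (i : Fin 2) :
    E.torusFrac hε (resSec E.sheaf (Fan.chart_mono k (Δ.zeroCone_le σ)) (s i)) ≠ 0 := by
  have h := E.fracRat_ne_zero (U := E.chartOpen hε) (Δ.genericPoint_mem_chart k _)
    (VectorBundle.ι_basis_ne_zero' (Δ.genericPoint_mem_chart k _) (E.frameBasis hε) 0)
    (E.ι_resSec_ne_zero hε hs i)
  rw [E.frameBasis_apply hs i] at h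
  exact h

end

/-- The characters of the torus, as rational functions on the projectivization. -/
def torusChar : Multiplicative (Fin n → ℤ) →* E.projectivization.functionFieldˣ :=
  MonoidHom.toHomUnits ((E.torusRat hε).toMonoidHom.comp (Δ.torusMonomial k))

lemma torusChar_apply (u : Multiplicative (Fin n → ℤ)) :
    (E.torusChar hε u : E.projectivization.functionField) = E.torusRat hε (Δ.torusMonomial k u) :=
  rfl

lemma constRatFun_eq_torusRat (c : k) :
    constRatFun E.structureMorphism c = E.torusRat hε (Δ.const k Δ.zeroCone c) := by
  rw [E.constRatFun_eq hε zero_ne_one, E.specRatFun_toricChart_base hε]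
  rw [AlgHom.commutes]
  rfl

section

variable [Algebra k E.projectivization.functionField]
  (halg : ∀ c, algebraMap k E.projectivization.functionField c = constRatFun E.structureMorphism c)
  {σ : Δ.Cone} {s : Fin 2 → Γ(E.sheaf, Δ.chart k σ)} (hs : IsFrame E.sheaf (Δ.chart k σ) s)
  {i j : Fin 2} (hij : i ≠ j)

include halg

lemma specRatFun_toricChart_single (u : dualMonoid σ.1) (c : k) :
    specRatFun (E.toricChart hs hij).map ((E.toricChart hs hij).base (.single u c)) =
      c • (E.torusChar hε (.ofAdd u.1) : E.projectivization.functionField) := by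
  rw [E.specRatFun_toricChart_base hε, Algebra.smul_def, halg, E.constRatFun_eq_torusRat hε,
    torusChar_apply, Fan.coordMap_single, ← map_mul]
  congr 1
  change _ = Δ.coord k _ (AddMonoidAlgebra.single 0 c) * Δ.coord k _ (AddMonoidAlgebra.single _ 1)
  rw [← map_mul, AddMonoidAlgebra.single_mul_single, zero_add, mul_one]
  rfl

lemma torusChar_mul_torusFrac {u : Fin n → ℤ} {x : Γ(E.sheaf, Δ.chart k Δ.zeroCone)} {p : k × k}
    (h : Δ.torusMonomial k (.ofAdd u) • x =
      Δ.const k Δ.zeroCone p.1 • ε 0 + Δ.const k Δ.zeroCone p.2 • ε 1) :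
    (E.torusChar hε (.ofAdd u) : E.projectivization.functionField) * E.torusFrac hε x =
      Polynomial.aeval (E.torusFrac hε (ε 1)) (linPoly p) := by
  rw [torusChar_apply, ← torusFrac_smul, h, torusFrac_add, torusFrac_smul, torusFrac_smul,
    torusFrac_zero, mul_one, ← constRatFun_eq_torusRat, ← constRatFun_eq_torusRat, ← halg, ← halg,
    linPoly, map_add, map_mul, Polynomial.aeval_C, Polynomial.aeval_C, Polynomial.aeval_X]

/-- The coordinate is the quotient of the weight vectors `s j` and `s i`. Each of them times its
character is a linear form in `ε 0, ε 1`, so the quotient is a character times a homographic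
transform of `ε 1 / ε 0`. -/
lemma specRatFun_toricChart_coord {μ : Fin 2 → Fin n → ℤ} {p : Fin 2 → k × k}
    (h : ∀ i, Δ.torusMonomial k (.ofAdd (μ i)) •
        resSec E.sheaf (Fan.chart_mono k (Δ.zeroCone_le σ)) (s i) =
          Δ.const k Δ.zeroCone (p i).1 • ε 0 + Δ.const k Δ.zeroCone (p i).2 • ε 1) :
    specRatFun (E.toricChart hs hij).map (E.toricChart hs hij).coord =
      E.torusChar hε (.ofAdd (μ i - μ j)) * homography (p i) (p j) (E.torusFrac hε (ε 1)) := by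
  have h1 := E.specRatFun_toricChart_coord_mul hε hs hij
  have h2 := E.torusFrac_resSec_ne_zero hε hs i
  have h3 := E.torusChar_mul_torusFrac hε halg (h i)
  have h4 := E.torusChar_mul_torusFrac hε halg (h j)
  have h5 := (E.torusChar hε (.ofAdd (μ j))).ne_zero
  have h6 := (E.torusChar hε (.ofAdd (μ i))).ne_zero
  rw [homography, ← h3, ← h4, ofAdd_sub, map_div, Units.val_div_eq_div_val, eq_comm,
    ← h1]
  field_simp

end

end ToricVectorBundle

/-- The pairing of characters with a lattice vector. -/
def latticePairing {n : ℕ} (w : Fin n → ℤ) : (Fin n → ℤ) →+ ℤ where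
  toFun u := ∑ i, u i * w i
  map_zero' := by simp
  map_add' u v := by simp [add_mul, Finset.sum_add_distrib]

lemma pairing_intCast {n : ℕ} (u w : Fin n → ℤ) :
    pairing u (fun i => (w i : ℝ)) = (latticePairing w u : ℝ) := by
  simp [pairing, latticePairing]

lemma mem_dualMonoid_hull_iff {n : ℕ} {σ : PointedCone ℝ (Fin n → ℝ)} {S : Finset (Fin n → ℤ)}
    (hS : σ = PointedCone.hull ℝ ((fun w : Fin n → ℤ => fun i => (w i : ℝ)) '' S))
    (u : Fin n → ℤ) : u ∈ dualMonoid σ ↔ ∀ w ∈ S, 0 ≤ latticePairing w u := by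
  constructor
  · intro hu w hw
    have h := hu (fun i => (w i : ℝ)) (by rw [hS]; exact PointedCone.subset_hull ⟨w, hw, rfl⟩)
    rw [pairing_intCast] at h
    exact_mod_cast h
  · intro h v hv
    rw [hS] at hv
    induction hv using Submodule.span_induction with
    | mem x hx =>
      obtain ⟨w, hw, rfl⟩ := hx
      rw [pairing_intCast]
      exact_mod_cast h w hw
    | zero => simp
    | add x y _ _ hx hy => rw [map_add]; exact add_nonneg hx hy
    | smul a x _ hx =>
      have : a • x = (a : ℝ) • x := rfl
      rw [this, map_smul]; exact mul_nonneg a.2 hx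

/-! ### Assembling the cover by monomial charts. -/

namespace ToricVectorBundle

variable {k : Type u} [Field k] {n : ℕ} {Δ : Fan n} (E : ToricVectorBundle k Δ 2)
  {ε : Fin 2 → Γ(E.sheaf, Δ.chart k Δ.zeroCone)} (hε : IsFrame E.sheaf (Δ.chart k Δ.zeroCone) ε)
  [Algebra k E.projectivization.functionField]
  (halg : ∀ c, algebraMap k E.projectivization.functionField c = constRatFun E.structureMorphism c)

section

variable {σ : Δ.Cone} {s : Fin 2 → Γ(E.sheaf, Δ.chart k σ)} (hs : IsFrame E.sheaf (Δ.chart k σ) s)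
  {i j : Fin 2} (hij : i ≠ j) {μ : Fin 2 → Fin n → ℤ} {p : Fin 2 → k × k}
  (h : ∀ i, Δ.torusMonomial k (.ofAdd (μ i)) •
    resSec E.sheaf (Fan.chart_mono k (Δ.zeroCone_le σ)) (s i) =
      Δ.const k Δ.zeroCone (p i).1 • ε 0 + Δ.const k Δ.zeroCone (p i).2 • ε 1)

include halg h

lemma mem_range_toricChart_iff (x : E.projectivization.functionField) :
    x ∈ (specRatFun (E.toricChart hs hij).map).range ↔
      ∃ F : AddMonoidAlgebra k ((Fin n → ℤ) × ℕ),
        (∀ g ∈ F.coeff.support, g.1 - g.2 • (μ i - μ j) ∈ dualMonoid σ.1) ∧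
        toricHom (E.torusChar hε) (homography (p i) (p j) (E.torusFrac hε (ε 1))) F = x :=
  mem_range_iff_toricHom (E.toricChart hs hij).generates
    (E.specRatFun_toricChart_single hε halg hs hij) (E.specRatFun_toricChart_coord hε halg hs hij h) x

/-- Membership of `g.1 - g.2 • (μ i - μ j)` in the dual monoid is tested on the generators of the
cone, and each of them gives one pair of weights. -/
lemma isMonomialChart_toricChart {S : Finset (Fin n → ℤ)}
    (hS : σ.1 = PointedCone.hull ℝ ((fun w : Fin n → ℤ => fun i => (w i : ℝ)) '' S))
    (u : dualMonoid σ.1) :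
    IsMonomialChart k (E.torusChar hε) (homography (p i) (p j) (E.torusFrac hε (ε 1)))
      (specChart (E.toricChart hs hij).map) (fun w : S => latticePairing w.1)
      (fun w => - latticePairing w.1 (μ i - μ j)) ((E.toricChart hs hij).base (.single u 1)) where
  mem_range_iff x := by
    refine (E.mem_range_toricChart_iff hε halg hs hij h x).trans
      (exists_congr fun F => and_congr_left' (forall₂_congr fun g _ => ?_))
    rw [mem_dualMonoid_hull_iff hS]
    constructor
    · intro h1 w
      have := h1 w.1 w.2
      rw [map_sub, map_nsmul, nsmul_eq_mul] at this
      linarith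
    · intro h1 w hw
      have := h1 ⟨w, hw⟩
      rw [map_sub, map_nsmul, nsmul_eq_mul]
      linarith
  exists_monomial := by
    -- Exponents of characters range over all of `ℤⁿ`, so division by powers of `χ^u` is always
    -- possible.
    refine ⟨(u.1, 0), ?_, fun g N _ => ⟨(g.1 - N • u.1, g.2), ?_⟩⟩
    · refine (E.specRatFun_toricChart_single hε halg hs hij u 1).trans ?_
      rw [one_smul, pow_zero, mul_one]
    · ext <;> simp

end

section

include halg

/-- The frame over the torus, as a frame of sections of weight zero. -/
lemma torusMonomial_zero_smul (i : Fin 2) : Δ.torusMonomial k (.ofAdd ((0 : Fin 2 → Fin n → ℤ) i)) •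
    resSec E.sheaf (Fan.chart_mono k (Δ.zeroCone_le Δ.zeroCone)) (ε i) =
      Δ.const k Δ.zeroCone ((![(1, 0), (0, 1)] : Fin 2 → k × k) i).1 • ε 0 +
      Δ.const k Δ.zeroCone ((![(1, 0), (0, 1)] : Fin 2 → k × k) i).2 • ε 1 := by
  rw [Pi.zero_apply, ofAdd_zero, map_one, one_smul, resSec_self]
  fin_cases i <;> simp

lemma mem_range_torusChart_iff (x : E.projectivization.functionField) :
    x ∈ (specRatFun (E.toricChart hε zero_ne_one).map).range ↔
      ∃ F : AddMonoidAlgebra k ((Fin n → ℤ) × ℕ),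
        toricHom (E.torusChar hε) (E.torusFrac hε (ε 1)) F = x := by
  have h := E.mem_range_toricChart_iff hε halg hε zero_ne_one (E.torusMonomial_zero_smul halg) x
  have h1 : homography ((1, 0) : k × k) (0, 1) (E.torusFrac hε (ε 1)) = E.torusFrac hε (ε 1) := by
    simp [homography, linPoly]
  rw [h]
  simp only [Δ.mem_dualMonoid_zeroCone, implies_true, true_and, Matrix.cons_val_zero,
    Matrix.cons_val_one, h1]

lemma mem_range_torusChart_iff' (x : E.projectivization.functionField) :
    x ∈ (specRatFun (E.toricChart hε one_ne_zero).map).range ↔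
      ∃ F : AddMonoidAlgebra k ((Fin n → ℤ) × ℕ),
        toricHom (E.torusChar hε) (E.torusFrac hε (ε 1))⁻¹ F = x := by
  have h := E.mem_range_toricChart_iff hε halg hε one_ne_zero (E.torusMonomial_zero_smul halg) x
  have h1 : homography ((0, 1) : k × k) (1, 0) (E.torusFrac hε (ε 1)) = (E.torusFrac hε (ε 1))⁻¹ :=
    homography_swap _
  rw [h]
  simp only [Δ.mem_dualMonoid_zeroCone, implies_true, true_and, Matrix.cons_val_zero,
    Matrix.cons_val_one, h1]

lemma specRatFun_torusChart_coord : specRatFun (E.toricChart hε zero_ne_one).map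
    (E.toricChart hε zero_ne_one).coord = E.torusFrac hε (ε 1) := by
  rw [E.specRatFun_toricChart_coord hε halg hε zero_ne_one (E.torusMonomial_zero_smul halg)]
  simp [homography, linPoly]

lemma specRatFun_torusChart_coord' : specRatFun (E.toricChart hε one_ne_zero).map
    (E.toricChart hε one_ne_zero).coord = (E.torusFrac hε (ε 1))⁻¹ := by
  rw [E.specRatFun_toricChart_coord hε halg hε one_ne_zero (E.torusMonomial_zero_smul halg)]
  simp [homography, linPoly]

/-- Over the torus, dehomogenization with respect to `ε 0` sends the fibre coordinate to a
polynomial variable over the functions on the torus, so there are no relations between the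
characters and `y`. -/
lemma toricHom_torusChar_injective :
    Function.Injective (toricHom (k := k) (E.torusChar hε) (E.torusFrac hε (ε 1))) := by
  obtain ⟨ev, h1, h2⟩ := E.exists_toricChart_eval hε zero_ne_one
  exact toricHom_injective (specRatFun_injective (E.toricChart hε zero_ne_one).map)
    (Δ.coord_bijective k _).injective ev h1 h2 Δ.mem_dualMonoid_zeroCone
    (E.specRatFun_toricChart_single hε halg hε zero_ne_one) (E.specRatFun_torusChart_coord hε halg)

/-- The cover consists of the two charts over the torus, with coordinates `y` and `y⁻¹`, and of two
monomial charts over each cone. -/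
lemma fg_of_isSectionAt [Infinite k] {s : ℕ} (L : Fin s → LineBundle E.projectivization)
    (R : Subalgebra k (AddMonoidAlgebra E.projectivization.functionField (Fin s → ℤ)))
    (hR : ∀ F, F ∈ R ↔ ∀ m x, IsSectionAt localRing (localRatio L) m (F.coeff m) x) : R.FG := by
  obtain ⟨ε, hε, hframe⟩ := E.exists_invariantFrame
  choose μ s p hs hp h using hframe
  choose S hS using fun σ : Δ.Cone => Δ.rational σ.1 σ.2
  -- The character `u σ` cuts out the zero cone in `σ`, so it is invertible exactly over the torus.
  choose u hu hu' using fun σ : Δ.Cone => Δ.exists_bot_face σ.2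
  have hfin : Finite Δ.Cone := Δ.finite
  -- Adding `1` exchanges the two indices: `i` is the denominator of the coordinate and `i + 1` its
  -- numerator.
  have hneg : ∀ i : Fin 2, i ≠ i + 1 := by decide
  refine fg_of_monomialCharts (ι := Δ.Cone × Fin 2) (J := fun l => S l.1)
    (fun x c => ?_) (E.toricHom_torusChar_injective hε halg)
    (exists_frac_toricHom (E.mem_range_torusChart_iff hε halg)
      (exists_specRatFun_frac (E.toricChart hε zero_ne_one).map))
    (specChart (E.toricChart hε zero_ne_one).map) (specChart (E.toricChart hε one_ne_zero).map)
    (E.mem_range_torusChart_iff hε halg) (E.mem_range_torusChart_iff' hε halg)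
    (E.toricChart hε one_ne_zero).coord (E.specRatFun_torusChart_coord' hε halg)
    (fun q hq => E.exists_toricChart_eq_of_notMem hε one_ne_zero hq)
    (fun l => specChart (E.toricChart (hs l.1) (hneg l.2)).map)
    (fun l => p l.1 l.2) (fun l => p l.1 (l.2 + 1)) (fun l => ?_)
    (fun l w => latticePairing w.1) (fun l w => - latticePairing w.1 (μ l.1 l.2 - μ l.1 (l.2 + 1)))
    (fun l => (E.toricChart (hs l.1) (hneg l.2)).base (.single ⟨u l.1, hu l.1⟩ 1))
    (fun l => E.isMonomialChart_toricChart hε halg (hs l.1) (hneg l.2) (h l.1) (hS l.1) _)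
    (fun l q hq => ?_) (fun x => ?_) (specChart_isLocallyTrivial _ L)
    (specChart_isLocallyTrivial _ L) (fun l => specChart_isLocallyTrivial _ L) R hR
  · rw [halg]
    exact ratFun_mem_localRing (U := ⊤) (p := x) trivial trivial _
  · obtain ⟨σ, i⟩ := l
    fin_cases i
    · exact hp σ
    -- For the second chart the two linear forms are exchanged and the determinant changes sign.
    · intro h0
      refine hp σ ?_
      change (p σ 1).1 * (p σ 0).2 - (p σ 0).1 * (p σ 1).2 = 0 at h0
      linear_combination -h0
  -- Where the supporting character is invertible, the point lies over the torus and hence in one of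
  -- the first two charts.
  · exact E.exists_toricChart_eq hε zero_ne_one
      (E.projection_mem_of_notMem (hs l.1) (hneg l.2) (Δ.zeroCone_le l.1)
        (u := ⟨u l.1, hu l.1⟩) (hu' l.1) hq)
  · obtain ⟨σ, y, hy⟩ := Δ.exists_chartι_eq k (E.projection x)
    have hx : E.projection x ∈ Δ.chart k σ := ⟨y, trivial, hy⟩
    right; right
    rcases E.exists_toricChart_eq (hs σ) (hneg 0) hx with ⟨q, hq⟩ | ⟨q, hq⟩
    · exact ⟨(σ, 0), q, hq⟩
    · exact ⟨(σ, 1), q, hq⟩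

end

end ToricVectorBundle

end ToricCox

end

theorem mainTheorem1 {k : Type u} [Field k] [IsAlgClosed k] {n : ℕ} (Δ : ToricCox.Fan n)
    (E : ToricCox.ToricVectorBundle k Δ 2) {s : ℕ}
    (L : Fin s → ToricCox.LineBundle E.projectivization) (hL : ToricCox.SpansPicQ L) :
    Algebra.FiniteType k (ToricCox.CoxRing E.structureMorphism L) := by 
  refine ToricCox.finiteType_coxRing E.structureMorphism ?_
  let := (ToricCox.constRatFun E.structureMorphism).toAlgebra
  exact fun R hR => E.fg_of_isSectionAt (fun _ => rfl) L R hR
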